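/- Let $d:\mathbb R\to(0,\infty)$ be $C^\infty$, with $d$, each of its derivatives and $1/d$ bounded on $\mathbb R$. For small $\varepsilon>0$ consider a ray in the waveguide $0\le y\le d(\varepsilon x)$: between the walls it moves by the Hamiltonian $H=p_x^2+p_y^2-1$ on the level $H=0$, and at each wall it is reflected elastically (finitely many reflections on a bounded time interval). Write $X=\varepsilon x$, let $f$ be the $2\pi$-periodic function with $f(\phi)=\phi$ on $(0,\pi)$ and $f(\phi)=\phi-2\pi$ on $(\pi,2\pi)$, and put $I=|p_y|d(X)/\pi$; let $\phi$ be the phase, continuous along the ray, with $f(\phi)=\pi y/d(X)$ if $p_y>0$ and $f(\phi)=-\pi y/d(X)$ if $p_y<0$; and put $\hat p_x=p_x+\varepsilon I\frac{d'(X)}{d(X)}f(\phi)$. In these variables $$H=\frac{\pi^2I^2}{d(X)^2}+\Big(\hat p_x-\varepsilon \frac{I\,d'(X)}{d(X)}f(\phi)\Big)^2-1 .$$ Fix $r\ge1$. Let $S=S_1+\varepsilon S_2+\dots+\varepsilon^{r-2}S_{r-1}$ and $\mathcal H_{\Sigma,r}=\mathcal H_0+\varepsilon\mathcal H_1+\dots+\varepsilon^{r-1}\mathcal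 H_{r-1}$, where $\mathcal H_0(I,p,X)=\pi^2I^2/d(X)^2+p^2-1$ and where $S_m(I,\phi,p,X)$ and $\mathcal H_m(I,p,X)$, for $I>0$, are determined recursively by the requirements that $S_m$ be continuous, $2\pi$-periodic and of zero mean in $\phi$ and that all coefficients of $\varepsilon^m$, $m<r$, vanish in $$H\big(I+\varepsilon\,\partial_\phi S,\ \phi,\ p+\varepsilon^2\partial_XS,\ X\big)-\mathcal H_{\Sigma,r}\big(I,\ p,\ X+\varepsilon^2\partial_pS,\ \varepsilon\big).$$ The improved variables $(\tilde I,\tilde\phi,\tilde p_x,\tilde x)$ are given by the near-identity canonical change of variables with generating function $\tilde I\phi+\tilde p_xx+\varepsilon S(\tilde I,\phi,\tilde p_x,\varepsilon x,\varepsilon)$, that is, $I=\tilde I+\varepsilon\partial_\phi S$, $\tilde\phi=\phi+\varepsilon\partial_{\tilde I}S$, $\hat p_x=\tilde p_x+\varepsilon^2\partial_XS$, $\varepsilon\tilde x=\varepsilon x+\varepsilon^2\partial_{\tilde p_x}S$. Let $k\ge1$ be an integer and let $L,c,\delta>0$. There are $C,\varepsilon_0>0$, depending only on $d,r,k,L,c,\delta$,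 such that the following holds for all $0<\varepsilon<\varepsilon_0$, all $0\le T\le L\varepsilon^{-k}$, and every ray on $[0,T]$ that starts strictly between the walls with $I(0)\ge c$. Below, $t$ runs over the times in $[0,T]$ at which the ray is strictly between the walls. (0) A continuous phase $\phi$ and the improved variables exist along the ray, with $|\tilde I-I|\le C\varepsilon$ and $|\tilde p_x-\hat p_x|\le C\varepsilon^2$. (1) Put $J=\tilde I(0)$. Then $|\tilde I(t)-J|\le C\varepsilon^r$ and $|\mathcal H_{\Sigma,r}(J,\tilde p_x(t),\varepsilon\tilde x(t),\varepsilon)|\le C\varepsilon^r$. Suppose further that, with $2U(X)=\pi^2I(0)^2/d(X)^2$ and $X_0=\varepsilon x(0)$, one of the following three conditions holds. They refer to the level $F=1$ of $F=2U(X)+p^2$ on which the ray lies. * (passing over all humps) $2U(X)\le1-\delta$ for all $X\in\mathbb R$; * (one reflection off a hump) $X_0$ lies in a closed half-line $A$ with endpoint $a$ such that $2U(a)=1$, $2U<1$ on $A\setminus\{a\}$, and $(1-2U)+|(2U)'|\ge\delta$ on $A$; * (resonator) $X_0$ lies in an interval $A=[a,b]$, $a<b$, such that $2U(a)=2U(b)=1$,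 $2U<1$ on $(a,b)$, and $(1-2U)+|(2U)'|\ge\delta$ on $A$. Then: (2) For every $t$ there is a point $(q,Z)$ of the curve $\mathcal H_{\Sigma,r}(J,q,Z,\varepsilon)=0$ with $|\tilde p_x(t)-q|\le C\varepsilon^r$ and $|\varepsilon\tilde x(t)-Z|\le C\varepsilon^r$. (3) If $(\psi,p,\xi)$ solves on $[0,T]$ the Hamiltonian equations $\dot\psi=\partial_J\mathcal H_{\Sigma,r}$, $\dot p=-\varepsilon\,\partial_X\mathcal H_{\Sigma,r}$, $\dot\xi=\partial_p\mathcal H_{\Sigma,r}$ at $(J,p,\varepsilon\xi,\varepsilon)$, with $\psi(0)=\tilde\phi(0)$, $p(0)=\tilde p_x(0)$, $\xi(0)=\tilde x(0)$, then for every $t$ $$|\varepsilon\tilde x(t)-\varepsilon\xi(t)|\le C\varepsilon^{r-k+1},\qquad |\tilde p_x(t)-p(t)|\le C\varepsilon^{r-k+1},\qquad |\tilde\phi(t)-\psi(t)|\le C\varepsilon^{r-k}.$$ -/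

import Mathlib

open scoped Real Topology ContDiff

noncomputable section

namespace Waveguide

/-! ### The ray in the waveguide `0 ≤ y ≤ d (ε x)` -/

/-- The width profile `d` is smooth and positive; `d`, all its derivatives and `1 / d` are
uniformly bounded on the real axis. -/
structure IsProfile (d : ℝ → ℝ) : Prop where
  smooth : ContDiff ℝ ∞ d
  bounded : ∀ n : ℕ, ∃ M : ℝ, ∀ X : ℝ, |iteratedDeriv n d X| ≤ M
  width_pos : ∃ m : ℝ, 0 < m ∧ ∀ X : ℝ, m ≤ d X

/-- The point `(x, y)` lies strictly between the two walls. -/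
def Inside (d : ℝ → ℝ) (ε x y : ℝ) : Prop := 0 < y ∧ y < d (ε * x)

/-- A ray on the time interval `[0, T]`: the motion with Hamiltonian `px² + py² - 1` on its zero
level, with finitely many elastic reflections at the walls `y = 0` and `y = d (ε x)`.
The momenta at the instants of reflection themselves carry no information. -/
structure IsRay (d : ℝ → ℝ) (ε T : ℝ) (x y px py : ℝ → ℝ) : Prop where
  cont_x : ContinuousOn x (Set.Icc 0 T)
  cont_y : ContinuousOn y (Set.Icc 0 T)
  mem : ∀ t ∈ Set.Icc 0 T, 0 ≤ y t ∧ y t ≤ d (ε * x t)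
  finite_impacts : {t ∈ Set.Icc 0 T | ¬ Inside d ε (x t) (y t)}.Finite
  energy : ∀ t ∈ Set.Icc 0 T, Inside d ε (x t) (y t) → px t ^ 2 + py t ^ 2 - 1 = 0
  flight_x : ∀ t ∈ Set.Icc 0 T, Inside d ε (x t) (y t) →
    HasDerivWithinAt x (2 * px t) (Set.Icc 0 T) t
  flight_y : ∀ t ∈ Set.Icc 0 T, Inside d ε (x t) (y t) →
    HasDerivWithinAt y (2 * py t) (Set.Icc 0 T) t
  flight_px : ∀ t ∈ Set.Icc 0 T, Inside d ε (x t) (y t) →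
    HasDerivWithinAt px 0 (Set.Icc 0 T) t
  flight_py : ∀ t ∈ Set.Icc 0 T, Inside d ε (x t) (y t) →
    HasDerivWithinAt py 0 (Set.Icc 0 T) t
  /-- Bottom wall: the vertical component of the momentum is reversed. -/
  reflect_bottom : ∀ t ∈ Set.Ioo 0 T, y t = 0 → ∃ u v : ℝ,
    Filter.Tendsto px (𝓝[<] t) (𝓝 u) ∧ Filter.Tendsto py (𝓝[<] t) (𝓝 v) ∧
    Filter.Tendsto px (𝓝[>] t) (𝓝 u) ∧ Filter.Tendsto py (𝓝[>] t) (𝓝 (-v))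
  /-- Upper wall, with slope `s = ε d' (ε x)`: the component of the momentum along the tangent
  `(1, s)` is preserved, and the component along the normal `(-s, 1)` is reversed. -/
  reflect_top : ∀ t ∈ Set.Ioo 0 T, y t = d (ε * x t) → ∃ u v u' v' : ℝ,
    Filter.Tendsto px (𝓝[<] t) (𝓝 u) ∧ Filter.Tendsto py (𝓝[<] t) (𝓝 v) ∧
    Filter.Tendsto px (𝓝[>] t) (𝓝 u') ∧ Filter.Tendsto py (𝓝[>] t) (𝓝 v') ∧
    u' + ε * deriv d (ε * x t) * v' = u + ε * deriv d (ε * x t) * v ∧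
    v' - ε * deriv d (ε * x t) * u' = -(v - ε * deriv d (ε * x t) * u)

/-! ### Action-angle variables -/

/-- The `2π`-periodic function equal to `φ` on `(0, π)` and to `φ - 2π` on `(π, 2π)`. -/
def saw (φ : ℝ) : ℝ := φ - 2 * π * round (φ / (2 * π))

/-- The action `I = |py| d (ε x) / π`. -/
def action (d : ℝ → ℝ) (ε x py : ℝ) : ℝ := |py| * d (ε * x) / π

/-- `φ` is (a real lift of) the phase of the point `(y, py)` inside the waveguide:
modulo `2π` it is `π y / d` if `py > 0` and `π (2 - y / d)` if `py < 0`. -/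
def IsPhase (d : ℝ → ℝ) (ε x y py φ : ℝ) : Prop :=
  (0 < py ∧ saw φ = π * y / d (ε * x)) ∨ (py < 0 ∧ saw φ = -(π * y / d (ε * x)))

/-- The momentum conjugate to `x` after the passage to action-angle variables. -/
def pHat (d : ℝ → ℝ) (ε x px py φ : ℝ) : ℝ :=
  px + ε * (action d ε x py * deriv d (ε * x) / d (ε * x) * saw φ)

/-- The Hamiltonian of the ray in the variables `(I, φ, pHat, x)`, `X = ε x`. -/
def waveH (d : ℝ → ℝ) (ε I φ p X : ℝ) : ℝ :=
  π ^ 2 * I ^ 2 / d X ^ 2 + (p - ε * (I * deriv d X / d X * saw φ)) ^ 2 - 1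

/-! ### The procedure of perturbation theory

`S ε I φ p X` stands for a generating function `S₁ + ε S₂ + ⋯` and `K ε I p X` for a Hamiltonian
`𝓗₀ + ε 𝓗₁ + ⋯` that does not depend on the phase. -/

/-- `H (I + ε ∂S/∂φ, φ, p + ε² ∂S/∂X, X) - K (I, p, X + ε² ∂S/∂p)`. -/
def waveResidual (d : ℝ → ℝ) (S : ℝ → ℝ → ℝ → ℝ → ℝ → ℝ) (K : ℝ → ℝ → ℝ → ℝ → ℝ)
    (ε I φ p X : ℝ) : ℝ :=
  waveH d ε (I + ε * deriv (fun θ => S ε I θ p X) φ) φ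
      (p + ε ^ 2 * deriv (fun Z => S ε I φ p Z) X) X
    - K ε I p (X + ε ^ 2 * deriv (fun q => S ε I φ q X) p)

/-- The coefficient of `ε ^ n` in the residual. -/
def residualCoeff (d : ℝ → ℝ) (S : ℝ → ℝ → ℝ → ℝ → ℝ → ℝ) (K : ℝ → ℝ → ℝ → ℝ → ℝ)
    (n : ℕ) (I φ p X : ℝ) : ℝ :=
  iteratedDeriv n (fun ε => waveResidual d S K ε I φ p X) 0 / (n.factorial : ℝ)

/-- The average over the phase. -/
def phaseMean (g : ℝ → ℝ) : ℝ := (2 * π)⁻¹ * ∫ θ in (-π)..π, g θ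

/-- The next term `𝓗ₙ` of the Hamiltonian: the phase average of the coefficient of `ε ^ n`. -/
def nextH (d : ℝ → ℝ) (S : ℝ → ℝ → ℝ → ℝ → ℝ → ℝ) (K : ℝ → ℝ → ℝ → ℝ → ℝ)
    (n : ℕ) (I p X : ℝ) : ℝ :=
  phaseMean (fun θ => residualCoeff d S K n I θ p X)

/-- The solution of `(2 π² I / d²) ∂Sₙ/∂φ + (coefficient of ε ^ n) = 𝓗ₙ` that vanishes at
`φ = 0`. -/
def nextPrim (d : ℝ → ℝ) (S : ℝ → ℝ → ℝ → ℝ → ℝ → ℝ) (K : ℝ → ℝ → ℝ → ℝ → ℝ)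
    (n : ℕ) (I φ p X : ℝ) : ℝ :=
  ∫ θ in (0 : ℝ)..φ,
    (nextH d S K n I p X - residualCoeff d S K n I θ p X) / (2 * π ^ 2 * I / d X ^ 2)

/-- The next term `Sₙ` of the generating function: the solution of the same equation with zero
phase average. -/
def nextS (d : ℝ → ℝ) (S : ℝ → ℝ → ℝ → ℝ → ℝ → ℝ) (K : ℝ → ℝ → ℝ → ℝ → ℝ)
    (n : ℕ) (I φ p X : ℝ) : ℝ :=
  nextPrim d S K n I φ p X - phaseMean (fun θ => nextPrim d S K n I θ p X)

/-- The pair `(S₁ + ε S₂ + ⋯ + ε ^ (n - 1) Sₙ, 𝓗₀ + ε 𝓗₁ + ⋯ + ε ^ n 𝓗ₙ)`. -/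
def normalForm (d : ℝ → ℝ) :
    ℕ → (ℝ → ℝ → ℝ → ℝ → ℝ → ℝ) × (ℝ → ℝ → ℝ → ℝ → ℝ)
  | 0 => (fun _ _ _ _ _ => 0, fun _ I p X => π ^ 2 * I ^ 2 / d X ^ 2 + p ^ 2 - 1)
  | n + 1 =>
    (fun ε I φ p X => (normalForm d n).1 ε I φ p X
        + ε ^ n * nextS d (normalForm d n).1 (normalForm d n).2 (n + 1) I φ p X,
      fun ε I p X => (normalForm d n).2 ε I p X
        + ε ^ (n + 1) * nextH d (normalForm d n).1 (normalForm d n).2 (n + 1) I p X)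

/-- `S = S₁ + ε S₂ + ⋯ + ε ^ (r - 2) S_{r - 1}`, for `1 ≤ r`. -/
def genS (d : ℝ → ℝ) (r : ℕ) : ℝ → ℝ → ℝ → ℝ → ℝ → ℝ := (normalForm d (r - 1)).1

/-- `𝓗_{Σ, r} = 𝓗₀ + ε 𝓗₁ + ⋯ + ε ^ (r - 1) 𝓗_{r - 1}`, for `1 ≤ r`; the arguments are
`ε`, the action, the momentum and the slow coordinate `X`. -/
def sigmaH (d : ℝ → ℝ) (r : ℕ) : ℝ → ℝ → ℝ → ℝ → ℝ := (normalForm d (r - 1)).2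

/-- `(I, φ, p, x) ↦ (I', φ', p', x')` according to the canonical change of variables with
generating function `I' φ + p' x + ε S (I', φ, p', ε x, ε)`. -/
structure IsImproved (d : ℝ → ℝ) (r : ℕ) (ε I φ p x I' φ' p' x' : ℝ) : Prop where
  action_eq : I = I' + ε * deriv (fun θ => genS d r ε I' θ p' (ε * x)) φ
  phase_eq : φ' = φ + ε * deriv (fun A => genS d r ε A φ p' (ε * x)) I'
  momentum_eq : p = p' + ε ^ 2 * deriv (fun X => genS d r ε I' φ p' X) (ε * x)
  position_eq : ε * x' = ε * x + ε ^ 2 * deriv (fun q => genS d r ε I' φ q (ε * x)) p'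

/-- A solution on `[0, T]` of the canonical equations with Hamiltonian `𝓗_{Σ, r} (J, p, ε x, ε)`,
in which the action `J` is constant. -/
structure IsSigmaFlow (d : ℝ → ℝ) (r : ℕ) (ε T J : ℝ) (ψ p x : ℝ → ℝ) : Prop where
  phase : ∀ t ∈ Set.Icc 0 T,
    HasDerivWithinAt ψ (deriv (fun A => sigmaH d r ε A (p t) (ε * x t)) J) (Set.Icc 0 T) t
  momentum : ∀ t ∈ Set.Icc 0 T,
    HasDerivWithinAt p (-(ε * deriv (fun X => sigmaH d r ε J (p t) X) (ε * x t)))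
      (Set.Icc 0 T) t
  position : ∀ t ∈ Set.Icc 0 T,
    HasDerivWithinAt x (deriv (fun q => sigmaH d r ε J q (ε * x t)) (p t)) (Set.Icc 0 T) t

/-! ### The three cases

The slow motion has in zero approximation the integral `F = 2U (X) + p²`, whose value on the ray
is `1`. The number `δ > 0` measures the distance of the level `F = 1` from equilibria and
separatrices. -/

/-- Twice the effective potential, `2U (X) = π² I² / d (X)²`. -/
def twoU (d : ℝ → ℝ) (I X : ℝ) : ℝ := π ^ 2 * I ^ 2 / d X ^ 2

/-- The level is above all humps of `2U`. -/
def OverHumps (d : ℝ → ℝ) (δ I : ℝ) : Prop := ∀ X : ℝ, twoU d I X + δ ≤ 1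

/-- On the set `s` of slow coordinates the level meets `2U` at most at `turning`, and nowhere
degenerately. -/
def TurnsOnlyAt (d : ℝ → ℝ) (δ I : ℝ) (s turning : Set ℝ) : Prop :=
  (∀ X ∈ turning, twoU d I X = 1) ∧ (∀ X ∈ s \ turning, twoU d I X < 1) ∧
    ∀ X ∈ s, δ ≤ (1 - twoU d I X) + |deriv (twoU d I) X|

/-- The ray starting at the slow coordinate `X₀` moves in a half-line bounded by one hump, at
which it can reflect only once. -/
def OneReflection (d : ℝ → ℝ) (δ I X₀ : ℝ) : Prop :=
  ∃ a : ℝ, (X₀ ∈ Set.Ici a ∧ TurnsOnlyAt d δ I (Set.Ici a) {a}) ∨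
    (X₀ ∈ Set.Iic a ∧ TurnsOnlyAt d δ I (Set.Iic a) {a})

/-- The ray starting at the slow coordinate `X₀` moves between two humps. -/
def Resonator (d : ℝ → ℝ) (δ I X₀ : ℝ) : Prop :=
  ∃ a b : ℝ, a < b ∧ X₀ ∈ Set.Icc a b ∧ TurnsOnlyAt d δ I (Set.Icc a b) {a, b}

end Waveguide

end

/-! Put `u = saw φ`. In the variables `(I, u, p, X)` the Hamiltonian is a polynomial in `u`, and so
is everything that perturbation theory makes of it: all terms of `S` and of the averaged Hamiltonian
are finite sums of monomials in `I`, `1 / I`, `u`, `p` whose coefficients are functions of `X`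
bounded with all derivatives (`IsPoly`). The homological equation is solved by a primitive in `u`.
Removing the mean of the right-hand side makes the primitive equal at `u = π` and `u = -π`, so that
`S` is continuous in `φ` although `saw` jumps. The class yields estimates uniform in `X`: the
residual of the normal form is `O(ε ^ r)` together with its first derivatives (`IsNormalForm.succ`,
`IsNormalForm.ord_residual`).

Between jumps, differentiating the residual and using the symmetry of the second derivatives of `S`
shows that the improved variables obey the averaged equations up to first derivatives of the
residual (`IsNormalForm.velocity_eq`, `IsNormalForm.motion`). A reflection off the bottom is
invisible in these variables. At a reflection off the top `u` passes from `π` to `-π` while `p` and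
`X` stay; there the derivatives of `S` along `I`, `p`, `X` agree at both ends, and the change of the
improved action is controlled by conservation of energy, since the leading Hamiltonian is strictly
increasing in the action (`IsNormalForm.reflection`). Impacts are separated in time
(`IsRay.separation`), so their number is at most linear in the time.

This gives a drift `ε ^ r (1 + T)` of the improved action, which is not enough for `T ~ ε ^ (-k)`.
The remedy is to use the normal form with `k` further terms: its action drifts by only `ε ^ (r + k)
(1 + T)`, and it differs from the original one by `O(ε ^ r)` at every instant
(`HybridMotion.action_conserved`). All this needs a lower bound for `|py|` in advance; it comes from
a continuation argument in which the almost conserved action improves the bound that was used to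
prove its conservation (`IsRay.fast_of_bootstrap`, `IsRay.fast`).

With the action frozen at its initial value, the improved momentum and slow coordinate form an
approximate orbit of a Hamiltonian system in the plane: the velocity error is `O(ε ^ (r + 1))`, the
jumps are as small, and the Hamiltonian `K` is `O(ε ^ r)` along it. In each of the three cases the
potential confines the slow coordinate to a region without equilibria on the level (`confinement`,
`ImprovedMotion.nondegenerate`), so the gradient of `K` is bounded below, and the intermediate value
theorem yields a true zero of `K` at distance `O(ε ^ r)`.

For the comparison with the averaged flow, the Gronwall inequality over the whole interval would
lose an exponential factor. Instead the two parts of the deviation are treated separately: the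
transversal part is always `O(ε ^ r)` because `K` is almost constant, and the part along the orbit
is removed by a shift of the time of the orbit. In one unit of slow time the shift grows by `O(ε ^
(r - 1))`, so after `ε T` units it is at most of order `ε ^ (r - 1) (1 + ε T)`; this costs `ε ^ r (1
+ ε T)` in the plane and `ε ^ (r - 1) (1 + ε T)` in the phase (`ApproxOrbit.exists_shift`,
`ApproxOrbit.shadow_steps`, `exists_shadow_constants`). -/

noncomputable section

namespace Waveguide

/-! ### Smooth functions with bounded derivatives -/

/-- Smooth functions all of whose derivatives, of order zero included, are bounded. -/
def BddSmooth (c : ℝ → ℝ) : Prop :=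
  ContDiff ℝ ∞ c ∧ ∀ n : ℕ, ∃ M : ℝ, ∀ X : ℝ, |iteratedDeriv n c X| ≤ M

namespace BddSmooth

variable {c c' : ℝ → ℝ}

theorem differentiable (hc : BddSmooth c) : Differentiable ℝ c :=
  hc.1.differentiable (by simp)

theorem hasDerivAt (hc : BddSmooth c) (X : ℝ) : HasDerivAt c (deriv c X) X :=
  (hc.differentiable X).hasDerivAt

theorem deriv (hc : BddSmooth c) : BddSmooth (deriv c) := by
  refine ⟨(contDiff_infty_iff_deriv.1 hc.1).2, fun n => ?_⟩
  obtain ⟨M, hM⟩ := hc.2 (n + 1)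
  exact ⟨M, fun X => by rw [← iteratedDeriv_succ']; exact hM X⟩

theorem iteratedDeriv (hc : BddSmooth c) (n : ℕ) : BddSmooth (iteratedDeriv n c) := by
  induction n with
  | zero => simpa using hc
  | succ n ih => rw [iteratedDeriv_succ]; exact ih.deriv

theorem bound (hc : BddSmooth c) : ∃ M : ℝ, 0 ≤ M ∧ ∀ X, |c X| ≤ M := by
  obtain ⟨M, hM⟩ := hc.2 0
  exact ⟨M, (abs_nonneg _).trans (hM 0), fun X => by simpa using hM X⟩

theorem const (a : ℝ) : BddSmooth fun _ => a := by
  refine ⟨contDiff_const, fun n => ?_⟩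
  rcases n with _ | n
  · exact ⟨|a|, fun X => by simp⟩
  · exact ⟨0, fun X => by simp [iteratedDeriv_const]⟩

/-- Induction by the product rule. Only derivatives up to order `n` are assumed bounded, because the
proof for reciprocals applies this when the higher derivatives are not yet under control. -/
theorem bound_mul_aux (n : ℕ) : ∀ c c' : ℝ → ℝ, ContDiff ℝ ∞ c → ContDiff ℝ ∞ c' →
    (∀ k ≤ n, ∃ M : ℝ, ∀ X, |_root_.iteratedDeriv k c X| ≤ M) →
    (∀ k ≤ n, ∃ M : ℝ, ∀ X, |_root_.iteratedDeriv k c' X| ≤ M) →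
    ∃ M : ℝ, ∀ X, |_root_.iteratedDeriv n (fun X => c X * c' X) X| ≤ M := by
  induction n with
  | zero =>
    intro c c' _ _ h h'
    obtain ⟨M, hM⟩ := h 0 le_rfl
    obtain ⟨M', hM'⟩ := h' 0 le_rfl
    refine ⟨M * M', fun X => ?_⟩
    simp only [iteratedDeriv_zero] at *
    rw [abs_mul]
    exact mul_le_mul (hM X) (hM' X) (abs_nonneg _) ((abs_nonneg _).trans (hM X))
  | succ n ih =>
    intro c c' hc hc' h h'
    have d1 := (contDiff_infty_iff_deriv.1 hc).2
    have d2 := (contDiff_infty_iff_deriv.1 hc').2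
    obtain ⟨M, hM⟩ := ih (_root_.deriv c) c' d1 hc'
      (fun k hk => by
        obtain ⟨M, hM⟩ := h (k + 1) (by omega)
        exact ⟨M, fun X => by rw [← iteratedDeriv_succ']; exact hM X⟩)
      (fun k hk => h' k (by omega))
    obtain ⟨M', hM'⟩ := ih c (_root_.deriv c') hc d2 (fun k hk => h k (by omega))
      (fun k hk => by
        obtain ⟨M, hM⟩ := h' (k + 1) (by omega)
        exact ⟨M, fun X => by rw [← iteratedDeriv_succ']; exact hM X⟩)
    refine ⟨M + M', fun X => ?_⟩
    have e : _root_.deriv (fun X => c X * c' X) =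
        fun X => _root_.deriv c X * c' X + c X * _root_.deriv c' X := by
      funext X
      exact deriv_fun_mul (hc.differentiable (by simp) X) (hc'.differentiable (by simp) X)
    rw [iteratedDeriv_succ', e, iteratedDeriv_fun_add
      (((d1.mul hc').of_le (by exact_mod_cast le_top)).contDiffAt)
      (((hc.mul d2).of_le (by exact_mod_cast le_top)).contDiffAt)]
    exact (abs_add_le _ _).trans (add_le_add (hM X) (hM' X))

theorem mul (hc : BddSmooth c) (hc' : BddSmooth c') : BddSmooth fun X => c X * c' X :=
  ⟨hc.1.mul hc'.1, fun n => bound_mul_aux n c c' hc.1 hc'.1 (fun k _ => hc.2 k)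
    (fun k _ => hc'.2 k)⟩

theorem neg (hc : BddSmooth c) : BddSmooth fun X => -c X := by
  simpa using (const (-1)).mul hc

/-- The identity `(1 / c)' = -c' (1 / c) ^ 2` expresses each derivative of the reciprocal through
lower ones, hence strong induction on the order. -/
theorem inv (hc : BddSmooth c) {m : ℝ} (hm : 0 < m) (h : ∀ X, m ≤ c X) :
    BddSmooth fun X => (c X)⁻¹ := by
  have h0 : ∀ X, c X ≠ 0 := fun X => (hm.trans_le (h X)).ne'
  have hs : ContDiff ℝ ∞ fun X => (c X)⁻¹ := hc.1.inv h0
  refine ⟨hs, fun n => ?_⟩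
  induction n using Nat.strong_induction_on with
  | _ n ih =>
    rcases n with _ | n
    · refine ⟨m⁻¹, fun X => ?_⟩
      rw [iteratedDeriv_zero, abs_of_pos (inv_pos.2 (hm.trans_le (h X)))]
      exact inv_anti₀ hm (h X)
    · have e : _root_.deriv (fun X => (c X)⁻¹) =
          fun X => (-_root_.deriv c X) * ((c X)⁻¹ * (c X)⁻¹) := by
        funext X
        rw [((hc.hasDerivAt X).fun_inv (h0 X)).deriv]
        field_simp
      have ih' : ∀ k ≤ n, ∃ M : ℝ, ∀ X, |_root_.iteratedDeriv k (fun X => (c X)⁻¹) X| ≤ M :=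
        fun k hk => ih k (by omega)
      rw [iteratedDeriv_succ', e]
      refine bound_mul_aux n _ _ hc.deriv.neg.1 (hs.mul hs) (fun k _ => hc.deriv.neg.2 k) ?_
      exact fun k hk => bound_mul_aux k _ _ hs hs (fun j hj => ih' j (hj.trans hk))
        (fun j hj => ih' j (hj.trans hk))

theorem lipschitz (hc : BddSmooth c) : ∃ M : ℝ, 0 ≤ M ∧ ∀ X Y, |c X - c Y| ≤ M * |X - Y| := by
  obtain ⟨M, hM0, hM⟩ := hc.deriv.bound
  refine ⟨M, hM0, fun X Y => ?_⟩
  simpa using Convex.norm_image_sub_le_of_norm_deriv_le (f := c) (s := Set.univ)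
    (fun x _ => hc.differentiable x) (fun x _ => hM x) convex_univ (Set.mem_univ Y)
    (Set.mem_univ X)

end BddSmooth

theorem IsProfile.bddSmooth {d : ℝ → ℝ} (hd : IsProfile d) : BddSmooth d :=
  ⟨hd.smooth, hd.bounded⟩

theorem IsProfile.inv_bddSmooth {d : ℝ → ℝ} (hd : IsProfile d) :
    BddSmooth fun X => (d X)⁻¹ := by
  obtain ⟨m, hm, h⟩ := hd.width_pos
  exact hd.bddSmooth.inv hm h

theorem IsProfile.pos {d : ℝ → ℝ} (hd : IsProfile d) (X : ℝ) : 0 < d X := by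
  obtain ⟨m, hm, h⟩ := hd.width_pos
  exact hm.trans_le (h X)

/-! ### Polynomial expressions in the action, the phase and the momentum -/

/-- The space of the variables `(I, u, p, X)`, where `u` stands for `saw φ`. -/
abbrev PS : Type := ℝ × ℝ × ℝ × ℝ

/-- Functions of `ε` and `(I, u, p, X)` that are, for `I > 0`, finite sums of monomials in
`ε, I, 1 / I, u, p` with coefficients that are bounded smooth functions of `X`. -/
inductive IsPoly : (ℝ → PS → ℝ) → Prop
  | mono (c : ℝ → ℝ) (hc : BddSmooth c) (n a a' e b : ℕ) : IsPoly fun ε v =>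
      c v.2.2.2 * ε ^ n * v.1 ^ a * (v.1⁻¹) ^ a' * v.2.1 ^ e * v.2.2.1 ^ b
  | add (F G : ℝ → PS → ℝ) : IsPoly F → IsPoly G → IsPoly fun ε v => F ε v + G ε v
  | congr (F G : ℝ → PS → ℝ) : (∀ ε v, 0 < v.1 → F ε v = G ε v) → IsPoly F → IsPoly G

/-- The derivative of `F ε` in the direction `e`. -/
def dirD (e : PS) (F : ℝ → PS → ℝ) (ε : ℝ) (v : PS) : ℝ := fderiv ℝ (F ε) v e

theorem isOpen_pos : IsOpen {v : PS | 0 < v.1} := isOpen_lt continuous_const continuous_fst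

theorem eventually_pos {v : PS} (hv : 0 < v.1) : ∀ᶠ w in 𝓝 v, 0 < w.1 :=
  isOpen_pos.mem_nhds hv

namespace IsPoly

variable {F G : ℝ → PS → ℝ}

theorem coeff {c : ℝ → ℝ} (hc : BddSmooth c) : IsPoly fun _ v => c v.2.2.2 :=
  congr _ _ (by intros; simp) (mono c hc 0 0 0 0 0)

theorem const (a : ℝ) : IsPoly fun _ _ => a := coeff (BddSmooth.const a)

theorem eps (n : ℕ) : IsPoly fun ε _ => ε ^ n :=
  congr _ _ (by intros; simp) (mono _ (BddSmooth.const 1) n 0 0 0 0)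

theorem act : IsPoly fun _ v => v.1 :=
  congr _ _ (by intros; simp) (mono _ (BddSmooth.const 1) 0 1 0 0 0)

theorem act_inv : IsPoly fun _ v => v.1⁻¹ :=
  congr _ _ (by intros; simp) (mono _ (BddSmooth.const 1) 0 0 1 0 0)

theorem ang : IsPoly fun _ v => v.2.1 :=
  congr _ _ (by intros; simp) (mono _ (BddSmooth.const 1) 0 0 0 1 0)

theorem mom : IsPoly fun _ v => v.2.2.1 :=
  congr _ _ (by intros; simp) (mono _ (BddSmooth.const 1) 0 0 0 0 1)

theorem mul (hF : IsPoly F) (hG : IsPoly G) : IsPoly fun ε v => F ε v * G ε v := by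
  induction hF with
  | mono c hc n a a' e b =>
    induction hG with
    | mono c₂ hc₂ n₂ a₂ a₂' e₂ b₂ =>
      refine congr _ _ ?_ (mono _ (hc.mul hc₂) (n + n₂) (a + a₂) (a' + a₂') (e + e₂) (b + b₂))
      intro ε v _
      simp only [pow_add]
      ring
    | add F G _ _ h1 h2 =>
      refine congr _ _ ?_ (add _ _ h1 h2)
      intros; ring
    | congr F G h _ ih =>
      refine congr _ _ ?_ ih
      intro ε v hv; rw [h ε v hv]
  | add F G _ _ h1 h2 =>
    refine congr _ _ ?_ (add _ _ h1 h2)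
    intros; ring
  | congr F G h _ ih =>
    refine congr _ _ ?_ ih
    intro ε v hv; rw [h ε v hv]

theorem neg (hF : IsPoly F) : IsPoly fun ε v => -F ε v :=
  congr _ _ (by intros; ring) ((const (-1)).mul hF)

theorem sub (hF : IsPoly F) (hG : IsPoly G) : IsPoly fun ε v => F ε v - G ε v :=
  congr _ _ (by intros; ring) (add _ _ hF hG.neg)

theorem pow (hF : IsPoly F) (n : ℕ) : IsPoly fun ε v => F ε v ^ n := by
  induction n with
  | zero => exact congr _ _ (by intros; simp) (const 1)
  | succ n ih => exact congr _ _ (by intros; rw [pow_succ]) (ih.mul hF)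

theorem sum {ι : Type*} (s : Finset ι) (f : ι → ℝ → PS → ℝ) (h : ∀ i ∈ s, IsPoly (f i)) :
    IsPoly fun ε v => ∑ i ∈ s, f i ε v := by
  classical
  induction s using Finset.induction_on with
  | empty => exact congr _ _ (by intros; simp) (const 0)
  | insert i s hi ih =>
    refine congr _ _ (by intros; rw [Finset.sum_insert hi])
      (add _ _ (h i (by simp)) (ih fun j hj => h j (by simp [hj])))

theorem contDiffAt (hF : IsPoly F) (ε : ℝ) {v : PS} (hv : 0 < v.1) :
    ContDiffAt ℝ ∞ (F ε) v := by
  induction hF with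
  | mono c hc n a a' e b =>
    have := hv.ne'
    have h1 : ContDiffAt ℝ ∞ (fun v : PS => c v.2.2.2) v :=
      hc.1.contDiffAt.comp v (by fun_prop)
    have h2 : ContDiffAt ℝ ∞ (fun v : PS => v.1⁻¹) v := contDiffAt_fst.inv this
    exact ((((h1.mul contDiffAt_const).mul (contDiffAt_fst.pow a)).mul (h2.pow a')).mul
      (contDiffAt_snd.fst.pow e)).mul (contDiffAt_snd.snd.fst.pow b)
  | add F G _ _ h1 h2 => exact h1.add h2
  | congr F G h _ ih =>
    refine ih.congr_of_eventuallyEq ?_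
    filter_upwards [eventually_pos hv] with w hw using (h ε w hw).symm

theorem differentiableAt (hF : IsPoly F) (ε : ℝ) {v : PS} (hv : 0 < v.1) :
    DifferentiableAt ℝ (F ε) v :=
  (hF.contDiffAt ε hv).differentiableAt (by simp)

theorem dirD_congr (h : ∀ ε v, 0 < v.1 → F ε v = G ε v) (e : PS) (ε : ℝ) {v : PS}
    (hv : 0 < v.1) : dirD e F ε v = dirD e G ε v := by
  have : F ε =ᶠ[𝓝 v] G ε := by
    filter_upwards [eventually_pos hv] with w hw using h ε w hw
  rw [dirD, dirD, this.fderiv_eq]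

theorem dirD (hF : IsPoly F) (e : PS) : IsPoly (dirD e F) := by
  induction hF with
  | mono c hc n a a' k b =>
    obtain ⟨e1, e2, e3, e4⟩ := e
    -- The product rule, one monomial for each factor. A truncated exponent such as `a - 1` does no
    -- harm at `a = 0`, since the coefficient then contains the factor `a`; the negative power of
    -- the action is raised instead of lowered.
    have key := add _ _ (add _ _ (add _ _ (add _ _
      (mono _ ((BddSmooth.const e4).mul hc.deriv) n a a' k b)
      (mono _ ((BddSmooth.const (e1 * a)).mul hc) n (a - 1) a' k b))
      (mono _ ((BddSmooth.const (-e1 * a')).mul hc) n a (a' + 1) k b))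
      (mono _ ((BddSmooth.const (e2 * k)).mul hc) n a a' (k - 1) b))
      (mono _ ((BddSmooth.const (e3 * b)).mul hc) n a a' k (b - 1))
    refine congr _ _ ?_ key
    intro ε v hv
    have h0 : HasFDerivAt (fun v : PS => v) (ContinuousLinearMap.id ℝ PS) v := hasFDerivAt_id v
    have h1 : HasFDerivAt (fun v : PS => v.2) _ v := h0.snd
    have h2 : HasFDerivAt (fun v : PS => v.2.2) _ v := h1.snd
    have hX : HasFDerivAt (fun v : PS => v.2.2.2) _ v := h2.snd
    have hp : HasFDerivAt (fun v : PS => v.2.2.1) _ v := h2.fst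
    have hu : HasFDerivAt (fun v : PS => v.2.1) _ v := h1.fst
    have hI : HasFDerivAt (fun v : PS => v.1) _ v := h0.fst
    have h := (((((hc.hasDerivAt v.2.2.2).comp_hasFDerivAt v hX).mul_const (ε ^ n)).mul
      (hI.pow a)).mul (((hasDerivAt_inv hv.ne').comp_hasFDerivAt v hI).pow a')).mul (hu.pow k)
      |>.mul (hp.pow b)
    have h' := h.fderiv
    simp only [Waveguide.dirD]
    refine Eq.trans ?_ (congrArg (fun L : PS →L[ℝ] ℝ => L (e1, e2, e3, e4)) h').symm
    simp
    rcases a' with _ | a'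
    · simp; ring
    · simp [pow_succ]; field_simp; ring
  | add F G hF hG h1 h2 =>
    refine congr _ _ ?_ (add _ _ h1 h2)
    intro ε v hv
    simp only [Waveguide.dirD]
    rw [fderiv_fun_add (hF.differentiableAt ε hv) (hG.differentiableAt ε hv)]
    rfl
  | congr F G h _ ih => exact congr _ _ (fun ε v hv => dirD_congr h e ε hv) ih

end IsPoly
end Waveguide

/-! ### Symmetry of derivatives, primitives in the angle and expansion in `ε`. -/

namespace Waveguide

namespace IsPoly

variable {F G : ℝ → PS → ℝ}

/-- It is through this symmetry, applied to the generating function, that the change of variables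
acts as a canonical one. -/
theorem dirD_comm (hF : IsPoly F) (e f : PS) (ε : ℝ) {v : PS} (hv : 0 < v.1) :
    Waveguide.dirD e (Waveguide.dirD f F) ε v = Waveguide.dirD f (Waveguide.dirD e F) ε v := by
  have h := hF.contDiffAt ε hv
  have hd : DifferentiableAt ℝ (fderiv ℝ (F ε)) v :=
    (h.fderiv_right (m := 1) (by norm_cast)).differentiableAt (by simp)
  have key : ∀ e f : PS, Waveguide.dirD e (Waveguide.dirD f F) ε v =
      fderiv ℝ (fderiv ℝ (F ε)) v e f := by
    intro e f
    change fderiv ℝ (fun w => fderiv ℝ (F ε) w f) v e = _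
    rw [fderiv_clm_apply hd (differentiableAt_const f)]
    simp
  rw [key, key]
  have h2 : ContDiffAt ℝ 2 (F ε) v := h.of_le ENat.LEInfty.out
  exact h2.isSymmSndFDerivAt (by simp) e f

/-- The primitive of an `ε`-free coefficient is produced as an expression that may depend on `ε`;
freezing `ε` brings it back to the `ε`-free ones. -/
theorem eps_zero (hF : IsPoly F) : IsPoly fun _ v => F 0 v := by
  induction hF with
  | mono c hc n a a' e b =>
    refine congr _ _ ?_ (mono _ ((BddSmooth.const (0 ^ n)).mul hc) 0 a a' e b)
    intro ε v _; ring
  | add F G _ _ h1 h2 => exact add _ _ h1 h2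
  | congr F G h _ ih => exact congr _ _ (fun ε v hv => h 0 v hv) ih

theorem subst_ang (hF : IsPoly F) (u : ℝ) : IsPoly fun ε v => F ε (v.1, u, v.2.2) := by
  induction hF with
  | mono c hc n a a' e b =>
    refine congr _ _ ?_ (mono _ ((BddSmooth.const (u ^ e)).mul hc) n a a' 0 b)
    intro ε v _; simp only [pow_zero, mul_one]; ring
  | add F G _ _ h1 h2 => exact add _ _ h1 h2
  | congr F G h _ ih => exact congr _ _ (fun ε v hv => h ε _ hv) ih

/-- Integration in `u` raises one exponent, so the class is closed under solving the homological
equation. This is the reason for working with polynomials in `u`. -/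
theorem primitive (hF : IsPoly F) : ∃ G, IsPoly G ∧
    (∀ ε (v : PS), 0 < v.1 → HasDerivAt (fun u => G ε (v.1, u, v.2.2)) (F ε v) v.2.1) ∧
    ∀ ε (v : PS), 0 < v.1 → G ε (v.1, 0, v.2.2) = 0 := by
  induction hF with
  | mono c hc n a a' e b =>
    refine ⟨_, mono _ ((BddSmooth.const ((e + 1 : ℝ)⁻¹)).mul hc) n a a' (e + 1) b,
      fun ε v _ => ?_, fun ε v _ => by simp⟩
    have h := (((hasDerivAt_pow (e + 1) v.2.1).const_mul
      ((e + 1 : ℝ)⁻¹ * c v.2.2.2 * ε ^ n * v.1 ^ a * (v.1⁻¹) ^ a'))).mul_const (v.2.2.1 ^ b)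
    refine h.congr_deriv ?_
    push_cast
    have : (e + 1 : ℝ) ≠ 0 := by positivity
    field_simp
  | add F G _ _ h1 h2 =>
    obtain ⟨G1, p1, d1, z1⟩ := h1
    obtain ⟨G2, p2, d2, z2⟩ := h2
    exact ⟨_, add _ _ p1 p2, fun ε v hv => (d1 ε v hv).add (d2 ε v hv),
      fun ε v hv => by rw [z1 ε v hv, z2 ε v hv, add_zero]⟩
  | congr F G h _ ih =>
    obtain ⟨G1, p1, d1, z1⟩ := ih
    exact ⟨G1, p1, fun ε v hv => by rw [← h ε v hv]; exact d1 ε v hv, z1⟩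

/-- The monomials carry explicit powers of `ε`: those below `n` are sorted into coefficients, and
each of the others gives up a factor `ε ^ n`. The remainder therefore stays in the class and
inherits its uniform bounds. -/
theorem split (hF : IsPoly F) (n : ℕ) : ∃ (f : ℕ → PS → ℝ) (G : ℝ → PS → ℝ),
    (∀ j, IsPoly fun _ v => f j v) ∧ IsPoly G ∧
    ∀ ε v, 0 < v.1 → F ε v = ∑ j ∈ Finset.range n, ε ^ j * f j v + ε ^ n * G ε v := by
  induction hF with
  | mono c hc k a a' e b =>
    by_cases hk : k < n
    · refine ⟨fun j v => if j = k then
        c v.2.2.2 * v.1 ^ a * (v.1⁻¹) ^ a' * v.2.1 ^ e * v.2.2.1 ^ b else 0, fun _ _ => 0,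
        fun j => ?_, const 0, fun ε v _ => ?_⟩
      · by_cases hj : j = k
        · simp only [hj, if_true]
          exact congr _ _ (by intros; simp) (mono c hc 0 a a' e b)
        · simp only [hj, if_false]; exact const 0
      · rw [Finset.sum_eq_single k (by intro j _ hj; simp [hj])
          (by intro h; exact absurd (Finset.mem_range.2 hk) h)]
        simp; ring
    · refine ⟨fun _ _ => 0, _, fun _ => const 0, mono c hc (k - n) a a' e b, fun ε v _ => ?_⟩
      have : ε ^ k = ε ^ n * ε ^ (k - n) := by rw [← pow_add]; congr 1; omega
      simp [this]; ring
  | add F G _ _ h1 h2 =>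
    obtain ⟨f1, G1, p1, q1, e1⟩ := h1
    obtain ⟨f2, G2, p2, q2, e2⟩ := h2
    refine ⟨fun j v => f1 j v + f2 j v, _, fun j => add _ _ (p1 j) (p2 j), add _ _ q1 q2,
      fun ε v hv => ?_⟩
    simp only [e1 ε v hv, e2 ε v hv, mul_add, Finset.sum_add_distrib]; ring
  | congr F G h _ ih =>
    obtain ⟨f1, G1, p1, q1, e1⟩ := ih
    exact ⟨f1, G1, p1, q1, fun ε v hv => by rw [← h ε v hv]; exact e1 ε v hv⟩

end IsPoly

/-! ### Bounds on slabs -/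

/-- The region where the action is bounded and bounded away from zero, and the angle and the
momentum are bounded. -/
def Slab (M : ℝ) : Set PS := {v | M⁻¹ ≤ v.1 ∧ v.1 ≤ M ∧ |v.2.1| ≤ M ∧ |v.2.2.1| ≤ M}

theorem Slab.pos {M : ℝ} (hM : 0 < M) {v : PS} (hv : v ∈ Slab M) : 0 < v.1 :=
  (inv_pos.2 hM).trans_le hv.1

theorem convex_slab (M : ℝ) : Convex ℝ (Slab M) := by
  have : Slab M = Set.Icc M⁻¹ M ×ˢ (Set.Icc (-M) M ×ˢ (Set.Icc (-M) M ×ˢ (Set.univ : Set ℝ))) := by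
    ext v
    simp only [Slab, Set.mem_ofPred_eq, Set.mem_prod, Set.mem_Icc, abs_le, Set.mem_univ]
    tauto
  rw [this]
  exact (convex_Icc _ _).prod ((convex_Icc _ _).prod ((convex_Icc _ _).prod convex_univ))

theorem clm_apply_eq (L : PS →L[ℝ] ℝ) (v : PS) :
    L v = v.1 * L (1, 0, 0, 0) + v.2.1 * L (0, 1, 0, 0) + v.2.2.1 * L (0, 0, 1, 0)
      + v.2.2.2 * L (0, 0, 0, 1) := by
  have : v = v.1 • ((1, 0, 0, 0) : PS) + v.2.1 • ((0, 1, 0, 0) : PS)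
      + v.2.2.1 • ((0, 0, 1, 0) : PS) + v.2.2.2 • ((0, 0, 0, 1) : PS) := by
    ext <;> simp
  conv_lhs => rw [this]
  simp only [map_add, map_smul, smul_eq_mul]

theorem PS.abs_le_norm (v : PS) :
    |v.1| ≤ ‖v‖ ∧ |v.2.1| ≤ ‖v‖ ∧ |v.2.2.1| ≤ ‖v‖ ∧ |v.2.2.2| ≤ ‖v‖ := by
  have h1 := norm_fst_le v
  have h2 := norm_snd_le v
  have h3 := norm_fst_le v.2
  have h4 := norm_snd_le v.2
  have h5 := norm_fst_le v.2.2
  have h6 := norm_snd_le v.2.2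
  simp only [Real.norm_eq_abs] at *
  exact ⟨h1, h3.trans h2, (h5.trans h4).trans h2, (h6.trans h4).trans h2⟩

theorem PS.norm_le {v : PS} {C : ℝ} (h1 : |v.1| ≤ C) (h2 : |v.2.1| ≤ C) (h3 : |v.2.2.1| ≤ C)
    (h4 : |v.2.2.2| ≤ C) : ‖v‖ ≤ C := by
  simp only [Prod.norm_def, Real.norm_eq_abs]
  exact max_le h1 (max_le h2 (max_le h3 h4))

theorem clm_norm_le {L : PS →L[ℝ] ℝ} {C : ℝ} (h1 : |L (1, 0, 0, 0)| ≤ C)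
    (h2 : |L (0, 1, 0, 0)| ≤ C) (h3 : |L (0, 0, 1, 0)| ≤ C) (h4 : |L (0, 0, 0, 1)| ≤ C) :
    ‖L‖ ≤ 4 * C := by
  have hC : 0 ≤ C := (abs_nonneg _).trans h1
  refine L.opNorm_le_bound (by positivity) fun v => ?_
  obtain ⟨a, b, c, e⟩ := PS.abs_le_norm v
  rw [clm_apply_eq L v, Real.norm_eq_abs]
  have m : ∀ x y : ℝ, |x| ≤ ‖v‖ → |y| ≤ C → |x * y| ≤ C * ‖v‖ := fun x y hx hy => by
    rw [abs_mul, mul_comm]; exact mul_le_mul hy hx (abs_nonneg _) hC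
  have := m _ _ a h1
  have := m _ _ b h2
  have := m _ _ c h3
  have := m _ _ e h4
  refine (abs_add_le _ _).trans ?_
  refine (add_le_add_left (abs_add_le _ _) _).trans ?_
  refine (add_le_add_left (add_le_add_left (abs_add_le _ _) _) _).trans ?_
  linarith

/-- A slab bounds `I`, `1 / I`, `u` and `p`; nothing is asked of `X`, since the coefficients are
bounded on the whole axis. -/
theorem IsPoly.bound {F : ℝ → PS → ℝ} (hF : IsPoly F) {M : ℝ} (hM : 0 < M) :
    ∃ C : ℝ, 0 ≤ C ∧ ∀ ε : ℝ, |ε| ≤ 1 → ∀ v ∈ Slab M, |F ε v| ≤ C := by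
  induction hF with
  | mono c hc n a a' e b =>
    obtain ⟨B, hB0, hB⟩ := hc.bound
    refine ⟨B * 1 * M ^ a * M ^ a' * M ^ e * M ^ b, by positivity, fun ε hε v hv => ?_⟩
    obtain ⟨h1, h2, h3, h4⟩ := hv
    have h0 : 0 < v.1 := (inv_pos.2 hM).trans_le h1
    have hi : v.1⁻¹ ≤ M := by rw [inv_le_comm₀ h0 hM]; exact h1
    simp only [abs_mul, abs_pow, abs_of_pos h0, abs_of_pos (inv_pos.2 h0)]
    gcongr
    · exact hB _
    · exact pow_le_one₀ (abs_nonneg _) hε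
  | add F G _ _ h1 h2 =>
    obtain ⟨C1, p1, b1⟩ := h1
    obtain ⟨C2, p2, b2⟩ := h2
    exact ⟨C1 + C2, by positivity, fun ε hε v hv =>
      (abs_add_le _ _).trans (add_le_add (b1 ε hε v hv) (b2 ε hε v hv))⟩
  | congr F G h _ ih =>
    obtain ⟨C1, p1, b1⟩ := ih
    exact ⟨C1, p1, fun ε hε v hv => by rw [← h ε v (Slab.pos hM hv)]; exact b1 ε hε v hv⟩

/-- `F` and its first derivatives in `(I, u, p, X)` are `O(ε ^ n)`, uniformly on slabs. -/
def Ord (n : ℕ) (F : ℝ → PS → ℝ) : Prop :=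
  ∀ M : ℝ, 0 < M → ∃ C : ℝ, 0 ≤ C ∧ ∀ ε : ℝ, |ε| ≤ 1 → ∀ v ∈ Slab M,
    DifferentiableAt ℝ (F ε) v ∧ |F ε v| ≤ C * |ε| ^ n ∧ ‖fderiv ℝ (F ε) v‖ ≤ C * |ε| ^ n

theorem IsPoly.ord {F : ℝ → PS → ℝ} (hF : IsPoly F) : Ord 0 F := by
  intro M hM
  obtain ⟨C0, p0, b0⟩ := hF.bound hM
  obtain ⟨C1, p1, b1⟩ := (hF.dirD (1, 0, 0, 0)).bound hM
  obtain ⟨C2, p2, b2⟩ := (hF.dirD (0, 1, 0, 0)).bound hM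
  obtain ⟨C3, p3, b3⟩ := (hF.dirD (0, 0, 1, 0)).bound hM
  obtain ⟨C4, p4, b4⟩ := (hF.dirD (0, 0, 0, 1)).bound hM
  refine ⟨C0 + 4 * (C1 + C2 + C3 + C4), by positivity, fun ε hε v hv =>
    ⟨hF.differentiableAt ε (Slab.pos hM hv), ?_, ?_⟩⟩
  · have := b0 ε hε v hv
    simp only [pow_zero, mul_one]; linarith
  · have : ‖fderiv ℝ (F ε) v‖ ≤ 4 * (C1 + C2 + C3 + C4) :=
      clm_norm_le ((b1 ε hε v hv).trans (by linarith)) ((b2 ε hε v hv).trans (by linarith))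
        ((b3 ε hε v hv).trans (by linarith)) ((b4 ε hε v hv).trans (by linarith))
    simp only [pow_zero, mul_one]; linarith

namespace Ord

variable {F G : ℝ → PS → ℝ} {m n : ℕ}

theorem congr (h : ∀ ε v, 0 < v.1 → F ε v = G ε v) (hF : Ord n F) : Ord n G := by
  intro M hM
  obtain ⟨C, p, b⟩ := hF M hM
  refine ⟨C, p, fun ε hε v hv => ?_⟩
  obtain ⟨b1, b2, b3⟩ := b ε hε v hv
  have h0 := Slab.pos hM hv
  have he : F ε =ᶠ[𝓝 v] G ε := by
    filter_upwards [eventually_pos h0] with w hw using h ε w hw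
  rw [he.fderiv_eq] at b3
  rw [h ε v h0] at b2
  exact ⟨b1.congr_of_eventuallyEq he.symm, b2, b3⟩

theorem add (hF : Ord n F) (hG : Ord n G) : Ord n fun ε v => F ε v + G ε v := by
  intro M hM
  obtain ⟨C, p, b⟩ := hF M hM
  obtain ⟨C', p', b'⟩ := hG M hM
  refine ⟨C + C', by positivity, fun ε hε v hv => ?_⟩
  obtain ⟨b1, b2, b3⟩ := b ε hε v hv
  obtain ⟨c1, c2, c3⟩ := b' ε hε v hv
  refine ⟨b1.fun_add c1, (abs_add_le _ _).trans (by linarith), ?_⟩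
  rw [fderiv_fun_add b1 c1]
  exact (norm_add_le _ _).trans (by linarith)

theorem mul (hF : Ord m F) (hG : Ord n G) : Ord (m + n) fun ε v => F ε v * G ε v := by
  intro M hM
  obtain ⟨C, p, b⟩ := hF M hM
  obtain ⟨C', p', b'⟩ := hG M hM
  refine ⟨2 * (C * C'), by positivity, fun ε hε v hv => ?_⟩
  obtain ⟨b1, b2, b3⟩ := b ε hε v hv
  obtain ⟨c1, c2, c3⟩ := b' ε hε v hv
  have h1 : ∀ x y : ℝ, 0 ≤ x → 0 ≤ y → x ≤ C * |ε| ^ m → y ≤ C' * |ε| ^ n →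
      x * y ≤ C * C' * |ε| ^ (m + n) := fun x y _ hy hx hy' => by
    rw [pow_add]
    calc x * y ≤ (C * |ε| ^ m) * (C' * |ε| ^ n) := mul_le_mul hx hy' hy (by positivity)
      _ = _ := by ring
  have h2 : 0 ≤ C * C' * |ε| ^ (m + n) := by positivity
  refine ⟨b1.fun_mul c1, ?_, ?_⟩
  · rw [abs_mul]
    have := h1 _ _ (abs_nonneg _) (abs_nonneg _) b2 c2
    linarith
  · rw [fderiv_fun_mul b1 c1]
    refine (norm_add_le _ _).trans ?_
    rw [norm_smul, norm_smul, Real.norm_eq_abs, Real.norm_eq_abs, mul_comm |G ε v|]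
    have := h1 _ _ (abs_nonneg _) (norm_nonneg _) b2 c3
    have := h1 _ _ (norm_nonneg _) (abs_nonneg _) b3 c2
    linarith

theorem of_le (hF : Ord n F) (h : m ≤ n) : Ord m F := by
  intro M hM
  obtain ⟨C, p, b⟩ := hF M hM
  refine ⟨C, p, fun ε hε v hv => ?_⟩
  obtain ⟨b1, b2, b3⟩ := b ε hε v hv
  have : C * |ε| ^ n ≤ C * |ε| ^ m :=
    mul_le_mul_of_nonneg_left (pow_le_pow_of_le_one (abs_nonneg _) hε h) p
  exact ⟨b1, b2.trans this, b3.trans this⟩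

theorem eps (n : ℕ) : Ord n fun ε _ => ε ^ n := by
  intro M hM
  refine ⟨1, zero_le_one, fun ε hε v hv => ⟨differentiableAt_const _, by simp [abs_pow], ?_⟩⟩
  simp

theorem neg (hF : Ord n F) : Ord n fun ε v => -F ε v :=
  congr (fun ε v _ => by simp) ((IsPoly.const (-1)).ord.mul hF |>.of_le (by simp))

end Ord

/-! ### Taylor expansion of a shift in the slow coordinate -/

/-- The remainder of the Taylor polynomial with `n` terms. -/
def taylorRem (n : ℕ) (c : ℝ → ℝ) (X w : ℝ) : ℝ :=
  c (X + w) - ∑ j ∈ Finset.range n, iteratedDeriv j c X * w ^ j / (j.factorial : ℝ)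

theorem sum_taylor_deriv (n : ℕ) (c : ℝ → ℝ) (X w : ℝ) :
    ∑ j ∈ Finset.range (n + 1), iteratedDeriv j c X * (j * w ^ (j - 1)) / (j.factorial : ℝ)
      = ∑ j ∈ Finset.range n, iteratedDeriv j (deriv c) X * w ^ j / (j.factorial : ℝ) := by
  rw [Finset.sum_range_succ']
  simp only [Nat.cast_zero, zero_mul, mul_zero, zero_div, add_zero]
  refine Finset.sum_congr rfl fun j _ => ?_
  rw [← iteratedDeriv_succ', Nat.factorial_succ]
  push_cast
  have : (j + 1 : ℝ) ≠ 0 := by positivity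
  have : (j.factorial : ℝ) ≠ 0 := by positivity
  field_simp

/-- Differentiation in the increment turns the remainder of `c` into the remainder of `c'` with one
term less, which makes the remainder estimate an induction that needs no integral formula. -/
theorem taylorRem_hasDerivAt {c : ℝ → ℝ} (hc : BddSmooth c) (n : ℕ) (X w : ℝ) :
    HasDerivAt (fun w => taylorRem (n + 1) c X w) (taylorRem n (deriv c) X w) w := by
  have h1 : HasDerivAt (fun w => c (X + w)) (deriv c (X + w)) w := by
    simpa using (hc.hasDerivAt (X + w)).comp_const_add X w
  have h2 : ∀ j ∈ Finset.range (n + 1), HasDerivAt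
      (fun w => iteratedDeriv j c X * w ^ j / (j.factorial : ℝ))
      (iteratedDeriv j c X * (j * w ^ (j - 1)) / (j.factorial : ℝ)) w := fun j _ =>
    ((hasDerivAt_pow j w).const_mul _).div_const _
  refine (h1.sub (HasDerivAt.fun_sum h2)).congr_deriv ?_
  rw [sum_taylor_deriv, taylorRem]

theorem taylorRem_bound (n : ℕ) : ∀ {c : ℝ → ℝ}, BddSmooth c →
    ∃ C : ℝ, 0 ≤ C ∧ ∀ X w, |taylorRem n c X w| ≤ C * |w| ^ n := by
  induction n with
  | zero =>
    intro c hc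
    obtain ⟨M, h0, hM⟩ := hc.bound
    exact ⟨M, h0, fun X w => by simpa [taylorRem] using hM (X + w)⟩
  | succ n ih =>
    intro c hc
    obtain ⟨C, h0, hC⟩ := ih hc.deriv
    refine ⟨C, h0, fun X w => ?_⟩
    have hz : taylorRem (n + 1) c X 0 = 0 := by
      rw [taylorRem, Finset.sum_range_succ']
      simp
    have := Convex.norm_image_sub_le_of_norm_hasDerivWithin_le
      (f := fun w => taylorRem (n + 1) c X w) (s := Set.uIcc 0 w) (C := C * |w| ^ n)
      (fun y _ => (taylorRem_hasDerivAt hc n X y).hasDerivWithinAt)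
      (fun y hy => (hC X y).trans (by
        have : |y| ≤ |w| := by simpa using Set.abs_sub_left_of_mem_uIcc hy
        gcongr)) (convex_uIcc 0 w) Set.left_mem_uIcc Set.right_mem_uIcc
    simp only [hz, sub_zero, Real.norm_eq_abs] at this
    rw [pow_succ, ← mul_assoc]; exact this

/-- The increment has size `ε ^ 2`, so the power `ε ^ n` is generous. The gradient consists of a
part along `X`, with the remainder of `c'` with `n + 1` terms, and a part along the increment, with
its remainder with `n` terms; the latter explains the additional Taylor term in the statement. -/
theorem ord_taylorRem {c : ℝ → ℝ} (hc : BddSmooth c) {G : ℝ → PS → ℝ} (hG : IsPoly G)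
    (n : ℕ) : Ord n fun ε v => taylorRem (n + 1) c v.2.2.2 (ε ^ 2 * G ε v) := by
  intro M hM
  obtain ⟨A, hA, bA⟩ := hG.ord M hM
  obtain ⟨B1, h1, b1⟩ := taylorRem_bound (n + 1) hc
  obtain ⟨B2, h2, b2⟩ := taylorRem_bound (n + 1) hc.deriv
  obtain ⟨B3, h3, b3⟩ := taylorRem_bound n hc.deriv
  refine ⟨B1 * A ^ (n + 1) + (B2 * A ^ (n + 1) + B3 * A ^ n * A), by positivity,
    fun ε hε v hv => ?_⟩
  obtain ⟨g1, g2, g3⟩ := bA ε hε v hv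
  simp only [pow_zero, mul_one] at g2 g3
  set w : PS → ℝ := fun v => ε ^ 2 * G ε v with hw
  have hε2 : |ε| ^ 2 ≤ 1 := pow_le_one₀ (abs_nonneg _) hε
  have wb : |w v| ≤ |ε| ^ 2 * A := by
    rw [hw]; simp only [abs_mul, abs_pow]; gcongr
  have hwd : HasFDerivAt w (ε ^ 2 • fderiv ℝ (G ε) v) v := g1.hasFDerivAt.const_mul (ε ^ 2)
  have wpow : ∀ k, |w v| ^ k ≤ A ^ k * |ε| ^ k := fun k => by
    calc |w v| ^ k ≤ (|ε| ^ 2 * A) ^ k := by gcongr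
      _ = A ^ k * |ε| ^ (k + k) := by ring
      _ ≤ A ^ k * |ε| ^ k :=
        mul_le_mul_of_nonneg_left (pow_le_pow_of_le_one (abs_nonneg _) hε (by omega))
          (by positivity)
  have wpow' : |w v| ^ (n + 1) ≤ A ^ (n + 1) * |ε| ^ n := (wpow (n + 1)).trans
    (mul_le_mul_of_nonneg_left (pow_le_pow_of_le_one (abs_nonneg _) hε (by omega))
      (by positivity))
  have hX : HasFDerivAt (fun v : PS => v.2.2.2) ((ContinuousLinearMap.snd ℝ ℝ ℝ).comp
        ((ContinuousLinearMap.snd ℝ ℝ (ℝ × ℝ)).comp (ContinuousLinearMap.snd ℝ ℝ (ℝ × ℝ × ℝ)))) v := by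
    have h0 : HasFDerivAt (fun v : PS => v) (ContinuousLinearMap.id ℝ PS) v := hasFDerivAt_id v
    have h1 : HasFDerivAt (fun v : PS => v.2) _ v := h0.snd
    have h2 : HasFDerivAt (fun v : PS => v.2.2) _ v := h1.snd
    exact h2.snd
  set lX : PS →L[ℝ] ℝ := ((ContinuousLinearMap.snd ℝ ℝ ℝ).comp
        ((ContinuousLinearMap.snd ℝ ℝ (ℝ × ℝ)).comp (ContinuousLinearMap.snd ℝ ℝ (ℝ × ℝ × ℝ)))) with hlX
  have nX : ‖lX‖ ≤ 1 := ContinuousLinearMap.opNorm_le_bound _ zero_le_one fun v => by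
    simpa [hlX] using (PS.abs_le_norm v).2.2.2
  have hT : HasFDerivAt (fun v : PS => taylorRem (n + 1) c v.2.2.2 (w v))
      (taylorRem (n + 1) (deriv c) v.2.2.2 (w v) • lX
        + taylorRem n (deriv c) v.2.2.2 (w v) • (ε ^ 2 • fderiv ℝ (G ε) v)) v := by
    have k1 : HasFDerivAt (fun v : PS => c (v.2.2.2 + w v)) _ v :=
      (hc.hasDerivAt _).comp_hasFDerivAt v (hX.fun_add hwd)
    have k2 : ∀ j ∈ Finset.range (n + 1), HasFDerivAt
        (fun v : PS => iteratedDeriv j c v.2.2.2 * w v ^ j * ((j.factorial : ℝ)⁻¹)) _ v := fun j _ =>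
      ((((hc.iteratedDeriv j).hasDerivAt _).comp_hasFDerivAt v hX).mul (hwd.pow j)).mul_const _
    have k := k1.fun_sub (HasFDerivAt.fun_sum k2)
    simp only [taylorRem, div_eq_mul_inv]
    refine k.congr_fderiv ?_
    refine ContinuousLinearMap.ext fun z => ?_
    -- The derivative of the Taylor polynomial splits according to whether the power of the
    -- increment or the coefficient is differentiated; after `sum_taylor_deriv` both parts are
    -- Taylor polynomials of `c'`.
    have e : (∑ i ∈ Finset.range (n + 1), (i.factorial : ℝ)⁻¹ •
          ((iteratedDeriv i c ∘ fun v : PS => v.2.2.2) v •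
            (i • w v ^ (i - 1)) • ε ^ 2 • fderiv ℝ (G ε) v +
            w v ^ i • deriv (iteratedDeriv i c) v.2.2.2 • lX)) z
        = (∑ j ∈ Finset.range (n + 1),
            iteratedDeriv j c v.2.2.2 * (j * w v ^ (j - 1)) / (j.factorial : ℝ))
            * (ε ^ 2 * fderiv ℝ (G ε) v z)
          + (∑ j ∈ Finset.range (n + 1), iteratedDeriv j (deriv c) v.2.2.2 * w v ^ j
            * (j.factorial : ℝ)⁻¹) * lX z := by
      rw [Finset.sum_mul, Finset.sum_mul, ← Finset.sum_add_distrib, sum_apply]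
      refine Finset.sum_congr rfl fun j _ => ?_
      simp [← iteratedDeriv_succ', iteratedDeriv_succ, div_eq_mul_inv]
      ring
    rw [sum_taylor_deriv] at e
    simp only [sub_apply, add_apply, smul_apply, smul_eq_mul, e,
      div_eq_mul_inv]
    ring
  refine ⟨hT.differentiableAt, ?_, ?_⟩
  · calc |taylorRem (n + 1) c v.2.2.2 (ε ^ 2 * G ε v)| ≤ B1 * |w v| ^ (n + 1) := b1 _ _
      _ ≤ B1 * (A ^ (n + 1) * |ε| ^ n) := by gcongr
      _ ≤ _ := by
        rw [← mul_assoc]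
        refine mul_le_mul_of_nonneg_right ?_ (by positivity)
        have : 0 ≤ B2 * A ^ (n + 1) + B3 * A ^ n * A := by positivity
        linarith
  · rw [hT.fderiv]
    refine (norm_add_le _ _).trans ?_
    rw [norm_smul, norm_smul, norm_smul, Real.norm_eq_abs, Real.norm_eq_abs, Real.norm_eq_abs,
      abs_pow]
    have t1 : |taylorRem (n + 1) (deriv c) v.2.2.2 (w v)| * ‖lX‖
        ≤ B2 * (A ^ (n + 1) * |ε| ^ n) * 1 := by
      refine mul_le_mul ((b2 _ _).trans ?_) nX (norm_nonneg _) (by positivity)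
      gcongr
    have t2 : |taylorRem n (deriv c) v.2.2.2 (w v)| * (|ε| ^ 2 * ‖fderiv ℝ (G ε) v‖)
        ≤ B3 * (A ^ n * |ε| ^ n) * (1 * A) := by
      refine mul_le_mul ((b3 _ _).trans ?_) ?_ (by positivity) (by positivity)
      · have := wpow n
        gcongr
      · gcongr
    have : 0 ≤ B1 * A ^ (n + 1) * |ε| ^ n := by positivity
    nlinarith [t1, t2, this]

/-- A polynomial expression shifted by `ε² G` in the slow coordinate. -/
def shiftX (K G : ℝ → PS → ℝ) (ε : ℝ) (v : PS) : ℝ :=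
  K ε (v.1, v.2.1, v.2.2.1, v.2.2.2 + ε ^ 2 * G ε v)

/-- The normal form is evaluated at the new slow coordinate, and composition with this shift leaves
the polynomial class. Up to any prescribed order, with first derivatives, a Taylor expansion returns
to it. -/
theorem IsPoly.exists_shiftX {K G : ℝ → PS → ℝ} (hK : IsPoly K) (hG : IsPoly G) (n : ℕ) :
    ∃ Q, IsPoly Q ∧ Ord n fun ε v => shiftX K G ε v - Q ε v := by
  induction hK with
  | mono c hc k a a' e b =>
    have hm : IsPoly fun ε v => ε ^ k * v.1 ^ a * (v.1⁻¹) ^ a' * v.2.1 ^ e * v.2.2.1 ^ b :=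
      congr _ _ (by intros; simp) (mono _ (BddSmooth.const 1) k a a' e b)
    have hT : IsPoly fun ε v => ∑ j ∈ Finset.range (n + 1),
        iteratedDeriv j c v.2.2.2 * (ε ^ 2 * G ε v) ^ j * ((j.factorial : ℝ)⁻¹) :=
      sum _ _ fun j _ => ((coeff (hc.iteratedDeriv j)).mul (((eps 2).mul hG).pow j)).mul (const _)
    refine ⟨_, hT.mul hm, ((ord_taylorRem hc hG n).mul hm.ord).congr ?_⟩
    intro ε v _
    simp only [taylorRem, shiftX, div_eq_mul_inv]
    ring
  | add F G _ _ h1 h2 =>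
    obtain ⟨Q1, p1, o1⟩ := h1
    obtain ⟨Q2, p2, o2⟩ := h2
    refine ⟨_, add _ _ p1 p2, (o1.add o2).congr ?_⟩
    intro ε v _
    simp only [shiftX]
    ring
  | congr F G h _ ih =>
    obtain ⟨Q1, p1, o1⟩ := ih
    refine ⟨Q1, p1, o1.congr ?_⟩
    intro ε v hv
    exact congrArg (· - Q1 ε v) (h ε (v.1, v.2.1, v.2.2.1, v.2.2.2 + _) hv)

/-- Smoothness in `ε` at a fixed point is what allows the iterated derivatives in the definition of
the procedure to be identified with coefficients of an asymptotic expansion. -/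
theorem IsPoly.contDiff_shiftX_eps {K G : ℝ → PS → ℝ} (hK : IsPoly K) {v : PS} (hv : 0 < v.1)
    (hG : ContDiff ℝ ∞ fun ε => G ε v) : ContDiff ℝ ∞ fun ε => shiftX K G ε v := by
  induction hK with
  | mono c hc k a a' e b =>
    simp only [shiftX]
    have := hc.1
    fun_prop
  | add F G _ _ h1 h2 => exact h1.add h2
  | congr F F' h _ ih =>
    have : (fun ε => shiftX F' G ε v) = fun ε => shiftX F G ε v :=
      funext fun ε => (h ε (v.1, v.2.1, v.2.2.1, v.2.2.2 + _) hv).symm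
    rw [this]; exact ih

theorem IsPoly.contDiff_eps {K : ℝ → PS → ℝ} (hK : IsPoly K) {v : PS} (hv : 0 < v.1) :
    ContDiff ℝ ∞ fun ε => K ε v := by
  have := hK.contDiff_shiftX_eps (G := fun _ _ => 0) hv contDiff_const
  simpa [shiftX] using this

/-! ### Partial derivatives -/

theorem hasDerivAt_fst {f : PS → ℝ} {v : PS} (hf : DifferentiableAt ℝ f v) :
    HasDerivAt (fun I => f (I, v.2)) (fderiv ℝ f v (1, 0, 0, 0)) v.1 := by
  have h : HasDerivAt (fun I : ℝ => ((I, v.2) : PS)) (1, 0) v.1 :=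
    (hasDerivAt_id v.1).prodMk (hasDerivAt_const _ _)
  exact HasFDerivAt.comp_hasDerivAt v.1 (f := fun I : ℝ => ((I, v.2) : PS)) hf.hasFDerivAt h

theorem hasDerivAt_ang {f : PS → ℝ} {v : PS} (hf : DifferentiableAt ℝ f v) :
    HasDerivAt (fun u => f (v.1, u, v.2.2)) (fderiv ℝ f v (0, 1, 0, 0)) v.2.1 := by
  have h : HasDerivAt (fun u : ℝ => ((v.1, u, v.2.2) : PS)) (0, 1, 0) v.2.1 :=
    (hasDerivAt_const _ _).prodMk ((hasDerivAt_id v.2.1).prodMk (hasDerivAt_const _ _))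
  exact HasFDerivAt.comp_hasDerivAt v.2.1 (f := fun u : ℝ => ((v.1, u, v.2.2) : PS))
    hf.hasFDerivAt h

theorem hasDerivAt_mom {f : PS → ℝ} {v : PS} (hf : DifferentiableAt ℝ f v) :
    HasDerivAt (fun p => f (v.1, v.2.1, p, v.2.2.2)) (fderiv ℝ f v (0, 0, 1, 0)) v.2.2.1 := by
  have h : HasDerivAt (fun p : ℝ => ((v.1, v.2.1, p, v.2.2.2) : PS)) (0, 0, 1, 0) v.2.2.1 :=
    (hasDerivAt_const _ _).prodMk ((hasDerivAt_const _ _).prodMk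
      ((hasDerivAt_id v.2.2.1).prodMk (hasDerivAt_const _ _)))
  exact HasFDerivAt.comp_hasDerivAt v.2.2.1 (f := fun p : ℝ => ((v.1, v.2.1, p, v.2.2.2) : PS))
    hf.hasFDerivAt h

theorem hasDerivAt_pos {f : PS → ℝ} {v : PS} (hf : DifferentiableAt ℝ f v) :
    HasDerivAt (fun X => f (v.1, v.2.1, v.2.2.1, X)) (fderiv ℝ f v (0, 0, 0, 1)) v.2.2.2 := by
  have h : HasDerivAt (fun X : ℝ => ((v.1, v.2.1, v.2.2.1, X) : PS)) (0, 0, 0, 1) v.2.2.2 :=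
    (hasDerivAt_const _ _).prodMk ((hasDerivAt_const _ _).prodMk
      ((hasDerivAt_const _ _).prodMk (hasDerivAt_id v.2.2.2)))
  exact HasFDerivAt.comp_hasDerivAt v.2.2.2
    (f := fun X : ℝ => ((v.1, v.2.1, v.2.2.1, X) : PS)) hf.hasFDerivAt h

/-! ### Coefficients of asymptotic expansions -/

/-- Let `ε` tend to `0` from the right to find that the first coefficient vanishes, divide by `ε`,
and repeat. -/
theorem coeff_eq_zero_of_bound (n : ℕ) : ∀ (a : ℕ → ℝ) (C : ℝ),
    (∀ ε : ℝ, 0 < ε → ε ≤ 1 → |∑ j ∈ Finset.range n, ε ^ j * a j| ≤ C * ε ^ n) →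
    ∀ j < n, a j = 0 := by
  induction n with
  | zero => intro a C _ j hj; omega
  | succ n ih =>
    intro a C h
    have h0 : a 0 = 0 := by
      have t1 : Filter.Tendsto (fun ε : ℝ => |∑ j ∈ Finset.range (n + 1), ε ^ j * a j|)
          (𝓝[>] 0) (𝓝 |∑ j ∈ Finset.range (n + 1), (0 : ℝ) ^ j * a j|) :=
        (Continuous.tendsto (by fun_prop) 0).mono_left nhdsWithin_le_nhds
      have t2 : Filter.Tendsto (fun ε : ℝ => C * ε ^ (n + 1)) (𝓝[>] 0)
          (𝓝 (C * (0 : ℝ) ^ (n + 1))) :=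
        (Continuous.tendsto (by fun_prop) 0).mono_left nhdsWithin_le_nhds
      have := le_of_tendsto_of_tendsto t1 t2 (by
        filter_upwards [Ioc_mem_nhdsGT (zero_lt_one' ℝ)] with ε hε using h ε hε.1 hε.2)
      rw [Finset.sum_range_succ'] at this
      simpa using this
    intro j hj
    rcases j with _ | j
    · exact h0
    · refine ih (fun j => a (j + 1)) C (fun ε hε hε1 => ?_) j (by omega)
      have := h ε hε hε1
      rw [Finset.sum_range_succ', h0, mul_zero, add_zero] at this
      have e : ∑ k ∈ Finset.range n, ε ^ (k + 1) * a (k + 1) =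
          ε * ∑ k ∈ Finset.range n, ε ^ k * a (k + 1) := by
        rw [Finset.mul_sum]
        exact Finset.sum_congr rfl fun k _ => by ring
      rw [e, abs_mul, abs_of_pos hε] at this
      refine le_of_mul_le_mul_left (this.trans_eq (by ring)) hε

/-- Uniqueness of asymptotic expansions: the difference between the Taylor polynomial and the given
one is `O(ε ^ n)`, hence zero coefficient by coefficient. -/
theorem iteratedDeriv_eq_of_bound {g : ℝ → ℝ} (hg : ContDiff ℝ ∞ g) {n : ℕ} {a : ℕ → ℝ} {C : ℝ}
    (h : ∀ ε : ℝ, 0 < ε → ε ≤ 1 → |g ε - ∑ j ∈ Finset.range n, ε ^ j * a j| ≤ C * ε ^ n)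
    {k : ℕ} (hk : k < n) : iteratedDeriv k g 0 = k.factorial * a k := by
  obtain ⟨m, rfl⟩ : ∃ m, n = m + 1 := ⟨n - 1, by omega⟩
  obtain ⟨B, hB⟩ := exists_taylor_mean_remainder_bound (f := g) (n := m) (zero_le_one' ℝ)
    (hg.of_le (by exact_mod_cast le_top)).contDiffOn
  have key := coeff_eq_zero_of_bound (m + 1)
    (fun j => (j.factorial : ℝ)⁻¹ * iteratedDeriv j g 0 - a j) (B + C) (fun ε h0 h1 => ?_) k hk
  · have : (k.factorial : ℝ) ≠ 0 := by positivity
    have key' : (k.factorial : ℝ)⁻¹ * iteratedDeriv k g 0 = a k := sub_eq_zero.1 key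
    rw [← key']; field_simp
  · have b1 := hB ε ⟨h0.le, h1⟩
    rw [taylor_within_apply, Real.norm_eq_abs, sub_zero] at b1
    have e : ∑ k ∈ Finset.range (m + 1), ((k.factorial : ℝ)⁻¹ * ε ^ k) •
        iteratedDerivWithin k g (Set.Icc 0 1) 0 =
        ∑ k ∈ Finset.range (m + 1), ε ^ k * ((k.factorial : ℝ)⁻¹ * iteratedDeriv k g 0) := by
      refine Finset.sum_congr rfl fun k _ => ?_
      rw [iteratedDerivWithin_eq_iteratedDeriv (uniqueDiffOn_Icc zero_lt_one)
        (hg.of_le (by exact_mod_cast le_top)).contDiffAt ⟨le_rfl, zero_le_one⟩, smul_eq_mul]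
      ring
    rw [e] at b1
    have b2 := h ε h0 h1
    simp only [mul_sub, Finset.sum_sub_distrib]
    rw [abs_le] at *
    constructor <;> nlinarith

/-! ### The saw-tooth function -/

theorem saw_add_int (u : ℝ) (n : ℤ) (h : |u| < π) : saw (u + 2 * π * n) = u := by
  have hp := Real.pi_pos
  have h2 : round ((u + 2 * π * n) / (2 * π)) = n := by
    have : (u + 2 * π * n) / (2 * π) = u / (2 * π) + n := by field_simp
    rw [this, round_add_intCast, round_eq_zero_iff.2, zero_add]
    rw [abs_lt] at h
    constructor
    · rw [le_div_iff₀ (by positivity)]; linarith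
    · rw [div_lt_iff₀ (by positivity)]; linarith
  rw [saw, h2]; ring

theorem saw_of_abs_lt {u : ℝ} (h : |u| < π) : saw u = u := by simpa using saw_add_int u 0 h

theorem saw_mem (φ : ℝ) : saw φ ∈ Set.Ico (-π) π := by
  have hp := Real.pi_pos
  have h1 := round_eq (φ / (2 * π))
  have h2 := Int.floor_le (φ / (2 * π) + 1 / 2)
  have h3 := Int.lt_floor_add_one (φ / (2 * π) + 1 / 2)
  rw [← h1] at h2 h3
  have e : φ = 2 * π * (φ / (2 * π)) := by field_simp
  rw [saw]
  constructor
  · nlinarith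
  · nlinarith

theorem eq_saw_add (φ : ℝ) : φ = saw φ + 2 * π * round (φ / (2 * π)) := by rw [saw]; ring

theorem saw_eventuallyEq {φ : ℝ} (h : saw φ ≠ -π) :
    ∀ᶠ θ in 𝓝 φ, saw θ = θ - 2 * π * round (φ / (2 * π)) := by
  obtain ⟨h1, h2⟩ := saw_mem φ
  have h1' : -π < saw φ := lt_of_le_of_ne h1 (Ne.symm h)
  have : ∀ᶠ θ in 𝓝 φ, |θ - 2 * π * round (φ / (2 * π))| < π := by
    refine (Continuous.tendsto (by fun_prop : Continuous fun θ : ℝ =>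
      |θ - 2 * π * round (φ / (2 * π))|) φ).eventually_lt_const ?_
    change |saw φ| < π
    exact abs_lt.2 ⟨h1', h2⟩
  filter_upwards [this] with θ hθ
  have := saw_add_int _ (round (φ / (2 * π))) hθ
  rwa [sub_add_cancel] at this

theorem hasDerivAt_saw {φ : ℝ} (h : saw φ ≠ -π) : HasDerivAt saw 1 φ :=
  ((hasDerivAt_id φ).sub_const _).congr_of_eventuallyEq (saw_eventuallyEq h)

theorem measurable_saw : Measurable saw := by
  have h : Measurable fun φ : ℝ => ((round (φ / (2 * π)) : ℤ) : ℝ) := by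
    simp only [round_eq]
    exact (measurable_of_countable (fun n : ℤ => (n : ℝ))).comp
      (((measurable_id.div_const _).add_const _).floor)
  exact measurable_id.sub (h.const_mul _)

/-- The only discontinuities of `saw` are passages from `π` to `-π`, which a function with equal
values at these two points does not notice. -/
theorem continuous_comp_saw {G : ℝ → ℝ} (hG : Continuous G) (h : G π = G (-π)) :
    Continuous fun φ => G (saw φ) := by
  have hp := Real.pi_pos
  rw [continuous_iff_continuousAt]
  intro φ
  by_cases hs : saw φ = -π
  · set k : ℤ := round (φ / (2 * π)) with hk
    have e : φ = -π + 2 * π * k := by rw [← hs]; exact eq_saw_add φ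
    rw [continuousAt_iff_continuous_left'_right']
    constructor
    -- To the left of the jump `saw` is still on the preceding branch, hence `k - 1`.
    · have h1 : ContinuousAt (fun θ => G (θ - 2 * π * (k - 1))) φ := by fun_prop
      have h2 := h1.continuousWithinAt (s := Set.Iio φ)
      refine h2.congr_of_eventuallyEq ?_ ?_
      · filter_upwards [Ioo_mem_nhdsLT (show φ - 2 * π < φ by linarith)] with θ hθ
        have := saw_add_int (θ - 2 * π * (k - 1)) (k - 1) (abs_lt.2
          ⟨by nlinarith [hθ.1], by nlinarith [hθ.2]⟩)
        push_cast at this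
        rw [sub_add_cancel] at this
        rw [this]
      · simp only [hs]; rw [← h]; congr 1; rw [e]; ring
    · have h1 : ContinuousAt (fun θ => G (θ - 2 * π * k)) φ := by fun_prop
      have h2 := h1.continuousWithinAt (s := Set.Ioi φ)
      refine h2.congr_of_eventuallyEq ?_ ?_
      · filter_upwards [Ioo_mem_nhdsGT (show φ < φ + 2 * π by linarith)] with θ hθ
        have := saw_add_int (θ - 2 * π * k) k (abs_lt.2
          ⟨by nlinarith [hθ.1], by nlinarith [hθ.2]⟩)
        rw [sub_add_cancel] at this
        rw [this]
      · simp only [hs]; congr 1; rw [e]; ring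
  · exact hG.continuousAt.comp (hasDerivAt_saw hs).continuousAt

theorem countable_saw_eq : {φ : ℝ | saw φ = -π}.Countable := by
  refine (Set.countable_range fun n : ℤ => -π + 2 * π * n).mono ?_
  intro φ hφ
  have h1 : saw φ = -π := hφ
  have h2 := eq_saw_add φ
  rw [h1] at h2
  exact ⟨round (φ / (2 * π)), h2.symm⟩

theorem intervalIntegrable_comp_saw {g : ℝ → ℝ} (hg : Continuous g) (a b : ℝ) :
    IntervalIntegrable (fun θ => g (saw θ)) MeasureTheory.volume a b := by
  obtain ⟨C, hC⟩ := (isCompact_Icc (a := -π) (b := π)).exists_bound_of_continuousOn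
    hg.continuousOn
  refine (intervalIntegrable_const (c := C)).mono_fun
    (hg.measurable.comp measurable_saw).aestronglyMeasurable ?_
  refine Filter.Eventually.of_forall fun θ => ?_
  exact (hC _ ⟨(saw_mem θ).1, (saw_mem θ).2.le⟩).trans (le_abs_self C)

/-- The fundamental theorem of calculus with a countable exceptional set: `G ∘ saw` is continuous,
and it has the derivative `g ∘ saw` off the jumps of `saw`. -/
theorem integral_comp_saw {g G : ℝ → ℝ} (hg : Continuous g) (hG : ∀ u, HasDerivAt G (g u) u)
    (h : G π = G (-π)) (φ : ℝ) : ∫ θ in (0 : ℝ)..φ, g (saw θ) = G (saw φ) - G 0 := by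
  have hc : Continuous G := continuous_iff_continuousAt.2 fun u => (hG u).continuousAt
  have := MeasureTheory.integral_eq_of_hasDerivAt_off_countable (fun θ => G (saw θ))
    (fun θ => g (saw θ)) (a := 0) (b := φ) countable_saw_eq
    (continuous_comp_saw hc h).continuousOn (fun θ hθ =>
      ((hG (saw θ)).comp θ (hasDerivAt_saw hθ.2)).congr_deriv (mul_one _)) (intervalIntegrable_comp_saw hg _ _)
  rw [this, saw_of_abs_lt (u := 0) (by simpa using Real.pi_pos)]

theorem integral_congr_saw {f g : ℝ → ℝ} (h : ∀ θ, saw θ ≠ -π → f θ = g θ) (a b : ℝ) :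
    ∫ θ in a..b, f θ = ∫ θ in a..b, g θ := by
  refine intervalIntegral.integral_congr_ae ?_
  have := countable_saw_eq.ae_notMem MeasureTheory.volume
  filter_upwards [this] with θ hθ _ using h θ hθ

/-- On the interior of the period `saw` is the identity. The hypothesis on `f` leaves out the jumps,
where the derivative of the generating function in the phase need not exist. -/
theorem phaseMean_eq {f g G : ℝ → ℝ} (hf : ∀ θ, saw θ ≠ -π → f θ = g (saw θ))
    (hg : Continuous g) (hG : ∀ u, HasDerivAt G (g u) u) :
    phaseMean f = (2 * π)⁻¹ * (G π - G (-π)) := by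
  have hp := Real.pi_pos
  rw [phaseMean, integral_congr_saw hf]
  congr 1
  rw [← intervalIntegral.integral_eq_sub_of_hasDerivAt (fun u _ => hG u)
    (hg.intervalIntegrable _ _)]
  refine intervalIntegral.integral_congr_ae ?_
  have := (Set.countable_singleton π).ae_notMem MeasureTheory.volume
  filter_upwards [this] with θ hθ hm
  rw [Set.uIoc_of_le (by linarith)] at hm
  rw [saw_of_abs_lt (abs_lt.2 ⟨hm.1, lt_of_le_of_ne hm.2 hθ⟩)]

/-! ### The procedure of perturbation theory in polynomial form -/

abbrev DI (F : ℝ → PS → ℝ) : ℝ → PS → ℝ := dirD (1, 0, 0, 0) F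
abbrev DU (F : ℝ → PS → ℝ) : ℝ → PS → ℝ := dirD (0, 1, 0, 0) F
abbrev DP (F : ℝ → PS → ℝ) : ℝ → PS → ℝ := dirD (0, 0, 1, 0) F
abbrev DX (F : ℝ → PS → ℝ) : ℝ → PS → ℝ := dirD (0, 0, 0, 1) F

/-- The Hamiltonian `waveH` as a function of `u = saw φ`. -/
def hatH (d : ℝ → ℝ) (ε : ℝ) (v : PS) : ℝ :=
  π ^ 2 * v.1 ^ 2 / d v.2.2.2 ^ 2
    + (v.2.2.1 - ε * (v.1 * deriv d v.2.2.2 / d v.2.2.2 * v.2.1)) ^ 2 - 1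

/-- The point `(I + ε ∂S/∂u, u, p + ε² ∂S/∂X, X)`. -/
def oldPoint (S : ℝ → PS → ℝ) (ε : ℝ) (v : PS) : PS :=
  (v.1 + ε * DU S ε v, v.2.1, v.2.2.1 + ε ^ 2 * DX S ε v, v.2.2.2)

/-- The function `waveResidual` in the variables `(I, u, p, X)`. -/
def residual (d : ℝ → ℝ) (S K : ℝ → PS → ℝ) (ε : ℝ) (v : PS) : ℝ :=
  hatH d ε (oldPoint S ε v) - shiftX K (DP S) ε v

/-- `S` and `K` represent the pair `normalForm d N` by polynomial expressions. -/
structure IsNormalForm (d : ℝ → ℝ) (N : ℕ) (S K : ℝ → PS → ℝ) : Prop where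
  polyS : IsPoly S
  polyK : IsPoly K
  S_eq : ∀ ε I φ p X, 0 < I → (normalForm d N).1 ε I φ p X = S ε (I, saw φ, p, X)
  K_eq : ∀ ε I u p X, 0 < I → (normalForm d N).2 ε I p X = K ε (I, u, p, X)
  S_end : ∀ ε I p X, 0 < I → S ε (I, π, p, X) = S ε (I, -π, p, X)
  K_lead : ∃ K₁, IsPoly K₁ ∧ ∀ ε (v : PS), 0 < v.1 →
    K ε v = π ^ 2 * v.1 ^ 2 / d v.2.2.2 ^ 2 + v.2.2.1 ^ 2 - 1 + ε * K₁ ε v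
  res : ∀ v : PS, 0 < v.1 → ∃ C : ℝ, ∀ ε : ℝ, |ε| ≤ 1 → |residual d S K ε v| ≤ C * |ε| ^ (N + 1)

theorem exists_mem_slab {v : PS} (hv : 0 < v.1) : ∃ M : ℝ, 0 < M ∧ v ∈ Slab M := by
  have := inv_pos.2 hv
  have h2 := abs_nonneg v.2.1
  have h3 := abs_nonneg v.2.2.1
  refine ⟨v.1 + v.1⁻¹ + |v.2.1| + |v.2.2.1|, by positivity, ?_, by linarith, by linarith,
    by linarith⟩
  rw [inv_le_comm₀ (by positivity) hv]; linarith

theorem IsPoly.bound_at {F : ℝ → PS → ℝ} (hF : IsPoly F) {v : PS} (hv : 0 < v.1) :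
    ∃ C : ℝ, 0 ≤ C ∧ ∀ ε : ℝ, |ε| ≤ 1 → |F ε v| ≤ C := by
  obtain ⟨M, hM, hm⟩ := exists_mem_slab hv
  obtain ⟨C, h0, h⟩ := hF.bound hM
  exact ⟨C, h0, fun ε hε => h ε hε v hm⟩

theorem Ord.bound_at {F : ℝ → PS → ℝ} {n : ℕ} (hF : Ord n F) {v : PS} (hv : 0 < v.1) :
    ∃ C : ℝ, 0 ≤ C ∧ ∀ ε : ℝ, |ε| ≤ 1 → |F ε v| ≤ C * |ε| ^ n := by
  obtain ⟨M, hM, hm⟩ := exists_mem_slab hv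
  obtain ⟨C, h0, h⟩ := hF M hM
  exact ⟨C, h0, fun ε hε => (h ε hε v hm).2.1⟩

theorem IsPoly.lipschitz_pos {F : ℝ → PS → ℝ} (hF : IsPoly F) {v : PS} (hv : 0 < v.1) :
    ∃ C : ℝ, 0 ≤ C ∧ ∀ ε : ℝ, |ε| ≤ 1 → ∀ X Y : ℝ,
      |F ε (v.1, v.2.1, v.2.2.1, X) - F ε (v.1, v.2.1, v.2.2.1, Y)| ≤ C * |X - Y| := by
  obtain ⟨M, hM, hm⟩ := exists_mem_slab hv
  obtain ⟨C, h0, h⟩ := (hF.dirD (0, 0, 0, 1)).bound hM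
  refine ⟨C, h0, fun ε hε X Y => ?_⟩
  have := Convex.norm_image_sub_le_of_norm_hasDerivWithin_le
    (f := fun X => F ε (v.1, v.2.1, v.2.2.1, X)) (s := Set.univ) (C := C)
    (fun x _ => (hasDerivAt_pos (v := (v.1, v.2.1, v.2.2.1, x))
      (hF.differentiableAt ε hv)).hasDerivWithinAt)
    (fun x _ => h ε hε (v.1, v.2.1, v.2.2.1, x) hm) convex_univ (Set.mem_univ Y) (Set.mem_univ X)
  exact this

section

variable {d : ℝ → ℝ}

theorem IsProfile.poly_inv (hd : IsProfile d) : IsPoly fun _ v => (d v.2.2.2)⁻¹ :=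
  IsPoly.coeff hd.inv_bddSmooth

theorem IsProfile.poly_slope (hd : IsProfile d) :
    IsPoly fun _ v => deriv d v.2.2.2 / d v.2.2.2 := by
  simpa only [div_eq_mul_inv] using IsPoly.coeff (hd.bddSmooth.deriv.mul hd.inv_bddSmooth)

theorem IsProfile.poly_hatH_comp (hd : IsProfile d) {A P : ℝ → PS → ℝ} (hA : IsPoly A)
    (hP : IsPoly P) : IsPoly fun ε v => hatH d ε (A ε v, v.2.1, P ε v, v.2.2.2) := by
  have h1 := ((IsPoly.const (π ^ 2)).mul (hA.pow 2)).mul (hd.poly_inv.pow 2)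
  have h2 := (hP.sub ((IsPoly.eps 1).mul ((hA.mul hd.poly_slope).mul IsPoly.ang))).pow 2
  refine IsPoly.congr _ _ ?_ ((IsPoly.add _ _ h1 h2).sub (IsPoly.const 1))
  intro ε v _
  simp only [hatH]
  ring

theorem IsProfile.poly_hatH (hd : IsProfile d) : IsPoly (hatH d) :=
  hd.poly_hatH_comp IsPoly.act IsPoly.mom

variable {N : ℕ} {S K : ℝ → PS → ℝ}

theorem poly_oldPoint_fst (hS : IsPoly S) : IsPoly fun ε v => (oldPoint S ε v).1 :=
  IsPoly.congr _ _ (by intros; simp [oldPoint])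
    (IsPoly.add _ _ IsPoly.act ((IsPoly.eps 1).mul (hS.dirD (0, 1, 0, 0))))

theorem poly_oldPoint_mom (hS : IsPoly S) : IsPoly fun ε v => (oldPoint S ε v).2.2.1 :=
  IsPoly.congr _ _ (by intros; simp [oldPoint])
    (IsPoly.add _ _ IsPoly.mom ((IsPoly.eps 2).mul (hS.dirD (0, 0, 0, 1))))

theorem poly_hatH_oldPoint (hd : IsProfile d) (hS : IsPoly S) :
    IsPoly fun ε v => hatH d ε (oldPoint S ε v) :=
  hd.poly_hatH_comp (poly_oldPoint_fst hS) (poly_oldPoint_mom hS)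

theorem exists_poly_residual (hd : IsProfile d) (hS : IsPoly S) (hK : IsPoly K) (n : ℕ) :
    ∃ Q, IsPoly Q ∧ Ord n fun ε v => residual d S K ε v - Q ε v := by
  obtain ⟨Q, hQ, oQ⟩ := hK.exists_shiftX (hS.dirD (0, 0, 1, 0)) n
  refine ⟨_, (poly_hatH_oldPoint hd hS).sub hQ, oQ.neg.congr ?_⟩
  intro ε v _
  simp only [residual, DP]
  ring

theorem contDiff_residual_eps (hd : IsProfile d) (hS : IsPoly S) (hK : IsPoly K) {v : PS}
    (hv : 0 < v.1) : ContDiff ℝ ∞ fun ε => residual d S K ε v :=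
  ((poly_hatH_oldPoint hd hS).contDiff_eps hv).sub
    (hK.contDiff_shiftX_eps hv ((hS.dirD (0, 0, 1, 0)).contDiff_eps hv))

/-- The residual is polynomial up to terms of order `N + 2`. Its coefficients below order `N + 1`
vanish by the pointwise bound `res` and uniqueness of expansions; the next one is polynomial and
agrees with the coefficient obtained by differentiating in `ε`, which is the one occurring in the
recursion. -/
theorem IsNormalForm.exists_coeff (h : IsNormalForm d N S K) (hd : IsProfile d) :
    ∃ ρ : PS → ℝ, (IsPoly fun _ v => ρ v) ∧
      (Ord (N + 2) fun ε v => residual d S K ε v - ε ^ (N + 1) * ρ v) ∧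
      ∀ v : PS, 0 < v.1 → iteratedDeriv (N + 1) (fun ε => residual d S K ε v) 0
        / ((N + 1).factorial : ℝ) = ρ v := by
  obtain ⟨Q, hQ, oQ⟩ := exists_poly_residual hd h.polyS h.polyK (N + 2)
  obtain ⟨f, G, hf, hG, e⟩ := hQ.split (N + 2)
  have o1 : Ord (N + 2) fun ε v =>
      residual d S K ε v - ∑ j ∈ Finset.range (N + 2), ε ^ j * f j v := by
    refine (oQ.add ((Ord.eps (N + 2)).mul hG.ord)).congr ?_
    intro ε v hv
    rw [e ε v hv]; ring
  have hz : ∀ v : PS, 0 < v.1 → ∀ j < N + 1, f j v = 0 := by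
    intro v hv
    obtain ⟨C, _, hC⟩ := o1.bound_at hv
    obtain ⟨C', hC'⟩ := h.res v hv
    obtain ⟨C'', _, hC''⟩ := (hf (N + 1)).bound_at hv
    refine coeff_eq_zero_of_bound (N + 1) (fun j => f j v) (C' + C + C'') fun ε h0 h1 => ?_
    have b1 := hC ε (by rwa [abs_of_pos h0])
    have b2 := hC' ε (by rwa [abs_of_pos h0])
    have b3 := hC'' ε (by rwa [abs_of_pos h0])
    rw [Finset.sum_range_succ] at b1
    rw [abs_of_pos h0] at b1 b2
    have p1 : 0 < ε ^ (N + 1) := by positivity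
    have b4 : |ε ^ (N + 1) * f (N + 1) v| ≤ C'' * ε ^ (N + 1) := by
      rw [abs_mul, abs_of_pos p1, mul_comm]; gcongr
    have p2 : C * ε ^ (N + 2) ≤ C * ε ^ (N + 1) := by
      gcongr _ * ?_
      exact pow_le_pow_of_le_one h0.le h1 (by omega)
    rw [abs_le] at *
    constructor <;> linarith
  refine ⟨f (N + 1), hf _, o1.congr ?_, fun v hv => ?_⟩
  · intro ε v hv
    rw [Finset.sum_range_succ, Finset.sum_eq_zero, zero_add]
    intro j hj
    rw [hz v hv j (Finset.mem_range.1 hj), mul_zero]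
  · obtain ⟨C, _, hC⟩ := o1.bound_at hv
    rw [iteratedDeriv_eq_of_bound (contDiff_residual_eps hd h.polyS h.polyK hv)
      (n := N + 2) (a := fun j => f j v) (C := C) (fun ε h0 h1 => ?_) (by omega)]
    · field_simp
    · have := hC ε (by rwa [abs_of_pos h0])
      rwa [abs_of_pos h0] at this

/-- The field `res` is only a bound at each point with a constant depending on the point. Since the
leading coefficient is polynomial, it improves to a bound that is uniform on slabs and holds for the
gradient too; the equations of motion need the gradient. -/
theorem IsNormalForm.ord_residual (h : IsNormalForm d N S K) (hd : IsProfile d) :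
    Ord (N + 1) (residual d S K) := by
  obtain ⟨ρ, h1, h2, _⟩ := h.exists_coeff hd
  refine ((h2.of_le (by omega : N + 1 ≤ N + 2)).add ((Ord.eps (N + 1)).mul h1.ord)).congr ?_
  intro ε v _; ring

theorem IsNormalForm.S_eventually (h : IsNormalForm d N S K) {φ : ℝ} (hφ : saw φ ≠ -π)
    {ε I p X : ℝ} (hI : 0 < I) :
    (fun θ => (normalForm d N).1 ε I θ p X) =ᶠ[𝓝 φ]
      fun θ => S ε (I, θ - 2 * π * round (φ / (2 * π)), p, X) := by
  filter_upwards [saw_eventuallyEq hφ] with θ hθ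
  rw [h.S_eq ε I θ p X hI, hθ]

/-- Off the jumps `saw` has slope `1`, so derivatives in the phase are derivatives in `u`. At a jump
`S` has a corner in general, hence the restriction on `φ`. -/
theorem IsNormalForm.deriv_phase (h : IsNormalForm d N S K) {φ : ℝ} (hφ : saw φ ≠ -π)
    {ε I p X : ℝ} (hI : 0 < I) :
    deriv (fun θ => (normalForm d N).1 ε I θ p X) φ = DU S ε (I, saw φ, p, X) := by
  rw [(h.S_eventually hφ hI).deriv_eq]
  have := hasDerivAt_ang (v := (I, saw φ, p, X)) (h.polyS.differentiableAt ε hI)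
  exact (HasDerivAt.comp_sub_const φ (2 * π * round (φ / (2 * π)))
    (f := fun u => S ε (I, u, p, X)) this).deriv

theorem IsNormalForm.deriv_pos (h : IsNormalForm d N S K) {ε I φ p X : ℝ} (hI : 0 < I) :
    deriv (fun X => (normalForm d N).1 ε I φ p X) X = DX S ε (I, saw φ, p, X) := by
  simp only [h.S_eq ε I φ p _ hI]
  exact (hasDerivAt_pos (v := (I, saw φ, p, X)) (h.polyS.differentiableAt ε hI)).deriv

theorem IsNormalForm.deriv_mom (h : IsNormalForm d N S K) {ε I φ p X : ℝ} (hI : 0 < I) :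
    deriv (fun p => (normalForm d N).1 ε I φ p X) p = DP S ε (I, saw φ, p, X) := by
  simp only [h.S_eq ε I φ _ X hI]
  exact (hasDerivAt_mom (v := (I, saw φ, p, X)) (h.polyS.differentiableAt ε hI)).deriv

theorem IsNormalForm.deriv_act (h : IsNormalForm d N S K) {ε I φ p X : ℝ} (hI : 0 < I) :
    deriv (fun A => (normalForm d N).1 ε A φ p X) I = DI S ε (I, saw φ, p, X) := by
  have : (fun A => (normalForm d N).1 ε A φ p X) =ᶠ[𝓝 I] fun A => S ε (A, saw φ, p, X) := by
    filter_upwards [lt_mem_nhds hI] with A hA using h.S_eq ε A φ p X hA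
  rw [this.deriv_eq]
  exact (hasDerivAt_fst (v := (I, saw φ, p, X)) (h.polyS.differentiableAt ε hI)).deriv

theorem IsNormalForm.waveResidual_eq (h : IsNormalForm d N S K) {φ : ℝ} (hφ : saw φ ≠ -π)
    {ε I p X : ℝ} (hI : 0 < I) :
    waveResidual d (normalForm d N).1 (normalForm d N).2 ε I φ p X
      = residual d S K ε (I, saw φ, p, X) := by
  rw [waveResidual, h.deriv_phase hφ hI, h.deriv_pos hI, h.deriv_mom hI,
    h.K_eq ε I (saw φ) p _ hI]
  rfl

end

/-- With `Y = I (d' / d) u` the residual of the unperturbed pair is `ε (ε Y ^ 2 - 2 p Y)`. -/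
theorem isNormalForm_zero {d : ℝ → ℝ} (hd : IsProfile d) :
    IsNormalForm d 0 (fun _ _ => 0)
      (fun _ v => π ^ 2 * v.1 ^ 2 / d v.2.2.2 ^ 2 + v.2.2.1 ^ 2 - 1) where
  polyS := IsPoly.const 0
  polyK := by
    refine IsPoly.congr _ _ ?_ ((IsPoly.add _ _ (((IsPoly.const (π ^ 2)).mul
      (IsPoly.act.pow 2)).mul (hd.poly_inv.pow 2)) (IsPoly.mom.pow 2)).sub (IsPoly.const 1))
    intro ε v _
    ring
  S_eq _ _ _ _ _ _ := rfl
  K_eq _ _ _ _ _ _ := rfl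
  S_end _ _ _ _ _ := rfl
  K_lead := ⟨_, IsPoly.const 0, fun ε v _ => by ring⟩
  res v hv := by
    have hY := (IsPoly.act.mul hd.poly_slope).mul IsPoly.ang
    have hG := ((IsPoly.eps 1).mul (hY.pow 2)).sub (((IsPoly.const 2).mul IsPoly.mom).mul hY)
    obtain ⟨C, h0, hC⟩ := hG.bound_at hv
    refine ⟨C, fun ε hε => ?_⟩
    have e : residual d (fun _ _ => 0) (fun _ v => π ^ 2 * v.1 ^ 2 / d v.2.2.2 ^ 2
        + v.2.2.1 ^ 2 - 1) ε v = (ε ^ 1 * (v.1 * (deriv d v.2.2.2 / d v.2.2.2) * v.2.1) ^ 2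
        - 2 * v.2.2.1 * (v.1 * (deriv d v.2.2.2 / d v.2.2.2) * v.2.1)) * ε := by
      simp [residual, oldPoint, hatH, shiftX, dirD]
      ring
    have := mul_le_mul_of_nonneg_right (hC ε hε) (abs_nonneg ε)
    rw [e, abs_mul]
    simpa only [zero_add, pow_one] using this

section

variable {d : ℝ → ℝ} {N : ℕ} {S K : ℝ → PS → ℝ}

theorem IsPoly.hasDerivAt_ang {F : ℝ → PS → ℝ} (hF : IsPoly F) (ε : ℝ) {v : PS} (hv : 0 < v.1) :
    HasDerivAt (fun u => F ε (v.1, u, v.2.2)) (DU F ε v) v.2.1 :=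
  Waveguide.hasDerivAt_ang (hF.differentiableAt ε hv)

theorem IsPoly.continuous_ang {F : ℝ → PS → ℝ} (hF : IsPoly F) (ε : ℝ) {I p X : ℝ} (hI : 0 < I) :
    Continuous fun u => F ε (I, u, p, X) :=
  continuous_iff_continuousAt.2 fun u =>
    (hF.hasDerivAt_ang ε (v := (I, u, p, X)) hI).continuousAt

/-- The terms `s` of the generating function and `k` of the Hamiltonian solve the homological
equation with right-hand side `ρ`. -/
theorem exists_homological (hd : IsProfile d) {ρ : PS → ℝ} (hρ : IsPoly fun _ v => ρ v) :
    ∃ s k g m P Pg : PS → ℝ, (IsPoly fun _ v => s v) ∧ (IsPoly fun _ v => k v) ∧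
      (∀ v : PS, s v = g v - m v) ∧
      (∀ v : PS, 0 < v.1 → DU (fun _ => s) 0 v = (k v - ρ v) / (2 * π ^ 2 * v.1 / d v.2.2.2 ^ 2)) ∧
      (∀ v : PS, 0 < v.1 → HasDerivAt (fun u => g (v.1, u, v.2.2))
        ((k v - ρ v) / (2 * π ^ 2 * v.1 / d v.2.2.2 ^ 2)) v.2.1) ∧
      (∀ v : PS, 0 < v.1 → g (v.1, 0, v.2.2) = 0) ∧
      (∀ v : PS, g (v.1, π, v.2.2) = g (v.1, -π, v.2.2)) ∧
      (∀ v : PS, 0 < v.1 → HasDerivAt (fun u => P (v.1, u, v.2.2)) (ρ v) v.2.1) ∧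
      (∀ v : PS, k v = (2 * π)⁻¹ * (P (v.1, π, v.2.2) - P (v.1, -π, v.2.2))) ∧
      (∀ v : PS, 0 < v.1 → HasDerivAt (fun u => Pg (v.1, u, v.2.2)) (g v) v.2.1) ∧
      ∀ v : PS, m v = (2 * π)⁻¹ * (Pg (v.1, π, v.2.2) - Pg (v.1, -π, v.2.2)) := by
  have hp := Real.pi_pos
  obtain ⟨P, hP, dP, zP⟩ := hρ.primitive
  have hk : IsPoly fun _ v => (2 * π)⁻¹ * (P 0 (v.1, π, v.2.2) - P 0 (v.1, -π, v.2.2)) :=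
    (IsPoly.const _).mul ((hP.eps_zero.subst_ang π).sub (hP.eps_zero.subst_ang (-π)))
  set k : PS → ℝ := fun v => (2 * π)⁻¹ * (P 0 (v.1, π, v.2.2) - P 0 (v.1, -π, v.2.2)) with hkd
  have ha : IsPoly fun _ v => (2 * π ^ 2 * v.1 / d v.2.2.2 ^ 2)⁻¹ := by
    refine IsPoly.congr _ _ ?_ (((IsPoly.const ((2 * π ^ 2)⁻¹)).mul IsPoly.act_inv).mul
      (IsPoly.coeff (hd.bddSmooth.mul hd.bddSmooth)))
    intro ε v hv
    have := (hd.pos v.2.2.2).ne'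
    field_simp
  -- The primitive in `u` of the mean minus the right-hand side, divided by the frequency `2 π ^ 2 I
  -- / d ^ 2`. Its values at `π` and `-π` coincide exactly because `k` is the mean over the period.
  set g : PS → ℝ := fun v => (k v * v.2.1 - P 0 v) * (2 * π ^ 2 * v.1 / d v.2.2.2 ^ 2)⁻¹ with hgd
  have hg : IsPoly fun _ v => g v := ((hk.mul IsPoly.ang).sub hP.eps_zero).mul ha
  have hgD : ∀ v : PS, 0 < v.1 → HasDerivAt (fun u => g (v.1, u, v.2.2))
        ((k v - ρ v) / (2 * π ^ 2 * v.1 / d v.2.2.2 ^ 2)) v.2.1 := by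
    intro v hv
    have h := ((((hasDerivAt_id v.2.1).const_mul (k v)).sub (dP 0 v hv)).mul_const
      (2 * π ^ 2 * v.1 / d v.2.2.2 ^ 2)⁻¹)
    rw [mul_one] at h
    exact h
  obtain ⟨Pg, hPg, dPg, _⟩ := hg.primitive
  have hm : IsPoly fun _ v => (2 * π)⁻¹ * (Pg 0 (v.1, π, v.2.2) - Pg 0 (v.1, -π, v.2.2)) :=
    (IsPoly.const _).mul ((hPg.eps_zero.subst_ang π).sub (hPg.eps_zero.subst_ang (-π)))
  refine ⟨fun v => g v - (2 * π)⁻¹ * (Pg 0 (v.1, π, v.2.2) - Pg 0 (v.1, -π, v.2.2)), k, g,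
    fun v => (2 * π)⁻¹ * (Pg 0 (v.1, π, v.2.2) - Pg 0 (v.1, -π, v.2.2)), P 0, Pg 0, hg.sub hm, hk, fun v => rfl, fun v hv => ?_, hgD,
    fun v hv => ?_, fun v => ?_, dP 0, fun v => rfl, dPg 0, fun v => rfl⟩
  · have h1 := (hg.sub hm).hasDerivAt_ang 0 hv
    exact h1.unique ((hgD v hv).sub_const
      ((2 * π)⁻¹ * (Pg 0 (v.1, π, v.2.2) - Pg 0 (v.1, -π, v.2.2))))
  · simp only [hgd, mul_zero, zP 0 v hv, sub_zero, zero_mul]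
  · simp only [hgd, hkd]
    congr 1
    field_simp
    ring

/-- The coefficient of `ε ^ (N + 1)` in the new residual is the old coefficient `ρ` plus `(2 π ^ 2 I
/ d ^ 2) ∂s/∂u - k`, which is zero by the choice of `s` and `k`. Every other effect of the new terms
is smaller by a factor `ε`. -/
theorem IsNormalForm.succ (h : IsNormalForm d N S K) (hd : IsProfile d) :
    ∃ s k : PS → ℝ, (IsPoly fun _ v => s v) ∧ (IsPoly fun _ v => k v) ∧
      IsNormalForm d (N + 1) (fun ε v => S ε v + ε ^ N * s v)
        (fun ε v => K ε v + ε ^ (N + 1) * k v) := by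
  obtain ⟨ρ, hρ, oρ, cρ⟩ := h.exists_coeff hd
  obtain ⟨s, k, g, m, P, Pg, hs, hk, s_eq, sD, gD, g0, gend, PD, k_eq, PgD, m_eq⟩ :=
    exists_homological hd hρ
  -- At the countably many corners of `S` the coefficient is not known; the integrals that define
  -- the next terms do not see them.
  have hc : ∀ I φ p X, 0 < I → saw φ ≠ -π →
      residualCoeff d (normalForm d N).1 (normalForm d N).2 (N + 1) I φ p X
        = ρ (I, saw φ, p, X) := by
    intro I φ p X hI hφ
    rw [residualCoeff, ← cρ (I, saw φ, p, X) hI]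
    simp only [h.waveResidual_eq hφ hI]
  have hH : ∀ I u p X, 0 < I →
      nextH d (normalForm d N).1 (normalForm d N).2 (N + 1) I p X = k (I, u, p, X) := by
    intro I u p X hI
    rw [k_eq (I, u, p, X)]
    exact phaseMean_eq (g := fun u => ρ (I, u, p, X)) (G := fun u => P (I, u, p, X))
      (fun θ hθ => hc I θ p X hI hθ) (hρ.continuous_ang 0 hI) (fun u => PD (I, u, p, X) hI)
  have hgc : ∀ I p X, 0 < I → Continuous fun u => g (I, u, p, X) := fun I p X hI =>
    continuous_iff_continuousAt.2 fun u => (gD (I, u, p, X) hI).continuousAt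
  have hprim : ∀ I φ p X, 0 < I →
      nextPrim d (normalForm d N).1 (normalForm d N).2 (N + 1) I φ p X = g (I, saw φ, p, X) := by
    intro I φ p X hI
    rw [nextPrim, integral_congr_saw (g := fun θ => (fun u => (k (I, u, p, X) - ρ (I, u, p, X))
      / (2 * π ^ 2 * I / d X ^ 2)) (saw θ)) (fun θ hθ => by
        rw [hc I θ p X hI hθ, hH I (saw θ) p X hI])]
    rw [integral_comp_saw (g := fun u => (k (I, u, p, X) - ρ (I, u, p, X))
      / (2 * π ^ 2 * I / d X ^ 2)) (G := fun u => g (I, u, p, X))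
      (((hk.continuous_ang 0 hI).sub (hρ.continuous_ang 0 hI)).div_const _)
      (fun u => gD (I, u, p, X) hI) (gend (I, 0, p, X))]
    have := g0 (I, 0, p, X) hI
    simp only [this, sub_zero]
  have hS : ∀ I φ p X, 0 < I →
      nextS d (normalForm d N).1 (normalForm d N).2 (N + 1) I φ p X = s (I, saw φ, p, X) := by
    intro I φ p X hI
    rw [nextS, hprim I φ p X hI, s_eq, m_eq]
    congr 1
    exact phaseMean_eq (g := fun u => g (I, u, p, X)) (G := fun u => Pg (I, u, p, X))
      (fun θ _ => hprim I θ p X hI) (hgc I p X hI) (fun u => PgD (I, u, p, X) hI)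
  refine ⟨s, k, hs, hk, ?_, ?_, ?_, ?_, ?_, ?_, ?_⟩
  · exact IsPoly.add _ _ h.polyS ((IsPoly.eps N).mul hs)
  · exact IsPoly.add _ _ h.polyK ((IsPoly.eps (N + 1)).mul hk)
  · intro ε I φ p X hI
    rw [← h.S_eq ε I φ p X hI, ← hS I φ p X hI]; rfl
  · intro ε I u p X hI
    rw [← h.K_eq ε I u p X hI, ← hH I u p X hI]; rfl
  · intro ε I p X hI
    have h1 := gend (I, 0, p, X)
    simp only at h1
    rw [h.S_end ε I p X hI, s_eq, s_eq, h1, m_eq, m_eq]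
  · obtain ⟨K₁, hK₁, e⟩ := h.K_lead
    refine ⟨_, IsPoly.add _ _ hK₁ ((IsPoly.eps N).mul hk), fun ε v hv => ?_⟩
    rw [e ε v hv]; ring
  · intro v hv
    have sU : ∀ ε, DU (fun ε v => S ε v + ε ^ N * s v) ε v = DU S ε v + ε ^ N * DU (fun _ => s) 0 v
        ∧ DX (fun ε v => S ε v + ε ^ N * s v) ε v = DX S ε v + ε ^ N * DX (fun _ => s) 0 v
        ∧ DP (fun ε v => S ε v + ε ^ N * s v) ε v = DP S ε v + ε ^ N * DP (fun _ => s) 0 v := by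
      intro ε
      have e := fderiv_fun_add (h.polyS.differentiableAt ε hv)
        ((hs.differentiableAt 0 hv).const_mul (ε ^ N))
      have e2 := fderiv_const_mul (hs.differentiableAt 0 hv) (ε ^ N)
      rw [e2] at e
      simp only [DU, DX, DP, dirD, e]
      exact ⟨rfl, rfl, rfl⟩
    -- the difference of the residuals, up to the terms of order `ε ^ (N + 2)`
    obtain ⟨C₁, _, b₁⟩ := oρ.bound_at hv
    obtain ⟨C₂, p₂, b₂⟩ := h.polyK.lipschitz_pos hv
    obtain ⟨C₃, p₃, b₃⟩ := hk.lipschitz_pos hv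
    obtain ⟨C₄, p₄, b₄⟩ := (hs.dirD (0, 0, 1, 0)).bound_at hv
    obtain ⟨C₅, p₅, b₅⟩ := (IsPoly.add _ _ (h.polyS.dirD (0, 0, 1, 0)) ((IsPoly.eps N).mul
      (hs.dirD (0, 0, 1, 0)))).bound_at hv
    have hsu := hs.dirD (0, 1, 0, 0)
    have hsx := hs.dirD (0, 0, 0, 1)
    have hSu := h.polyS.dirD (0, 1, 0, 0)
    have hA := IsPoly.add _ _ (poly_oldPoint_fst h.polyS) ((IsPoly.eps (N + 1)).mul hsu)
    have hY := IsPoly.sub (IsPoly.add _ _ (poly_oldPoint_mom h.polyS)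
      ((IsPoly.eps (N + 2)).mul hsx)) ((IsPoly.eps 1).mul ((hA.mul hd.poly_slope).mul IsPoly.ang))
    have hY' := IsPoly.sub (poly_oldPoint_mom h.polyS) ((IsPoly.eps 1).mul
      (((poly_oldPoint_fst h.polyS).mul hd.poly_slope).mul IsPoly.ang))
    obtain ⟨C₆, _, b₆⟩ := (IsPoly.add _ _ (((IsPoly.const (π ^ 2)).mul (hd.poly_inv.pow 2)).mul
      (IsPoly.add _ _ (((IsPoly.const 2).mul hSu).mul hsu) ((IsPoly.eps N).mul (hsu.pow 2))))
      ((hsx.sub ((hsu.mul hd.poly_slope).mul IsPoly.ang)).mul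
        (IsPoly.add _ _ hY hY'))).bound_at hv
    refine ⟨C₁ + C₂ * C₄ + C₃ * C₅ + C₆, fun ε hε => ?_⟩
    have b₁ := b₁ ε hε
    have b₆ := b₆ ε hε
    have b₂ := b₂ ε hε (v.2.2.2 + ε ^ 2 * (DP S ε v + ε ^ N * DP (fun _ => s) 0 v))
      (v.2.2.2 + ε ^ 2 * DP S ε v)
    have b₃ := b₃ ε hε (v.2.2.2 + ε ^ 2 * (DP S ε v + ε ^ N * DP (fun _ => s) 0 v)) v.2.2.2
    have b₄ := b₄ ε hε
    have b₅ := b₅ ε hε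
    obtain ⟨eU, eX, eP⟩ := sU ε
    set E := π ^ 2 * (d v.2.2.2)⁻¹ ^ 2 * (2 * DU S ε v * DU (fun _ => s) 0 v
      + ε ^ N * DU (fun _ => s) 0 v ^ 2) + _ * _ with hE
    replace b₆ : |E| ≤ C₆ := b₆
    -- Only the part linear in `∂s/∂u` of the square of the action has order `N + 1`. The quadratic
    -- part and both changes of the horizontal momentum have order at least `N + 2` and are
    -- collected in `E`.
    have e1 : hatH d ε (oldPoint (fun ε v => S ε v + ε ^ N * s v) ε v)
        - hatH d ε (oldPoint S ε v)
        = ε ^ (N + 1) * (2 * π ^ 2 * v.1 / d v.2.2.2 ^ 2 * DU (fun _ => s) 0 v)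
          + ε ^ (N + 2) * E := by
      rw [hE]
      simp only [oldPoint, hatH, eU, eX, dirD]
      ring
    have e2 : 2 * π ^ 2 * v.1 / d v.2.2.2 ^ 2 * DU (fun _ => s) 0 v = k v - ρ v := by
      rw [sD v hv]
      have := (hd.pos v.2.2.2).ne'
      have := Real.pi_pos.ne'
      have := hv.ne'
      field_simp
    have key : residual d (fun ε v => S ε v + ε ^ N * s v) (fun ε v => K ε v + ε ^ (N + 1) * k v) ε v
        = (residual d S K ε v - ε ^ (N + 1) * ρ v)
          - (K ε (v.1, v.2.1, v.2.2.1, v.2.2.2 + ε ^ 2 * (DP S ε v + ε ^ N * DP (fun _ => s) 0 v))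
            - K ε (v.1, v.2.1, v.2.2.1, v.2.2.2 + ε ^ 2 * DP S ε v))
          - ε ^ (N + 1) * (k (v.1, v.2.1, v.2.2.1,
            v.2.2.2 + ε ^ 2 * (DP S ε v + ε ^ N * DP (fun _ => s) 0 v)) - k v)
          + ε ^ (N + 2) * E := by
      simp only [residual, shiftX, eP]
      rw [e2] at e1
      linear_combination e1
    rw [key]
    have hpos : 0 ≤ |ε| ^ (N + 2) := by positivity
    have t2 : |K ε (v.1, v.2.1, v.2.2.1, v.2.2.2 + ε ^ 2 * (DP S ε v + ε ^ N * DP (fun _ => s) 0 v))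
        - K ε (v.1, v.2.1, v.2.2.1, v.2.2.2 + ε ^ 2 * DP S ε v)| ≤ C₂ * C₄ * |ε| ^ (N + 2) := by
      refine b₂.trans ?_
      rw [show v.2.2.2 + ε ^ 2 * (DP S ε v + ε ^ N * DP (fun _ => s) 0 v)
        - (v.2.2.2 + ε ^ 2 * DP S ε v) = ε ^ (N + 2) * DP (fun _ => s) 0 v by ring, abs_mul,
        abs_pow, mul_assoc, mul_comm C₄]
      gcongr
      exact b₄
    have t3 : |ε ^ (N + 1) * (k (v.1, v.2.1, v.2.2.1,
        v.2.2.2 + ε ^ 2 * (DP S ε v + ε ^ N * DP (fun _ => s) 0 v)) - k v)|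
        ≤ C₃ * C₅ * |ε| ^ (N + 2) := by
      have : |k (v.1, v.2.1, v.2.2.1,
        v.2.2.2 + ε ^ 2 * (DP S ε v + ε ^ N * DP (fun _ => s) 0 v)) - k v| ≤ C₃ * (|ε| * C₅) := by
        refine b₃.trans ?_
        rw [add_sub_cancel_left, abs_mul, abs_pow]
        gcongr
        · calc |ε| ^ 2 ≤ |ε| ^ 1 := pow_le_pow_of_le_one (abs_nonneg _) hε (by norm_num)
            _ = |ε| := pow_one _
        · exact b₅
      rw [abs_mul, abs_pow]
      calc _ ≤ |ε| ^ (N + 1) * (C₃ * (|ε| * C₅)) := by gcongr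
        _ = _ := by ring
    have t4 : |ε ^ (N + 2) * E| ≤ C₆ * |ε| ^ (N + 2) := by
      rw [abs_mul, abs_pow, mul_comm]; gcongr
    refine (abs_add_le _ _).trans ((add_le_add_left ((abs_sub _ _).trans (add_le_add_left
      (abs_sub _ _) _)) _).trans ?_)
    rw [show N + 1 + 1 = N + 2 by ring]
    linarith

/-- Besides existence, this records that a normal form with `j` more terms differs from the given
one by `ε ^ N` times a polynomial expression. Conservation of the action on long intervals rests on
comparing two such normal forms. -/
theorem IsNormalForm.add (h : IsNormalForm d N S K) (hd : IsProfile d) (j : ℕ) :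
    ∃ s k : ℝ → PS → ℝ, IsPoly s ∧ IsPoly k ∧
      IsNormalForm d (N + j) (fun ε v => S ε v + ε ^ N * s ε v)
        (fun ε v => K ε v + ε ^ (N + 1) * k ε v) := by
  induction j with
  | zero => exact ⟨_, _, IsPoly.const 0, IsPoly.const 0, by simpa using h⟩
  | succ j ih =>
    obtain ⟨s, k, hs, hk, h'⟩ := ih
    obtain ⟨s', k', hs', hk', h''⟩ := h'.succ hd
    refine ⟨_, _, IsPoly.add _ _ hs ((IsPoly.eps j).mul hs'),
      IsPoly.add _ _ hk ((IsPoly.eps j).mul hk'), ?_⟩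
    have e1 : (fun ε v => S ε v + ε ^ N * (s ε v + ε ^ j * s' v)) =
        fun ε v => S ε v + ε ^ N * s ε v + ε ^ (N + j) * s' v := by
      funext ε v; ring
    have e2 : (fun ε v => K ε v + ε ^ (N + 1) * (k ε v + ε ^ j * k' v)) =
        fun ε v => K ε v + ε ^ (N + 1) * k ε v + ε ^ (N + j + 1) * k' v := by
      funext ε v; ring
    rw [e1, e2]
    exact h''

theorem exists_isNormalForm (hd : IsProfile d) (N : ℕ) : ∃ S K, IsNormalForm d N S K := by
  obtain ⟨s, k, _, _, h⟩ := (isNormalForm_zero hd).add hd N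
  rw [zero_add] at h
  exact ⟨_, _, h⟩

end

/-! ### The change of variables -/

theorem Ord.lipschitz {F : ℝ → PS → ℝ} {n : ℕ} (hF : Ord n F) {M : ℝ} (hM : 0 < M) :
    ∃ C : ℝ, 0 ≤ C ∧ ∀ ε : ℝ, |ε| ≤ 1 → ∀ v ∈ Slab M, ∀ w ∈ Slab M,
      |F ε v - F ε w| ≤ C * |ε| ^ n * ‖v - w‖ := by
  obtain ⟨C, h0, h⟩ := hF M hM
  refine ⟨C, h0, fun ε hε v hv w hw => ?_⟩
  exact Convex.norm_image_sub_le_of_norm_fderiv_le (f := F ε) (s := Slab M)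
    (fun x hx => (h ε hε x hx).1) (fun x hx => (h ε hε x hx).2.2) (convex_slab M) hw hv

theorem IsPoly.lipschitz {F : ℝ → PS → ℝ} (hF : IsPoly F) {M : ℝ} (hM : 0 < M) :
    ∃ C : ℝ, 0 ≤ C ∧ ∀ ε : ℝ, |ε| ≤ 1 → ∀ v ∈ Slab M, ∀ w ∈ Slab M,
      |F ε v - F ε w| ≤ C * ‖v - w‖ := by
  simpa using hF.ord.lipschitz hM

theorem closedBall_subset_slab {M : ℝ} (hM : 1 ≤ M) {v : PS} (hv : v ∈ Slab M) :
    Metric.closedBall v ((2 * M)⁻¹) ⊆ Slab (2 * M) := by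
  intro w hw
  rw [Metric.mem_closedBall, dist_eq_norm] at hw
  obtain ⟨a1, a2, a3, _⟩ := PS.abs_le_norm (w - v)
  obtain ⟨h1, h2, h3, h4⟩ := hv
  have hM0 : 0 < M := by linarith
  have hi : (2 * M)⁻¹ ≤ 1 := inv_le_one_of_one_le₀ (by linarith)
  have hi2 : M⁻¹ = 2 * (2 * M)⁻¹ := by field_simp
  simp only [Prod.fst_sub, Prod.snd_sub] at a1 a2 a3
  have b1 := abs_le.1 (a1.trans hw)
  have b2 := abs_le.1 (a2.trans hw)
  have b3 := abs_le.1 (a3.trans hw)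
  rw [abs_le] at h3 h4
  refine ⟨by linarith, by linarith, abs_le.2 ⟨by linarith, by linarith⟩,
    abs_le.2 ⟨by linarith, by linarith⟩⟩

/-- The difference between `oldPoint S ε v` and `v`. -/
def chartShift (S : ℝ → PS → ℝ) (ε : ℝ) (v : PS) : PS := (ε * DU S ε v, 0, ε ^ 2 * DX S ε v, 0)

theorem oldPoint_eq (S : ℝ → PS → ℝ) (ε : ℝ) (v : PS) : oldPoint S ε v = v + chartShift S ε v := by
  simp only [oldPoint, chartShift]
  ext <;> simp

theorem eps_sq_le {ε : ℝ} (h0 : 0 < ε) (h1 : ε ≤ 1) : ε ^ 2 ≤ ε := by nlinarith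

theorem chartShift_bounds {S : ℝ → PS → ℝ} (hS : IsPoly S) {M : ℝ} (hM : 0 < M) :
    ∃ C : ℝ, 0 < C ∧ ∀ ε : ℝ, 0 < ε → ε ≤ 1 → ∀ v ∈ Slab M,
      |ε * DU S ε v| ≤ C * ε ∧ |ε ^ 2 * DX S ε v| ≤ C * ε ^ 2 ∧
      (DifferentiableAt ℝ (chartShift S ε) v) ∧ ‖fderiv ℝ (chartShift S ε) v‖ ≤ C * ε ∧
      ∀ w ∈ Slab M, ‖chartShift S ε v - chartShift S ε w‖ ≤ C * ε * ‖v - w‖ := by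
  obtain ⟨C₁, p₁, b₁⟩ := (hS.dirD (0, 1, 0, 0)).ord M hM
  obtain ⟨C₂, p₂, b₂⟩ := (hS.dirD (0, 0, 0, 1)).ord M hM
  have key : ∀ ε : ℝ, 0 < ε → ε ≤ 1 → ∀ v ∈ Slab M,
      (DifferentiableAt ℝ (chartShift S ε) v) ∧
        ‖fderiv ℝ (chartShift S ε) v‖ ≤ (C₁ + C₂ + 1) * ε := by
    intro ε h0 h1 v hv
    have hε : |ε| ≤ 1 := by rwa [abs_of_pos h0]
    have h2 := eps_sq_le h0 h1
    obtain ⟨d1, e1, f1⟩ := b₁ ε hε v hv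
    obtain ⟨d2, e2, f2⟩ := b₂ ε hε v hv
    simp only [pow_zero, mul_one] at f1 f2
    have hd := (d1.hasFDerivAt.const_mul ε).prodMk ((hasFDerivAt_const (0 : ℝ) v).prodMk
      ((d2.hasFDerivAt.const_mul (ε ^ 2)).prodMk (hasFDerivAt_const (0 : ℝ) v)))
    have hd' : HasFDerivAt (chartShift S ε) _ v := hd
    refine ⟨hd'.differentiableAt, ?_⟩
    rw [hd'.fderiv]
    refine ContinuousLinearMap.opNorm_le_bound _ (by positivity) fun z => ?_
    have n1 : |fderiv ℝ (DU S ε) v z| ≤ C₁ * ‖z‖ :=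
      ((fderiv ℝ (DU S ε) v).le_opNorm z).trans (mul_le_mul_of_nonneg_right f1 (norm_nonneg _))
    have n2 : |fderiv ℝ (DX S ε) v z| ≤ C₂ * ‖z‖ :=
      ((fderiv ℝ (DX S ε) v).le_opNorm z).trans (mul_le_mul_of_nonneg_right f2 (norm_nonneg _))
    have hz := norm_nonneg z
    have q1 : |ε * fderiv ℝ (DU S ε) v z| ≤ (C₁ + C₂ + 1) * ε * ‖z‖ := by
      rw [abs_mul, abs_of_pos h0]
      calc ε * |fderiv ℝ (DU S ε) v z| ≤ ε * (C₁ * ‖z‖) := by gcongr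
        _ = C₁ * (ε * ‖z‖) := by ring
        _ ≤ (C₁ + C₂ + 1) * (ε * ‖z‖) := by gcongr; linarith
        _ = _ := by ring
    have q2 : |ε ^ 2 * fderiv ℝ (DX S ε) v z| ≤ (C₁ + C₂ + 1) * ε * ‖z‖ := by
      rw [abs_mul, abs_of_pos (by positivity)]
      calc ε ^ 2 * |fderiv ℝ (DX S ε) v z| ≤ ε * (C₂ * ‖z‖) := by gcongr
        _ = C₂ * (ε * ‖z‖) := by ring
        _ ≤ (C₁ + C₂ + 1) * (ε * ‖z‖) := by gcongr; linarith
        _ = _ := by ring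
    have q0 : |(0 : ℝ)| ≤ (C₁ + C₂ + 1) * ε * ‖z‖ := by rw [abs_zero]; positivity
    exact PS.norm_le q1 q0 q2 q0
  refine ⟨C₁ + C₂ + 1, by positivity, fun ε h0 h1 v hv => ⟨?_, ?_, (key ε h0 h1 v hv).1,
    (key ε h0 h1 v hv).2, fun w hw => ?_⟩⟩
  · have := (b₁ ε (by rwa [abs_of_pos h0]) v hv).2.1
    rw [abs_mul, abs_of_pos h0, mul_comm]
    simp only [pow_zero, mul_one] at this
    gcongr
    linarith
  · have := (b₂ ε (by rwa [abs_of_pos h0]) v hv).2.1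
    rw [abs_mul, abs_of_pos (by positivity : 0 < ε ^ 2), mul_comm]
    simp only [pow_zero, mul_one] at this
    gcongr
    linarith
  · exact Convex.norm_image_sub_le_of_norm_fderiv_le (f := chartShift S ε) (s := Slab M)
      (fun x hx => (key ε h0 h1 x hx).1) (fun x hx => (key ε h0 h1 x hx).2) (convex_slab M) hw hv

open Classical in
/-- The inverse of `oldPoint S ε`, with values in `Slab (2 * M)`. -/
def newPoint (S : ℝ → PS → ℝ) (M ε : ℝ) (v : PS) : PS :=
  if h : ∃ m ∈ Slab (2 * M), oldPoint S ε m = v then h.choose else v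

/-- For small `ε` the shift is Lipschitz with constant `1 / 2`, so the identity plus the shift
expands distances by at least `1 / 2`. -/
theorem oldPoint_stable {S : ℝ → PS → ℝ} (hS : IsPoly S) {M : ℝ} (hM : 0 < M) :
    ∃ ε₀ : ℝ, 0 < ε₀ ∧ ∀ ε : ℝ, 0 < ε → ε < ε₀ → ∀ v ∈ Slab M, ∀ w ∈ Slab M,
      ‖v - w‖ ≤ 2 * ‖oldPoint S ε v - oldPoint S ε w‖ := by
  obtain ⟨C, hC, b⟩ := chartShift_bounds hS hM
  refine ⟨min 1 (1 / (2 * C)), by positivity, fun ε h0 h1 v hv w hw => ?_⟩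
  have h2 : ε < 1 / (2 * C) := h1.trans_le (min_le_right _ _)
  rw [lt_div_iff₀ (by positivity)] at h2
  have := (b ε h0 (h1.le.trans (min_le_left _ _)) v hv).2.2.2.2 w hw
  have e : v - w = (oldPoint S ε v - oldPoint S ε w) - (chartShift S ε v - chartShift S ε w) := by
    rw [oldPoint_eq, oldPoint_eq]; abel
  have h3 : ‖v - w‖ ≤ ‖oldPoint S ε v - oldPoint S ε w‖ + ‖chartShift S ε v - chartShift S ε w‖ := by
    conv_lhs => rw [e]
    exact norm_sub_le _ _
  nlinarith [norm_nonneg (v - w)]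

/-- In the mixed variables (new action, old phase, new momentum, old position) the change of
variables is the explicit map `oldPoint`, a perturbation of the identity in the action and the
momentum only. It is inverted by the contraction principle on a ball inside the doubled slab. -/
theorem newPoint_spec {S : ℝ → PS → ℝ} (hS : IsPoly S) {M : ℝ} (hM : 1 ≤ M) :
    ∃ C ε₀ : ℝ, 0 < C ∧ 0 < ε₀ ∧ ∀ ε : ℝ, 0 < ε → ε < ε₀ → ∀ v ∈ Slab M,
      newPoint S M ε v ∈ Slab (2 * M) ∧ oldPoint S ε (newPoint S M ε v) = v ∧
      |(newPoint S M ε v).1 - v.1| ≤ C * ε ∧ |(newPoint S M ε v).2.2.1 - v.2.2.1| ≤ C * ε ^ 2 ∧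
      (newPoint S M ε v).2.1 = v.2.1 ∧ (newPoint S M ε v).2.2.2 = v.2.2.2 ∧
      ∀ w ∈ Slab M, ‖newPoint S M ε v - newPoint S M ε w‖ ≤ 2 * ‖v - w‖ := by
  have hM0 : 0 < M := by linarith
  obtain ⟨C, hC, b⟩ := chartShift_bounds hS (by linarith : 0 < 2 * M)
  obtain ⟨ε₁, hε₁, st⟩ := oldPoint_stable hS (by linarith : 0 < 2 * M)
  refine ⟨C, min ε₁ (min 1 (1 / (2 * C * (2 * M)))), hC, by positivity, fun ε h0 h1 => ?_⟩
  have hε1 : ε < 1 := h1.trans_le ((min_le_right _ _).trans (min_le_left _ _))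
  have hεC : ε * (2 * C * (2 * M)) < 1 := by
    have := h1.trans_le ((min_le_right _ _).trans (min_le_right _ _))
    rwa [lt_div_iff₀ (by positivity)] at this
  have hst := st ε h0 (h1.trans_le (min_le_left _ _))
  have ex : ∀ v ∈ Slab M, ∃ m ∈ Slab (2 * M), oldPoint S ε m = v := by
    intro v hv
    have hsub := closedBall_subset_slab hM hv
    set s := Metric.closedBall v ((2 * M)⁻¹) with hs
    -- A fixed point of this map is a preimage of `v` under `oldPoint`.
    set f : PS → PS := fun m => v - chartShift S ε m with hf
    have hCε : C * ε ≤ 1 / 2 := by nlinarith [mul_pos h0 hC]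
    have hmaps : Set.MapsTo f s s := by
      intro m hm
      obtain ⟨c1, c2, -⟩ := b ε h0 hε1.le m (hsub hm)
      rw [hs, Metric.mem_closedBall, dist_eq_norm]
      have hle : C * ε ≤ (2 * M)⁻¹ := by
        rw [← one_div, le_div_iff₀ (by positivity)]; nlinarith [mul_pos h0 hC]
      have h2 := eps_sq_le h0 hε1.le
      have hle2 : C * ε ^ 2 ≤ (2 * M)⁻¹ := (by gcongr : C * ε ^ 2 ≤ C * ε).trans hle
      have : f m - v = -chartShift S ε m := by simp only [hf]; abel
      rw [this, norm_neg]
      have hp : |(0 : ℝ)| ≤ (2 * M)⁻¹ := by rw [abs_zero]; positivity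
      exact PS.norm_le (c1.trans hle) hp (c2.trans hle2) hp
    have hcontr : ContractingWith (1 / 2) (hmaps.restrict f s s) := by
      refine ⟨by norm_num, LipschitzWith.of_dist_le_mul fun x y => ?_⟩
      obtain ⟨-, -, -, -, c⟩ := b ε h0 hε1.le x (hsub x.2)
      have := c y (hsub y.2)
      rw [Subtype.dist_eq, Subtype.dist_eq, dist_eq_norm, dist_eq_norm]
      have e : f x - f y = -(chartShift S ε x - chartShift S ε y) := by simp only [hf]; abel
      simp only [Set.MapsTo.val_restrict_apply, e, norm_neg]
      refine this.trans ?_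
      push_cast
      gcongr
    obtain ⟨m, hm, hfix, -⟩ := hcontr.exists_fixedPoint' Metric.isClosed_closedBall.isComplete
      hmaps (Metric.mem_closedBall_self (by positivity : 0 ≤ (2 * M)⁻¹)) (edist_ne_top _ _)
    refine ⟨m, hsub hm, ?_⟩
    have : v - chartShift S ε m = m := hfix
    rw [oldPoint_eq]
    nth_rewrite 1 [← this]
    abel
  have spec : ∀ v ∈ Slab M, newPoint S M ε v ∈ Slab (2 * M) ∧ oldPoint S ε (newPoint S M ε v) = v := by
    intro v hv
    rw [newPoint, dif_pos (ex v hv)]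
    exact (ex v hv).choose_spec
  intro v hv
  obtain ⟨s1, s2⟩ := spec v hv
  obtain ⟨c1, c2, -⟩ := b ε h0 hε1.le _ s1
  refine ⟨s1, s2, ?_, ?_, ?_, ?_,
    fun w hw => ?_⟩
  · have := congrArg (fun z : PS => z.1) s2
    simp only [oldPoint] at this
    rw [← this, sub_add_cancel_left, abs_neg]; exact c1
  · have := congrArg (fun z : PS => z.2.2.1) s2
    simp only [oldPoint] at this
    rw [← this, sub_add_cancel_left, abs_neg]; exact c2
  · have h := congrArg (fun z : PS => z.2.1) s2
    exact h
  · have h := congrArg (fun z : PS => z.2.2.2) s2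
    exact h
  · obtain ⟨t1, t2⟩ := spec w hw
    have := hst _ s1 _ t1
    rwa [s2, t2] at this

/-- Differentiation of a function given implicitly by `m + g (m) = γ`. -/
theorem hasDerivWithinAt_of_add_eq {E : Type*} [NormedAddCommGroup E] [NormedSpace ℝ E]
    [CompleteSpace E] {m γ : ℝ → E} {g : E → E} {L : E →L[ℝ] E} {γ' : E} {s : Set ℝ} {t : ℝ}
    {C : ℝ} (ht : t ∈ s) (hγ : HasDerivWithinAt γ γ' s t) (hg : HasFDerivAt g L (m t))
    (hL : ‖L‖ < 1) (heq : ∀ τ ∈ s, m τ + g (m τ) = γ τ)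
    (hlip : ∀ τ ∈ s, ‖m τ - m t‖ ≤ C * ‖γ τ - γ t‖) :
    ∃ m' : E, m' + L m' = γ' ∧ HasDerivWithinAt m m' s t := by
  -- As `‖L‖ < 1`, the operator `1 + L` is inverted by the Neumann series.
  set U := Units.oneSub (-L) (by rwa [norm_neg]) with hU
  have hUv : (U : E →L[ℝ] E) = 1 + L := by simp [hU, Units.val_oneSub]
  have hinv : ∀ x : E, (↑U⁻¹ : E →L[ℝ] E) (x + L x) = x := by
    intro x
    have h := congrArg (fun f : E →L[ℝ] E => f x) U.inv_mul
    simp only [hUv] at h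
    simpa using h
  have hinv' : ∀ x : E, (↑U⁻¹ : E →L[ℝ] E) x + L ((↑U⁻¹ : E →L[ℝ] E) x) = x := by
    intro x
    have h := congrArg (fun f : E →L[ℝ] E => f x) U.mul_inv
    simp only [hUv] at h
    simpa using h
  refine ⟨(↑U⁻¹ : E →L[ℝ] E) γ', hinv' γ', ?_⟩
  have hγo := hasDerivWithinAt_iff_isLittleO.1 hγ
  have hO : (fun τ => γ τ - γ t) =O[𝓝[s] t] fun τ => τ - t := hγ.hasFDerivWithinAt.isBigO_sub
  -- The Lipschitz hypothesis supplies this bound before differentiability of `m` is known; it turns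
  -- the error of the linearization of `g` at `m t` into an error in time.
  have hmO : (fun τ => m τ - m t) =O[𝓝[s] t] fun τ => τ - t := by
    refine Asymptotics.IsBigO.trans (Asymptotics.IsBigO.of_bound C ?_) hO
    filter_upwards [self_mem_nhdsWithin] with τ hτ using hlip τ hτ
  have hmc : Filter.Tendsto m (𝓝[s] t) (𝓝 (m t)) := by
    have h1 : Filter.Tendsto (fun τ => τ - t) (𝓝[s] t) (𝓝 0) := by
      have : Filter.Tendsto (fun τ => τ - t) (𝓝 t) (𝓝 (t - t)) :=
        Continuous.tendsto (by fun_prop) t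
      rw [sub_self] at this
      exact this.mono_left nhdsWithin_le_nhds
    exact tendsto_sub_nhds_zero_iff.1 (hmO.trans_tendsto h1)
  have hgo : (fun τ => g (m τ) - g (m t) - L (m τ - m t)) =o[𝓝[s] t] fun τ => τ - t :=
    ((hasFDerivAt_iff_isLittleO.1 hg).comp_tendsto hmc).trans_isBigO hmO
  rw [hasDerivWithinAt_iff_isLittleO]
  have h3 := ((↑U⁻¹ : E →L[ℝ] E).isBigO_comp _ _).trans_isLittleO (hγo.sub hgo)
  refine h3.congr' ?_ Filter.EventuallyEq.rfl
  filter_upwards [self_mem_nhdsWithin] with τ hτ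
  have e : γ τ - γ t - (τ - t) • γ' - (g (m τ) - g (m t) - L (m τ - m t))
      = ((m τ - m t) + L (m τ - m t)) - (τ - t) • γ' := by
    rw [← heq τ hτ, ← heq t ht]; abel
  rw [e, map_sub, hinv, map_smul]

/-! ### The equations of motion in the improved variables -/

/-- The arguments at which the normal form is evaluated: the new slow coordinate replaces `X`. -/
def shiftPoint (S : ℝ → PS → ℝ) (ε : ℝ) (m : PS) : PS :=
  (m.1, m.2.1, m.2.2.1, m.2.2.2 + ε ^ 2 * DP S ε m)

/-- The velocity of `(I, u, p, X)` in the Hamiltonian system with Hamiltonian `hatH`. -/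
def hatVelocity (d : ℝ → ℝ) (ε : ℝ) (v : PS) : PS :=
  (-DU (hatH d) ε v, DI (hatH d) ε v, -(ε * DX (hatH d) ε v), ε * DP (hatH d) ε v)

section

variable {d : ℝ → ℝ} {N : ℕ} {S K : ℝ → PS → ℝ}

theorem fderiv_chartShift (hS : IsPoly S) (ε : ℝ) {m : PS} (hm : 0 < m.1) (e : PS) :
    fderiv ℝ (chartShift S ε) m e =
      (ε * fderiv ℝ (DU S ε) m e, 0, ε ^ 2 * fderiv ℝ (DX S ε) m e, 0) := by
  have d1 := (hS.dirD (0, 1, 0, 0)).differentiableAt ε hm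
  have d2 := (hS.dirD (0, 0, 0, 1)).differentiableAt ε hm
  have hd := (d1.hasFDerivAt.const_mul ε).prodMk ((hasFDerivAt_const (0 : ℝ) m).prodMk
    ((d2.hasFDerivAt.const_mul (ε ^ 2)).prodMk (hasFDerivAt_const (0 : ℝ) m)))
  have hd' : HasFDerivAt (chartShift S ε) _ m := hd
  rw [hd'.fderiv]
  rfl

theorem differentiableAt_chartShift (hS : IsPoly S) (ε : ℝ) {m : PS} (hm : 0 < m.1) :
    DifferentiableAt ℝ (chartShift S ε) m := by
  have d1 := (hS.dirD (0, 1, 0, 0)).differentiableAt ε hm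
  have d2 := (hS.dirD (0, 0, 0, 1)).differentiableAt ε hm
  exact ((d1.hasFDerivAt.const_mul ε).prodMk ((hasFDerivAt_const (0 : ℝ) m).prodMk
    ((d2.hasFDerivAt.const_mul (ε ^ 2)).prodMk (hasFDerivAt_const (0 : ℝ) m)))).differentiableAt

theorem IsNormalForm.DU_eq_zero (h : IsNormalForm d N S K) (ε : ℝ) {m : PS} (hm : 0 < m.1) :
    DU K ε m = 0 := by
  have h1 := h.polyK.hasDerivAt_ang ε hm
  have h2 : (fun u => K ε (m.1, u, m.2.2)) = fun _ => (normalForm d N).2 ε m.1 m.2.2.1 m.2.2.2 :=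
    funext fun u => (h.K_eq ε m.1 u m.2.2.1 m.2.2.2 hm).symm
  rw [h2] at h1
  exact h1.unique (hasDerivAt_const _ _)

theorem IsNormalForm.fderiv_residual (h : IsNormalForm d N S K) (hd : IsProfile d) (ε : ℝ) {m : PS}
    (hm : 0 < m.1) (hv : 0 < (oldPoint S ε m).1) (e : PS) :
    fderiv ℝ (residual d S K ε) m e =
      fderiv ℝ (hatH d ε) (oldPoint S ε m) (e + fderiv ℝ (chartShift S ε) m e)
      - fderiv ℝ (K ε) (shiftPoint S ε m) (e + (0, 0, 0, ε ^ 2 * fderiv ℝ (DP S ε) m e)) := by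
  have d1 := (differentiableAt_chartShift h.polyS ε hm).hasFDerivAt
  have hid : HasFDerivAt (fun v : PS => v) (ContinuousLinearMap.id ℝ PS) m := hasFDerivAt_id m
  have d2 : HasFDerivAt (oldPoint S ε)
      (ContinuousLinearMap.id ℝ PS + fderiv ℝ (chartShift S ε) m) m := by
    have : oldPoint S ε = fun v => v + chartShift S ε v := funext fun v => oldPoint_eq S ε v
    rw [this]
    exact hid.add d1
  have d3 := ((h.polyS.dirD (0, 0, 1, 0)).differentiableAt ε hm).hasFDerivAt.const_mul (ε ^ 2)
  have d3' := (hasFDerivAt_const (0 : ℝ) m).prodMk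
      ((hasFDerivAt_const (0 : ℝ) m).prodMk ((hasFDerivAt_const (0 : ℝ) m).prodMk d3))
  have d4 := hid.fun_add d3'
  have hs : (fun v => v + ((0, 0, 0, ε ^ 2 * DP S ε v) : PS)) = shiftPoint S ε := by
    funext v
    simp only [shiftPoint]
    ext <;> simp
  rw [hs] at d4
  have d5 := (hd.poly_hatH.differentiableAt ε hv).hasFDerivAt.comp m d2
  have hsp : 0 < (shiftPoint S ε m).1 := hm
  have d6 := (h.polyK.differentiableAt ε hsp).hasFDerivAt.comp m d4
  have d7 : HasFDerivAt (residual d S K ε) _ m := d5.sub d6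
  rw [d7.fderiv]
  rfl

/-- Differentiate `hatH (oldPoint m) - K (shiftPoint m)` along the four coordinates and substitute
Hamilton's equations of the old variables. Since the second derivatives of `S` commute, what remains
is a linear system for the defects of the averaged equations with derivatives of the residual on the
right. The unknowns are the velocity of the new action and the defect of the momentum; the other two
defects are then explicit. -/
theorem IsNormalForm.velocity_eq (h : IsNormalForm d N S K) (hd : IsProfile d) {ε : ℝ} {m m' : PS}
    (hm : 0 < m.1) (hv : 0 < (oldPoint S ε m).1)
    (hm' : m' + fderiv ℝ (chartShift S ε) m m' = hatVelocity d ε (oldPoint S ε m)) :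
    (m'.1 * (1 + ε * DI (DU S) ε m) + ε * DP (DU S) ε m
      * (m'.2.2.1 + ε * DX K ε (shiftPoint S ε m)) = -DU (residual d S K) ε m) ∧
    ((m'.2.2.1 + ε * DX K ε (shiftPoint S ε m)) * (1 + ε ^ 2 * DP (DX S) ε m)
      + ε ^ 2 * DI (DX S) ε m * m'.1 = -(ε * DX (residual d S K) ε m)) ∧
    (m'.2.2.2 + ε ^ 2 * fderiv ℝ (DP S ε) m m' - ε * DP K ε (shiftPoint S ε m)
      = ε * DP (residual d S K) ε m + ε ^ 2 * DI (DP S) ε m * m'.1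
        + ε ^ 2 * DP (DP S) ε m * (m'.2.2.1 + ε * DX K ε (shiftPoint S ε m))) ∧
    (m'.2.1 + ε * fderiv ℝ (DI S ε) m m' - DI K ε (shiftPoint S ε m)
      = DI (residual d S K) ε m + ε * DI (DI S) ε m * m'.1
        + ε * DP (DI S) ε m * (m'.2.2.1 + ε * DX K ε (shiftPoint S ε m))) := by
  rw [fderiv_chartShift h.polyS ε hm, clm_apply_eq (fderiv ℝ (DU S ε) m) m',
    clm_apply_eq (fderiv ℝ (DX S ε) m) m'] at hm'
  have e1 := congrArg (fun z : PS => z.1) hm'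
  have e2 := congrArg (fun z : PS => z.2.1) hm'
  have e3 := congrArg (fun z : PS => z.2.2.1) hm'
  have e4 := congrArg (fun z : PS => z.2.2.2) hm'
  simp only [hatVelocity, Prod.fst_add, Prod.snd_add, add_zero] at e1 e2 e3 e4
  have hK := h.DU_eq_zero ε (m := shiftPoint S ε m) hm
  have r : ∀ e, dirD e (residual d S K) ε m = _ := fun e => h.fderiv_residual hd ε hm hv e
  have rI := r (1, 0, 0, 0)
  have rU := r (0, 1, 0, 0)
  have rP := r (0, 0, 1, 0)
  have rX := r (0, 0, 0, 1)
  rw [fderiv_chartShift h.polyS ε hm, clm_apply_eq (fderiv ℝ (hatH d ε) _),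
    clm_apply_eq (fderiv ℝ (K ε) _)] at rI rU rP rX
  have cUX := h.polyS.dirD_comm (0, 1, 0, 0) (0, 0, 0, 1) ε hm
  have cUP := h.polyS.dirD_comm (0, 1, 0, 0) (0, 0, 1, 0) ε hm
  have cIU := h.polyS.dirD_comm (1, 0, 0, 0) (0, 1, 0, 0) ε hm
  have cXP := h.polyS.dirD_comm (0, 0, 0, 1) (0, 0, 1, 0) ε hm
  have cIX := h.polyS.dirD_comm (1, 0, 0, 0) (0, 0, 0, 1) ε hm
  have cIP := h.polyS.dirD_comm (1, 0, 0, 0) (0, 0, 1, 0) ε hm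
  have fold : ∀ (F : ℝ → PS → ℝ) (e : PS) (v : PS), fderiv ℝ (F ε) v e = dirD e F ε v :=
    fun _ _ _ => rfl
  simp only [Prod.fst_add, Prod.snd_add, add_zero, zero_add, zero_mul, one_mul, fold]
    at e1 e2 e3 e4 rI rU rP rX
  rw [clm_apply_eq (fderiv ℝ (DP S ε) m) m', clm_apply_eq (fderiv ℝ (DI S ε) m) m']
  simp only [fold]
  simp only [DU, DI, DX, DP] at *
  rw [hK, cUX, cUP] at rU
  rw [cXP] at rX
  rw [cIU, cIX, cIP] at rI
  rw [← e2] at rI rU rP rX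
  rw [e4] at e1 e3 ⊢
  refine ⟨?_, ?_, ?_, ?_⟩
  · linear_combination e1 + rU
  · rw [cUX] at e3
    linear_combination e3 + ε * rX
  · rw [cUP, cXP]
    linear_combination - ε * rP
  · linear_combination - rI

theorem exists_bound_list {M : ℝ} (hM : 0 < M) (l : List (ℝ → PS → ℝ)) (h : ∀ F ∈ l, IsPoly F) :
    ∃ B : ℝ, 0 < B ∧ ∀ F ∈ l, ∀ ε : ℝ, |ε| ≤ 1 → ∀ v ∈ Slab M, |F ε v| ≤ B := by
  induction l with
  | nil => exact ⟨1, one_pos, by simp⟩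
  | cons F l ih =>
    obtain ⟨B, hB, b⟩ := ih fun G hG => h G (by simp [hG])
    obtain ⟨C, hC, c⟩ := (h F (by simp)).bound hM
    refine ⟨B + C, by positivity, fun G hG ε hε v hv => ?_⟩
    rcases List.mem_cons.1 hG with rfl | hG
    · exact (c ε hε v hv).trans (by linarith)
    · exact (b G hG ε hε v hv).trans (by linarith)

/-- The system is diagonally dominant: with `B` a bound for the second derivatives of `S` and `ε B <
1 / 4`, the coupling terms are absorbed on the left. -/
theorem IsNormalForm.velocity_bounds (h : IsNormalForm d N S K) (hd : IsProfile d) {M : ℝ}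
    (hM : 0 < M) : ∃ C ε₀ : ℝ, 0 < C ∧ 0 < ε₀ ∧ ∀ ε : ℝ, 0 < ε → ε < ε₀ → ∀ m ∈ Slab M, ∀ m' : PS,
      0 < (oldPoint S ε m).1 →
      m' + fderiv ℝ (chartShift S ε) m m' = hatVelocity d ε (oldPoint S ε m) →
      |m'.1| ≤ C * ε ^ (N + 1) ∧
      |m'.2.2.1 + ε * DX K ε (shiftPoint S ε m)| ≤ C * ε ^ (N + 2) ∧
      |m'.2.2.2 + ε ^ 2 * fderiv ℝ (DP S ε) m m' - ε * DP K ε (shiftPoint S ε m)|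
        ≤ C * ε ^ (N + 2) ∧
      |m'.2.1 + ε * fderiv ℝ (DI S ε) m m' - DI K ε (shiftPoint S ε m)| ≤ C * ε ^ (N + 1) := by
  have hp : ∀ e f : PS, IsPoly (dirD e (dirD f S)) := fun e f => (h.polyS.dirD f).dirD e
  obtain ⟨B, hB, b⟩ := exists_bound_list hM [DI (DU S), DP (DU S), DI (DX S), DP (DX S), DI (DP S),
    DP (DP S), DI (DI S), DP (DI S)] (by
      intro F hF
      simp only [List.mem_cons, List.not_mem_nil, or_false] at hF
      rcases hF with rfl | rfl | rfl | rfl | rfl | rfl | rfl | rfl <;> exact hp _ _)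
  simp only [List.mem_cons, List.not_mem_nil, or_false, forall_eq_or_imp, forall_eq] at b
  obtain ⟨b1, b2, b3, b4, b5, b6, b7, b8⟩ := b
  obtain ⟨R, hR, r⟩ := h.ord_residual hd M hM
  refine ⟨10 * (R + 1), min 1 (1 / (4 * B)), by positivity, by positivity,
    fun ε h0 h1 m hm m' hv hm' => ?_⟩
  have hε1 : ε < 1 := h1.trans_le (min_le_left _ _)
  have hεB : ε * B < 1 / 4 := by
    have := h1.trans_le (min_le_right _ _)
    rw [lt_div_iff₀ (by positivity)] at this
    linarith
  have hε : |ε| ≤ 1 := by rw [abs_of_pos h0]; exact hε1.le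
  obtain ⟨q1, q2, q3, q4⟩ := h.velocity_eq hd (Slab.pos hM hm) hv hm'
  set α := m'.1 with hα
  set β := m'.2.2.1 + ε * DX K ε (shiftPoint S ε m) with hβ
  have n1 : ∀ e : PS, ‖e‖ ≤ 1 → |dirD e (residual d S K) ε m| ≤ R * ε ^ (N + 1) := by
    intro e he
    have h3 := (r ε hε m hm).2.2
    rw [abs_of_pos h0] at h3
    calc |dirD e (residual d S K) ε m| ≤ ‖fderiv ℝ (residual d S K ε) m‖ * ‖e‖ :=
          (fderiv ℝ (residual d S K ε) m).le_opNorm e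
      _ ≤ (R * ε ^ (N + 1)) * 1 := by gcongr
      _ = _ := mul_one _
  have rI := n1 (1, 0, 0, 0) (PS.norm_le (by simp) (by simp) (by simp) (by simp))
  have rU := n1 (0, 1, 0, 0) (PS.norm_le (by simp) (by simp) (by simp) (by simp))
  have rP := n1 (0, 0, 1, 0) (PS.norm_le (by simp) (by simp) (by simp) (by simp))
  have rX := n1 (0, 0, 0, 1) (PS.norm_le (by simp) (by simp) (by simp) (by simp))
  set ρ := R * ε ^ (N + 1) with hρ
  have hρ0 : 0 ≤ ρ := by positivity
  have prod : ∀ x y : ℝ, |x| ≤ B → |ε * x * y| ≤ |y| / 4 := by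
    intro x y hx
    rw [abs_mul, abs_mul, abs_of_pos h0]
    calc ε * |x| * |y| ≤ ε * B * |y| := by gcongr
      _ ≤ 1 / 4 * |y| := by gcongr
      _ = |y| / 4 := by ring
  have p1 := prod _ α (b1 ε hε m hm)
  have p2 := prod _ β (b2 ε hε m hm)
  have p3 := prod _ α (b3 ε hε m hm)
  have p4 := prod _ β (b4 ε hε m hm)
  have p5 := prod _ α (b5 ε hε m hm)
  have p6 := prod _ β (b6 ε hε m hm)
  have p7 := prod _ α (b7 ε hε m hm)
  have p8 := prod _ β (b8 ε hε m hm)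
  have scale : ∀ x y : ℝ, |x| ≤ y → |ε * x| ≤ ε * y := by
    intro x y hx
    rw [abs_mul, abs_of_pos h0]; gcongr
  have a1 : |α| ≤ ρ + |α| / 4 + |β| / 4 := by
    have e : α = -DU (residual d S K) ε m - ε * DI (DU S) ε m * α - ε * DP (DU S) ε m * β := by
      linear_combination q1
    calc |α| = |-DU (residual d S K) ε m - ε * DI (DU S) ε m * α - ε * DP (DU S) ε m * β| := by
          rw [← e]
      _ ≤ |-DU (residual d S K) ε m| + |ε * DI (DU S) ε m * α| + |ε * DP (DU S) ε m * β| :=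
          (abs_sub _ _).trans (by gcongr; exact abs_sub _ _)
      _ ≤ _ := by rw [abs_neg]; linarith
  -- The momentum equation carries an overall factor `ε`, since momentum and slow coordinate are
  -- conjugate up to this factor. Here the error gains one order over that of the action.
  have a2 : |β| ≤ ε * (ρ + |α| / 4 + |β| / 4) := by
    have e : β = ε * (-DX (residual d S K) ε m - ε * DP (DX S) ε m * β
        - ε * DI (DX S) ε m * α) := by
      linear_combination q2
    conv_lhs => rw [e]
    refine scale _ _ ?_
    calc _ ≤ |-DX (residual d S K) ε m| + |ε * DP (DX S) ε m * β| + |ε * DI (DX S) ε m * α| :=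
          (abs_sub _ _).trans (by gcongr; exact abs_sub _ _)
      _ ≤ _ := by rw [abs_neg]; linarith
  have hα0 := abs_nonneg α
  have hβ0 := abs_nonneg β
  have a2' : |β| ≤ ρ + |α| / 4 + |β| / 4 := a2.trans (by nlinarith)
  have a3 : |α| ≤ 4 * ρ := by linarith
  have a4 : |β| ≤ 4 * ρ := by linarith
  have a5 : |β| ≤ ε * (3 * ρ) := a2.trans (by gcongr; linarith)
  have hpow : ε ^ (N + 2) = ε * ε ^ (N + 1) := by ring
  have hρ1 : ρ ≤ (R + 1) * ε ^ (N + 1) := by rw [hρ]; gcongr; linarith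
  have hP : 0 < (R + 1) * ε ^ (N + 1) := by positivity
  have fin : ∀ x : ℝ, x ≤ ε * (10 * ρ) → x ≤ 10 * (R + 1) * ε ^ (N + 2) := by
    intro x hx
    refine hx.trans ?_
    rw [hpow]
    calc ε * (10 * ρ) ≤ ε * (10 * ((R + 1) * ε ^ (N + 1))) := by gcongr
      _ = _ := by ring
  refine ⟨by linarith, fin _ (a5.trans (by gcongr; linarith)), fin _ ?_, ?_⟩
  · rw [q3, show ε * DP (residual d S K) ε m + ε ^ 2 * DI (DP S) ε m * α
      + ε ^ 2 * DP (DP S) ε m * β = ε * (DP (residual d S K) ε m + ε * DI (DP S) ε m * α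
      + ε * DP (DP S) ε m * β) by ring]
    refine scale _ _ ?_
    refine (abs_add_three _ _ _).trans ?_
    linarith
  · rw [q4]
    refine (abs_add_three _ _ _).trans ?_
    linarith

end

/-! ### Motion and reflections in the improved variables. -/

section

variable {d : ℝ → ℝ} {N : ℕ} {S K : ℝ → PS → ℝ}

theorem IsNormalForm.K_ang (h : IsNormalForm d N S K) (ε : ℝ) {v : PS} (hv : 0 < v.1) (u : ℝ) :
    K ε v = K ε (v.1, u, v.2.2) := by
  rw [← h.K_eq ε v.1 u v.2.2.1 v.2.2.2 hv, h.K_eq ε v.1 v.2.1 v.2.2.1 v.2.2.2 hv]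

/-- Independence of the angle passes to all derivatives by translating in `u`; it allows the value
`0` to be put for the angle when the averaged system is studied in the plane. -/
theorem IsNormalForm.dirD_ang (h : IsNormalForm d N S K) (e : PS) (ε : ℝ) {v : PS} (hv : 0 < v.1)
    (u : ℝ) : dirD e K ε v = dirD e K ε (v.1, u, v.2.2) := by
  have hv' : 0 < ((v.1, u, v.2.2) : PS).1 := hv
  have hdiff := h.polyK.differentiableAt ε hv'
  have hg : HasFDerivAt (fun w : PS => ((w.1, w.2.1 + (u - v.2.1), w.2.2) : PS))
      (ContinuousLinearMap.id ℝ PS) v := by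
    have h1 := (hasFDerivAt_id (𝕜 := ℝ) v).add_const ((0, u - v.2.1, 0, 0) : PS)
    have e1 : (fun w : PS => id w + ((0, u - v.2.1, 0, 0) : PS)) =
        fun w : PS => ((w.1, w.2.1 + (u - v.2.1), w.2.2) : PS) := by
      funext w; ext <;> simp
    rw [e1] at h1
    exact h1
  have hgv : ((v.1, v.2.1 + (u - v.2.1), v.2.2) : PS) = (v.1, u, v.2.2) := by simp
  have h2 : HasFDerivAt (fun w : PS => K ε (w.1, w.2.1 + (u - v.2.1), w.2.2))
      ((fderiv ℝ (K ε) (v.1, u, v.2.2)).comp (ContinuousLinearMap.id ℝ PS)) v := by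
    rw [← hgv] at hdiff ⊢
    exact hdiff.hasFDerivAt.comp v hg
  have he : K ε =ᶠ[𝓝 v] fun w => K ε (w.1, w.2.1 + (u - v.2.1), w.2.2) := by
    filter_upwards [eventually_pos hv] with w hw using h.K_ang ε hw _
  rw [dirD, dirD, (h2.congr_of_eventuallyEq he).fderiv]
  rfl

/-- The equality of `S` at the two ends may be differentiated along `I`, `p` and `X`, but not along
`u`. Hence only the action needs a separate argument at a reflection. -/
theorem IsNormalForm.dirD_end (h : IsNormalForm d N S K) (ε : ℝ) {A q X : ℝ} (hA : 0 < A) :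
    DI S ε (A, π, q, X) = DI S ε (A, -π, q, X) ∧ DP S ε (A, π, q, X) = DP S ε (A, -π, q, X) ∧
      DX S ε (A, π, q, X) = DX S ε (A, -π, q, X) := by
  refine ⟨?_, ?_, ?_⟩
  · have h1 := hasDerivAt_fst (v := (A, π, q, X)) (h.polyS.differentiableAt ε hA)
    have h2 := hasDerivAt_fst (v := (A, -π, q, X)) (h.polyS.differentiableAt ε hA)
    refine h1.unique (h2.congr_of_eventuallyEq ?_)
    filter_upwards [lt_mem_nhds hA] with a ha using h.S_end ε a q X ha
  · have h1 := hasDerivAt_mom (v := (A, π, q, X)) (h.polyS.differentiableAt ε hA)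
    have h2 := hasDerivAt_mom (v := (A, -π, q, X)) (h.polyS.differentiableAt ε hA)
    exact h1.unique (h2.congr_of_eventuallyEq
      (Filter.Eventually.of_forall fun a => h.S_end ε A a X hA))
  · have h1 := hasDerivAt_pos (v := (A, π, q, X)) (h.polyS.differentiableAt ε hA)
    have h2 := hasDerivAt_pos (v := (A, -π, q, X)) (h.polyS.differentiableAt ε hA)
    exact h1.unique (h2.congr_of_eventuallyEq
      (Filter.Eventually.of_forall fun a => h.S_end ε A q a hA))

/-- Along a solution of the Hamiltonian system the improved variables satisfy the equations of the
normal form up to small errors. -/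
theorem IsNormalForm.motion (h : IsNormalForm d N S K) (hd : IsProfile d) {M : ℝ} (hM : 1 ≤ M) :
    ∃ C ε₀ : ℝ, 0 < C ∧ 0 < ε₀ ∧ ∀ ε : ℝ, 0 < ε → ε < ε₀ →
      ∀ (γ : ℝ → PS) (s : Set ℝ) (t : ℝ), t ∈ s → (∀ τ ∈ s, γ τ ∈ Slab M) →
      HasDerivWithinAt γ (hatVelocity d ε (γ t)) s t →
      ∃ a q x f : ℝ,
        HasDerivWithinAt (fun τ => (newPoint S M ε (γ τ)).1) a s t ∧
        HasDerivWithinAt (fun τ => (newPoint S M ε (γ τ)).2.2.1) q s t ∧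
        HasDerivWithinAt (fun τ => (shiftPoint S ε (newPoint S M ε (γ τ))).2.2.2) x s t ∧
        HasDerivWithinAt (fun τ => (newPoint S M ε (γ τ)).2.1 +
          ε * DI S ε (newPoint S M ε (γ τ))) f s t ∧
        |a| ≤ C * ε ^ (N + 1) ∧
        |q + ε * DX K ε (shiftPoint S ε (newPoint S M ε (γ t)))| ≤ C * ε ^ (N + 2) ∧
        |x - ε * DP K ε (shiftPoint S ε (newPoint S M ε (γ t)))| ≤ C * ε ^ (N + 2) ∧
        |f - DI K ε (shiftPoint S ε (newPoint S M ε (γ t)))| ≤ C * ε ^ (N + 1) := by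
  have hM2 : 0 < 2 * M := by linarith
  obtain ⟨C, ε₁, hC, hε₁, b⟩ := h.velocity_bounds hd hM2
  obtain ⟨C₂, ε₂, -, hε₂, b₂⟩ := newPoint_spec h.polyS hM
  obtain ⟨C₃, hC₃, b₃⟩ := chartShift_bounds h.polyS hM2
  refine ⟨C, min (min ε₁ ε₂) (min 1 (1 / (2 * C₃))), hC, by positivity, ?_⟩
  intro ε h0 h1 γ s t ht hγ hγ'
  have l1 : ε < ε₁ := h1.trans_le ((min_le_left _ _).trans (min_le_left _ _))
  have l2 : ε < ε₂ := h1.trans_le ((min_le_left _ _).trans (min_le_right _ _))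
  have l3 : ε < 1 := h1.trans_le ((min_le_right _ _).trans (min_le_left _ _))
  have l4 : ε < 1 / (2 * C₃) := h1.trans_le ((min_le_right _ _).trans (min_le_right _ _))
  rw [lt_div_iff₀ (by positivity)] at l4
  set m : ℝ → PS := fun τ => newPoint S M ε (γ τ) with hm
  have spec : ∀ τ ∈ s, m τ ∈ Slab (2 * M) ∧ oldPoint S ε (m τ) = γ τ ∧ _ := fun τ hτ =>
    ⟨(b₂ ε h0 l2 _ (hγ τ hτ)).1, (b₂ ε h0 l2 _ (hγ τ hτ)).2.1,
      (b₂ ε h0 l2 _ (hγ τ hτ)).2.2.2.2.2.2⟩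
  obtain ⟨mt, ot, -⟩ := spec t ht
  have hpos := Slab.pos hM2 mt
  obtain ⟨-, -, dg, ng, -⟩ := b₃ ε h0 l3.le _ mt
  obtain ⟨m', em', dm⟩ := hasDerivWithinAt_of_add_eq (m := m) (γ := γ) (g := chartShift S ε)
    (C := 2) ht hγ' dg.hasFDerivAt (by linarith)
    (fun τ hτ => by rw [← oldPoint_eq]; exact (spec τ hτ).2.1)
    (fun τ hτ => (spec τ hτ).2.2 _ (hγ t ht))
  rw [← ot] at em'
  obtain ⟨v1, v2, v3, v4⟩ := b ε h0 l1 (m t) mt m' (by rw [ot]; exact Slab.pos (by linarith) (hγ t ht))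
    em'
  have d1 : HasDerivWithinAt (fun τ => (m τ).1) m'.1 s t := dm.fst
  have d2 : HasDerivWithinAt (fun τ => (m τ).2.1) m'.2.1 s t := dm.snd.fst
  have d3 : HasDerivWithinAt (fun τ => (m τ).2.2.1) m'.2.2.1 s t := dm.snd.snd.fst
  have d4 : HasDerivWithinAt (fun τ => (m τ).2.2.2) m'.2.2.2 s t := dm.snd.snd.snd
  have d5 : HasDerivWithinAt (fun τ => DP S ε (m τ)) (fderiv ℝ (DP S ε) (m t) m') s t :=
    ((h.polyS.dirD _).differentiableAt ε hpos).hasFDerivAt.comp_hasDerivWithinAt t dm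
  have d6 : HasDerivWithinAt (fun τ => DI S ε (m τ)) (fderiv ℝ (DI S ε) (m t) m') s t :=
    ((h.polyS.dirD _).differentiableAt ε hpos).hasFDerivAt.comp_hasDerivWithinAt t dm
  exact ⟨_, _, _, _, d1, d3, d4.fun_add (d5.const_mul (ε ^ 2)), d2.fun_add (d6.const_mul ε),
    v1, v2, v3, v4⟩

/-- On the zero level of `hatH` the averaged Hamiltonian is minus the residual. -/
theorem IsNormalForm.energy (h : IsNormalForm d N S K) (hd : IsProfile d) {M : ℝ} (hM : 1 ≤ M) :
    ∃ C ε₀ : ℝ, 0 < C ∧ 0 < ε₀ ∧ ∀ ε : ℝ, 0 < ε → ε < ε₀ → ∀ v ∈ Slab M, hatH d ε v = 0 →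
      |K ε (shiftPoint S ε (newPoint S M ε v))| ≤ C * ε ^ (N + 1) := by
  obtain ⟨R, hR, r⟩ := h.ord_residual hd (2 * M) (by linarith)
  obtain ⟨C₂, ε₂, -, hε₂, b₂⟩ := newPoint_spec h.polyS hM
  refine ⟨R + 1, min 1 ε₂, by positivity, by positivity, fun ε h0 h1 v hv hH => ?_⟩
  have l3 : ε < 1 := h1.trans_le (min_le_left _ _)
  obtain ⟨s1, s2, -⟩ := b₂ ε h0 (h1.trans_le (min_le_right _ _)) v hv
  have := (r ε (by rw [abs_of_pos h0]; exact l3.le) _ s1).2.1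
  rw [residual, s2, hH, zero_sub, abs_neg, abs_of_pos h0] at this
  refine this.trans ?_
  gcongr
  linarith

set_option maxHeartbeats 1000000 in
/-- The improved variables before and after a reflection off the upper wall. -/
theorem IsNormalForm.reflection (h : IsNormalForm d N S K) (hd : IsProfile d) {M : ℝ} (hM : 1 ≤ M) :
    ∃ C ε₀ : ℝ, 0 < C ∧ 0 < ε₀ ∧ ∀ ε : ℝ, 0 < ε → ε < ε₀ → ∀ v ∈ Slab M, ∀ w ∈ Slab M,
      v.2.1 = π → w.2.1 = -π → v.2.2 = w.2.2 → hatH d ε v = 0 → hatH d ε w = 0 →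
      |(newPoint S M ε v).1 - (newPoint S M ε w).1| ≤ C * ε ^ (N + 1) ∧
      |(newPoint S M ε v).2.2.1 - (newPoint S M ε w).2.2.1| ≤ C * ε ^ (N + 2) ∧
      |(shiftPoint S ε (newPoint S M ε v)).2.2.2 - (shiftPoint S ε (newPoint S M ε w)).2.2.2|
        ≤ C * ε ^ (N + 2) ∧
      |ε * DI S ε (newPoint S M ε v) - ε * DI S ε (newPoint S M ε w)| ≤ C * ε ^ (N + 2) := by
  have hM2 : 0 < 2 * M := by linarith
  obtain ⟨C₁, ε₁, hC₁, hε₁, b₁⟩ := h.energy hd hM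
  obtain ⟨C₂, ε₂, -, hε₂, b₂⟩ := newPoint_spec h.polyS hM
  obtain ⟨Λ₁, p₁, l₁⟩ := (h.polyS.dirD (1, 0, 0, 0)).lipschitz hM2
  obtain ⟨Λ₂, p₂, l₂⟩ := (h.polyS.dirD (0, 0, 1, 0)).lipschitz hM2
  obtain ⟨Λ₃, p₃, l₃⟩ := (h.polyS.dirD (0, 0, 0, 1)).lipschitz hM2
  obtain ⟨Λ₄, p₄, l₄⟩ := h.polyK.lipschitz hM2
  obtain ⟨K₁, hK₁, eK⟩ := h.K_lead
  obtain ⟨Λ₅, p₅, l₅⟩ := hK₁.lipschitz hM2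
  obtain ⟨D, hD0, hD⟩ := hd.bddSmooth.bound
  have hpi := Real.pi_pos
  set Λ := Λ₁ + Λ₂ + Λ₃ + 1 with hΛ
  have hΛ0 : 0 < Λ := by positivity
  -- A lower bound for the divided difference `π ^ 2 (I + I') / d ^ 2` of the leading Hamiltonian in
  -- the action: both actions are at least `1 / (2 M)`, and `d ≤ D + 1`.
  set κ := π ^ 2 / (M * (D + 1) ^ 2) with hκ
  have hκ0 : 0 < κ := by positivity
  set E := 4 * Λ * Λ₄ + Λ₅ + Λ + 1 with hE
  have hE0 : 0 < E := by positivity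
  refine ⟨(4 * C₁ / κ) * (1 + 2 * Λ), min (min ε₁ ε₂) (min 1 (min (κ / (2 * E)) (1 / (2 * E)))),
    by positivity, by positivity, ?_⟩
  intro ε h0 h1 v hv w hw hvu hwu hvw hHv hHw
  have m1 : ε < ε₁ := h1.trans_le ((min_le_left _ _).trans (min_le_left _ _))
  have m2 : ε < ε₂ := h1.trans_le ((min_le_left _ _).trans (min_le_right _ _))
  have m3 : ε < 1 := h1.trans_le ((min_le_right _ _).trans (min_le_left _ _))
  have m4 : ε < κ / (2 * E) :=
    h1.trans_le ((min_le_right _ _).trans ((min_le_right _ _).trans (min_le_left _ _)))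
  have m5 : ε < 1 / (2 * E) :=
    h1.trans_le ((min_le_right _ _).trans ((min_le_right _ _).trans (min_le_right _ _)))
  rw [lt_div_iff₀ (by positivity)] at m4 m5
  have hε : |ε| ≤ 1 := by rw [abs_of_pos h0]; exact m3.le
  have hsq := eps_sq_le h0 m3.le
  obtain ⟨mv, ov, -, -, uv, xv, -⟩ := b₂ ε h0 m2 v hv
  obtain ⟨mw, ow, -, -, uw, xw, -⟩ := b₂ ε h0 m2 w hw
  have ev := b₁ ε h0 m1 v hv hHv
  have ew := b₁ ε h0 m1 w hw hHw
  set m := newPoint S M ε v with hm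
  set n := newPoint S M ε w with hn
  have mpos := Slab.pos hM2 mv
  have npos := Slab.pos hM2 mw
  set a := |m.1 - n.1| with ha
  set b := |m.2.2.1 - n.2.2.1| with hb
  have ha0 : 0 ≤ a := abs_nonneg _
  have hb0 : 0 ≤ b := abs_nonneg _
  -- the reflected point with the phase `π`
  set n' : PS := (n.1, π, n.2.2) with hn'
  have mn' : n' ∈ Slab (2 * M) := by
    have := mv.2.2.1
    rw [uv, hvu] at this
    exact ⟨mw.1, mw.2.1, this, mw.2.2.2⟩
  have nn : n = (n.1, -π, n.2.2) := by
    ext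
    · rfl
    · simp [uw, hwu]
    · rfl
    · rfl
  have dist1 : ‖m - n'‖ ≤ a + b := by
    refine PS.norm_le ?_ ?_ ?_ ?_
    · simp [hn', ha, hb0]
    · simp [hn', uv, hvu]; positivity
    · simp [hn', hb, ha0]
    · simp [hn', xv, xw, hvw]; positivity
  obtain ⟨E1, E2, E3⟩ := h.dirD_end ε (A := n.1) (q := n.2.2.1) (X := n.2.2.2) npos
  have lipI : |DI S ε m - DI S ε n| ≤ Λ * (a + b) := by
    rw [nn]
    have := l₁ ε hε m mv n' mn'
    have e : DI S ε n' = DI S ε (n.1, -π, n.2.2) := E1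
    rw [← e]
    exact this.trans (mul_le_mul (by linarith) dist1 (norm_nonneg _) hΛ0.le)
  have lipP : |DP S ε m - DP S ε n| ≤ Λ * (a + b) := by
    rw [nn]
    have := l₂ ε hε m mv n' mn'
    have e : DP S ε n' = DP S ε (n.1, -π, n.2.2) := E2
    rw [← e]
    exact this.trans (mul_le_mul (by linarith) dist1 (norm_nonneg _) hΛ0.le)
  have lipX : |DX S ε m - DX S ε n| ≤ Λ * (a + b) := by
    rw [nn]
    have := l₃ ε hε m mv n' mn'
    have e : DX S ε n' = DX S ε (n.1, -π, n.2.2) := E3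
    rw [← e]
    exact this.trans (mul_le_mul (by linarith) dist1 (norm_nonneg _) hΛ0.le)
  have hΛE : Λ ≤ E := by
    have : 0 ≤ 4 * Λ * Λ₄ := by positivity
    linarith
  have hε2 : ε ^ 2 * Λ ≤ 1 / 2 := by
    have : ε ^ 2 * Λ ≤ ε * E := mul_le_mul hsq hΛE hΛ0.le h0.le
    linarith
  -- The old momenta coincide and `∂S/∂X` has the same values at both ends of the angle, so the new
  -- momenta differ only through the differences of action and momentum themselves, with a factor `ε
  -- ^ 2`.
  have bb : b ≤ ε ^ 2 * (Λ * (a + b)) := by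
    have q1 := congrArg (fun z : PS => z.2.2.1) ov
    have q2 := congrArg (fun z : PS => z.2.2.1) ow
    simp only [oldPoint] at q1 q2
    have : m.2.2.1 - n.2.2.1 = -(ε ^ 2 * (DX S ε m - DX S ε n)) := by
      have : v.2.2.1 = w.2.2.1 := by rw [hvw]
      linear_combination q1 - q2 + this
    have e : b = ε ^ 2 * |DX S ε m - DX S ε n| := by
      rw [hb, this, abs_neg, abs_mul, abs_of_pos (by positivity : 0 < ε ^ 2)]
    exact e.le.trans (by gcongr)
  have bb1 : b ≤ a := by
    have e : ε ^ 2 * (Λ * (a + b)) = ε ^ 2 * Λ * (a + b) := by ring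
    have := mul_le_mul_of_nonneg_right hε2 (add_nonneg ha0 hb0)
    linarith
  have hab : Λ * (a + b) ≤ 2 * Λ * a := by
    have := mul_le_mul_of_nonneg_left bb1 hΛ0.le
    linarith
  have bb2 : b ≤ ε ^ 2 * (2 * Λ * a) := bb.trans (by gcongr)
  have xx : |(shiftPoint S ε m).2.2.2 - (shiftPoint S ε n).2.2.2| ≤ ε ^ 2 * (2 * Λ * a) := by
    have : (shiftPoint S ε m).2.2.2 - (shiftPoint S ε n).2.2.2
        = ε ^ 2 * (DP S ε m - DP S ε n) := by
      have : m.2.2.2 = n.2.2.2 := by rw [xv, xw, hvw]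
      simp only [shiftPoint]
      linear_combination this
    rw [this, abs_mul, abs_of_pos (by positivity : 0 < ε ^ 2)]
    gcongr
    exact lipP.trans hab
  -- the change of the action, from the conservation of energy
  set P₁ : PS := (m.1, 0, (shiftPoint S ε m).2.2) with hP₁
  set P₂ : PS := (m.1, 0, (shiftPoint S ε n).2.2) with hP₂
  set P₃ : PS := (n.1, 0, (shiftPoint S ε n).2.2) with hP₃
  have hM20 : (0 : ℝ) ≤ 2 * M := hM2.le
  have z1 : |(0 : ℝ)| ≤ 2 * M := by simpa using hM20
  have s1 : P₁ ∈ Slab (2 * M) := ⟨mv.1, mv.2.1, z1, mv.2.2.2⟩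
  have s2 : P₂ ∈ Slab (2 * M) := ⟨mv.1, mv.2.1, z1, mw.2.2.2⟩
  have s3 : P₃ ∈ Slab (2 * M) := ⟨mw.1, mw.2.1, z1, mw.2.2.2⟩
  have k1 : |K ε P₁| ≤ C₁ * ε ^ (N + 1) := by
    have hps : 0 < (shiftPoint S ε m).1 := mpos
    rw [h.K_ang ε hps 0] at ev
    exact ev
  have k3 : |K ε P₃| ≤ C₁ * ε ^ (N + 1) := by
    have hps : 0 < (shiftPoint S ε n).1 := npos
    rw [h.K_ang ε hps 0] at ew
    exact ew
  have d12 : ‖P₁ - P₂‖ ≤ ε ^ 2 * (2 * Λ * a) := by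
    have : 0 ≤ ε ^ 2 * (2 * Λ * a) := by positivity
    refine PS.norm_le ?_ ?_ ?_ ?_
    · simpa [hP₁, hP₂] using this
    · simpa [hP₁, hP₂] using this
    · exact bb2
    · exact xx
  have d23 : ‖P₂ - P₃‖ ≤ a := by
    refine PS.norm_le ?_ ?_ ?_ ?_
    · simp [hP₃, hP₂, ha]
    · simpa [hP₃, hP₂] using ha0
    · simpa [hP₃, hP₂] using ha0
    · simpa [hP₃, hP₂] using ha0
  have k12 : |K ε P₁ - K ε P₂| ≤ Λ₄ * (ε ^ 2 * (2 * Λ * a)) :=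
    (l₄ ε hε _ s1 _ s2).trans (by gcongr)
  have k23 : |K₁ ε P₂ - K₁ ε P₃| ≤ Λ₅ * a := (l₅ ε hε _ s2 _ s3).trans (by gcongr)
  set X := (shiftPoint S ε n).2.2.2 with hX
  have hdX := hd.pos X
  have lead : κ * a ≤ |π ^ 2 * (m.1 ^ 2 - n.1 ^ 2) / d X ^ 2| := by
    have e : |π ^ 2 * (m.1 ^ 2 - n.1 ^ 2) / d X ^ 2| = (π ^ 2 * (m.1 + n.1) / d X ^ 2) * a := by
      rw [ha, show π ^ 2 * (m.1 ^ 2 - n.1 ^ 2) / d X ^ 2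
        = (π ^ 2 * (m.1 + n.1) / d X ^ 2) * (m.1 - n.1) by ring, abs_mul, abs_of_pos (by positivity)]
    rw [e]
    refine mul_le_mul_of_nonneg_right ?_ ha0
    have h5 : M⁻¹ ≤ m.1 + n.1 := by
      have h6 := mv.1
      have h7 := mw.1
      have : M⁻¹ = 2 * (2 * M)⁻¹ := by field_simp
      linarith
    have h6 : d X ≤ D + 1 := (le_abs_self _).trans ((hD X).trans (by linarith))
    calc κ = π ^ 2 * M⁻¹ / (D + 1) ^ 2 := by rw [hκ]; field_simp
      _ ≤ π ^ 2 * (m.1 + n.1) / d X ^ 2 := by gcongr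
  have eq23 : K ε P₂ - K ε P₃ = π ^ 2 * (m.1 ^ 2 - n.1 ^ 2) / d X ^ 2
      + ε * (K₁ ε P₂ - K₁ ε P₃) := by
    rw [eK ε P₂ mpos, eK ε P₃ npos]
    simp only [hP₂, hP₃, ← hX]
    ring
  have main : κ * a ≤ 2 * (C₁ * ε ^ (N + 1)) + ε * E * a := by
    have e : π ^ 2 * (m.1 ^ 2 - n.1 ^ 2) / d X ^ 2 = K ε P₁ - K ε P₃ - (K ε P₁ - K ε P₂)
        - ε * (K₁ ε P₂ - K₁ ε P₃) := by linear_combination -eq23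
    rw [e] at lead
    refine lead.trans ((abs_sub _ _).trans ?_)
    have t1 := abs_sub (K ε P₁ - K ε P₃) (K ε P₁ - K ε P₂)
    have t2 := abs_sub (K ε P₁) (K ε P₃)
    have t3 : |ε * (K₁ ε P₂ - K₁ ε P₃)| ≤ ε * (Λ₅ * a) := by
      rw [abs_mul, abs_of_pos h0]; gcongr
    have t4 : Λ₄ * (ε ^ 2 * (2 * Λ * a)) ≤ Λ₄ * (ε * (2 * Λ * a)) := by gcongr
    have t5 : 0 ≤ ε * a := by positivity
    have t6 : ε * E * a = 2 * (Λ₄ * (ε * (2 * Λ * a))) + ε * (Λ₅ * a) + Λ * (ε * a) + ε * a := by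
      rw [hE]; ring
    have t7 : 0 ≤ Λ₄ * (ε * (2 * Λ * a)) := by positivity
    have t8 : 0 ≤ Λ * (ε * a) := by positivity
    linarith
  -- The smallness of `ε` makes `ε E ≤ κ / 2`, so the term with `a` is absorbed by the slope in the
  -- action.
  have fin : a ≤ (4 * C₁ / κ) * ε ^ (N + 1) := by
    have : κ / 2 * a ≤ 2 * (C₁ * ε ^ (N + 1)) := by
      have : ε * E * a ≤ κ / 2 * a := by gcongr; linarith
      linarith
    rw [div_mul_eq_mul_div, le_div_iff₀ hκ0]
    linarith
  set Q := (4 * C₁ / κ) * ε ^ (N + 1) with hQ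
  have hQ0 : 0 ≤ Q := by positivity
  have fin2 : ε ^ 2 * (2 * Λ * a) ≤ (4 * C₁ / κ) * (1 + 2 * Λ) * ε ^ (N + 2) := by
    calc ε ^ 2 * (2 * Λ * a) ≤ ε * (2 * Λ * Q) := by gcongr
      _ ≤ ε * ((1 + 2 * Λ) * Q) := by gcongr; linarith
      _ = _ := by rw [hQ]; ring
  refine ⟨?_, bb2.trans fin2, xx.trans fin2, ?_⟩
  · refine fin.trans ?_
    calc Q ≤ (1 + 2 * Λ) * Q := le_mul_of_one_le_left hQ0 (by linarith)
      _ = _ := by rw [hQ]; ring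
  · rw [← mul_sub, abs_mul, abs_of_pos h0]
    calc ε * |DI S ε m - DI S ε n| ≤ ε * (Λ * (a + b)) := by gcongr
      _ ≤ ε * (2 * Λ * Q) := by gcongr ε * ?_; exact hab.trans (by gcongr)
      _ ≤ ε * ((1 + 2 * Λ) * Q) := by gcongr; linarith
      _ = _ := by rw [hQ]; ring

/-- Two normal forms that agree to a given order lead to improved variables that are close. -/
theorem newPoint_compare {s : ℝ → PS → ℝ} (hS : IsPoly S) (hs : IsPoly s) (N : ℕ) {M : ℝ}
    (hM : 1 ≤ M) : ∃ C ε₀ : ℝ, 0 < C ∧ 0 < ε₀ ∧ ∀ ε : ℝ, 0 < ε → ε < ε₀ → ∀ v ∈ Slab M,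
      ‖newPoint (fun ε v => S ε v + ε ^ N * s ε v) M ε v - newPoint S M ε v‖
        ≤ C * ε ^ (N + 1) := by
  have hM2 : 0 < 2 * M := by linarith
  have hS' : IsPoly fun ε v => S ε v + ε ^ N * s ε v := IsPoly.add _ _ hS ((IsPoly.eps N).mul hs)
  obtain ⟨C₁, ε₁, -, hε₁, b₁⟩ := newPoint_spec hS hM
  obtain ⟨C₂, ε₂, -, hε₂, b₂⟩ := newPoint_spec hS' hM
  obtain ⟨ε₃, hε₃, b₃⟩ := oldPoint_stable hS hM2
  obtain ⟨C₄, hC₄, b₄⟩ := chartShift_bounds hs hM2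
  refine ⟨2 * C₄, min (min ε₁ ε₂) (min 1 ε₃), by positivity, by positivity, ?_⟩
  intro ε h0 h1 v hv
  have m1 : ε < ε₁ := h1.trans_le ((min_le_left _ _).trans (min_le_left _ _))
  have m2 : ε < ε₂ := h1.trans_le ((min_le_left _ _).trans (min_le_right _ _))
  have m3 : ε < 1 := h1.trans_le ((min_le_right _ _).trans (min_le_left _ _))
  have m4 : ε < ε₃ := h1.trans_le ((min_le_right _ _).trans (min_le_right _ _))
  obtain ⟨s1, o1, -⟩ := b₁ ε h0 m1 v hv
  obtain ⟨s2, o2, -⟩ := b₂ ε h0 m2 v hv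
  set m := newPoint S M ε v
  set n := newPoint (fun ε v => S ε v + ε ^ N * s ε v) M ε v
  refine (b₃ ε h0 m4 n s2 m s1).trans ?_
  have npos := Slab.pos hM2 s2
  have e := fderiv_fun_add (hS.differentiableAt ε npos)
    ((hs.differentiableAt ε npos).const_mul (ε ^ N))
  rw [fderiv_const_mul (hs.differentiableAt ε npos) (ε ^ N)] at e
  have key : oldPoint S ε n - oldPoint S ε m = -(ε ^ N • chartShift s ε n) := by
    rw [o1, ← o2]
    simp only [oldPoint, chartShift, DU, DX, dirD, e]
    ext <;> simp <;> ring
  obtain ⟨c1, c2, -⟩ := b₄ ε h0 m3.le n s2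
  rw [key, norm_neg, norm_smul, Real.norm_eq_abs, abs_of_pos (by positivity)]
  have c2' : |ε ^ 2 * DX s ε n| ≤ C₄ * ε := c2.trans (by
    have := eps_sq_le h0 m3.le
    gcongr)
  have c0 : |(0 : ℝ)| ≤ C₄ * ε := by rw [abs_zero]; positivity
  have : ‖chartShift s ε n‖ ≤ C₄ * ε := PS.norm_le c1 c0 c2' c0
  calc 2 * (ε ^ N * ‖chartShift s ε n‖) ≤ 2 * (ε ^ N * (C₄ * ε)) := by gcongr
    _ = _ := by ring

end

/-! ### Rays in action-angle variables -/

/-- The times at which the ray is strictly between the walls. -/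
def flightTimes (d : ℝ → ℝ) (ε T : ℝ) (x y : ℝ → ℝ) : Set ℝ :=
  {t ∈ Set.Icc 0 T | Inside d ε (x t) (y t)}

/-- The times at which the ray is at a wall. -/
def impactTimes (d : ℝ → ℝ) (ε T : ℝ) (x y : ℝ → ℝ) : Set ℝ :=
  {t ∈ Set.Icc 0 T | ¬ Inside d ε (x t) (y t)}

/-- The variables `(I, u, p, X)` of the point `(x, y)` of a ray with the momenta `(α, β)`. -/
def rayPoint (d : ℝ → ℝ) (ε x y α β : ℝ) : PS :=
  (|β| * d (ε * x) / π, β / |β| * (π * y / d (ε * x)),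
    α + ε * (deriv d (ε * x) / d (ε * x) * (β * y)), ε * x)

/-- The variables `(I, u, p, X)` along a ray. -/
def rayState (d : ℝ → ℝ) (ε : ℝ) (x y px py : ℝ → ℝ) (t : ℝ) : PS :=
  rayPoint d ε (x t) (y t) (px t) (py t)

theorem hatH_rayPoint {d : ℝ → ℝ} (hd : IsProfile d) (ε x y α : ℝ) {β : ℝ} (hβ : β ≠ 0) :
    hatH d ε (rayPoint d ε x y α β) = α ^ 2 + β ^ 2 - 1 := by
  have h1 := (hd.pos (ε * x)).ne'
  have h2 : |β| ≠ 0 := abs_ne_zero.2 hβ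
  have h3 := Real.pi_pos.ne'
  simp only [hatH, rayPoint]
  have e1 : π ^ 2 * (|β| * d (ε * x) / π) ^ 2 / d (ε * x) ^ 2 = β ^ 2 := by
    rw [← sq_abs β]; field_simp
  have e2 : |β| * d (ε * x) / π * deriv d (ε * x) / d (ε * x) *
      (β / |β| * (π * y / d (ε * x))) = deriv d (ε * x) / d (ε * x) * (β * y) := by
    field_simp
  rw [e1, e2]; ring

theorem hasDerivAt_hatH {d : ℝ → ℝ} (hd : IsProfile d) (ε : ℝ) {v : PS} (hv : 0 < v.1) :
    hatVelocity d ε v =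
      (2 * ε * (v.2.2.1 - ε * (v.1 * deriv d v.2.2.2 / d v.2.2.2 * v.2.1))
          * (v.1 * deriv d v.2.2.2 / d v.2.2.2),
        2 * π ^ 2 * v.1 / d v.2.2.2 ^ 2
          - 2 * ε * (v.2.2.1 - ε * (v.1 * deriv d v.2.2.2 / d v.2.2.2 * v.2.1))
            * (deriv d v.2.2.2 / d v.2.2.2 * v.2.1),
        ε * (2 * π ^ 2 * v.1 ^ 2 * deriv d v.2.2.2 / d v.2.2.2 ^ 3
          + 2 * ε * (v.2.2.1 - ε * (v.1 * deriv d v.2.2.2 / d v.2.2.2 * v.2.1))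
            * (v.1 * v.2.1 * ((deriv (deriv d) v.2.2.2 * d v.2.2.2 - deriv d v.2.2.2 ^ 2)
              / d v.2.2.2 ^ 2))),
        2 * ε * (v.2.2.1 - ε * (v.1 * deriv d v.2.2.2 / d v.2.2.2 * v.2.1))) := by
  obtain ⟨I, u, p, X⟩ := v
  simp only at hv
  have h1 := (hd.pos X).ne'
  have hdiff := hd.poly_hatH.differentiableAt ε (v := (I, u, p, X)) hv
  have a1 := (hasDerivAt_fst hdiff).unique (f₁' := 2 * π ^ 2 * I / d X ^ 2
      - 2 * ε * (p - ε * (I * deriv d X / d X * u)) * (deriv d X / d X * u)) (by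
    have := (((((hasDerivAt_id I).pow 2).const_mul (π ^ 2)).div_const (d X ^ 2)).add
      (((((((hasDerivAt_id I).mul_const (deriv d X)).div_const (d X)).mul_const u).const_mul
        ε).const_sub p).pow 2)).sub_const 1
    refine HasDerivAt.congr_deriv (f := fun z => hatH d ε (z, u, p, X)) this ?_
    simp; field_simp; ring)
  have a2 := (hasDerivAt_ang hdiff).unique (f₁' := -(2 * ε * (p - ε * (I * deriv d X / d X * u))
      * (I * deriv d X / d X))) (by
    have := (((((((hasDerivAt_id u).const_mul (I * deriv d X / d X)).const_mul
        ε).const_sub p).pow 2)).const_add (π ^ 2 * I ^ 2 / d X ^ 2)).sub_const 1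
    refine HasDerivAt.congr_deriv (f := fun z => hatH d ε (I, z, p, X)) this ?_
    simp; ring)
  have a3 := (hasDerivAt_mom hdiff).unique (f₁' := 2 * (p - ε * (I * deriv d X / d X * u))) (by
    have := (((((hasDerivAt_id p).sub_const (ε * (I * deriv d X / d X * u))).pow 2)).const_add
      (π ^ 2 * I ^ 2 / d X ^ 2)).sub_const 1
    refine HasDerivAt.congr_deriv (f := fun z => hatH d ε (I, u, z, X)) this ?_
    simp)
  have b1 := hd.bddSmooth.hasDerivAt X
  have b2 := hd.bddSmooth.deriv.hasDerivAt X
  have a4 := (hasDerivAt_pos hdiff).unique (f₁' := -(2 * π ^ 2 * I ^ 2 * deriv d X / d X ^ 3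
      + 2 * ε * (p - ε * (I * deriv d X / d X * u)) * (I * u * ((deriv (deriv d) X * d X
        - deriv d X ^ 2) / d X ^ 2)))) (by
    have := (((b1.pow 2).fun_inv (pow_ne_zero 2 h1)).const_mul (π ^ 2 * I ^ 2)).add
      (((((((b2.const_mul I).fun_div b1 h1).mul_const u).const_mul ε).const_sub p).pow 2))
        |>.sub_const 1
    refine HasDerivAt.congr_deriv (f := fun z => hatH d ε (I, u, p, z)) this ?_
    simp; field_simp; ring)
  have c1 : DI (hatH d) ε (I, u, p, X) = _ := a1
  have c2 : DU (hatH d) ε (I, u, p, X) = _ := a2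
  have c3 : DP (hatH d) ε (I, u, p, X) = _ := a3
  have c4 : DX (hatH d) ε (I, u, p, X) = _ := a4
  simp only [hatVelocity, c1, c2, c3, c4]
  ext <;> simp <;> ring

section

variable {d : ℝ → ℝ} {ε T : ℝ} {x y px py : ℝ → ℝ}

/-- Straight flight is checked by direct computation against Hamilton's equations for `hatH`; no
general theory of canonical transformations is used. The derivative is taken within a set so that
the end points of the time interval are included. -/
theorem rayState_hasDeriv (hd : IsProfile d) {s : Set ℝ} {t : ℝ}
    (hx : HasDerivWithinAt x (2 * px t) s t) (hy : HasDerivWithinAt y (2 * py t) s t)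
    (hpx : HasDerivWithinAt px 0 s t) (hpy : HasDerivWithinAt py 0 s t) (h0 : py t ≠ 0) :
    HasDerivWithinAt (rayState d ε x y px py) (hatVelocity d ε (rayState d ε x y px py t)) s t := by
  have h1 := (hd.pos (ε * x t)).ne'
  have h2 : |py t| ≠ 0 := abs_ne_zero.2 h0
  have h3 := Real.pi_pos.ne'
  have hpos : 0 < (rayState d ε x y px py t).1 := by
    have := hd.pos (ε * x t)
    have := abs_pos.2 h0
    simp only [rayState, rayPoint]
    positivity
  have eX : HasDerivWithinAt (fun τ => ε * x τ) (ε * (2 * px t)) s t := hx.const_mul ε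
  have ed : HasDerivWithinAt (fun τ => d (ε * x τ)) (deriv d (ε * x t) * (ε * (2 * px t))) s t :=
    (hd.bddSmooth.hasDerivAt _).comp_hasDerivWithinAt t eX
  have ed' : HasDerivWithinAt (fun τ => deriv d (ε * x τ))
      (deriv (deriv d) (ε * x t) * (ε * (2 * px t))) s t :=
    (hd.bddSmooth.deriv.hasDerivAt _).comp_hasDerivWithinAt t eX
  have ea : HasDerivWithinAt (fun τ => |py τ|) 0 s t := by
    have := (hasDerivAt_abs h0).comp_hasDerivWithinAt t hpy
    simp only [mul_zero] at this
    exact this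
  have r1 := (ea.fun_mul ed).div_const π
  have r2 := (hpy.fun_div ea h2).fun_mul ((hy.const_mul π).fun_div ed h1)
  have r3 := hpx.fun_add (((ed'.fun_div ed h1).fun_mul (hpy.fun_mul hy)).const_mul ε)
  have r := r1.prodMk (r2.prodMk (r3.prodMk eX))
  refine HasDerivWithinAt.congr_deriv (f := rayState d ε x y px py) r ?_
  rw [hasDerivAt_hatH hd ε hpos]
  simp only [rayState, rayPoint]
  have e2 : |py t| * d (ε * x t) / π * deriv d (ε * x t) / d (ε * x t) *
      (py t / |py t| * (π * y t / d (ε * x t))) = deriv d (ε * x t) / d (ε * x t) * (py t * y t) := by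
    field_simp
  rw [e2, add_sub_cancel_right]
  have hs : |py t| ^ 2 = py t ^ 2 := sq_abs _
  ext
  · simp; field_simp
  · simp; field_simp; rw [hs]; ring
  · simp; left; field_simp; rw [hs]; ring
  · simp; ring

theorem eqOn_Icc_of_hasDerivAt {f : ℝ → ℝ} {a b α : ℝ}
    (hf : ContinuousOn f (Set.Icc a b)) (h : ∀ t ∈ Set.Ioo a b, HasDerivAt f α t) :
    ∀ t ∈ Set.Icc a b, f t = f a + α * (t - a) := by
  intro t ht
  rcases eq_or_lt_of_le ht.1 with e | e
  · simp [← e]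
  obtain ⟨c, -, hc⟩ := exists_hasDerivAt_eq_slope f (fun _ => α) e
    (hf.mono (Set.Icc_subset_Icc_right ht.2)) fun z hz => h z ⟨hz.1, hz.2.trans_le ht.2⟩
  rw [eq_div_iff (by linarith)] at hc
  linarith

theorem IsRay.mono (h : IsRay d ε T x y px py) {T' : ℝ} (hT : T' ≤ T) :
    IsRay d ε T' x y px py := by
  have hs : Set.Icc 0 T' ⊆ Set.Icc 0 T := Set.Icc_subset_Icc_right hT
  have hs' : Set.Ioo 0 T' ⊆ Set.Ioo 0 T := Set.Ioo_subset_Ioo_right hT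
  exact ⟨h.cont_x.mono hs, h.cont_y.mono hs, fun t ht => h.mem t (hs ht),
    h.finite_impacts.subset fun t ht => ⟨hs ht.1, ht.2⟩, fun t ht => h.energy t (hs ht),
    fun t ht hi => (h.flight_x t (hs ht) hi).mono hs, fun t ht hi => (h.flight_y t (hs ht) hi).mono hs,
    fun t ht hi => (h.flight_px t (hs ht) hi).mono hs,
    fun t ht hi => (h.flight_py t (hs ht) hi).mono hs,
    fun t ht => h.reflect_bottom t (hs' ht), fun t ht => h.reflect_top t (hs' ht)⟩

/-- The momenta are constant on the open interval, and also at an end point that is not on a wall;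
at an impact their values are irrelevant, while the positions extend by continuity. -/
theorem IsRay.flight (h : IsRay d ε T x y px py) {a b : ℝ} (hab : a < b)
    (hs : Set.Ioo a b ⊆ flightTimes d ε T x y) (hs' : Set.Icc a b ⊆ Set.Icc 0 T) :
    ∃ α β : ℝ, α ^ 2 + β ^ 2 = 1 ∧
      (∀ t ∈ Set.Icc a b, Inside d ε (x t) (y t) → px t = α ∧ py t = β) ∧
      (∀ t ∈ Set.Icc a b, x t = x a + 2 * α * (t - a) ∧ y t = y a + 2 * β * (t - a)) := by
  have nh : ∀ t ∈ Set.Ioo a b, Set.Icc 0 T ∈ 𝓝 t := fun t ht =>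
    Filter.mem_of_superset (Icc_mem_nhds ht.1 ht.2) hs'
  have const : ∀ p : ℝ → ℝ, (∀ t ∈ Set.Icc 0 T, Inside d ε (x t) (y t) →
      HasDerivWithinAt p 0 (Set.Icc 0 T) t) → ∀ t ∈ Set.Icc a b, Inside d ε (x t) (y t) →
        p t = p ((a + b) / 2) := by
    intro p hp
    have hd : ∀ t ∈ Set.Ioo a b, HasDerivAt p 0 t := fun t ht =>
      (hp t (hs ht).1 (hs ht).2).hasDerivAt (nh t ht)
    have hmid : (a + b) / 2 ∈ Set.Ioo a b := ⟨by linarith, by linarith⟩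
    have c0 : ∀ t ∈ Set.Ioo a b, p t = p ((a + b) / 2) := fun t ht =>
      isOpen_Ioo.is_const_of_deriv_eq_zero isPreconnected_Ioo
        (fun z hz => (hd z hz).differentiableAt.differentiableWithinAt)
        (fun z hz => (hd z hz).deriv) ht hmid
    intro t ht hi
    have hc : ContinuousWithinAt p (Set.Ioo a b) t :=
      (hp t (hs' ht) hi).continuousWithinAt.mono (Set.Ioo_subset_Icc_self.trans hs')
    have : (𝓝[Set.Ioo a b] t).NeBot := by
      rw [← mem_closure_iff_nhdsWithin_neBot, closure_Ioo hab.ne]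
      exact ht
    refine tendsto_nhds_unique hc (tendsto_const_nhds.congr' ?_)
    filter_upwards [self_mem_nhdsWithin] with z hz using (c0 z hz).symm
  have cx := const px h.flight_px
  have cy := const py h.flight_py
  have hmid : (a + b) / 2 ∈ Set.Ioo a b := ⟨by linarith, by linarith⟩
  refine ⟨px ((a + b) / 2), py ((a + b) / 2), ?_, fun t ht hi => ⟨cx t ht hi, cy t ht hi⟩,
    fun t ht => ⟨?_, ?_⟩⟩
  · have := h.energy _ (hs hmid).1 (hs hmid).2
    linarith
  · refine eqOn_Icc_of_hasDerivAt (h.cont_x.mono hs') (fun z hz => ?_) t ht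
    rw [← cx z (Set.Ioo_subset_Icc_self hz) (hs hz).2]
    exact (h.flight_x z (hs hz).1 (hs hz).2).hasDerivAt (nh z hz)
  · refine eqOn_Icc_of_hasDerivAt (h.cont_y.mono hs') (fun z hz => ?_) t ht
    rw [← cy z (Set.Ioo_subset_Icc_self hz) (hs hz).2]
    exact (h.flight_y z (hs hz).1 (hs hz).2).hasDerivAt (nh z hz)

theorem IsRay.exists_flight_left (h : IsRay d ε T x y px py) {τ : ℝ} (h0 : 0 < τ) (hT : τ ≤ T) :
    ∃ a, 0 < a ∧ a < τ ∧ Set.Ioo a τ ⊆ flightTimes d ε T x y := by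
  have h1 : ∀ᶠ t in 𝓝[<] τ, t ∉ impactTimes d ε T x y \ {τ} :=
    nhdsWithin_le_nhds ((h.finite_impacts.sdiff.isClosed.isOpen_compl).mem_nhds (by simp))
  have h2 : ∀ᶠ t in 𝓝[<] τ, t ∈ Set.Ioo (τ / 2) τ := Ioo_mem_nhdsLT (by linarith)
  obtain ⟨l, hl, hs⟩ := mem_nhdsLT_iff_exists_Ioo_subset.1 (h1.and h2)
  have hl : l < τ := hl
  refine ⟨max l (τ / 2), by positivity, max_lt hl (by linarith), fun t ht => ?_⟩
  obtain ⟨m1, m2⟩ := hs ⟨(le_max_left _ _).trans_lt ht.1, ht.2⟩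
  have ht' : t ∈ Set.Icc 0 T := ⟨by linarith [m2.1], by linarith [m2.2]⟩
  refine ⟨ht', ?_⟩
  by_contra hc
  exact m1 ⟨⟨ht', hc⟩, ne_of_lt m2.2⟩

theorem IsRay.exists_flight_right (h : IsRay d ε T x y px py) {τ : ℝ} (h0 : 0 ≤ τ) (hT : τ < T) :
    ∃ b, τ < b ∧ b < T ∧ Set.Ioo τ b ⊆ flightTimes d ε T x y := by
  have h1 : ∀ᶠ t in 𝓝[>] τ, t ∉ impactTimes d ε T x y \ {τ} :=
    nhdsWithin_le_nhds ((h.finite_impacts.sdiff.isClosed.isOpen_compl).mem_nhds (by simp))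
  have h2 : ∀ᶠ t in 𝓝[>] τ, t ∈ Set.Ioo τ ((τ + T) / 2) := Ioo_mem_nhdsGT (by linarith)
  obtain ⟨l, hl, hs⟩ := mem_nhdsGT_iff_exists_Ioo_subset.1 (h1.and h2)
  have hl : τ < l := hl
  refine ⟨min l ((τ + T) / 2), lt_min hl (by linarith), (min_le_right _ _).trans_lt (by linarith),
    fun t ht => ?_⟩
  obtain ⟨m1, m2⟩ := hs ⟨ht.1, ht.2.trans_le (min_le_left _ _)⟩
  have ht' : t ∈ Set.Icc 0 T := ⟨by linarith [m2.1], by linarith [m2.2]⟩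
  refine ⟨ht', ?_⟩
  by_contra hc
  exact m1 ⟨⟨ht', hc⟩, ne_of_gt m2.1⟩

theorem continuous_rayPoint (hd : IsProfile d) (ε α β : ℝ) :
    Continuous fun z : ℝ × ℝ => rayPoint d ε z.1 z.2 α β := by
  have c0 : Continuous fun z : ℝ × ℝ => d (ε * z.1) :=
    hd.bddSmooth.1.continuous.comp (by fun_prop)
  have c1 : Continuous fun z : ℝ × ℝ => deriv d (ε * z.1) :=
    hd.bddSmooth.deriv.1.continuous.comp (by fun_prop)
  have h0 : ∀ z : ℝ × ℝ, d (ε * z.1) ≠ 0 := fun z => (hd.pos _).ne'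
  exact ((c0.const_mul _).div_const _).prodMk
    ((((continuous_snd.const_mul π).div c0 h0).const_mul _).prodMk
    ((((c1.div c0 h0).mul (continuous_snd.const_mul β)).const_mul ε |>.const_add α).prodMk
      (continuous_fst.const_mul ε)))

end

/-! ### One-sided limits at the walls. -/

section

variable {d : ℝ → ℝ} {ε T : ℝ} {x y px py : ℝ → ℝ}

theorem deriv_nonpos_of_left_min {f : ℝ → ℝ} {D a τ : ℝ} (ha : a < τ) (hf : HasDerivAt f D τ)
    (h : ∀ t ∈ Set.Ioo a τ, f τ ≤ f t) : D ≤ 0 := by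
  have h1 := (hasDerivWithinAt_iff_tendsto_slope' (s := Set.Iio τ) (by simp)).1
    hf.hasDerivWithinAt
  refine le_of_tendsto h1 ?_
  filter_upwards [Ioo_mem_nhdsLT ha] with t ht
  rw [slope_def_field]
  exact div_nonpos_of_nonneg_of_nonpos (by linarith [h t ht]) (by linarith [ht.2])

/-- The two inequalities at the end say that a ray arriving at a wall moves towards it: otherwise it
would have been outside the waveguide just before. -/
theorem IsRay.left_limit (h : IsRay d ε T x y px py) (hd : IsProfile d) {τ : ℝ} (h0 : 0 < τ)
    (hT : τ ≤ T) : ∃ α β : ℝ, α ^ 2 + β ^ 2 = 1 ∧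
      (∀ᶠ t in 𝓝[<] τ, t ∈ flightTimes d ε T x y ∧ px t = α ∧ py t = β) ∧
      Filter.Tendsto (rayState d ε x y px py) (𝓝[<] τ) (𝓝 (rayPoint d ε (x τ) (y τ) α β)) ∧
      (y τ = 0 → β ≤ 0) ∧ (y τ = d (ε * x τ) → ε * deriv d (ε * x τ) * α ≤ β) := by
  obtain ⟨a, ha0, ha, hs⟩ := h.exists_flight_left h0 hT
  have hs' : Set.Icc a τ ⊆ Set.Icc 0 T := Set.Icc_subset_Icc ha0.le hT
  obtain ⟨α, β, e, hp, hxy⟩ := h.flight ha hs hs'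
  have ev : ∀ᶠ t in 𝓝[<] τ, t ∈ flightTimes d ε T x y ∧ px t = α ∧ py t = β := by
    filter_upwards [Ioo_mem_nhdsLT ha] with t ht
    exact ⟨hs ht, hp t (Set.Ioo_subset_Icc_self ht) (hs ht).2⟩
  have hτ : τ ∈ Set.Icc a τ := Set.right_mem_Icc.2 ha.le
  refine ⟨α, β, e, ev, ?_, fun hy => ?_, fun hy => ?_⟩
  · have c1 : Filter.Tendsto x (𝓝[<] τ) (𝓝 (x τ)) := by
      rw [← nhdsWithin_Ioo_eq_nhdsLT ha]
      exact (h.cont_x τ (hs' hτ)).mono (Set.Ioo_subset_Icc_self.trans hs')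
    have c2 : Filter.Tendsto y (𝓝[<] τ) (𝓝 (y τ)) := by
      rw [← nhdsWithin_Ioo_eq_nhdsLT ha]
      exact (h.cont_y τ (hs' hτ)).mono (Set.Ioo_subset_Icc_self.trans hs')
    refine (((continuous_rayPoint hd ε α β).tendsto (x τ, y τ)).comp
      (c1.prodMk_nhds c2)).congr' ?_
    filter_upwards [ev] with t ht
    simp only [Function.comp_apply, rayState, ht.2.1, ht.2.2]
  · have h1 := (hxy τ hτ).2
    have h2 := (h.mem a (hs' (Set.left_mem_Icc.2 ha.le))).1
    by_contra hc
    have : 0 < 2 * β * (τ - a) := by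
      have : 0 < τ - a := by linarith
      have : 0 < β := by linarith
      positivity
    linarith
  · set f : ℝ → ℝ := fun t => d (ε * (x a + 2 * α * (t - a))) - (y a + 2 * β * (t - a)) with hf
    have hx1 := (hxy τ hτ).1
    have hy1 := (hxy τ hτ).2
    have l1 : HasDerivAt (fun t => ε * (x a + 2 * α * (t - a))) (ε * (2 * α * 1)) τ :=
      ((((hasDerivAt_id τ).sub_const a).const_mul (2 * α)).const_add (x a)).const_mul ε
    have l2 : HasDerivAt (fun t => y a + 2 * β * (t - a)) (2 * β * 1) τ :=
      ((((hasDerivAt_id τ).sub_const a).const_mul (2 * β)).const_add (y a))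
    have l3 : HasDerivAt f (deriv d (ε * (x a + 2 * α * (τ - a))) * (ε * (2 * α * 1)) - 2 * β * 1) τ :=
      ((hd.bddSmooth.hasDerivAt _).comp τ l1).sub l2
    rw [← hx1] at l3
    have := deriv_nonpos_of_left_min ha l3 (fun t ht => by
      have ht' := Set.Ioo_subset_Icc_self ht
      simp only [hf]
      rw [← hx1, ← hy1, ← (hxy t ht').1, ← (hxy t ht').2, hy, sub_self]
      have := (h.mem t (hs' ht')).2
      linarith)
    linarith

theorem IsRay.right_limit (h : IsRay d ε T x y px py) (hd : IsProfile d) {τ : ℝ} (h0 : 0 ≤ τ)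
    (hT : τ < T) : ∃ α β : ℝ, α ^ 2 + β ^ 2 = 1 ∧
      (∀ᶠ t in 𝓝[>] τ, t ∈ flightTimes d ε T x y ∧ px t = α ∧ py t = β) ∧
      Filter.Tendsto (rayState d ε x y px py) (𝓝[>] τ) (𝓝 (rayPoint d ε (x τ) (y τ) α β)) := by
  obtain ⟨b, hb, hbT, hs⟩ := h.exists_flight_right h0 hT
  have hs' : Set.Icc τ b ⊆ Set.Icc 0 T := Set.Icc_subset_Icc h0 hbT.le
  obtain ⟨α, β, e, hp, hxy⟩ := h.flight hb hs hs'
  have ev : ∀ᶠ t in 𝓝[>] τ, t ∈ flightTimes d ε T x y ∧ px t = α ∧ py t = β := by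
    filter_upwards [Ioo_mem_nhdsGT hb] with t ht
    exact ⟨hs ht, hp t (Set.Ioo_subset_Icc_self ht) (hs ht).2⟩
  have hτ : τ ∈ Set.Icc τ b := Set.left_mem_Icc.2 hb.le
  refine ⟨α, β, e, ev, ?_⟩
  have c1 : Filter.Tendsto x (𝓝[>] τ) (𝓝 (x τ)) := by
    rw [← nhdsWithin_Ioo_eq_nhdsGT hb]
    exact (h.cont_x τ (hs' hτ)).mono (Set.Ioo_subset_Icc_self.trans hs')
  have c2 : Filter.Tendsto y (𝓝[>] τ) (𝓝 (y τ)) := by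
    rw [← nhdsWithin_Ioo_eq_nhdsGT hb]
    exact (h.cont_y τ (hs' hτ)).mono (Set.Ioo_subset_Icc_self.trans hs')
  refine (((continuous_rayPoint hd ε α β).tendsto (x τ, y τ)).comp
    (c1.prodMk_nhds c2)).congr' ?_
  filter_upwards [ev] with t ht
  simp only [Function.comp_apply, rayState, ht.2.1, ht.2.2]

theorem IsRay.wall (h : IsRay d ε T x y px py) {τ : ℝ} (hτ : τ ∈ impactTimes d ε T x y) :
    y τ = 0 ∨ y τ = d (ε * x τ) := by
  obtain ⟨h1, h2⟩ := h.mem τ hτ.1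
  by_contra hc
  push Not at hc
  exact hτ.2 ⟨lt_of_le_of_ne h1 (Ne.symm hc.1), lt_of_le_of_ne h2 hc.2⟩

/-- Solving the two laws of reflection gives `(1 + s ^ 2) v' = -v + s ^ 2 v + 2 s u`. A slope small
compared with `v` therefore reverses the sign of the vertical momentum and changes its modulus by
`O(s)`. -/
theorem elastic_reflection {u v u' v' s c₀ : ℝ} (h1 : u' + s * v' = u + s * v)
    (h2 : v' - s * u' = -(v - s * u)) (hu : |u| ≤ 1) (hv1 : |v| ≤ 1) (hs : 4 * |s| ≤ c₀)
    (hc : c₀ ≤ 1) (hc0 : 0 < c₀) (hv : c₀ ≤ v) : v' < 0 ∧ |(-v') - v| ≤ 4 * |s| := by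
  have hs1 : |s| ≤ 1 := by linarith [abs_nonneg s]
  have hs2 : s ^ 2 ≤ |s| := by
    rw [← sq_abs]; nlinarith [abs_nonneg s]
  have hsu : |s * u| ≤ |s| := by rw [abs_mul]; exact mul_le_of_le_one_right (abs_nonneg _) hu
  have e1 : v' * (1 + s ^ 2) = -v + s ^ 2 * v + 2 * (s * u) := by linear_combination h2 + s * h1
  have hv2 := (abs_le.1 hv1).2
  have hq : s ^ 2 * v ≤ |s| := (mul_le_of_le_one_right (sq_nonneg s) hv2).trans hs2
  have hq0 : 0 ≤ s ^ 2 * v := mul_nonneg (sq_nonneg s) (by linarith)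
  obtain ⟨a1, a2⟩ := abs_le.1 hsu
  have e2 : (-v' - v) * (1 + s ^ 2) = -(2 * (s ^ 2 * v)) - 2 * (s * u) := by
    linear_combination -e1
  refine ⟨?_, ?_⟩
  · by_contra hc'
    have : 0 ≤ v' * (1 + s ^ 2) := mul_nonneg (not_lt.1 hc') (by positivity)
    linarith
  · have : |(-v' - v)| * (1 + s ^ 2) ≤ 4 * |s| := by
      rw [← abs_of_pos (by positivity : 0 < 1 + s ^ 2), ← abs_mul, e2]
      exact abs_le.2 ⟨by linarith, by linarith⟩
    exact (le_mul_of_one_le_right (abs_nonneg _) (by linarith [sq_nonneg s])).trans this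

theorem abs_le_one_of_sq {α β : ℝ} (h : α ^ 2 + β ^ 2 = 1) : |α| ≤ 1 ∧ |β| ≤ 1 :=
  ⟨(sq_le_one_iff_abs_le_one α).1 (by linarith [sq_nonneg β]),
    (sq_le_one_iff_abs_le_one β).1 (by linarith [sq_nonneg α])⟩

/-- The one-sided limits of the action-angle variables at a reflection. -/
theorem IsRay.impact (h : IsRay d ε T x y px py) (hd : IsProfile d) {D₁ c₀ : ℝ} (hε : 0 < ε)
    (hD₁ : ∀ X, |deriv d X| ≤ D₁) (hc0 : 0 < c₀) (hc1 : c₀ ≤ 1) (hsmall : 4 * (ε * D₁) ≤ c₀)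
    {τ : ℝ} (hτ : τ ∈ impactTimes d ε T x y) (h0 : 0 < τ)
    (hfast : ∀ t ∈ flightTimes d ε T x y, t < τ → c₀ ≤ |py t|) :
    ∃ v : PS, Filter.Tendsto (rayState d ε x y px py) (𝓝[<] τ) (𝓝 v) ∧
      (y τ = 0 → v.2.1 = 0) ∧ (y τ = d (ε * x τ) → v.2.1 = π) ∧ (τ < T → 
      ∃ w : PS, Filter.Tendsto (rayState d ε x y px py) (𝓝[>] τ) (𝓝 w) ∧ v.2.2 = w.2.2 ∧
        (y τ = 0 → v = w) ∧ (y τ = d (ε * x τ) → w.2.1 = -π) ∧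
        ∃ β β' : ℝ, (∀ᶠ t in 𝓝[<] τ, t ∈ flightTimes d ε T x y ∧ py t = β) ∧
          (∀ᶠ t in 𝓝[>] τ, t ∈ flightTimes d ε T x y ∧ py t = β') ∧
            |(|β'| - |β|)| ≤ 4 * (ε * D₁)) := by
  obtain ⟨α, β, e, ev, lim, hb, ht⟩ := h.left_limit hd h0 hτ.1.2
  obtain ⟨t₀, ⟨m0, m1, m2⟩, m3⟩ := (ev.and self_mem_nhdsWithin).exists
  have hβ : c₀ ≤ |β| := m2 ▸ hfast t₀ m0 m3
  obtain ⟨hα1, hβ1⟩ := abs_le_one_of_sq e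
  have hpi := Real.pi_pos
  have hdX := hd.pos (ε * x τ)
  set s := ε * deriv d (ε * x τ) with hs
  have hsD : |s| ≤ ε * D₁ := by
    rw [hs, abs_mul, abs_of_pos hε]; exact mul_le_mul_of_nonneg_left (hD₁ _) hε.le
  have hsα : |s * α| ≤ ε * D₁ := by
    rw [abs_mul]; exact (mul_le_of_le_one_right (abs_nonneg _) hα1).trans hsD
  -- A ray that meets the upper wall has `β ≥ s α ≥ -c₀ / 4`; together with `|β| ≥ c₀` this excludes
  -- negative `β`, and in particular grazing incidence.
  have tpos : y τ = d (ε * x τ) → c₀ ≤ β := fun hy => by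
    have h1 := ht hy
    rcases le_or_gt 0 β with h2 | h2
    · rwa [abs_of_nonneg h2] at hβ
    · rw [abs_of_neg h2] at hβ
      have := (abs_le.1 hsα).1
      linarith
  refine ⟨_, lim, fun hy => by simp [rayPoint, hy], fun hy => ?_, fun hT => ?_⟩
  · have hp : 0 < β := hc0.trans_le (tpos hy)
    simp only [rayPoint, hy, abs_of_pos hp]
    field_simp
  obtain ⟨α', β', e', ev', lim'⟩ := h.right_limit hd h0.le hT
  have tl1 : Filter.Tendsto px (𝓝[<] τ) (𝓝 α) :=
    tendsto_const_nhds.congr' (ev.mono fun t ht => ht.2.1.symm)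
  have tl2 : Filter.Tendsto py (𝓝[<] τ) (𝓝 β) :=
    tendsto_const_nhds.congr' (ev.mono fun t ht => ht.2.2.symm)
  have tr1 : Filter.Tendsto px (𝓝[>] τ) (𝓝 α') :=
    tendsto_const_nhds.congr' (ev'.mono fun t ht => ht.2.1.symm)
  have tr2 : Filter.Tendsto py (𝓝[>] τ) (𝓝 β') :=
    tendsto_const_nhds.congr' (ev'.mono fun t ht => ht.2.2.symm)
  have hτ' : τ ∈ Set.Ioo 0 T := ⟨h0, hT⟩
  refine ⟨_, lim', ?_⟩
  rcases h.wall hτ with hy | hy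
  · obtain ⟨u, v, r1, r2, r3, r4⟩ := h.reflect_bottom τ hτ' hy
    have q1 : α' = α := tendsto_nhds_unique tr1 (tendsto_nhds_unique r1 tl1 ▸ r3)
    have q2 : β' = -β := tendsto_nhds_unique tr2 (tendsto_nhds_unique r2 tl2 ▸ r4)
    subst q1 q2
    refine ⟨by simp [rayPoint, hy], fun _ => by simp [rayPoint, hy], fun hy' => ?_,
      β, -β, ev.mono fun t ht => ⟨ht.1, ht.2.2⟩, ev'.mono fun t ht => ⟨ht.1, ht.2.2⟩, ?_⟩
    · rw [hy] at hy'
      exact absurd hy' hdX.ne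
    · rw [abs_neg, sub_self, abs_zero]
      linarith [abs_nonneg s]
  · obtain ⟨u, v, u', v', r1, r2, r3, r4, r5, r6⟩ := h.reflect_top τ hτ' hy
    have q1 := tendsto_nhds_unique r1 tl1
    have q2 := tendsto_nhds_unique r2 tl2
    have q3 := tendsto_nhds_unique r3 tr1
    have q4 := tendsto_nhds_unique r4 tr2
    subst q1 q2 q3 q4
    have hv := tpos hy
    obtain ⟨n1, n2⟩ := elastic_reflection r5 r6 hα1 hβ1 (by linarith) hc1 hc0 hv
    refine ⟨?_, fun hy' => ?_, fun _ => ?_, v, v', ev.mono fun t ht => ⟨ht.1, ht.2.2⟩,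
      ev'.mono fun t ht => ⟨ht.1, ht.2.2⟩, ?_⟩
    -- At `y = d` the momentum conjugate to `x` is `px + s py`, the tangential component that an
    -- elastic reflection preserves.
    · simp only [rayPoint, hy, Prod.mk.injEq, and_true]
      have key : ∀ z, deriv d (ε * x τ) / d (ε * x τ) * (z * d (ε * x τ))
          = deriv d (ε * x τ) * z := fun z => by field_simp
      rw [key, key]
      linarith
    · rw [hy] at hy'
      exact absurd hy' hdX.ne'
    · simp only [rayPoint, hy, abs_of_neg n1]
      field_simp
      rw [div_self n1.ne]
    · rw [abs_of_neg n1, abs_of_pos (hc0.trans_le hv)]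
      linarith

theorem rayPoint_mem_slab (hd : IsProfile d) {c₀ : ℝ} (hc0 : 0 < c₀) :
    ∃ M : ℝ, 1 ≤ M ∧ ∀ ε x y α β : ℝ, 0 < ε → ε ≤ 1 → 0 ≤ y → y ≤ d (ε * x) →
      α ^ 2 + β ^ 2 = 1 → c₀ ≤ |β| → rayPoint d ε x y α β ∈ Slab M := by
  obtain ⟨m, hm, hmd⟩ := hd.width_pos
  obtain ⟨D, hD0, hD⟩ := hd.bddSmooth.bound
  obtain ⟨D₁, hD10, hD₁⟩ := hd.bddSmooth.deriv.bound
  have hpi := Real.pi_gt_three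
  have hp4 := Real.pi_le_four
  have hpp := Real.pi_pos
  -- The summands bound in turn `1 / I`, `I`, `|u| ≤ π`, and the correction to the horizontal
  -- momentum.
  refine ⟨π / (c₀ * m) + D + 4 + D₁, by linarith [show 0 < π / (c₀ * m) by positivity], ?_⟩
  intro ε x y α β h0 h1 hy0 hy1 e hβ
  have hq : 0 < π / (c₀ * m) := by positivity
  have hdX := hd.pos (ε * x)
  obtain ⟨a1, a2⟩ := abs_le_one_of_sq e
  have hβ0 : 0 < |β| := hc0.trans_le hβ
  have hyd : y / d (ε * x) ≤ 1 := by rwa [div_le_one hdX]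
  have hyd0 : 0 ≤ y / d (ε * x) := by positivity
  refine ⟨?_, ?_, ?_, ?_⟩
  · calc (π / (c₀ * m) + D + 4 + D₁)⁻¹ ≤ (π / (c₀ * m))⁻¹ := inv_anti₀ hq (by linarith)
      _ = c₀ * m / π := inv_div _ _
      _ ≤ |β| * d (ε * x) / π := by gcongr; exact hmd _
  · have : d (ε * x) ≤ D := (le_abs_self _).trans (hD _)
    have h2 : |β| * d (ε * x) / π ≤ d (ε * x) := by
      rw [div_le_iff₀ hpp]
      have := mul_le_of_le_one_left hdX.le a2
      have : d (ε * x) ≤ d (ε * x) * π := le_mul_of_one_le_right hdX.le (by linarith)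
      linarith
    simp only [rayPoint]
    linarith
  · simp only [rayPoint]
    rw [abs_mul, abs_div, abs_abs, div_self hβ0.ne', one_mul, mul_div_assoc, abs_mul,
      abs_of_pos hpp, abs_of_nonneg hyd0]
    have : π * (y / d (ε * x)) ≤ π := mul_le_of_le_one_right hpp.le hyd
    linarith
  · simp only [rayPoint]
    have e1 : deriv d (ε * x) / d (ε * x) * (β * y) = deriv d (ε * x) * β * (y / d (ε * x)) := by
      field_simp
    have e2 : |ε * (deriv d (ε * x) * β * (y / d (ε * x)))| ≤ D₁ := by
      rw [abs_mul, abs_mul, abs_mul, abs_of_pos h0, abs_of_nonneg hyd0]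
      calc ε * (|deriv d (ε * x)| * |β| * (y / d (ε * x))) ≤ 1 * (D₁ * 1 * 1) := by
            gcongr
            exact hD₁ _
        _ = D₁ := by ring
    rw [e1]
    have := abs_add_le α (ε * (deriv d (ε * x) * β * (y / d (ε * x))))
    linarith

end

/-! ### Piecewise smooth functions -/

/-- Cells of length `ρ` contain at most one point each: `⌊(τ - s) / ρ⌋` is injective on the set. -/
theorem ncard_le_of_separated {s t ρ : ℝ} (hρ : 0 < ρ) (hst : s ≤ t) {F : Set ℝ}
    (hF : F ⊆ Set.Icc s t)
    (hsep : ∀ τ ∈ F, ∀ τ' ∈ F, τ < τ' → ρ ≤ τ' - τ) : (F.ncard : ℝ) ≤ 1 + (t - s) / ρ := by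
  have key : F.ncard ≤ (Set.Iic ⌊(t - s) / ρ⌋₊).ncard := by
    refine Set.ncard_le_ncard_of_injOn (fun τ => ⌊(τ - s) / ρ⌋₊) (fun τ hτ => ?_) ?_
      (Set.finite_Iic _)
    · obtain ⟨_, h2⟩ := hF hτ
      exact Nat.floor_le_floor (by gcongr)
    · have main : ∀ a ∈ F, ∀ b ∈ F, a < b → ⌊(a - s) / ρ⌋₊ ≠ ⌊(b - s) / ρ⌋₊ := by
        intro a ha b hb hab h
        have h1 := hsep a ha b hb hab
        have ha0 : 0 ≤ (a - s) / ρ := div_nonneg (by linarith [(hF ha).1]) hρ.le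
        have h2 := Nat.floor_le ha0
        have h3 := Nat.lt_floor_add_one ((b - s) / ρ)
        rw [← h] at h3
        have h4 : (b - s) / ρ < (a - s) / ρ + 1 := by linarith
        have h5 : (a - s) / ρ + 1 = (a - s + ρ) / ρ := by field_simp
        rw [h5, div_lt_div_iff_of_pos_right hρ] at h4
        linarith
      intro a ha b hb h
      rcases lt_trichotomy a b with h1 | h1 | h1
      · exact absurd h (main a ha b hb h1)
      · exact h1
      · exact absurd h.symm (main b hb a ha h1)
  have h2 : (Set.Iic ⌊(t - s) / ρ⌋₊).ncard = ⌊(t - s) / ρ⌋₊ + 1 := by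
    rw [← Nat.card_coe_set_eq]; simp
  rw [h2] at key
  have h3 := Nat.floor_le (div_nonneg (by linarith : 0 ≤ t - s) hρ.le)
  calc (F.ncard : ℝ) ≤ ((⌊(t - s) / ρ⌋₊ + 1 : ℕ) : ℝ) := by exact_mod_cast key
    _ ≤ _ := by push_cast; linarith

/-- Induction on the number of jumps, splitting at the last one. The induction hypothesis is applied
at times slightly before that jump, where there are fewer jumps, and passed to the limit; after it
the mean value inequality applies. -/
theorem piecewise_drift_ncard {E : Type*} [NormedAddCommGroup E] [NormedSpace ℝ E] {G : Set ℝ}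
    {A B : ℝ} {g : ℝ → E} {s t : ℝ} (hs : s ∈ G) (ht : t ∈ G) (hst : s ≤ t)
    (hfin : (Set.Ioo s t \ G).Finite)
    (hg : ∀ z ∈ Set.Icc s t ∩ G, ∃ g', HasDerivWithinAt g g' G z ∧ ‖g'‖ ≤ A)
    (hj : ∀ τ ∈ Set.Ioo s t \ G, ∃ l l', Filter.Tendsto g (𝓝[<] τ) (𝓝 l) ∧
      Filter.Tendsto g (𝓝[>] τ) (𝓝 l') ∧ ‖l' - l‖ ≤ B) :
    ‖g t - g s‖ ≤ A * (t - s) + B * (Set.Ioo s t \ G).ncard := by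
  have hA : 0 ≤ A := by
    obtain ⟨g', -, h⟩ := hg s ⟨Set.left_mem_Icc.2 hst, hs⟩
    exact (norm_nonneg _).trans h
  induction hn : (Set.Ioo s t \ G).ncard using Nat.strong_induction_on generalizing t with
  | _ n ih =>
    have smooth : ∀ a ∈ Set.Icc s t, ∀ b ∈ Set.Icc s t, a ≤ b → Set.Icc a b ⊆ G →
        ‖g b - g a‖ ≤ A * (b - a) := by
      intro a ha b hb hab hG
      rcases eq_or_lt_of_le hab with e | e
      · simp [e]
      have := Convex.norm_image_sub_le_of_norm_hasDerivWithin_le (f := g) (s := Set.Icc a b)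
        (f' := fun z => derivWithin g (Set.Icc a b) z) (C := A) (x := a) (y := b) ?_ ?_
        (convex_Icc a b) (Set.left_mem_Icc.2 hab) (Set.right_mem_Icc.2 hab)
      · rwa [Real.norm_eq_abs, abs_of_nonneg (by linarith)] at this
      · intro z hz
        obtain ⟨g', h1, -⟩ := hg z ⟨⟨ha.1.trans hz.1, hz.2.trans hb.2⟩, hG hz⟩
        exact (h1.mono hG).differentiableWithinAt.hasDerivWithinAt
      · intro z hz
        obtain ⟨g', h1, h2⟩ := hg z ⟨⟨ha.1.trans hz.1, hz.2.trans hb.2⟩, hG hz⟩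
        rw [(h1.mono hG).derivWithin (uniqueDiffOn_Icc e z hz)]
        exact h2
    rcases Set.eq_empty_or_nonempty (Set.Ioo s t \ G) with he | hne
    · have hn0 : n = 0 := by rw [← hn, he, Set.ncard_empty]
      rw [hn0, Nat.cast_zero, mul_zero, add_zero]
      refine smooth s (Set.left_mem_Icc.2 hst) t (Set.right_mem_Icc.2 hst) hst fun z hz => ?_
      rcases eq_or_lt_of_le hz.1 with e1 | e1
      · exact e1 ▸ hs
      rcases eq_or_lt_of_le hz.2 with e2 | e2
      · exact e2 ▸ ht
      by_contra hc
      exact Set.notMem_empty z (he ▸ ⟨⟨e1, e2⟩, hc⟩)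
    · obtain ⟨τ, hτ, hmax⟩ := Set.exists_max_image _ id hfin hne
      simp only [id] at hmax
      obtain ⟨l, l', t1, t2, hl⟩ := hj τ hτ
      obtain ⟨⟨hτs, hτt⟩, hτG⟩ := hτ
      have hB : 0 ≤ B := (norm_nonneg _).trans hl
      have evG : ∀ᶠ z in 𝓝[<] τ, z ∈ Set.Ioo s τ ∧ z ∈ G := by
        have h1 : ∀ᶠ z in 𝓝[<] τ, z ∉ (Set.Ioo s t \ G) \ {τ} :=
          nhdsWithin_le_nhds ((hfin.sdiff.isClosed.isOpen_compl).mem_nhds (by simp))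
        filter_upwards [h1, Ioo_mem_nhdsLT hτs] with z hz hz'
        refine ⟨hz', ?_⟩
        by_contra hc
        exact hz ⟨⟨⟨hz'.1, hz'.2.trans hτt⟩, hc⟩, ne_of_lt hz'.2⟩
      have b1 : ‖l - g s‖ ≤ A * (τ - s) + B * (n - 1) := by
        refine le_of_tendsto (t1.sub_const (g s)).norm ?_
        filter_upwards [evG] with z hz
        have hsub : Set.Ioo s z \ G ⊆ Set.Ioo s t \ G := fun w hw =>
          ⟨⟨hw.1.1, hw.1.2.trans (hz.1.2.trans hτt)⟩, hw.2⟩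
        have hlt : (Set.Ioo s z \ G).ncard < n := by
          rw [← hn]
          refine Set.ncard_lt_ncard ⟨hsub, fun hc => ?_⟩ hfin
          have h1 : τ ∈ Set.Ioo s z \ G := hc ⟨⟨hτs, hτt⟩, hτG⟩
          exact absurd h1.1.2 (not_lt.2 hz.1.2.le)
        have := ih _ hlt hz.2 hz.1.1.le (hfin.subset hsub)
          (fun w hw => hg w ⟨⟨hw.1.1, hw.1.2.trans (hz.1.2.trans hτt).le⟩, hw.2⟩)
          (fun w hw => hj w (hsub hw)) rfl
        refine this.trans ?_
        have h3 : ((Set.Ioo s z \ G).ncard : ℝ) ≤ n - 1 := by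
          have : ((Set.Ioo s z \ G).ncard : ℝ) + 1 ≤ n := by exact_mod_cast hlt
          linarith
        have := hz.1.2.le
        gcongr
      have b2 : ‖g t - l'‖ ≤ A * (t - τ) := by
        refine le_of_tendsto (t2.const_sub (g t)).norm ?_
        filter_upwards [Ioo_mem_nhdsGT hτt] with z hz
        have h1 := smooth z ⟨(hτs.trans hz.1).le, hz.2.le⟩ t (Set.right_mem_Icc.2 hst) hz.2.le
          (fun w hw => by
            rcases eq_or_lt_of_le hw.2 with e2 | e2
            · exact e2 ▸ ht
            by_contra hc
            have := hmax w ⟨⟨hτs.trans (hz.1.trans_le hw.1), e2⟩, hc⟩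
            linarith [hz.1, hw.1])
        refine h1.trans ?_
        have := hz.1.le
        gcongr
      calc ‖g t - g s‖ = ‖(g t - l') + (l' - l) + (l - g s)‖ := by congr 1; abel
        _ ≤ ‖g t - l'‖ + ‖l' - l‖ + ‖l - g s‖ := norm_add₃_le
        _ ≤ A * (t - τ) + B + (A * (τ - s) + B * (n - 1)) := by gcongr
        _ = _ := by ring

theorem piecewise_drift {E : Type*} [NormedAddCommGroup E] [NormedSpace ℝ E] {G : Set ℝ}
    {A B ρ : ℝ} {g : ℝ → E} {s t : ℝ} (hs : s ∈ G) (ht : t ∈ G) (hst : s ≤ t)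
    (hfin : (Set.Ioo s t \ G).Finite) (hB : 0 ≤ B) (hρ : 0 < ρ)
    (hsep : ∀ τ ∈ Set.Ioo s t \ G, ∀ τ' ∈ Set.Ioo s t \ G, τ < τ' → ρ ≤ τ' - τ)
    (hg : ∀ z ∈ Set.Icc s t ∩ G, ∃ g', HasDerivWithinAt g g' G z ∧ ‖g'‖ ≤ A)
    (hj : ∀ τ ∈ Set.Ioo s t \ G, ∃ l l', Filter.Tendsto g (𝓝[<] τ) (𝓝 l) ∧
      Filter.Tendsto g (𝓝[>] τ) (𝓝 l') ∧ ‖l' - l‖ ≤ B) :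
    ‖g t - g s‖ ≤ A * (t - s) + B * (1 + (t - s) / ρ) :=
  (piecewise_drift_ncard hs ht hst hfin hg hj).trans (by
    gcongr
    exact ncard_le_of_separated hρ hst (fun τ hτ => ⟨hτ.1.1.le, hτ.1.2.le⟩) hsep)

/-- A motion with the Hamiltonian `hatH` on its zero level that is interrupted by finitely many
reflections. -/
structure HybridMotion (d : ℝ → ℝ) (ε T M ρ : ℝ) (G : Set ℝ) (γ : ℝ → PS) : Prop where
  sub : G ⊆ Set.Icc 0 T
  start : 0 ∈ G
  finite : (Set.Icc 0 T \ G).Finite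
  slab : ∀ t ∈ G, γ t ∈ Slab M
  energy : ∀ t ∈ G, hatH d ε (γ t) = 0
  velocity : ∀ t ∈ G, HasDerivWithinAt γ (hatVelocity d ε (γ t)) G t
  jump : ∀ τ ∈ Set.Ioo 0 T \ G, ∃ v w : PS, Filter.Tendsto γ (𝓝[<] τ) (𝓝 v) ∧
    Filter.Tendsto γ (𝓝[>] τ) (𝓝 w) ∧ (v = w ∨ (v.2.1 = π ∧ w.2.1 = -π ∧ v.2.2 = w.2.2))
  sep : ∀ τ ∈ Set.Icc 0 T \ G, ∀ τ' ∈ Set.Icc 0 T \ G, τ < τ' → ρ ≤ τ' - τ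

/-! ### Rays as hybrid motions. -/

section

variable {d : ℝ → ℝ} {ε T : ℝ} {x y px py : ℝ → ℝ}

theorem sdiff_flightTimes : Set.Icc 0 T \ flightTimes d ε T x y = impactTimes d ε T x y := by
  ext t
  simp only [flightTimes, impactTimes, Set.mem_sdiff, Set.mem_ofPred_eq]
  tauto

/-- Consider consecutive impacts. Between opposite walls the ray climbs at least `m` with vertical
speed at most `2`. Two consecutive impacts at the bottom would need zero vertical speed. Between two
at the top the height of the wall would change by at most `2 ε D₁` per unit of time, less than the
ray's vertical speed `2 |py| ≥ 2 c₀`. -/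
theorem IsRay.separation (h : IsRay d ε T x y px py) {m D₁ c₀ : ℝ} (hε : 0 < ε)
    (hm : ∀ X, m ≤ d X) (hd : IsProfile d)
    (hD₁ : ∀ X, |deriv d X| ≤ D₁) (hc0 : 0 < c₀) (hsmall : ε * D₁ < c₀)
    (hfast : ∀ t ∈ flightTimes d ε T x y, c₀ ≤ |py t|) :
    ∀ τ ∈ impactTimes d ε T x y, ∀ τ' ∈ impactTimes d ε T x y, τ < τ' → m / 2 ≤ τ' - τ := by
  have cons : ∀ τ ∈ impactTimes d ε T x y, ∀ τ' ∈ impactTimes d ε T x y, τ < τ' →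
      Set.Ioo τ τ' ⊆ flightTimes d ε T x y → m / 2 ≤ τ' - τ := by
    intro τ hτ τ' hτ' hlt hs
    obtain ⟨α, β, e, hp, hxy⟩ := h.flight hlt hs (Set.Icc_subset_Icc hτ.1.1 hτ'.1.2)
    obtain ⟨a1, a2⟩ := abs_le_one_of_sq e
    have hmid : (τ + τ') / 2 ∈ Set.Ioo τ τ' := ⟨by linarith, by linarith⟩
    have hβ : c₀ ≤ |β| := by
      rw [← (hp _ (Set.Ioo_subset_Icc_self hmid) (hs hmid).2).2]
      exact hfast _ (hs hmid)
    obtain ⟨ex, ey⟩ := hxy τ' (Set.right_mem_Icc.2 hlt.le)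
    have hpos : 0 < τ' - τ := by linarith
    have dist : |y τ' - y τ| = 2 * |β| * (τ' - τ) := by
      rw [ey, add_sub_cancel_left, abs_mul, abs_mul, abs_two, abs_of_pos hpos]
    have far : m ≤ |y τ' - y τ| → m / 2 ≤ τ' - τ := fun hf => by
      rw [dist] at hf
      have : |β| * (τ' - τ) ≤ τ' - τ := mul_le_of_le_one_left hpos.le a2
      linarith
    rcases h.wall hτ with h1 | h1 <;> rcases h.wall hτ' with h2 | h2
    · rw [h1, h2, sub_self, abs_zero] at dist
      have : 0 < 2 * |β| * (τ' - τ) := by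
        have : 0 < |β| := hc0.trans_le hβ
        positivity
      linarith
    · refine far ?_
      rw [h1, h2, sub_zero]
      exact (hm _).trans (le_abs_self _)
    · refine far ?_
      rw [h1, h2, zero_sub, abs_neg]
      exact (hm _).trans (le_abs_self _)
    · have hl : |d (ε * x τ') - d (ε * x τ)| ≤ D₁ * |ε * x τ' - ε * x τ| :=
        Convex.norm_image_sub_le_of_norm_deriv_le (f := d) (s := Set.univ)
          (fun z _ => hd.bddSmooth.differentiable z) (fun z _ => hD₁ z) convex_univ
          (Set.mem_univ _) (Set.mem_univ _)
      rw [← h1, ← h2, dist, ex, ← mul_sub, add_sub_cancel_left, abs_mul, abs_mul, abs_mul, abs_two,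
        abs_of_pos hpos, abs_of_pos hε] at hl
      have hD0 : 0 ≤ D₁ := (abs_nonneg _).trans (hD₁ 0)
      have : D₁ * (ε * (2 * |α| * (τ' - τ))) ≤ ε * D₁ * (2 * (τ' - τ)) := by
        have : D₁ * (ε * (2 * |α| * (τ' - τ))) = ε * D₁ * (2 * (τ' - τ)) * |α| := by ring
        rw [this]
        exact mul_le_of_le_one_right (by positivity) a1
      have h5 : ε * D₁ * (2 * (τ' - τ)) < c₀ * (2 * (τ' - τ)) := by gcongr
      have h6 : c₀ * (2 * (τ' - τ)) ≤ |β| * (2 * (τ' - τ)) := by gcongr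
      linarith
  intro τ hτ τ' hτ' hlt
  obtain ⟨σ, ⟨hσ, hσ'⟩, hmax⟩ := Set.exists_max_image
    (impactTimes d ε T x y ∩ Set.Ico τ τ') id (h.finite_impacts.inter_of_left _)
    ⟨τ, hτ, le_rfl, hlt⟩
  simp only [id] at hmax
  have := cons σ hσ τ' hτ' hσ'.2 (fun t ht => by
    have ht' : t ∈ Set.Icc 0 T := ⟨hσ.1.1.trans ht.1.le, ht.2.le.trans hτ'.1.2⟩
    refine ⟨ht', ?_⟩
    by_contra hc
    have := hmax t ⟨⟨ht', hc⟩, hσ'.1.trans ht.1.le, ht.2⟩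
    linarith [ht.1])
  linarith [hσ'.1]

/-- In action-angle variables a reflection off the bottom is no event, as both limits coincide; one
off the top sends `u` from `π` to `-π`, keeps `p` and `X`, and may change the action. -/
theorem IsRay.hybridMotion (hd : IsProfile d) {c₀ : ℝ} (hc0 : 0 < c₀) (hc1 : c₀ ≤ 1) :
    ∃ M ρ ε₀ : ℝ, 1 ≤ M ∧ 0 < ρ ∧ 0 < ε₀ ∧ ∀ ε T : ℝ, 0 < ε → ε < ε₀ → ∀ x y px py : ℝ → ℝ,
      IsRay d ε T x y px py → 0 ∈ flightTimes d ε T x y →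
      (∀ t ∈ flightTimes d ε T x y, c₀ ≤ |py t|) →
      HybridMotion d ε T M ρ (flightTimes d ε T x y) (rayState d ε x y px py) := by
  obtain ⟨M, hM, hslab⟩ := rayPoint_mem_slab hd hc0
  obtain ⟨m, hm0, hm⟩ := hd.width_pos
  obtain ⟨D₁, hD0, hD₁⟩ := hd.bddSmooth.deriv.bound
  refine ⟨M, m / 2, min 1 (c₀ / (4 * (D₁ + 1))), hM, by positivity, by positivity, ?_⟩
  intro ε T h0 h1 x y px py hr hst hfast
  have l1 : ε < 1 := h1.trans_le (min_le_left _ _)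
  have l2 : ε < c₀ / (4 * (D₁ + 1)) := h1.trans_le (min_le_right _ _)
  rw [lt_div_iff₀ (by positivity)] at l2
  have e2 : ∀ t ∈ flightTimes d ε T x y, px t ^ 2 + py t ^ 2 = 1 := fun t ht => by
    linarith [hr.energy t ht.1 ht.2]
  have hne : ∀ t ∈ flightTimes d ε T x y, py t ≠ 0 := fun t ht =>
    abs_pos.1 (hc0.trans_le (hfast t ht))
  have hsub : flightTimes d ε T x y ⊆ Set.Icc 0 T := fun t ht => ht.1
  refine ⟨hsub, hst, ?_, fun t ht => ?_, fun t ht => ?_, fun t ht => ?_, fun τ hτ => ?_, ?_⟩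
  · rw [sdiff_flightTimes]; exact hr.finite_impacts
  · exact hslab ε _ _ _ _ h0 l1.le ht.2.1.le ht.2.2.le (e2 t ht) (hfast t ht)
  · rw [rayState, hatH_rayPoint hd _ _ _ _ (hne t ht)]
    linarith [e2 t ht]
  · exact rayState_hasDeriv hd ((hr.flight_x t ht.1 ht.2).mono hsub)
      ((hr.flight_y t ht.1 ht.2).mono hsub) ((hr.flight_px t ht.1 ht.2).mono hsub)
      ((hr.flight_py t ht.1 ht.2).mono hsub) (hne t ht)
  · have hτ' : τ ∈ impactTimes d ε T x y := by
      rw [← sdiff_flightTimes]; exact ⟨Set.Ioo_subset_Icc_self hτ.1, hτ.2⟩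
    obtain ⟨v, lv, -, a2, a3⟩ := hr.impact hd h0 hD₁ hc0 hc1 (by linarith) hτ' hτ.1.1
      (fun t ht _ => hfast t ht)
    obtain ⟨w, lw, b1, b2, b3, -⟩ := a3 hτ.1.2
    refine ⟨v, w, lv, lw, ?_⟩
    rcases hr.wall hτ' with hy | hy
    · exact Or.inl (b2 hy)
    · exact Or.inr ⟨a2 hy, b3 hy, b1⟩
  · rw [sdiff_flightTimes]
    exact hr.separation h0 hm hd hD₁ hc0 (by linarith) hfast

end

/-! ### Shadowing in a Hamiltonian system with one degree of freedom -/

/-- Bounds for a Hamiltonian vector field `V` with Hamiltonian `K` in the plane and for the velocity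
`W` of the phase. -/
structure PlaneField (D : Set (ℝ × ℝ)) (V : ℝ × ℝ → ℝ × ℝ) (K W : ℝ × ℝ → ℝ) (B Λ : ℝ) : Prop where
  field_le : ∀ z ∈ D, ‖V z‖ ≤ B
  field_lip : ∀ z ∈ D, ∀ w ∈ D, ‖V z - V w‖ ≤ Λ * ‖z - w‖
  phase_le : ∀ z ∈ D, ‖W z‖ ≤ B
  phase_lip : ∀ z ∈ D, ∀ w ∈ D, ‖W z - W w‖ ≤ Λ * ‖z - w‖
  taylor : ∀ z ∈ D, ∀ w ∈ D,
    |K w - K z - ((V z).2 * (w - z).1 - (V z).1 * (w - z).2)| ≤ Λ * ‖w - z‖ ^ 2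

/-- An orbit of the slow system on a level close to zero, with its phase. -/
structure PlaneOrbit (D : Set (ℝ × ℝ)) (V : ℝ × ℝ → ℝ × ℝ) (K W : ℝ × ℝ → ℝ) (ε e c T : ℝ)
    (z : ℝ → ℝ × ℝ) (ψ : ℝ → ℝ) : Prop where
  mem : ∀ s ∈ Set.Icc 0 T, z s ∈ D
  velocity : ∀ s ∈ Set.Icc 0 T, HasDerivWithinAt z (ε • V (z s)) (Set.Icc 0 T) s
  phase : ∀ s ∈ Set.Icc 0 T, HasDerivWithinAt ψ (W (z s)) (Set.Icc 0 T) s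
  level : ∀ s ∈ Set.Icc 0 T, |K (z s)| ≤ c * e

/-- A piecewise smooth approximate orbit. -/
structure ApproxOrbit (D : Set (ℝ × ℝ)) (V : ℝ × ℝ → ℝ × ℝ) (K W : ℝ × ℝ → ℝ) (ε e c ρ κ T : ℝ)
    (G : Set ℝ) (w : ℝ → ℝ × ℝ) (Φ : ℝ → ℝ) : Prop where
  sub : G ⊆ Set.Icc 0 T
  start : 0 ∈ G
  finite : (Set.Icc 0 T \ G).Finite
  sep : ∀ τ ∈ Set.Icc 0 T \ G, ∀ τ' ∈ Set.Icc 0 T \ G, τ < τ' → ρ ≤ τ' - τ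
  mem : ∀ t ∈ G, w t ∈ D
  velocity : ∀ t ∈ G, ∃ w', HasDerivWithinAt w w' G t ∧ ‖w' - ε • V (w t)‖ ≤ c * (ε * e)
  jump : ∀ τ ∈ Set.Ioo 0 T \ G, ∃ l l', Filter.Tendsto w (𝓝[<] τ) (𝓝 l) ∧
    Filter.Tendsto w (𝓝[>] τ) (𝓝 l') ∧ ‖l' - l‖ ≤ c * (ε * e)
  phase : ∀ t ∈ G, ∃ f, HasDerivWithinAt Φ f G t ∧ ‖f - W (w t)‖ ≤ c * e
  phase_jump : ∀ τ ∈ Set.Ioo 0 T \ G, ∃ l l', Filter.Tendsto Φ (𝓝[<] τ) (𝓝 l) ∧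
    Filter.Tendsto Φ (𝓝[>] τ) (𝓝 l') ∧ ‖l' - l‖ ≤ c * e
  level : ∀ t ∈ G, |K (w t)| ≤ c * e
  nondegenerate : ∀ t ∈ G, κ ≤ ‖V (w t)‖

section

variable {D : Set (ℝ × ℝ)} {V : ℝ × ℝ → ℝ × ℝ} {K W : ℝ × ℝ → ℝ} {ε e c ρ κ T B Λ : ℝ}
  {G : Set ℝ} {w z : ℝ → ℝ × ℝ} {Φ ψ : ℝ → ℝ}

theorem PlaneOrbit.lipschitz (ho : PlaneOrbit D V K W ε e c T z ψ) (hf : PlaneField D V K W B Λ)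
    (hε : 0 < ε) {s t : ℝ} (hs : s ∈ Set.Icc 0 T) (ht : t ∈ Set.Icc 0 T) :
    ‖z t - z s‖ ≤ ε * B * |t - s| ∧ ‖ψ t - ψ s‖ ≤ B * |t - s| := by
  refine ⟨?_, ?_⟩
  · refine Convex.norm_image_sub_le_of_norm_hasDerivWithin_le (s := Set.Icc 0 T)
      (fun a ha => ho.velocity a ha) (fun a ha => ?_) (convex_Icc 0 T) hs ht
    rw [norm_smul, Real.norm_eq_abs, abs_of_pos hε]
    exact mul_le_mul_of_nonneg_left (hf.field_le _ (ho.mem a ha)) hε.le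
  · exact Convex.norm_image_sub_le_of_norm_hasDerivWithin_le (s := Set.Icc 0 T)
      (fun a ha => ho.phase a ha) (fun a ha => hf.phase_le _ (ho.mem a ha)) (convex_Icc 0 T) hs ht

/-- The drift of the difference of a piecewise smooth function and a smooth function whose time is
shifted. -/
theorem drift_difference {E : Type*} [NormedAddCommGroup E] [NormedSpace ℝ E] {A b : ℝ}
    {g g₁ : ℝ → E} {f₁ : ℝ → E} (hsub : G ⊆ Set.Icc 0 T)
    (hfin : (Set.Icc 0 T \ G).Finite)
    (hsep : ∀ τ ∈ Set.Icc 0 T \ G, ∀ τ' ∈ Set.Icc 0 T \ G, τ < τ' → ρ ≤ τ' - τ) (hρ : 0 < ρ)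
    (hb : 0 ≤ b) {t₀ t s₀ : ℝ} (ht₀ : t₀ ∈ G) (ht : t ∈ G) (hle : t₀ ≤ t) (hs₀ : 0 ≤ s₀)
    (hs : s₀ + (t - t₀) ≤ T)
    (hg₁ : ∀ s ∈ Set.Icc 0 T, HasDerivWithinAt g₁ (f₁ s) (Set.Icc 0 T) s)
    (hg : ∀ τ ∈ G ∩ Set.Icc t₀ t, ∃ g', HasDerivWithinAt g g' G τ ∧
      ‖g' - f₁ (s₀ + (τ - t₀))‖ ≤ A)
    (hj : ∀ τ ∈ Set.Ioo 0 T \ G, ∃ l l', Filter.Tendsto g (𝓝[<] τ) (𝓝 l) ∧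
      Filter.Tendsto g (𝓝[>] τ) (𝓝 l') ∧ ‖l' - l‖ ≤ b) :
    ‖(g t - g₁ (s₀ + (t - t₀))) - (g t₀ - g₁ s₀)‖
      ≤ A * (t - t₀) + b * (1 + (t - t₀) / ρ) := by
  set G' := G ∩ Set.Icc t₀ t with hG'
  have hdiff : Set.Ioo t₀ t \ G' ⊆ Set.Ioo 0 T \ G := fun τ hτ =>
    ⟨⟨(hsub ht₀).1.trans_lt hτ.1.1, hτ.1.2.trans_le (hsub ht).2⟩,
      fun hc => hτ.2 ⟨hc, Set.Ioo_subset_Icc_self hτ.1⟩⟩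
  have hdiff' : Set.Ioo t₀ t \ G' ⊆ Set.Icc 0 T \ G := fun τ hτ =>
    ⟨Set.Ioo_subset_Icc_self (hdiff hτ).1, (hdiff hτ).2⟩
  have maps : ∀ τ ∈ Set.Icc t₀ t, s₀ + (τ - t₀) ∈ Set.Icc 0 T := fun τ hτ =>
    ⟨by linarith [hτ.1], by linarith [hτ.2]⟩
  have := piecewise_drift (G := G') (A := A) (B := b) (ρ := ρ)
    (g := fun τ => g τ - g₁ (s₀ + (τ - t₀))) ⟨ht₀, Set.left_mem_Icc.2 hle⟩
    ⟨ht, Set.right_mem_Icc.2 hle⟩ hle (hfin.subset hdiff') hb hρ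
    (fun τ hτ τ' hτ' => hsep τ (hdiff' hτ) τ' (hdiff' hτ')) ?_ ?_
  · simpa using this
  · rintro τ ⟨-, hτ⟩
    obtain ⟨g', h1, h2⟩ := hg τ hτ
    refine ⟨_, (h1.mono Set.inter_subset_left).sub ?_, h2⟩
    have i1 : HasDerivWithinAt (fun τ : ℝ => s₀ + (τ - t₀)) 1 G' τ :=
      (((hasDerivAt_id τ).sub_const t₀).const_add s₀).hasDerivWithinAt
    have := (hg₁ _ (maps τ hτ.2)).scomp τ i1 (fun a ha => maps a ha.2)
    rwa [one_smul] at this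
  · intro τ hτ
    obtain ⟨l, l', h1, h2, h3⟩ := hj τ (hdiff hτ)
    have hin : Set.Icc 0 T ∈ 𝓝 (s₀ + (τ - t₀)) :=
      Icc_mem_nhds (by linarith [hτ.1.1]) (by linarith [hτ.1.2])
    have hc : ContinuousAt g₁ (s₀ + (τ - t₀)) :=
      ((hg₁ _ (maps τ (Set.Ioo_subset_Icc_self hτ.1))).hasDerivAt hin).continuousAt
    have hc' : Filter.Tendsto (fun τ => g₁ (s₀ + (τ - t₀))) (𝓝 τ) (𝓝 (g₁ (s₀ + (τ - t₀)))) :=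
      hc.tendsto.comp (Continuous.tendsto (by fun_prop : Continuous fun τ : ℝ => s₀ + (τ - t₀)) τ)
    refine ⟨_, _, h1.sub (hc'.mono_left nhdsWithin_le_nhds),
      h2.sub (hc'.mono_left nhdsWithin_le_nhds), ?_⟩
    rwa [sub_sub_sub_cancel_right]

/-- Over a short interval of the slow time an approximate orbit stays near an orbit. -/
theorem ApproxOrbit.near (ha : ApproxOrbit D V K W ε e c ρ κ T G w Φ)
    (ho : PlaneOrbit D V K W ε e c T z ψ) (hf : PlaneField D V K W B Λ) (hε : 0 < ε) (hε1 : ε ≤ 1)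
    (he : 0 < e) (hρ : 0 < ρ) (hc : 0 ≤ c) (hΛ : 0 ≤ Λ) {t₀ t s₀ δ₀ : ℝ} (ht₀ : t₀ ∈ G) (ht : t ∈ G)
    (hle : t₀ ≤ t) (hs₀ : 0 ≤ s₀) (hs : s₀ + (t - t₀) ≤ T) (hshort : ε * (t - t₀) * (2 * (Λ + 1)) ≤ 1)
    (hδ : ‖w t₀ - z s₀‖ ≤ δ₀) :
    ‖w t - z (s₀ + (t - t₀))‖ ≤ 2 * (δ₀ + c * (2 + 1 / ρ) * e) ∧
    ‖(Φ t - ψ (s₀ + (t - t₀))) - (Φ t₀ - ψ s₀)‖ ≤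
      (Λ * (2 * (δ₀ + c * (2 + 1 / ρ) * e)) + c * (2 + 1 / ρ) * e) / ε := by
  set Δ : ℝ → ℝ × ℝ := fun τ => w τ - z (s₀ + (τ - t₀)) with hΔ
  have hΔ0 : Δ t₀ = w t₀ - z s₀ := by simp [hΔ]
  have maps : ∀ τ ∈ Set.Icc t₀ t, s₀ + (τ - t₀) ∈ Set.Icc 0 T := fun τ hτ =>
    ⟨by linarith [hτ.1], by linarith [hτ.2]⟩
  have hl0 : 0 ≤ ε * (t - t₀) := mul_nonneg hε.le (by linarith)
  have hl1 : ε * (t - t₀) ≤ 1 := by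
    have : ε * (t - t₀) * 1 ≤ ε * (t - t₀) * (2 * (Λ + 1)) := by gcongr; linarith
    linarith
  have drift : ∀ a : ℝ, ∀ τ ∈ G ∩ Set.Icc t₀ t,
      (∀ σ ∈ G ∩ Set.Icc t₀ t, ‖V (w σ) - V (z (s₀ + (σ - t₀)))‖ ≤ a) →
      ‖Δ τ - Δ t₀‖ ≤ ε * (t - t₀) * a + c * (2 + 1 / ρ) * e := by
    intro a τ hτ h
    have ha0 : 0 ≤ a := (norm_nonneg _).trans (h τ hτ)
    have := drift_difference (A := ε * a + c * (ε * e)) (b := c * (ε * e)) ha.sub ha.finite ha.sep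
      hρ (by positivity) ht₀ hτ.1 hτ.2.1 hs₀ (by linarith [hτ.2.2]) ho.velocity
      (fun σ hσ => by
        obtain ⟨w', h1, h2⟩ := ha.velocity σ hσ.1
        refine ⟨w', h1, ?_⟩
        have h3 := h σ ⟨hσ.1, hσ.2.1, hσ.2.2.trans hτ.2.2⟩
        calc ‖w' - ε • V (z (s₀ + (σ - t₀)))‖
            = ‖(w' - ε • V (w σ)) + ε • (V (w σ) - V (z (s₀ + (σ - t₀))))‖ := by
              congr 1; rw [smul_sub]; abel
          _ ≤ c * (ε * e) + ε * a := by
              refine (norm_add_le _ _).trans (add_le_add h2 ?_)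
              rw [norm_smul, Real.norm_eq_abs, abs_of_pos hε]
              gcongr
          _ = _ := by ring) ha.jump
    have e1 : Δ τ - Δ t₀ = w τ - z (s₀ + (τ - t₀)) - (w t₀ - z s₀) := by rw [hΔ0]
    rw [e1]
    refine this.trans ?_
    have h5 : τ - t₀ ≤ t - t₀ := by linarith [hτ.2.2]
    have h6 : 0 ≤ τ - t₀ := by linarith [hτ.2.1]
    calc (ε * a + c * (ε * e)) * (τ - t₀) + c * (ε * e) * (1 + (τ - t₀) / ρ)
        ≤ (ε * a + c * (ε * e)) * (t - t₀) + c * (ε * e) * (1 + (t - t₀) / ρ) := by gcongr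
      _ = ε * (t - t₀) * a + (c * e) * (ε * (t - t₀)) + c * e * ε + c * e * (ε * (t - t₀)) / ρ := by
          ring
      _ ≤ ε * (t - t₀) * a + (c * e) * 1 + c * e * 1 + c * e * 1 / ρ := by gcongr
      _ = _ := by ring
  set I := G ∩ Set.Icc t₀ t with hI
  have htI : t ∈ I := ⟨ht, Set.right_mem_Icc.2 hle⟩
  have bdd : BddAbove ((fun τ => ‖Δ τ‖) '' I) := by
    refine ⟨‖Δ t₀‖ + (ε * (t - t₀) * (2 * B) + c * (2 + 1 / ρ) * e), ?_⟩
    rintro _ ⟨τ, hτ, rfl⟩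
    have := drift (2 * B) τ hτ (fun σ hσ => by
      refine (norm_sub_le _ _).trans ?_
      have h1 := hf.field_le _ (ha.mem σ hσ.1)
      have h2 := hf.field_le _ (ho.mem _ (maps σ hσ.2))
      linarith)
    have h3 := norm_add_le (Δ t₀) (Δ τ - Δ t₀)
    rw [add_sub_cancel] at h3
    simp only
    linarith
  -- In place of the Gronwall inequality: the supremum of the deviation is finite by a crude
  -- estimate, and over a slow time at most `1 / (2 (Λ + 1))` the feedback through the Lipschitz
  -- constant is at most half of it.
  set m := sSup ((fun τ => ‖Δ τ‖) '' I) with hm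
  have hle_m : ∀ τ ∈ I, ‖Δ τ‖ ≤ m := fun τ hτ => le_csSup bdd ⟨τ, hτ, rfl⟩
  have hm0 : 0 ≤ m := (norm_nonneg _).trans (hle_m t htI)
  have hm1 : m ≤ δ₀ + (ε * (t - t₀) * (Λ * m) + c * (2 + 1 / ρ) * e) := by
    refine csSup_le ⟨_, t, htI, rfl⟩ ?_
    rintro _ ⟨τ, hτ, rfl⟩
    have := drift (Λ * m) τ hτ (fun σ hσ =>
      (hf.field_lip _ (ha.mem σ hσ.1) _ (ho.mem _ (maps σ hσ.2))).trans
        (mul_le_mul_of_nonneg_left (hle_m σ hσ) hΛ))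
    have h3 := norm_add_le (Δ t₀) (Δ τ - Δ t₀)
    rw [add_sub_cancel] at h3
    rw [hΔ0] at h3
    rw [hΔ0] at this
    simp only
    linarith
  have hm2 : m ≤ 2 * (δ₀ + c * (2 + 1 / ρ) * e) := by
    have : ε * (t - t₀) * (Λ * m) ≤ m / 2 := by
      have h1 : ε * (t - t₀) * (2 * Λ) ≤ 1 := by
        refine le_trans ?_ hshort
        gcongr
        linarith
      have h2 := mul_le_mul_of_nonneg_right h1 hm0
      linarith
    linarith
  refine ⟨(hle_m t htI).trans hm2, ?_⟩
  have := drift_difference (g := Φ) (A := Λ * m + c * e) (b := c * e) ha.sub ha.finite ha.sep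
    hρ (by positivity) ht₀ ht hle hs₀ hs ho.phase
    (fun σ hσ => by
      obtain ⟨f, h1, h2⟩ := ha.phase σ hσ.1
      refine ⟨f, h1, ?_⟩
      have h3 := (hf.phase_lip _ (ha.mem σ hσ.1) _ (ho.mem _ (maps σ hσ.2))).trans
        (mul_le_mul_of_nonneg_left (hle_m σ hσ) hΛ)
      calc ‖f - W (z (s₀ + (σ - t₀)))‖
          = ‖(f - W (w σ)) + (W (w σ) - W (z (s₀ + (σ - t₀))))‖ := by congr 1; ring
        _ ≤ c * e + Λ * m := (norm_add_le _ _).trans (add_le_add h2 h3)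
        _ = _ := by ring) ha.phase_jump
  refine this.trans ?_
  rw [le_div_iff₀ hε]
  calc ((Λ * m + c * e) * (t - t₀) + c * e * (1 + (t - t₀) / ρ)) * ε
      = Λ * m * (ε * (t - t₀)) + c * e * (ε * (t - t₀)) + c * e * ε
        + c * e * (ε * (t - t₀)) / ρ := by ring
    _ ≤ Λ * m * 1 + c * e * 1 + c * e * 1 + c * e * 1 / ρ := by gcongr
    _ = Λ * m + c * (2 + 1 / ρ) * e := by ring
    _ ≤ _ := by gcongr

theorem sq_norm_le_sum (v : ℝ × ℝ) : ‖v‖ ^ 2 ≤ v.1 ^ 2 + v.2 ^ 2 := by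
  rw [Prod.norm_def]
  rcases max_choice ‖v.1‖ ‖v.2‖ with h | h <;> rw [h, Real.norm_eq_abs, sq_abs]
  · linarith [sq_nonneg v.2]
  · linarith [sq_nonneg v.1]

/-- A shift of the time of the orbit removes the deviation along the orbit; the transversal deviation
is controlled by the level of the Hamiltonian. -/
theorem ApproxOrbit.exists_shift (ha : ApproxOrbit D V K W ε e c ρ κ T G w Φ)
    (ho : PlaneOrbit D V K W ε e c T z ψ) (hf : PlaneField D V K W B Λ) (hε : 0 < ε)
    (he : 0 < e) (hΛ : 0 ≤ Λ) (hκ : 0 < κ) (hB : 0 ≤ B) {C₂ : ℝ} (hC₂ : 0 ≤ C₂)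
    (small : Λ * (C₂ + B * (2 * C₂ * B / κ ^ 2)) * (2 * C₂ * B / κ ^ 2) * e ≤ 1)
    (small' : Λ * C₂ ^ 2 * e ≤ 1) {t s₁ : ℝ} (ht : t ∈ G)
    (h0 : 2 * C₂ * B / κ ^ 2 * (e / ε) ≤ s₁) (hT : s₁ + 2 * C₂ * B / κ ^ 2 * (e / ε) ≤ T)
    (hd : ‖w t - z s₁‖ ≤ C₂ * e) :
    ∃ s₂ ∈ Set.Icc 0 T, |s₂ - s₁| ≤ 2 * C₂ * B / κ ^ 2 * (e / ε) ∧
      ‖w t - z s₂‖ ≤ ((2 * c + 1) * B / κ ^ 2 + 1) * e := by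
  set a := 2 * C₂ * B / κ ^ 2 with haa
  have ha0 : 0 ≤ a := by positivity
  have hη : 0 ≤ a * (e / ε) := by positivity
  have hs₁ : s₁ ∈ Set.Icc 0 T := ⟨by linarith, by linarith⟩
  set Δ := w t - z s₁ with hΔ
  set v := V (w t) with hv
  have hvB : ‖v‖ ≤ B := hf.field_le _ (ha.mem t ht)
  set q := v.1 ^ 2 + v.2 ^ 2 with hq
  have hqκ : κ ^ 2 ≤ q :=
    (pow_le_pow_left₀ hκ.le (ha.nondegenerate t ht) 2).trans (sq_norm_le_sum v)
  have hq0 : 0 < q := by have : 0 < κ ^ 2 := by positivity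
                         linarith
  have v1 : |v.1| ≤ B := (norm_fst_le v).trans hvB
  have v2 : |v.2| ≤ B := (norm_snd_le v).trans hvB
  have D1 : |Δ.1| ≤ C₂ * e := (norm_fst_le Δ).trans hd
  have D2 : |Δ.2| ≤ C₂ * e := (norm_snd_le Δ).trans hd
  -- The coefficient of the orthogonal projection of the deviation onto the field. Moving along the
  -- orbit for the time `τ / ε` removes this component, and what is left is a multiple of the field
  -- turned by a right angle.
  set τ := (Δ.1 * v.1 + Δ.2 * v.2) / q with hτ
  have hτa : |τ| ≤ a * e := by
    rw [hτ, abs_div, abs_of_pos hq0, div_le_iff₀ hq0]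
    have h1 : |Δ.1 * v.1 + Δ.2 * v.2| ≤ C₂ * e * B + C₂ * e * B := by
      refine (abs_add_le _ _).trans ?_
      rw [abs_mul, abs_mul]
      gcongr
    have h2 : C₂ * e * B + C₂ * e * B = a * e * κ ^ 2 := by rw [haa]; field_simp; ring
    rw [h2] at h1
    exact h1.trans (by gcongr)
  have hshift : |τ / ε| ≤ a * (e / ε) := by
    rw [abs_div, abs_of_pos hε, ← mul_div_assoc]
    gcongr
  obtain ⟨g1, g2⟩ := abs_le.1 hshift
  have hs₂ : s₁ + τ / ε ∈ Set.Icc 0 T := ⟨by linarith, by linarith⟩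
  refine ⟨s₁ + τ / ε, hs₂, by rwa [add_sub_cancel_left], ?_⟩
  -- the displacement along the orbit
  have disp : ‖z (s₁ + τ / ε) - z s₁ - τ • v‖ ≤ e := by
    have hsub : Set.uIcc s₁ (s₁ + τ / ε) ⊆ Set.Icc 0 T := Set.uIcc_subset_Icc hs₁ hs₂
    have := Convex.norm_image_sub_le_of_norm_hasDerivWithin_le
      (s := Set.uIcc s₁ (s₁ + τ / ε)) (f := fun s => z s - (ε * (s - s₁)) • v)
      (f' := fun s => ε • V (z s) - ε • v) (C := ε * (Λ * ((C₂ + B * a) * e)))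
      (x := s₁) (y := s₁ + τ / ε) (fun s hs => by
        have h1 : HasDerivWithinAt (fun s : ℝ => ε * (s - s₁)) ε (Set.uIcc s₁ (s₁ + τ / ε)) s := by
          simpa using (((hasDerivAt_id s).sub_const s₁).const_mul ε).hasDerivWithinAt
        exact ((ho.velocity s (hsub hs)).mono hsub).sub (h1.smul_const v))
      (fun s hs => by
        have hss := hsub hs
        rw [← smul_sub, norm_smul, Real.norm_eq_abs, abs_of_pos hε]
        have h1 := hf.field_lip _ (ho.mem s hss) _ (ha.mem t ht)
        have h2 := (ho.lipschitz hf hε hs₁ hss).1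
        have h3 : |s - s₁| ≤ a * (e / ε) := by
          have := Set.abs_sub_left_of_mem_uIcc hs
          rw [add_sub_cancel_left] at this
          exact this.trans hshift
        have h4 : ‖z s - w t‖ ≤ (C₂ + B * a) * e := by
          calc ‖z s - w t‖ = ‖(z s - z s₁) - Δ‖ := by congr 1; rw [hΔ]; abel
            _ ≤ ε * B * |s - s₁| + C₂ * e := (norm_sub_le _ _).trans (add_le_add h2 hd)
            _ ≤ ε * B * (a * (e / ε)) + C₂ * e := by gcongr
            _ = _ := by field_simp; ring
        refine mul_le_mul_of_nonneg_left (h1.trans ?_) hε.le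
        gcongr)
      (convex_uIcc _ _) Set.left_mem_uIcc Set.right_mem_uIcc
    simp only [add_sub_cancel_left, sub_self, mul_zero, zero_smul, sub_zero] at this
    rw [mul_div_cancel₀ _ hε.ne'] at this
    have e1 : z (s₁ + τ / ε) - z s₁ - τ • v = z (s₁ + τ / ε) - τ • v - z s₁ := by abel
    rw [e1]
    refine this.trans ?_
    rw [Real.norm_eq_abs]
    calc ε * (Λ * ((C₂ + B * a) * e)) * |τ / ε| ≤ ε * (Λ * ((C₂ + B * a) * e)) * (a * (e / ε)) := by
          gcongr
      _ = (Λ * (C₂ + B * a) * a * e) * e := by field_simp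
      _ ≤ 1 * e := by gcongr
      _ = e := one_mul e
  -- the transversal displacement
  set n := Δ.1 * v.2 - Δ.2 * v.1 with hn
  -- Up to sign `n` is the first-order change of `K` from `w t` to `z s₁`. Both levels are at most
  -- `c e`, and `small'` makes the quadratic remainder at most `e`.
  have hn1 : |n| ≤ (2 * c + 1) * e := by
    have h1 := hf.taylor _ (ha.mem t ht) _ (ho.mem s₁ hs₁)
    have h2 := ha.level t ht
    have h3 := ho.level s₁ hs₁
    have h4 : z s₁ - w t = -Δ := by rw [hΔ]; abel
    rw [h4, norm_neg] at h1
    simp only [Prod.fst_neg, Prod.snd_neg] at h1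
    have h5 : Λ * ‖Δ‖ ^ 2 ≤ e := by
      calc Λ * ‖Δ‖ ^ 2 ≤ Λ * (C₂ * e) ^ 2 := by gcongr
        _ = (Λ * C₂ ^ 2 * e) * e := by ring
        _ ≤ 1 * e := by gcongr
        _ = e := one_mul e
    have h6 : n = (K (z s₁) - K (w t) - (v.2 * -Δ.1 - v.1 * -Δ.2)) - K (z s₁) + K (w t) := by
      rw [hn]; ring
    rw [h6]
    have h7 := abs_add_le ((K (z s₁) - K (w t) - (v.2 * -Δ.1 - v.1 * -Δ.2)) - K (z s₁)) (K (w t))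
    have h8 := abs_sub (K (z s₁) - K (w t) - (v.2 * -Δ.1 - v.1 * -Δ.2)) (K (z s₁))
    linarith
  have trans : ‖Δ - τ • v‖ ≤ (2 * c + 1) * B / κ ^ 2 * e := by
    have hce : 0 ≤ (2 * c + 1) * e := (abs_nonneg _).trans hn1
    have hnq : |n / q| ≤ (2 * c + 1) * e / κ ^ 2 := by
      rw [abs_div, abs_of_pos hq0]
      gcongr
    have hpos : 0 ≤ (2 * c + 1) * e / κ ^ 2 := by positivity
    have comp1 : (Δ - τ • v).1 = n / q * v.2 := by
      simp only [Prod.fst_sub, Prod.smul_fst, smul_eq_mul, hτ, hn]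
      field_simp
      rw [hq]; ring
    have comp2 : (Δ - τ • v).2 = -(n / q * v.1) := by
      simp only [Prod.snd_sub, Prod.smul_snd, smul_eq_mul, hτ, hn]
      field_simp
      rw [hq]; ring
    have e2 : (2 * c + 1) * B / κ ^ 2 * e = (2 * c + 1) * e / κ ^ 2 * B := by ring
    rw [e2, Prod.norm_def, comp1, comp2, Real.norm_eq_abs, Real.norm_eq_abs, abs_neg, abs_mul,
      abs_mul]
    exact max_le (by gcongr) (by gcongr)
  calc ‖w t - z (s₁ + τ / ε)‖ = ‖(Δ - τ • v) - (z (s₁ + τ / ε) - z s₁ - τ • v)‖ := by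
        congr 1; rw [hΔ]; abel
    _ ≤ (2 * c + 1) * B / κ ^ 2 * e + e := (norm_sub_le _ _).trans (add_le_add trans disp)
    _ = _ := by ring

end

section

variable {D : Set (ℝ × ℝ)} {V : ℝ × ℝ → ℝ × ℝ} {K W : ℝ × ℝ → ℝ} {ε e c ρ κ T B Λ : ℝ}
  {G : Set ℝ} {w z : ℝ → ℝ × ℝ} {Φ ψ : ℝ → ℝ}

theorem exists_mem_Ioo_of_finite (hfin : (Set.Icc 0 T \ G).Finite) {a b : ℝ} (hab : a < b)
    (ha : 0 ≤ a) (hb : b ≤ T) : ∃ t ∈ G, a < t ∧ t < b := by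
  by_contra hc
  push Not at hc
  refine (Set.Ioo_infinite hab) (hfin.subset fun t ht => ⟨⟨ha.trans ht.1.le, ht.2.le.trans hb⟩, ?_⟩)
  exact fun hG => absurd ht.2 (not_lt.2 (hc t hG ht.1))

/-- The constants of the shadowing argument, one slow step after another. -/
theorem ApproxOrbit.shadow_steps (ha : ApproxOrbit D V K W ε e c ρ κ T G w Φ)
    (ho : PlaneOrbit D V K W ε e c T z ψ) (hf : PlaneField D V K W B Λ) (hε : 0 < ε) (hε1 : ε ≤ 1)
    (he : 0 < e) (hρ : 0 < ρ) (hc : 0 ≤ c) (hΛ : 0 ≤ Λ) (hκ : 0 < κ) (hB : 0 ≤ B)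
    (hw : w 0 = z 0) (hΦ : Φ 0 = ψ 0) {C₁ C₂ a b h : ℝ}
    (hC₁ : C₁ = (2 * c + 1) * B / κ ^ 2 + 1 + 2 * (c * (2 + 1 / ρ)))
    (hC₂ : C₂ = 2 * (C₁ + c * (2 + 1 / ρ))) (haa : a = 2 * C₂ * B / κ ^ 2)
    (hb : b = Λ * C₂ + c * (2 + 1 / ρ) + B * a) (hh : h = 1 / (4 * (Λ + 1)))
    (small : Λ * (C₂ + B * a) * a * e ≤ 1) (small' : Λ * C₂ ^ 2 * e ≤ 1)
    (small'' : a * e ≤ h / 2) (n : ℕ) :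
    ∀ t ∈ G, ε * t ≤ (n + 1) * h → t + (n + 1) * (a * (e / ε)) ≤ T →
      ∃ s ∈ Set.Icc 0 T, |s - t| ≤ (n + 1) * (a * (e / ε)) ∧ ‖w t - z s‖ ≤ C₁ * e ∧
        ‖Φ t - ψ s‖ ≤ (n + 1) * (b * (e / ε)) := by
  have hc2 : 0 ≤ c * (2 + 1 / ρ) := by positivity
  have hC₁0 : 0 ≤ C₁ := by rw [hC₁]; positivity
  have hC₂0 : 0 ≤ C₂ := by rw [hC₂]; positivity
  have ha0 : 0 ≤ a := by rw [haa]; positivity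
  have hb0 : 0 ≤ b := by rw [hb]; positivity
  have hh0 : 0 < h := by rw [hh]; positivity
  have hη : 0 ≤ a * (e / ε) := by positivity
  -- A slow interval of length `2 h` is the longest one to which `ApproxOrbit.near` applies.
  have hh2 : 2 * h * (2 * (Λ + 1)) = 1 := by rw [hh]; field_simp; norm_num
  induction n with
  | zero =>
    intro t ht h1 h2
    simp only [Nat.cast_zero, zero_add, one_mul] at h1 h2 ⊢
    have ht0 := (ha.sub ht).1
    have hshort : ε * (t - 0) * (2 * (Λ + 1)) ≤ 1 := by
      rw [sub_zero]
      exact (mul_le_mul_of_nonneg_right (by linarith) (by positivity)).trans hh2.le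
    obtain ⟨n1, n2⟩ := ha.near ho hf hε hε1 he hρ hc hΛ ha.start ht ht0 le_rfl
      (by linarith) hshort (δ₀ := 0) (by rw [hw, sub_self, norm_zero])
    simp only [sub_zero, zero_add] at n1 n2
    rw [hΦ, sub_self, sub_zero] at n2
    refine ⟨t, ha.sub ht, by rw [sub_self, abs_zero]; exact hη, n1.trans ?_, n2.trans ?_⟩
    · rw [← mul_assoc]
      gcongr
      rw [hC₁]
      have : 0 ≤ (2 * c + 1) * B / κ ^ 2 := by positivity
      linarith
    · rw [← mul_div_assoc]
      gcongr
      have h3 : 2 * (c * (2 + 1 / ρ) * e) ≤ C₂ * e := by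
        rw [hC₂, ← mul_assoc]
        gcongr
        linarith
      have h4 : Λ * (2 * (c * (2 + 1 / ρ) * e)) ≤ Λ * (C₂ * e) := by gcongr
      have h5 : 0 ≤ B * a * e := by positivity
      rw [hb]
      linarith
  | succ n ih =>
    intro t ht h1 h2
    push_cast at h1 h2 ⊢
    by_cases hcase : ε * t ≤ (n + 1) * h
    · obtain ⟨s, hs, b1, b2, b3⟩ := ih t ht hcase (by linarith)
      have hη2 : 0 ≤ b * (e / ε) := by positivity
      exact ⟨s, hs, b1.trans (by linarith), b2, b3.trans (by linarith)⟩
    rw [not_le] at hcase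
    have hn0 : (0 : ℝ) ≤ n := n.cast_nonneg
    have htT := (ha.sub ht).2
    have hu : (n + 1) * h / ε < t := by rw [div_lt_iff₀ hε]; linarith
    -- The restart time must avoid the impacts, so it is taken from a window. Its position makes the
    -- slow gap to `t` larger than `h / 2`, which leaves room for one more shift by `small''`, and
    -- at most `2 h`.
    obtain ⟨t₀, ht₀, l1, l2⟩ := exists_mem_Ioo_of_finite (G := G) (T := T) ha.finite
      (a := n * h / ε) (b := (n + 1 / 2) * h / ε) (by gcongr; linarith) (by positivity) (by
        have : (n + 1 / 2) * h / ε ≤ (n + 1) * h / ε := by gcongr; norm_num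
        linarith)
    rw [div_lt_iff₀ hε] at l1
    rw [lt_div_iff₀ hε] at l2
    have gap : h / 2 < ε * (t - t₀) := by linarith
    have gap2 : ε * (t - t₀) ≤ 2 * h := by linarith
    have hη' : a * (e / ε) ≤ t - t₀ := by
      rw [← mul_div_assoc, div_le_iff₀ hε]
      linarith
    obtain ⟨s₀, hs₀, b1, b2, b3⟩ := ih t₀ ht₀ (by linarith) (by linarith)
    obtain ⟨c1, c2⟩ := abs_le.1 b1
    have hle : t₀ ≤ t := by linarith
    have hshort : ε * (t - t₀) * (2 * (Λ + 1)) ≤ 1 :=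
      (mul_le_mul_of_nonneg_right gap2 (by positivity)).trans hh2.le
    obtain ⟨n1, n2⟩ := ha.near ho hf hε hε1 he hρ hc hΛ ht₀ ht hle hs₀.1 (by linarith) hshort b2
    have e1 : 2 * (C₁ * e + c * (2 + 1 / ρ) * e) = C₂ * e := by rw [hC₂]; ring
    rw [e1] at n1 n2
    -- The deviation has grown from `C₁ e` to at most `C₂ e`, and the shift resets it to a bound
    -- that does not involve `C₂` and is below `C₁ e`. Thus only the time shift and the phase error
    -- accumulate, by a fixed amount per step.
    obtain ⟨s₂, hs₂, d1, d2⟩ := ha.exists_shift ho hf hε he hΛ hκ hB hC₂0 (by rwa [← haa]) small' ht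
      (s₁ := s₀ + (t - t₀)) (by rw [← haa]; linarith [hs₀.1]) (by rw [← haa]; linarith) n1
    rw [← haa] at d1
    have hs₁ : s₀ + (t - t₀) ∈ Set.Icc 0 T := ⟨by linarith [hs₀.1], by linarith⟩
    have d3 := (ho.lipschitz hf hε hs₁ hs₂).2
    refine ⟨s₂, hs₂, ?_, d2.trans ?_, ?_⟩
    · obtain ⟨f1, f2⟩ := abs_le.1 d1
      exact abs_le.2 ⟨by linarith, by linarith⟩
    · gcongr
      rw [hC₁]
      linarith
    · have d4 : B * |s₂ - (s₀ + (t - t₀))| ≤ B * (a * (e / ε)) := by gcongr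
      have e2 : Φ t - ψ s₂ = ((Φ t - ψ (s₀ + (t - t₀))) - (Φ t₀ - ψ s₀)) + (Φ t₀ - ψ s₀)
        - (ψ s₂ - ψ (s₀ + (t - t₀))) := by ring
      rw [e2]
      refine ((norm_sub_le _ _).trans (add_le_add (norm_add_le _ _) le_rfl)).trans ?_
      have e3 : b * (e / ε) = (Λ * (C₂ * e) + c * (2 + 1 / ρ) * e) / ε + B * (a * (e / ε)) := by
        rw [hb]; ring
      linarith

/-- An approximate orbit follows the orbit with the same initial point, with an error that grows
linearly in time. -/
theorem exists_shadow_constants (hρ : 0 < ρ) (hc : 0 ≤ c) (hΛ : 0 ≤ Λ) (hκ : 0 < κ) (hB : 0 ≤ B) :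
    ∃ C ε₀ : ℝ, 0 < C ∧ 0 < ε₀ ∧ ∀ (ε e T : ℝ) (D : Set (ℝ × ℝ)) (V : ℝ × ℝ → ℝ × ℝ)
      (K W : ℝ × ℝ → ℝ) (G : Set ℝ) (w z : ℝ → ℝ × ℝ) (Φ ψ : ℝ → ℝ), 0 < ε → ε < ε₀ → 0 < e →
      e ≤ ε → PlaneField D V K W B Λ → ApproxOrbit D V K W ε e c ρ κ T G w Φ →
      PlaneOrbit D V K W ε e c T z ψ → w 0 = z 0 → Φ 0 = ψ 0 → ∀ t ∈ G,
        ‖w t - z t‖ ≤ C * (e * (1 + ε * T)) ∧ ‖Φ t - ψ t‖ ≤ C * (e / ε * (1 + ε * T)) := by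
  obtain ⟨C₁, hC₁⟩ : ∃ C₁, C₁ = (2 * c + 1) * B / κ ^ 2 + 1 + 2 * (c * (2 + 1 / ρ)) := ⟨_, rfl⟩
  obtain ⟨C₂, hC₂⟩ : ∃ C₂, C₂ = 2 * (C₁ + c * (2 + 1 / ρ)) := ⟨_, rfl⟩
  obtain ⟨a, haa⟩ : ∃ a, a = 2 * C₂ * B / κ ^ 2 := ⟨_, rfl⟩
  obtain ⟨b, hb⟩ : ∃ b, b = Λ * C₂ + c * (2 + 1 / ρ) + B * a := ⟨_, rfl⟩
  obtain ⟨h, hh⟩ : ∃ h, h = 1 / (4 * (Λ + 1)) := ⟨_, rfl⟩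
  have hC₁0 : 0 ≤ C₁ := by rw [hC₁]; positivity
  have hC₂0 : 0 ≤ C₂ := by rw [hC₂]; positivity
  have ha0 : 0 ≤ a := by rw [haa]; positivity
  have hb0 : 0 ≤ b := by rw [hb]; positivity
  have hh0 : 0 < h := by rw [hh]; positivity
  set E := Λ * (C₂ + B * a) * a + Λ * C₂ ^ 2 + 1 with hE
  have hE0 : 0 < E := by positivity
  set C₃ := (B + c) * a + c + c * a / ρ + C₁ + 2 * (B * a) + b with hC₃
  have hC₃0 : 0 ≤ C₃ := by positivity
  refine ⟨C₃ * (3 + 1 / h) + 1, min 1 (min (1 / E) (h / (2 * (a + 1)))), by positivity,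
    by positivity, ?_⟩
  intro ε e T D V K W G w z Φ ψ h0 h1 he heε hf ha ho hw hΦ t ht
  have l1 : ε < 1 := h1.trans_le (min_le_left _ _)
  have l2 : ε < 1 / E := h1.trans_le ((min_le_right _ _).trans (min_le_left _ _))
  have l3 : ε < h / (2 * (a + 1)) := h1.trans_le ((min_le_right _ _).trans (min_le_right _ _))
  rw [lt_div_iff₀ (by positivity)] at l2 l3
  have s0 : E * e ≤ 1 := by
    have : e * E ≤ ε * E := by gcongr
    linarith
  have small : Λ * (C₂ + B * a) * a * e ≤ 1 := by
    refine le_trans ?_ s0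
    gcongr
    rw [hE]
    have : 0 ≤ Λ * C₂ ^ 2 := by positivity
    linarith
  have small' : Λ * C₂ ^ 2 * e ≤ 1 := by
    refine le_trans ?_ s0
    gcongr
    rw [hE]
    have : 0 ≤ Λ * (C₂ + B * a) * a := by positivity
    linarith
  have small'' : a * e ≤ h / 2 := by
    have h2 : e * (2 * (a + 1)) ≤ ε * (2 * (a + 1)) := by gcongr
    linarith
  have he1 : e ≤ 1 := by linarith
  have hT : 0 ≤ T := (ha.sub ha.start).2
  obtain ⟨ht0, htT⟩ := ha.sub ht
  -- The number of slow steps that cover the interval, at most linear in `ε T`.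
  set n := ⌈ε * T / h⌉₊ with hn
  have hn1 : ε * T ≤ n * h := by
    have := Nat.le_ceil (ε * T / h)
    rwa [div_le_iff₀ hh0] at this
  have hn2 : (n : ℝ) ≤ ε * T / h + 1 := (Nat.ceil_lt_add_one (by positivity)).le
  have step := ha.shadow_steps ho hf h0 l1.le he hρ hc hΛ hκ hB hw hΦ hC₁ hC₂ haa hb hh small small'
    small'' n
  have hn0 : (0 : ℝ) ≤ n := n.cast_nonneg
  set η := a * (e / ε) with hη
  have hη0 : 0 ≤ η := by positivity
  -- The stepwise statement needs room for the shifted time before `T`. Near the end of the interval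
  -- an earlier time `t₁` is used, at a distance comparable to the total shift; the gap is bridged
  -- by the crude drift of both motions.
  have close : ∃ t₁ ∈ G, t₁ ≤ t ∧ t - t₁ ≤ (n + 2) * η ∧ ∃ s ∈ Set.Icc 0 T, |s - t₁| ≤ (n + 1) * η ∧
      ‖w t₁ - z s‖ ≤ C₁ * e ∧ ‖Φ t₁ - ψ s‖ ≤ (n + 1) * (b * (e / ε)) := by
    have use : ∀ t' ∈ G, t' + (n + 1) * η ≤ T → ∃ s ∈ Set.Icc 0 T, |s - t'| ≤ (n + 1) * η ∧
        ‖w t' - z s‖ ≤ C₁ * e ∧ ‖Φ t' - ψ s‖ ≤ (n + 1) * (b * (e / ε)) := fun t' ht' hle =>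
      step t' ht' (by
        have := mul_le_mul_of_nonneg_left (ha.sub ht').2 h0.le
        linarith) hle
    by_cases hcase : t + (n + 1) * η ≤ T
    · exact ⟨t, ht, le_rfl, by rw [sub_self]; positivity, use t ht hcase⟩
    rw [not_le] at hcase
    rcases le_or_gt T ((n + 1) * η) with h5 | h5
    · refine ⟨0, ha.start, ht0, by linarith, 0, ⟨le_rfl, hT⟩, ?_, ?_, ?_⟩
      · rw [sub_zero, abs_zero]; positivity
      · rw [hw, sub_self, norm_zero]; positivity
      · rw [hΦ, sub_self, norm_zero]; positivity
    · rcases eq_or_lt_of_le hη0 with h6 | h6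
      · rw [← h6, mul_zero, add_zero] at hcase
        exact absurd htT (not_le.2 hcase)
      obtain ⟨t₁, ht₁, m1, m2⟩ := exists_mem_Ioo_of_finite ha.finite
        (a := max 0 (T - (n + 1) * η - η)) (b := T - (n + 1) * η)
        (max_lt (by linarith) (by linarith)) (le_max_left _ _) (by
          have : 0 ≤ (n + 1) * η := by positivity
          linarith)
      have m3 := (le_max_right _ _).trans_lt m1
      exact ⟨t₁, ht₁, by linarith, by linarith, use t₁ ht₁ (by linarith)⟩
  obtain ⟨t₁, ht₁, le1, le2, s, hs, k1, k2, k3⟩ := close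
  have ht₁' := ha.sub ht₁
  have jumps : ∀ {F : Type} [NormedAddCommGroup F] [NormedSpace ℝ F] (g : ℝ → F) (A b : ℝ),
      0 ≤ A → 0 ≤ b → (∀ t ∈ G, ∃ g', HasDerivWithinAt g g' G t ∧ ‖g'‖ ≤ A) →
      (∀ τ ∈ Set.Ioo 0 T \ G, ∃ l l', Filter.Tendsto g (𝓝[<] τ) (𝓝 l) ∧
        Filter.Tendsto g (𝓝[>] τ) (𝓝 l') ∧ ‖l' - l‖ ≤ b) →
      ‖g t - g t₁‖ ≤ A * ((n + 2) * η) + b * (1 + (n + 2) * η / ρ) := by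
    intro F _ _ g A b hA hb hg hj
    have hsub : Set.Ioo t₁ t \ G ⊆ Set.Ioo 0 T \ G := fun τ hτ =>
      ⟨⟨ht₁'.1.trans_lt hτ.1.1, hτ.1.2.trans_le htT⟩, hτ.2⟩
    have hsub' : Set.Ioo t₁ t \ G ⊆ Set.Icc 0 T \ G := fun τ hτ =>
      ⟨Set.Ioo_subset_Icc_self (hsub hτ).1, hτ.2⟩
    refine (piecewise_drift ht₁ ht le1 (ha.finite.subset hsub') hb hρ
      (fun τ hτ τ' hτ' => ha.sep τ (hsub' hτ) τ' (hsub' hτ')) (fun τ hτ => hg τ hτ.2)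
      (fun τ hτ => hj τ (hsub hτ))).trans ?_
    gcongr
  have j1 := jumps w (ε * B + c * (ε * e)) (c * (ε * e)) (by positivity) (by positivity)
    (fun τ hτ => by
      obtain ⟨w', q1, q2⟩ := ha.velocity τ hτ
      refine ⟨w', q1, ?_⟩
      have h3 : ‖ε • V (w τ)‖ ≤ ε * B := by
        rw [norm_smul, Real.norm_eq_abs, abs_of_pos h0]
        exact mul_le_mul_of_nonneg_left (hf.field_le _ (ha.mem τ hτ)) h0.le
      have h4 := norm_add_le (w' - ε • V (w τ)) (ε • V (w τ))
      rw [sub_add_cancel] at h4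
      linarith) ha.jump
  have j2 := jumps Φ (B + c * e) (c * e) (by positivity) (by positivity)
    (fun τ hτ => by
      obtain ⟨f, q1, q2⟩ := ha.phase τ hτ
      refine ⟨f, q1, ?_⟩
      have h3 := hf.phase_le _ (ha.mem τ hτ)
      have h4 := norm_add_le (f - W (w τ)) (W (w τ))
      rw [sub_add_cancel] at h4
      linarith) ha.phase_jump
  have hst : |t - s| ≤ (2 * n + 3) * η := by
    obtain ⟨f1, f2⟩ := abs_le.1 k1
    exact abs_le.2 ⟨by linarith, by linarith⟩
  obtain ⟨o1, o2⟩ := ho.lipschitz hf h0 hs ⟨ht0, htT⟩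
  have count : (n : ℝ) + 2 ≤ (3 + 1 / h) * (1 + ε * T) := by
    have : 0 ≤ ε * T := by positivity
    have h2 : (3 + 1 / h) * (1 + ε * T) = ε * T / h + 3 + 3 * (ε * T) + 1 / h := by ring
    have h3 : 0 < 1 / h := by positivity
    linarith
  have hεη : ε * η = a * e := by rw [hη]; field_simp
  have fin : ∀ R : ℝ, 0 ≤ R → (n + 2) * C₃ * R ≤ (C₃ * (3 + 1 / h) + 1) * (R * (1 + ε * T)) := by
    intro R hR
    calc (n + 2) * C₃ * R ≤ (3 + 1 / h) * (1 + ε * T) * C₃ * R := by gcongr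
      _ = C₃ * (3 + 1 / h) * (R * (1 + ε * T)) := by ring
      _ ≤ _ := by gcongr; linarith
  refine ⟨?_, ?_⟩
  · have e1 : w t - z t = (w t - w t₁) + (w t₁ - z s) - (z t - z s) := by abel
    have sum : ‖w t - z t‖ ≤ ((ε * B + c * (ε * e)) * ((n + 2) * η)
        + c * (ε * e) * (1 + (n + 2) * η / ρ)) + C₁ * e + ε * B * ((2 * n + 3) * η) := by
      rw [e1]
      refine ((norm_sub_le _ _).trans (add_le_add (norm_add_le _ _) le_rfl)).trans ?_
      have : ε * B * |t - s| ≤ ε * B * ((2 * n + 3) * η) := by gcongr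
      linarith
    refine sum.trans (le_trans ?_ (fin e he.le))
    calc _ = (ε * η) * ((B + c * e) * (n + 2)) + c * e * ε + (ε * η) * (c * e * (n + 2) / ρ) + C₁ * e
          + (ε * η) * (B * (2 * n + 3)) := by ring
      _ = e * (a * (B + c * e) * (n + 2) + c * ε + c * a / ρ * e * (n + 2) + C₁
          + B * a * (2 * n + 3)) := by rw [hεη]; ring
      _ ≤ e * (a * (B + c * 1) * (n + 2) + c * (n + 2) + c * a / ρ * 1 * (n + 2) + C₁ * (n + 2)
          + B * a * (2 * (n + 2)) + b * (n + 2)) := by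
          have t1 : a * (B + c * e) * (n + 2) ≤ a * (B + c * 1) * (n + 2) := by gcongr
          have t2 : c * ε ≤ c * (n + 2) := by gcongr; linarith
          have t3 : c * a / ρ * e * (n + 2) ≤ c * a / ρ * 1 * (n + 2) := by gcongr
          have t4 : C₁ ≤ C₁ * (n + 2) := le_mul_of_one_le_right hC₁0 (by linarith)
          have t5 : B * a * (2 * n + 3) ≤ B * a * (2 * (n + 2)) := by gcongr; linarith
          have t6 : 0 ≤ b * (n + 2) := by positivity
          refine mul_le_mul_of_nonneg_left ?_ he.le
          linarith
      _ = (n + 2) * C₃ * e := by rw [hC₃]; ring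
  · have e1 : Φ t - ψ t = (Φ t - Φ t₁) + (Φ t₁ - ψ s) - (ψ t - ψ s) := by ring
    have sum : ‖Φ t - ψ t‖ ≤ ((B + c * e) * ((n + 2) * η)
        + c * e * (1 + (n + 2) * η / ρ)) + (n + 1) * (b * (e / ε)) + B * ((2 * n + 3) * η) := by
      rw [e1]
      refine ((norm_sub_le _ _).trans (add_le_add (norm_add_le _ _) le_rfl)).trans ?_
      have : B * |t - s| ≤ B * ((2 * n + 3) * η) := by gcongr
      linarith
    have hR : 0 ≤ e / ε := by positivity
    refine sum.trans (le_trans ?_ (fin (e / ε) hR))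
    have hce : c * e ≤ c * (e / ε) := by
      gcongr
      rw [le_div_iff₀ h0]
      exact mul_le_of_le_one_right he.le l1.le
    calc _ = c * e + (e / ε) * (a * (B + c * e) * (n + 2) + c * a / ρ * e * (n + 2)
          + (n + 1) * b + B * a * (2 * n + 3)) := by rw [hη]; ring
      _ ≤ c * (e / ε) + (e / ε) * (a * (B + c * 1) * (n + 2) + c * a / ρ * 1 * (n + 2)
          + (n + 2) * b + B * a * (2 * (n + 2))) := by
          have t1 : a * (B + c * e) * (n + 2) ≤ a * (B + c * 1) * (n + 2) := by gcongr
          have t3 : c * a / ρ * e * (n + 2) ≤ c * a / ρ * 1 * (n + 2) := by gcongr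
          have t4 : (n + 1) * b ≤ (n + 2) * b := by gcongr; norm_num
          have t5 : B * a * (2 * n + 3) ≤ B * a * (2 * (n + 2)) := by gcongr; linarith
          refine add_le_add hce (mul_le_mul_of_nonneg_left ?_ hR)
          linarith
      _ ≤ c * (e / ε) * (n + 2) + (e / ε) * (a * (B + c * 1) * (n + 2) + c * a / ρ * 1 * (n + 2)
          + (n + 2) * b + B * a * (2 * (n + 2))) + C₁ * (e / ε) * (n + 2) := by
          have t2 : c * (e / ε) ≤ c * (e / ε) * (n + 2) :=
            le_mul_of_one_le_right (by positivity) (by linarith)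
          have t6 : 0 ≤ C₁ * (e / ε) * (n + 2) := by positivity
          linarith
      _ = (n + 2) * C₃ * (e / ε) := by rw [hC₃]; ring

end

/-! ### The improved variables along a hybrid motion -/

theorem isClosed_slab (M : ℝ) : IsClosed (Slab M) := by
  have c1 : Continuous fun v : PS => v.1 := continuous_fst
  have c2 : Continuous fun v : PS => |v.2.1| := continuous_snd.fst.abs
  have c3 : Continuous fun v : PS => |v.2.2.1| := continuous_snd.snd.fst.abs
  exact (isClosed_le continuous_const c1).inter ((isClosed_le c1 continuous_const).inter
    ((isClosed_le c2 continuous_const).inter (isClosed_le c3 continuous_const)))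

section

variable {d : ℝ → ℝ} {N : ℕ} {S K : ℝ → PS → ℝ} {ε T M ρ : ℝ} {G : Set ℝ} {γ : ℝ → PS}

theorem HybridMotion.eventually_mem (h : HybridMotion d ε T M ρ G γ) {τ : ℝ}
    (hτ : τ ∈ Set.Ioo 0 T) : (∀ᶠ t in 𝓝[<] τ, t ∈ G) ∧ ∀ᶠ t in 𝓝[>] τ, t ∈ G := by
  have h1 : ∀ᶠ t in 𝓝 τ, t ∉ (Set.Icc 0 T \ G) \ {τ} :=
    (h.finite.sdiff.isClosed.isOpen_compl).mem_nhds (by simp)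
  have h2 : ∀ᶠ t in 𝓝 τ, t ∈ Set.Icc 0 T := Icc_mem_nhds hτ.1 hτ.2
  have h3 : ∀ᶠ t in 𝓝 τ, t ≠ τ → t ∈ G := by
    filter_upwards [h1, h2] with t h1 h2 hne
    by_contra hc
    exact h1 ⟨⟨h2, hc⟩, hne⟩
  refine ⟨?_, ?_⟩
  · filter_upwards [nhdsWithin_le_nhds h3, self_mem_nhdsWithin] with t ht h using ht (ne_of_lt h)
  · filter_upwards [nhdsWithin_le_nhds h3, self_mem_nhdsWithin] with t ht h using ht (ne_of_gt h)

theorem HybridMotion.limit_mem (h : HybridMotion d ε T M ρ G γ) (hd : IsProfile d) (hM : 0 < M)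
    {l : Filter ℝ} [l.NeBot] (hl : ∀ᶠ t in l, t ∈ G) {v : PS} (hv : Filter.Tendsto γ l (𝓝 v)) :
    v ∈ Slab M ∧ hatH d ε v = 0 := by
  have h1 : v ∈ Slab M := (isClosed_slab M).mem_of_tendsto hv (hl.mono fun t ht => h.slab t ht)
  refine ⟨h1, ?_⟩
  have h2 := ((hd.poly_hatH.differentiableAt ε (Slab.pos hM h1)).continuousAt.tendsto.comp hv)
  exact tendsto_nhds_unique h2 (tendsto_const_nhds.congr' (hl.mono fun t ht => (h.energy t ht).symm))

theorem tendsto_newPoint (hl : ∀ v ∈ Slab M, ∀ w ∈ Slab M,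
    ‖newPoint S M ε v - newPoint S M ε w‖ ≤ 2 * ‖v - w‖) {l : Filter ℝ} {v : PS}
    (hγ : ∀ᶠ t in l, γ t ∈ Slab M) (hv : v ∈ Slab M) (h : Filter.Tendsto γ l (𝓝 v)) :
    Filter.Tendsto (fun t => newPoint S M ε (γ t)) l (𝓝 (newPoint S M ε v)) := by
  rw [tendsto_iff_norm_sub_tendsto_zero] at h ⊢
  refine squeeze_zero' (Filter.Eventually.of_forall fun t => norm_nonneg _)
    (hγ.mono fun t ht => hl _ ht v hv) ?_
  simpa using h.const_mul 2

theorem IsPoly.continuousAt {F : ℝ → PS → ℝ} (hF : IsPoly F) (ε : ℝ) {v : PS} (hv : 0 < v.1) :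
    ContinuousAt (F ε) v := (hF.differentiableAt ε hv).continuousAt

theorem continuousAt_shiftPoint (hS : IsPoly S) (ε : ℝ) {v : PS} (hv : 0 < v.1) :
    ContinuousAt (shiftPoint S ε) v := by
  have h := (hS.dirD (0, 0, 1, 0)).continuousAt ε hv
  exact continuousAt_fst.prodMk (continuousAt_snd.fst.prodMk (continuousAt_snd.snd.fst.prodMk
    (continuousAt_snd.snd.snd.add (h.const_mul (ε ^ 2)))))

/-- The changes of the improved variables at a reflection. -/
theorem HybridMotion.improved_jump (h : IsNormalForm d N S K) (hd : IsProfile d) (hM : 1 ≤ M) :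
    ∃ C ε₀ : ℝ, 0 < C ∧ 0 < ε₀ ∧ ∀ (ε T ρ : ℝ) (G : Set ℝ) (γ : ℝ → PS), 0 < ε → ε < ε₀ →
      HybridMotion d ε T M ρ G γ → ∀ τ ∈ Set.Ioo 0 T \ G, ∃ m n : PS, 0 < m.1 ∧ 0 < n.1 ∧
        Filter.Tendsto (fun t => newPoint S M ε (γ t)) (𝓝[<] τ) (𝓝 m) ∧
        Filter.Tendsto (fun t => newPoint S M ε (γ t)) (𝓝[>] τ) (𝓝 n) ∧
        |n.1 - m.1| ≤ C * ε ^ (N + 1) ∧ |n.2.2.1 - m.2.2.1| ≤ C * ε ^ (N + 2) ∧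
        |(shiftPoint S ε n).2.2.2 - (shiftPoint S ε m).2.2.2| ≤ C * ε ^ (N + 2) ∧
        |ε * DI S ε n - ε * DI S ε m| ≤ C * ε ^ (N + 2) := by
  obtain ⟨C₁, ε₁, hC₁, hε₁, b₁⟩ := h.reflection hd hM
  obtain ⟨C₂, ε₂, -, hε₂, b₂⟩ := newPoint_spec h.polyS hM
  have hM0 : 0 < M := by linarith
  refine ⟨C₁, min ε₁ ε₂, hC₁, by positivity, ?_⟩
  intro ε T ρ G γ h0 h1 hm τ hτ
  have m1 : ε < ε₁ := h1.trans_le (min_le_left _ _)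
  have m2 : ε < ε₂ := h1.trans_le (min_le_right _ _)
  obtain ⟨v, w, lv, lw, hvw⟩ := hm.jump τ hτ
  obtain ⟨el, er⟩ := hm.eventually_mem hτ.1
  obtain ⟨sv, hv⟩ := hm.limit_mem hd hM0 el lv
  obtain ⟨sw, hw⟩ := hm.limit_mem hd hM0 er lw
  have lip : ∀ v ∈ Slab M, ∀ w ∈ Slab M,
      ‖newPoint S M ε v - newPoint S M ε w‖ ≤ 2 * ‖v - w‖ := fun v hv =>
    (b₂ ε h0 m2 v hv).2.2.2.2.2.2
  have tv := tendsto_newPoint lip (el.mono fun t ht => hm.slab t ht) sv lv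
  have tw := tendsto_newPoint lip (er.mono fun t ht => hm.slab t ht) sw lw
  have pv := Slab.pos (by linarith) (b₂ ε h0 m2 v sv).1
  have pw := Slab.pos (by linarith) (b₂ ε h0 m2 w sw).1
  refine ⟨_, _, pv, pw, tv, tw, ?_⟩
  rcases hvw with e | ⟨a1, a2, a3⟩
  · subst e
    simp only [sub_self, abs_zero]
    exact ⟨by positivity, by positivity, by positivity, by positivity⟩
  · obtain ⟨r1, r2, r3, r4⟩ := b₁ ε h0 m1 v sv w sw a1 a2 a3 hv hw
    exact ⟨by rwa [abs_sub_comm], by rwa [abs_sub_comm], by rwa [abs_sub_comm],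
      by rwa [abs_sub_comm]⟩

/-- The drift of the improved action. -/
theorem HybridMotion.action_drift (h : IsNormalForm d N S K) (hd : IsProfile d) (hM : 1 ≤ M)
    (hρ : 0 < ρ) :
    ∃ C ε₀ : ℝ, 0 < C ∧ 0 < ε₀ ∧ ∀ (ε T : ℝ) (G : Set ℝ) (γ : ℝ → PS), 0 < ε → ε < ε₀ →
      HybridMotion d ε T M ρ G γ → ∀ t ∈ G,
        |(newPoint S M ε (γ t)).1 - (newPoint S M ε (γ 0)).1| ≤ C * ε ^ (N + 1) * (1 + T) := by
  obtain ⟨C₁, ε₁, hC₁, hε₁, b₁⟩ := h.motion hd hM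
  obtain ⟨C₂, ε₂, hC₂, hε₂, b₂⟩ := HybridMotion.improved_jump h hd hM
  refine ⟨C₁ + C₂ + C₂ / ρ, min ε₁ ε₂, by positivity, by positivity, ?_⟩
  intro ε T G γ h0 h1 hm t ht
  have m1 : ε < ε₁ := h1.trans_le (min_le_left _ _)
  have m2 : ε < ε₂ := h1.trans_le (min_le_right _ _)
  obtain ⟨t0, tT⟩ := hm.sub ht
  have hsub : Set.Ioo 0 t \ G ⊆ Set.Ioo 0 T \ G := fun τ hτ => ⟨⟨hτ.1.1, hτ.1.2.trans_le tT⟩, hτ.2⟩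
  have hsub' : Set.Ioo 0 t \ G ⊆ Set.Icc 0 T \ G := fun τ hτ =>
    ⟨Set.Ioo_subset_Icc_self (hsub hτ).1, hτ.2⟩
  have := piecewise_drift (g := fun t => (newPoint S M ε (γ t)).1) (A := C₁ * ε ^ (N + 1))
    (B := C₂ * ε ^ (N + 1)) hm.start ht t0 (hm.finite.subset hsub') (by positivity) hρ
    (fun τ hτ τ' hτ' => hm.sep τ (hsub' hτ) τ' (hsub' hτ'))
    (fun z hz => by
      obtain ⟨a, q, x, f, d1, -, -, -, e1, -⟩ := b₁ ε h0 m1 γ G z hz.2 hm.slab (hm.velocity z hz.2)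
      exact ⟨a, d1, e1⟩)
    (fun τ hτ => by
      obtain ⟨m, n, -, -, l1, l2, j1, -⟩ := b₂ ε T ρ G γ h0 m2 hm τ (hsub hτ)
      exact ⟨m.1, n.1, (continuous_fst.tendsto m).comp l1, (continuous_fst.tendsto n).comp l2, j1⟩)
  refine this.trans ?_
  rw [sub_zero]
  have hT : 0 ≤ T := t0.trans tT
  calc C₁ * ε ^ (N + 1) * t + C₂ * ε ^ (N + 1) * (1 + t / ρ)
      ≤ C₁ * ε ^ (N + 1) * T + C₂ * ε ^ (N + 1) * (1 + T / ρ) := by gcongr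
    _ = (C₁ * T + C₂ + C₂ / ρ * T) * ε ^ (N + 1) := by ring
    _ ≤ (C₁ * T + C₂ + C₂ / ρ * T + (C₁ + C₂ / ρ + C₂ * T)) * ε ^ (N + 1) := by
        have : 0 ≤ C₁ + C₂ / ρ + C₂ * T := by positivity
        exact mul_le_mul_of_nonneg_right (by linarith) (by positivity)
    _ = _ := by ring

end

/-! ### The averaged Hamiltonian on the plane of the momentum and the slow coordinate -/

/-- The Hamiltonian vector field of `K` at the value `J` of the action. -/
def planeV (K : ℝ → PS → ℝ) (ε J : ℝ) (z : ℝ × ℝ) : ℝ × ℝ :=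
  (-DX K ε (J, 0, z.1, z.2), DP K ε (J, 0, z.1, z.2))

theorem norm_planeEmb (J : ℝ) (z w : ℝ × ℝ) :
    ‖((J, 0, z.1, z.2) : PS) - (J, 0, w.1, w.2)‖ = ‖z - w‖ := by
  simp [Prod.norm_def]

/-- The values of the action and the momentum in `Slab M`. -/
def PlaneStrip (M : ℝ) : Set (ℝ × ℝ) := {z | |z.1| ≤ M}

theorem mem_slab_plane {M J : ℝ} (hM : 0 < M) (h1 : M⁻¹ ≤ J) (h2 : J ≤ M) {z : ℝ × ℝ}
    (hz : z ∈ PlaneStrip M) : ((J, 0, z.1, z.2) : PS) ∈ Slab M :=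
  ⟨h1, h2, by simpa using hM.le, hz⟩

/-- Everything follows from bounds on slabs, uniformly in `X`, `ε` and the frozen action. The
quadratic estimate is the mean value inequality for a function with Lipschitz gradient, valid since
the strip is convex. -/
theorem IsPoly.planeField {K : ℝ → PS → ℝ} (hK : IsPoly K) {M : ℝ} (hM : 0 < M) :
    ∃ B Λ : ℝ, 0 < B ∧ 0 < Λ ∧ ∀ ε J : ℝ, |ε| ≤ 1 → M⁻¹ ≤ J → J ≤ M →
      PlaneField (PlaneStrip M) (planeV K ε J) (fun z => K ε (J, 0, z.1, z.2))
        (fun z => DI K ε (J, 0, z.1, z.2)) B Λ := by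
  obtain ⟨B₁, p₁, b₁⟩ := (hK.dirD (1, 0, 0, 0)).bound hM
  obtain ⟨B₂, p₂, b₂⟩ := (hK.dirD (0, 0, 1, 0)).bound hM
  obtain ⟨B₃, p₃, b₃⟩ := (hK.dirD (0, 0, 0, 1)).bound hM
  obtain ⟨Λ₁, q₁, l₁⟩ := (hK.dirD (1, 0, 0, 0)).lipschitz hM
  obtain ⟨Λ₂, q₂, l₂⟩ := (hK.dirD (0, 0, 1, 0)).lipschitz hM
  obtain ⟨Λ₃, q₃, l₃⟩ := (hK.dirD (0, 0, 0, 1)).lipschitz hM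
  refine ⟨B₁ + B₂ + B₃ + 1, Λ₁ + Λ₂ + Λ₃ + 1, by positivity, by positivity, ?_⟩
  intro ε J hε h1 h2
  have hs : ∀ z ∈ PlaneStrip M, ((J, 0, z.1, z.2) : PS) ∈ Slab M := fun z hz =>
    mem_slab_plane hM h1 h2 hz
  have hJ : 0 < J := (inv_pos.2 hM).trans_le h1
  have L1 : ∀ z ∈ PlaneStrip M, ∀ w ∈ PlaneStrip M,
      |DI K ε (J, 0, z.1, z.2) - DI K ε (J, 0, w.1, w.2)| ≤ Λ₁ * ‖z - w‖ := fun z hz w hw => by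
    rw [← norm_planeEmb J]; exact l₁ ε hε _ (hs z hz) _ (hs w hw)
  have L2 : ∀ z ∈ PlaneStrip M, ∀ w ∈ PlaneStrip M,
      |DP K ε (J, 0, z.1, z.2) - DP K ε (J, 0, w.1, w.2)| ≤ Λ₂ * ‖z - w‖ := fun z hz w hw => by
    rw [← norm_planeEmb J]; exact l₂ ε hε _ (hs z hz) _ (hs w hw)
  have L3 : ∀ z ∈ PlaneStrip M, ∀ w ∈ PlaneStrip M,
      |DX K ε (J, 0, z.1, z.2) - DX K ε (J, 0, w.1, w.2)| ≤ Λ₃ * ‖z - w‖ := fun z hz w hw => by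
    rw [← norm_planeEmb J]; exact l₃ ε hε _ (hs z hz) _ (hs w hw)
  refine ⟨fun z hz => ?_, fun z hz w hw => ?_, fun z hz => ?_, fun z hz w hw => ?_,
    fun z hz w hw => ?_⟩
  · rw [planeV, Prod.norm_def]
    refine max_le ?_ ?_
    · simp only [norm_neg]
      exact (b₃ ε hε _ (hs z hz)).trans (by linarith)
    · exact (b₂ ε hε _ (hs z hz)).trans (by linarith)
  · have h0 := norm_nonneg (z - w)
    rw [planeV, planeV, Prod.norm_def]
    refine max_le ?_ ?_
    · simp only [Prod.fst_sub, Real.norm_eq_abs]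
      rw [neg_sub_neg, abs_sub_comm]
      exact (L3 z hz w hw).trans (by gcongr; linarith)
    · exact (L2 z hz w hw).trans (by gcongr; linarith)
  · exact (b₁ ε hε _ (hs z hz)).trans (by linarith)
  · exact (L1 z hz w hw).trans (by gcongr; linarith)
  · -- second order Taylor estimate
    have conv : Convex ℝ (PlaneStrip M) := by
      have : PlaneStrip M = (ContinuousLinearMap.fst ℝ ℝ ℝ) ⁻¹' Set.Icc (-M) M := by
        ext z; simp [PlaneStrip, abs_le]
      rw [this]
      exact (convex_Icc (-M) M).is_linear_preimage (ContinuousLinearMap.fst ℝ ℝ ℝ).isLinear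
    set φ : ℝ × ℝ → (ℝ × ℝ →L[ℝ] ℝ) := fun z =>
      DP K ε (J, 0, z.1, z.2) • ContinuousLinearMap.fst ℝ ℝ ℝ
        + DX K ε (J, 0, z.1, z.2) • ContinuousLinearMap.snd ℝ ℝ ℝ with hφ
    have hder : ∀ y ∈ segment ℝ z w, HasFDerivWithinAt (fun z : ℝ × ℝ => K ε (J, 0, z.1, z.2)) (φ y)
        (segment ℝ z w) y := by
      intro y _
      have h3 : HasFDerivAt (fun z : ℝ × ℝ => ((J, 0, z.1, z.2) : PS))
          ((0 : ℝ × ℝ →L[ℝ] ℝ).prod ((0 : ℝ × ℝ →L[ℝ] ℝ).prod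
            ((ContinuousLinearMap.fst ℝ ℝ ℝ).prod (ContinuousLinearMap.snd ℝ ℝ ℝ)))) y :=
        (hasFDerivAt_const J y).prodMk ((hasFDerivAt_const (0 : ℝ) y).prodMk
          (hasFDerivAt_fst.prodMk hasFDerivAt_snd))
      have h4 := ((hK.differentiableAt ε (v := (J, 0, y.1, y.2)) hJ).hasFDerivAt.comp y h3)
      refine (h4.congr_fderiv ?_).hasFDerivWithinAt
      refine ContinuousLinearMap.ext fun u => ?_
      have h5 : fderiv ℝ (K ε) (J, 0, y.1, y.2) (0, 0, u.1, u.2) = φ y u := by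
        rw [clm_apply_eq]
        simp only [hφ, zero_mul, zero_add, add_apply, smul_apply,
          ContinuousLinearMap.coe_fst', ContinuousLinearMap.coe_snd', smul_eq_mul]
        exact congrArg₂ (· + ·) (mul_comm _ _) (mul_comm _ _)
      exact h5
    have hsub : segment ℝ z w ⊆ PlaneStrip M := conv.segment_subset hz hw
    have bound : ∀ y ∈ segment ℝ z w, ‖φ y - φ z‖ ≤ (Λ₁ + Λ₂ + Λ₃ + 1) * ‖w - z‖ := by
      intro y hy
      have h5 : ‖y - z‖ ≤ ‖w - z‖ := norm_sub_le_of_mem_segment hy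
      refine ContinuousLinearMap.opNorm_le_bound _ (by positivity) fun u => ?_
      have h6 : (φ y - φ z) u = (DP K ε (J, 0, y.1, y.2) - DP K ε (J, 0, z.1, z.2)) * u.1
          + (DX K ε (J, 0, y.1, y.2) - DX K ε (J, 0, z.1, z.2)) * u.2 := by
        simp [hφ]; ring
      rw [h6, Real.norm_eq_abs]
      refine (abs_add_le _ _).trans ?_
      rw [abs_mul, abs_mul]
      have u1 : |u.1| ≤ ‖u‖ := norm_fst_le u
      have u2 : |u.2| ≤ ‖u‖ := norm_snd_le u
      have h7 := (L2 y (hsub hy) z hz).trans (mul_le_mul_of_nonneg_left h5 q₂)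
      have h8 := (L3 y (hsub hy) z hz).trans (mul_le_mul_of_nonneg_left h5 q₃)
      calc _ ≤ Λ₂ * ‖w - z‖ * ‖u‖ + Λ₃ * ‖w - z‖ * ‖u‖ := by gcongr
        _ = (Λ₂ + Λ₃) * ‖w - z‖ * ‖u‖ := by ring
        _ ≤ _ := mul_le_mul_of_nonneg_right (mul_le_mul_of_nonneg_right (by linarith)
          (norm_nonneg _)) (norm_nonneg _)
    have := Convex.norm_image_sub_le_of_norm_hasFDerivWithin_le' hder bound (convex_segment z w)
      (left_mem_segment ℝ z w) (right_mem_segment ℝ z w)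
    rw [pow_two, ← mul_assoc]
    refine le_trans (le_of_eq ?_) this
    rw [Real.norm_eq_abs]
    congr 1
    simp [hφ, planeV]

section

variable {d : ℝ → ℝ} {N : ℕ} {S K : ℝ → PS → ℝ} {ε T M ρ : ℝ} {G : Set ℝ} {γ : ℝ → PS}

/-- The variables `(p, X)` of a point after the change of variables. -/
def planePoint (S : ℝ → PS → ℝ) (M ε : ℝ) (v : PS) : ℝ × ℝ :=
  ((newPoint S M ε v).2.2.1, (shiftPoint S ε (newPoint S M ε v)).2.2.2)

/-- The improved variables along a hybrid motion form an approximate orbit of the averaged system. -/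
theorem HybridMotion.approxOrbit (h : IsNormalForm d N S K) (hd : IsProfile d) (hM : 1 ≤ M)
    {c₁ : ℝ} (hc₁ : 0 < c₁) :
    ∃ c ε₀ : ℝ, 0 < c ∧ 0 < ε₀ ∧ ∀ (ε T ρ κ : ℝ) (G : Set ℝ) (γ : ℝ → PS) (φ : ℝ → ℝ), 0 < ε →
      ε < ε₀ → HybridMotion d ε T M ρ G γ →
      (∀ t ∈ G, |(newPoint S M ε (γ t)).1 - (newPoint S M ε (γ 0)).1| ≤ c₁ * ε ^ (N + 1)) →
      ContinuousOn φ (Set.Icc 0 T) →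
      (∀ t ∈ G, ∃ k : ℝ, ∀ᶠ τ in 𝓝[G] t, φ τ = (γ τ).2.1 + k) →
      (∀ t ∈ G, κ ≤ ‖planeV K ε (newPoint S M ε (γ 0)).1 (planePoint S M ε (γ t))‖) →
      ApproxOrbit (PlaneStrip (2 * M)) (planeV K ε (newPoint S M ε (γ 0)).1)
        (fun z => K ε ((newPoint S M ε (γ 0)).1, 0, z.1, z.2))
        (fun z => DI K ε ((newPoint S M ε (γ 0)).1, 0, z.1, z.2)) ε (ε ^ (N + 1)) c ρ κ T G
        (fun t => planePoint S M ε (γ t)) (fun t => φ t + ε * DI S ε (newPoint S M ε (γ t))) := by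
  have hM2 : 0 < 2 * M := by linarith
  obtain ⟨C₁, ε₁, hC₁, hε₁, b₁⟩ := h.motion hd hM
  obtain ⟨C₂, ε₂, hC₂, hε₂, b₂⟩ := HybridMotion.improved_jump h hd hM
  obtain ⟨C₃, ε₃, hC₃, hε₃, b₃⟩ := h.energy hd hM
  obtain ⟨C₄, ε₄, -, hε₄, b₄⟩ := newPoint_spec h.polyS hM
  obtain ⟨Λ₀, q₀, l₀⟩ := h.polyK.lipschitz hM2
  obtain ⟨Λ₁, q₁, l₁⟩ := (h.polyK.dirD (1, 0, 0, 0)).lipschitz hM2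
  obtain ⟨Λ₂, q₂, l₂⟩ := (h.polyK.dirD (0, 0, 1, 0)).lipschitz hM2
  obtain ⟨Λ₃, q₃, l₃⟩ := (h.polyK.dirD (0, 0, 0, 1)).lipschitz hM2
  refine ⟨C₁ + C₂ + C₃ + (Λ₀ + Λ₁ + Λ₂ + Λ₃) * c₁, min (min ε₁ ε₂) (min (min ε₃ ε₄) 1),
    by positivity, by positivity, ?_⟩
  intro ε T ρ κ G γ φ h0 h1 hm hA hφ hφ' hκ
  have m1 : ε < ε₁ := h1.trans_le ((min_le_left _ _).trans (min_le_left _ _))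
  have m2 : ε < ε₂ := h1.trans_le ((min_le_left _ _).trans (min_le_right _ _))
  have m3 : ε < ε₃ :=
    h1.trans_le ((min_le_right _ _).trans ((min_le_left _ _).trans (min_le_left _ _)))
  have m4 : ε < ε₄ :=
    h1.trans_le ((min_le_right _ _).trans ((min_le_left _ _).trans (min_le_right _ _)))
  have m5 : ε < 1 := h1.trans_le ((min_le_right _ _).trans (min_le_right _ _))
  have hε : |ε| ≤ 1 := by rw [abs_of_pos h0]; exact m5.le
  set J := (newPoint S M ε (γ 0)).1 with hJ
  set m : ℝ → PS := fun t => newPoint S M ε (γ t) with hmdef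
  set c := C₁ + C₂ + C₃ + (Λ₀ + Λ₁ + Λ₂ + Λ₃) * c₁ with hc
  have hslab : ∀ t ∈ G, m t ∈ Slab (2 * M) := fun t ht => (b₄ ε h0 m4 _ (hm.slab t ht)).1
  have hJslab := hslab 0 hm.start
  have hJpos : 0 < J := Slab.pos hM2 hJslab
  have z1 : |(0 : ℝ)| ≤ 2 * M := by rw [abs_zero]; exact hM2.le
  have point : ∀ t ∈ G, ((J, 0, (planePoint S M ε (γ t)).1, (planePoint S M ε (γ t)).2) : PS)
      ∈ Slab (2 * M) := fun t ht => ⟨hJslab.1, hJslab.2.1, z1, (hslab t ht).2.2.2⟩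
  have point' : ∀ t ∈ G, (((m t).1, 0, (planePoint S M ε (γ t)).1, (planePoint S M ε (γ t)).2) : PS)
      ∈ Slab (2 * M) := fun t ht => ⟨(hslab t ht).1, (hslab t ht).2.1, z1, (hslab t ht).2.2.2⟩
  have dist : ∀ t ∈ G, ‖(((m t).1, 0, (planePoint S M ε (γ t)).1, (planePoint S M ε (γ t)).2) : PS)
      - (J, 0, (planePoint S M ε (γ t)).1, (planePoint S M ε (γ t)).2)‖ ≤ c₁ * ε ^ (N + 1) := by
    intro t ht
    have : 0 ≤ c₁ * ε ^ (N + 1) := by positivity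
    refine PS.norm_le (hA t ht) ?_ ?_ ?_ <;> simpa using this
  have hsp : ∀ t, 0 < (m t).1 → 0 < (shiftPoint S ε (m t)).1 := fun t ht => ht
  -- Freezing the action at its initial value costs as much as the action drifts, which by
  -- hypothesis has the same order as the other errors.
  have move : ∀ (F : PS) (Λ : ℝ), (∀ ε : ℝ, |ε| ≤ 1 → ∀ v ∈ Slab (2 * M), ∀ w ∈ Slab (2 * M),
      |dirD F K ε v - dirD F K ε w| ≤ Λ * ‖v - w‖) → 0 ≤ Λ → ∀ t ∈ G,
      |dirD F K ε (shiftPoint S ε (m t)) - dirD F K ε (J, 0, (planePoint S M ε (γ t)).1,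
        (planePoint S M ε (γ t)).2)| ≤ Λ * c₁ * ε ^ (N + 1) := by
    intro F Λ hl hΛ t ht
    rw [h.dirD_ang F ε (hsp t (Slab.pos hM2 (hslab t ht))) 0, mul_assoc]
    exact (hl ε hε _ (point' t ht) _ (point t ht)).trans
      (mul_le_mul_of_nonneg_left (dist t ht) hΛ)
  have epos : 0 < ε ^ (N + 1) := by positivity
  have e2 : ε ^ (N + 2) = ε * ε ^ (N + 1) := by ring
  have cs : 0 ≤ Λ₀ * c₁ ∧ 0 ≤ Λ₁ * c₁ ∧ 0 ≤ Λ₂ * c₁ ∧ 0 ≤ Λ₃ * c₁ :=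
    ⟨by positivity, by positivity, by positivity, by positivity⟩
  obtain ⟨cs0, cs1, cs2, cs3⟩ := cs
  have hc' : c = C₁ + C₂ + C₃ + Λ₀ * c₁ + Λ₁ * c₁ + Λ₂ * c₁ + Λ₃ * c₁ := by rw [hc]; ring
  refine ⟨hm.sub, hm.start, hm.finite, hm.sep, fun t ht => (hslab t ht).2.2.2, fun t ht => ?_,
    fun τ hτ => ?_, fun t ht => ?_, fun τ hτ => ?_, fun t ht => ?_, hκ⟩
  · obtain ⟨a, q, x, f, -, d2, d3, -, -, v2, v3, -⟩ :=
      b₁ ε h0 m1 γ G t ht hm.slab (hm.velocity t ht)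
    refine ⟨(q, x), d2.prodMk d3, ?_⟩
    have n2 := move _ _ l₂ q₂ t ht
    have n3 := move _ _ l₃ q₃ t ht
    rw [Prod.norm_def]
    refine max_le ?_ ?_
    · simp only [planeV, Prod.smul_mk, Prod.fst_sub, smul_eq_mul, Real.norm_eq_abs]
      have : ∀ A B : ℝ, q - ε * -A = (q + ε * B) - ε * (B - A) := fun A B => by ring
      rw [this _ (DX K ε (shiftPoint S ε (m t)))]
      refine (abs_sub _ _).trans ?_
      rw [abs_mul, abs_of_pos h0]
      calc _ ≤ C₁ * ε ^ (N + 2) + ε * (Λ₃ * c₁ * ε ^ (N + 1)) :=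
            add_le_add v2 (mul_le_mul_of_nonneg_left n3 h0.le)
        _ = (C₁ + Λ₃ * c₁) * (ε * ε ^ (N + 1)) := by rw [e2]; ring
        _ ≤ _ := mul_le_mul_of_nonneg_right (by linarith) (by positivity)
    · simp only [planeV, Prod.smul_mk, Prod.snd_sub, smul_eq_mul, Real.norm_eq_abs]
      have : ∀ A B : ℝ, x - ε * A = (x - ε * B) + ε * (B - A) := fun A B => by ring
      rw [this _ (DP K ε (shiftPoint S ε (m t)))]
      refine (abs_add_le _ _).trans ?_
      rw [abs_mul, abs_of_pos h0]
      calc _ ≤ C₁ * ε ^ (N + 2) + ε * (Λ₂ * c₁ * ε ^ (N + 1)) :=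
            add_le_add v3 (mul_le_mul_of_nonneg_left n2 h0.le)
        _ = (C₁ + Λ₂ * c₁) * (ε * ε ^ (N + 1)) := by rw [e2]; ring
        _ ≤ _ := mul_le_mul_of_nonneg_right (by linarith) (by positivity)
  · obtain ⟨v, w, pv, pw, t1, t2, -, j2, j3, -⟩ := b₂ ε T ρ G γ h0 m2 hm τ hτ
    have cont : ∀ v : PS, 0 < v.1 → ContinuousAt (fun n : PS =>
        ((n.2.2.1, (shiftPoint S ε n).2.2.2) : ℝ × ℝ)) v := fun v hv =>
      continuousAt_snd.snd.fst.prodMk (continuousAt_shiftPoint h.polyS ε hv).snd.snd.snd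
    refine ⟨_, _, (cont v pv).tendsto.comp t1, (cont w pw).tendsto.comp t2, ?_⟩
    rw [Prod.norm_def]
    refine max_le ?_ ?_
    · refine j2.trans ?_
      rw [e2]
      exact mul_le_mul_of_nonneg_right (by linarith) (by positivity)
    · refine j3.trans ?_
      rw [e2]
      exact mul_le_mul_of_nonneg_right (by linarith) (by positivity)
  · obtain ⟨a, q, x, f, -, -, -, d4, -, -, -, v4⟩ :=
      b₁ ε h0 m1 γ G t ht hm.slab (hm.velocity t ht)
    obtain ⟨k, hk⟩ := hφ' t ht
    have n1 := move _ _ l₁ q₁ t ht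
    refine ⟨f, ?_, ?_⟩
    -- The change of variables keeps the angle, and the phase differs from the angle by a locally
    -- constant multiple of the period, so both have the same velocity.
    · have hu : ∀ τ ∈ G, (m τ).2.1 = (γ τ).2.1 := fun τ hτ =>
        (b₄ ε h0 m4 _ (hm.slab τ hτ)).2.2.2.2.1
      refine (d4.add_const k).congr_of_eventuallyEq ?_ ?_
      · filter_upwards [hk, self_mem_nhdsWithin] with τ h1 h2
        rw [h1, ← hu τ h2]; ring
      · rw [hk.self_of_nhdsWithin ht, ← hu t ht]; ring
    · rw [Real.norm_eq_abs]
      have : ∀ A B : ℝ, f - A = (f - B) + (B - A) := fun A B => by ring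
      rw [this _ (DI K ε (shiftPoint S ε (m t)))]
      refine (abs_add_le _ _).trans ?_
      calc _ ≤ C₁ * ε ^ (N + 1) + Λ₁ * c₁ * ε ^ (N + 1) := add_le_add v4 n1
        _ = (C₁ + Λ₁ * c₁) * ε ^ (N + 1) := by ring
        _ ≤ _ := mul_le_mul_of_nonneg_right (by linarith) (by positivity)
  · obtain ⟨v, w, pv, pw, t1, t2, -, -, -, j4⟩ := b₂ ε T ρ G γ h0 m2 hm τ hτ
    have cont : ∀ v : PS, 0 < v.1 → ContinuousAt (fun n : PS => ε * DI S ε n) v := fun v hv =>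
      ((h.polyS.dirD (1, 0, 0, 0)).continuousAt ε hv).const_mul ε
    have hφτ : Filter.Tendsto φ (𝓝 τ) (𝓝 (φ τ)) :=
      (hφ τ (Set.Ioo_subset_Icc_self hτ.1)).continuousAt (Icc_mem_nhds hτ.1.1 hτ.1.2)
    refine ⟨_, _, (hφτ.mono_left nhdsWithin_le_nhds).add ((cont v pv).tendsto.comp t1),
      (hφτ.mono_left nhdsWithin_le_nhds).add ((cont w pw).tendsto.comp t2), ?_⟩
    rw [add_sub_add_left_eq_sub, Real.norm_eq_abs]
    refine j4.trans ?_
    calc C₂ * ε ^ (N + 2) = C₂ * ε ^ (N + 1) * ε := by ring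
      _ ≤ C₂ * ε ^ (N + 1) * 1 := by gcongr
      _ = C₂ * ε ^ (N + 1) := mul_one _
      _ ≤ _ := mul_le_mul_of_nonneg_right (by linarith) (by positivity)
  · have n0 := b₃ ε h0 m3 _ (hm.slab t ht) (hm.energy t ht)
    rw [h.K_ang ε (hsp t (Slab.pos hM2 (hslab t ht))) 0] at n0
    have n1 := (l₀ ε hε _ (point' t ht) _ (point t ht)).trans
      (mul_le_mul_of_nonneg_left (dist t ht) q₀)
    have n2 : |K ε ((m t).1, 0, (planePoint S M ε (γ t)).1, (planePoint S M ε (γ t)).2)|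
      ≤ C₃ * ε ^ (N + 1) := n0
    have := abs_sub (K ε ((m t).1, 0, (planePoint S M ε (γ t)).1, (planePoint S M ε (γ t)).2))
      (K ε ((m t).1, 0, (planePoint S M ε (γ t)).1, (planePoint S M ε (γ t)).2)
        - K ε (J, 0, (planePoint S M ε (γ t)).1, (planePoint S M ε (γ t)).2))
    rw [sub_sub_cancel] at this
    calc _ ≤ C₃ * ε ^ (N + 1) + Λ₀ * (c₁ * ε ^ (N + 1)) := this.trans (add_le_add n2 n1)
      _ = (C₃ + Λ₀ * c₁) * ε ^ (N + 1) := by ring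
      _ ≤ _ := mul_le_mul_of_nonneg_right (by linarith) (by positivity)

/-- The leading terms of the averaged Hamiltonian and of its derivatives. -/
theorem IsNormalForm.leading (h : IsNormalForm d N S K) (hd : IsProfile d) {M : ℝ} (hM : 0 < M) :
    ∃ B : ℝ, 0 < B ∧ ∀ ε J : ℝ, 0 < ε → ε ≤ 1 → M⁻¹ ≤ J → J ≤ M → ∀ z ∈ PlaneStrip M,
      |K ε (J, 0, z.1, z.2) - (twoU d J z.2 + z.1 ^ 2 - 1)| ≤ B * ε ∧
      |DP K ε (J, 0, z.1, z.2) - 2 * z.1| ≤ B * ε ∧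
      |DX K ε (J, 0, z.1, z.2) - deriv (twoU d J) z.2| ≤ B * ε := by
  obtain ⟨K₁, hK₁, e⟩ := h.K_lead
  obtain ⟨B₁, p₁, b₁⟩ := hK₁.bound hM
  obtain ⟨B₂, p₂, b₂⟩ := (hK₁.dirD (0, 0, 1, 0)).bound hM
  obtain ⟨B₃, p₃, b₃⟩ := (hK₁.dirD (0, 0, 0, 1)).bound hM
  refine ⟨B₁ + B₂ + B₃ + 1, by positivity, ?_⟩
  intro ε J h0 h1 hJ1 hJ2 z hz
  have hJ : 0 < J := (inv_pos.2 hM).trans_le hJ1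
  have hε : |ε| ≤ 1 := by rwa [abs_of_pos h0]
  have hs : ((J, 0, z.1, z.2) : PS) ∈ Slab M := mem_slab_plane hM hJ1 hJ2 hz
  have hp : 0 < ((J, 0, z.1, z.2) : PS).1 := hJ
  have fin : ∀ A : ℝ, |A| ≤ B₁ + B₂ + B₃ → |ε * A| ≤ (B₁ + B₂ + B₃ + 1) * ε := fun A hA => by
    rw [abs_mul, abs_of_pos h0, mul_comm]
    exact mul_le_mul_of_nonneg_right (by linarith) h0.le
  refine ⟨?_, ?_, ?_⟩
  · rw [e ε _ hp, twoU, add_sub_cancel_left]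
    exact fin _ ((b₁ ε hε _ hs).trans (by linarith))
  · have d1 := hasDerivAt_mom (h.polyK.differentiableAt ε hp)
    have d2 := hasDerivAt_mom (hK₁.differentiableAt ε hp)
    have d3 : HasDerivAt (fun p : ℝ => K ε (J, 0, p, z.2))
        (2 * z.1 + ε * DP K₁ ε (J, 0, z.1, z.2)) z.1 := by
      have e1 : (fun p : ℝ => K ε (J, 0, p, z.2)) = fun p => π ^ 2 * J ^ 2 / d z.2 ^ 2 + p ^ 2 - 1
          + ε * K₁ ε (J, 0, p, z.2) := funext fun p => e ε (J, 0, p, z.2) hJ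
      rw [e1]
      have := ((((hasDerivAt_id z.1).pow 2).const_add (π ^ 2 * J ^ 2 / d z.2 ^ 2)).sub_const 1).add
        (d2.const_mul ε)
      refine this.congr_deriv ?_
      simp; left; rfl
    have d4 : DP K ε (J, 0, z.1, z.2) = _ := d1.unique d3
    rw [d4, add_sub_cancel_left]
    exact fin _ ((b₂ ε hε _ hs).trans (by linarith))
  · have d1 := hasDerivAt_pos (h.polyK.differentiableAt ε hp)
    have d2 := hasDerivAt_pos (hK₁.differentiableAt ε hp)
    have dU : HasDerivAt (twoU d J) (deriv (twoU d J) z.2) z.2 := by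
      have hne := (hd.pos z.2).ne'
      have : DifferentiableAt ℝ (twoU d J) z.2 := by
        have := hd.bddSmooth.differentiable z.2
        unfold twoU
        fun_prop (disch := positivity)
      exact this.hasDerivAt
    have d3 : HasDerivAt (fun X : ℝ => K ε (J, 0, z.1, X))
        (deriv (twoU d J) z.2 + ε * DX K₁ ε (J, 0, z.1, z.2)) z.2 := by
      have e1 : (fun X : ℝ => K ε (J, 0, z.1, X)) = fun X => twoU d J X + z.1 ^ 2 - 1
          + ε * K₁ ε (J, 0, z.1, X) := funext fun X => e ε (J, 0, z.1, X) hJ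
      rw [e1]
      exact ((dU.add_const (z.1 ^ 2)).sub_const 1).add (d2.const_mul ε)
    have d4 : DX K ε (J, 0, z.1, z.2) = _ := d1.unique d3
    rw [d4, add_sub_cancel_left]
    exact fin _ ((b₃ ε hε _ hs).trans (by linarith))

/-- The averaged system has no equilibria near the level. -/
theorem IsNormalForm.nondegenerate (h : IsNormalForm d N S K) (hd : IsProfile d) {M δ c : ℝ}
    (hM : 1 ≤ M) (hδ : 0 < δ) (hc : 0 < c) :
    ∃ ε₀ : ℝ, 0 < ε₀ ∧ ∀ ε J : ℝ, 0 < ε → ε < ε₀ → M⁻¹ ≤ J → J ≤ M → ∀ z ∈ PlaneStrip M,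
      |K ε (J, 0, z.1, z.2)| ≤ c * ε →
      δ / 2 ≤ (1 - twoU d J z.2) + |deriv (twoU d J) z.2| →
      δ / (16 * M) ≤ ‖planeV K ε J z‖ := by
  have hM0 : 0 < M := by linarith
  obtain ⟨B, hB, b⟩ := h.leading hd hM0
  refine ⟨min 1 (δ / (16 * M * (B + c))), by positivity, ?_⟩
  intro ε J h0 h1 hJ1 hJ2 z hz hK hnd
  have m1 : ε < 1 := h1.trans_le (min_le_left _ _)
  have m2 : ε < δ / (16 * M * (B + c)) := h1.trans_le (min_le_right _ _)
  have hsm : (B + c) * ε ≤ δ / (16 * M) := by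
    rw [le_div_iff₀ (by positivity)]
    rw [lt_div_iff₀ (by positivity)] at m2
    linarith
  have hδM : δ / (16 * M) ≤ δ / 16 := by
    gcongr
    linarith
  obtain ⟨b1, b2, b3⟩ := b ε J h0 m1.le hJ1 hJ2 z hz
  have hBε : B * ε ≤ δ / (16 * M) := le_trans (by gcongr; linarith) hsm
  have f1 : |DX K ε (J, 0, z.1, z.2)| ≤ ‖planeV K ε J z‖ := by
    simp [planeV, Prod.norm_def]
  have f2 : |DP K ε (J, 0, z.1, z.2)| ≤ ‖planeV K ε J z‖ := norm_snd_le (planeV K ε J z)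
  -- Either the force is large, or `1 - 2U` is, and then the energy makes `p ^ 2 ≥ δ / 8`, so that
  -- the velocity is large.
  by_cases hcase : δ / 4 ≤ |deriv (twoU d J) z.2|
  · have := abs_sub_abs_le_abs_sub (deriv (twoU d J) z.2) (DX K ε (J, 0, z.1, z.2))
    rw [abs_sub_comm] at this
    linarith
  · rw [not_le] at hcase
    have g1 := (abs_le.1 b1).1
    have g2 := (abs_le.1 b1).2
    have g3 := (abs_le.1 hK)
    have hp2 : δ / 8 ≤ z.1 ^ 2 := by
      have : (B + c) * ε = B * ε + c * ε := by ring
      linarith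
    have hp3 : z.1 ^ 2 ≤ M * |z.1| := by
      rw [← sq_abs, pow_two]
      exact mul_le_mul_of_nonneg_right hz (abs_nonneg _)
    have hp4 : δ / (16 * M) * 2 ≤ |z.1| := by
      rw [div_mul_eq_mul_div, div_le_iff₀ (by positivity)]
      linarith
    have := abs_sub_abs_le_abs_sub (2 * z.1) (DP K ε (J, 0, z.1, z.2))
    rw [abs_sub_comm, abs_mul, abs_two] at this
    have : 0 < δ / (16 * M) := by positivity
    linarith

end

/-- Near an approximate zero of the Hamiltonian at which the field does not vanish there is a
zero. -/
theorem PlaneField.exists_zero {V : ℝ × ℝ → ℝ × ℝ} {K W : ℝ × ℝ → ℝ} {B Λ M κ η : ℝ}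
    (hf : PlaneField (PlaneStrip M) V K W B Λ) (hK : Continuous K) (hκ : 0 < κ) {z : ℝ × ℝ}
    (hz : |z.1| + 2 * η / κ ≤ M) (hη : 0 < η) (hKz : |K z| ≤ η) (hV : κ ≤ ‖V z‖)
    (small : 4 * Λ * η ≤ κ ^ 2) : ∃ z' : ℝ × ℝ, K z' = 0 ∧ ‖z' - z‖ ≤ 2 * η / κ := by
  have hs0 : 0 < 2 * η / κ := by positivity
  set s := 2 * η / κ with hs
  obtain ⟨k1, k2⟩ := abs_le.1 hKz
  have hΛs : Λ * s ^ 2 ≤ η := by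
    have : Λ * s ^ 2 = (4 * Λ * η) * η / κ ^ 2 := by rw [hs]; field_simp; ring
    rw [this, div_le_iff₀ (by positivity), mul_comm]
    exact mul_le_mul_of_nonneg_left small hη.le
  have hκs : κ * s = 2 * η := by rw [hs]; field_simp
  -- the Hamiltonian changes its sign along a coordinate direction
  have main : ∀ u : ℝ × ℝ, ‖u‖ = 1 → κ ≤ |(V z).2 * u.1 - (V z).1 * u.2| →
      ∃ z' : ℝ × ℝ, K z' = 0 ∧ ‖z' - z‖ ≤ s := by
    intro u hu hcomp
    have hzm : z ∈ PlaneStrip M := by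
      show |z.1| ≤ M
      linarith
    have est : ∀ a : ℝ, |a| ≤ s →
        |K (z + a • u) - K z - a * ((V z).2 * u.1 - (V z).1 * u.2)| ≤ Λ * a ^ 2 := by
      intro a ha
      have hu1 : |u.1| ≤ 1 := hu ▸ norm_fst_le u
      have hmem : z + a • u ∈ PlaneStrip M := by
        show |z.1 + a * u.1| ≤ M
        have h1 := abs_add_le z.1 (a * u.1)
        have h2 : |a * u.1| ≤ s := by
          rw [abs_mul]
          exact (mul_le_of_le_one_right (abs_nonneg _) hu1).trans ha
        linarith
      have := hf.taylor z hzm _ hmem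
      rw [add_sub_cancel_left, norm_smul, hu, mul_one, Real.norm_eq_abs, sq_abs] at this
      simp only [Prod.smul_fst, Prod.smul_snd, smul_eq_mul] at this
      convert this using 2
      ring
    have e1 := abs_le.1 (est s (abs_of_pos hs0).le)
    have e2 := abs_le.1 (est (-s) (by rw [abs_neg, abs_of_pos hs0]))
    rw [neg_sq] at e2
    have hc : Continuous fun a : ℝ => K (z + a • u) := by fun_prop
    have close : ∀ a ∈ Set.Icc (-s) s, ‖z + a • u - z‖ ≤ s := fun a ha => by
      rw [add_sub_cancel_left, norm_smul, hu, mul_one, Real.norm_eq_abs]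
      exact abs_le.2 ha
    have hle : -s ≤ s := by linarith
    rcases le_abs.1 hcomp with h | h
    · have h2 := mul_le_mul_of_nonneg_left h hs0.le
      obtain ⟨a, ha, ha0⟩ := intermediate_value_Icc hle hc.continuousOn
        (show (0 : ℝ) ∈ _ from ⟨by linarith [e2.2], by linarith [e1.1]⟩)
      exact ⟨_, ha0, close a ha⟩
    · have h2 := mul_le_mul_of_nonneg_left h hs0.le
      obtain ⟨a, ha, ha0⟩ := intermediate_value_Icc' hle hc.continuousOn
        (show (0 : ℝ) ∈ _ from ⟨by linarith [e1.2], by linarith [e2.1]⟩)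
      exact ⟨_, ha0, close a ha⟩
  rw [Prod.norm_def] at hV
  rcases le_max_iff.1 hV with h | h
  · exact main (0, 1) (by simp) (by simpa using h)
  · exact main (1, 0) (by simp) (by simpa using h)

/-! ### Confinement by the effective potential -/

/-- As `f` lies below `1` to the right of `a`, its slope at `a` is at most `-δ`. The bound on `μ`
keeps the slope below `-δ / 2` up to the distance `3 μ / δ` to the left, where `f` has risen above
`1 + μ`; a continuous path with `f ≤ 1 + μ` cannot cross that point. -/
theorem barrier {f f' X : ℝ → ℝ} {Λ δ a b μ T : ℝ} (hf : ∀ x, HasDerivAt f (f' x) x)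
    (hΛ : ∀ x y, |f' x - f' y| ≤ Λ * |x - y|) (hδ : 0 < δ) (hab : a < b) (fa : f a = 1)
    (hd : δ ≤ |f' a|) (hlt : ∀ x ∈ Set.Ioo a b, f x < 1) (hX : ContinuousOn X (Set.Icc 0 T))
    (hX0 : a ≤ X 0) (hμ : 0 < μ) (small : 6 * Λ * μ ≤ δ ^ 2)
    (hle : ∀ t ∈ Set.Icc 0 T, f (X t) ≤ 1 + μ) : ∀ t ∈ Set.Icc 0 T, a - 3 * μ / δ ≤ X t := by
  have hs0 : 0 < 3 * μ / δ := by positivity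
  set s := 3 * μ / δ with hs
  have neg : f' a ≤ 0 := by
    have h1 : HasDerivAt (fun t => -f (-t)) (f' a) (-a) := by
      have h2 : HasDerivAt f (f' a) (-(-a)) := by rw [neg_neg]; exact hf a
      exact (h2.comp (-a) (hasDerivAt_neg (-a))).neg.congr_deriv (by ring)
    refine deriv_nonpos_of_left_min (a := -b) (by linarith) h1 fun t ht => ?_
    rw [neg_neg, fa, neg_le_neg_iff]
    exact (hlt (-t) ⟨by linarith [ht.2], by linarith [ht.1]⟩).le
  rw [abs_of_nonpos neg] at hd
  have high : 1 + μ < f (a - s) := by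
    obtain ⟨ξ, hξ, e⟩ := exists_hasDerivAt_eq_slope f f' (show a - s < a by linarith)
      (fun x _ => (hf x).continuousAt.continuousWithinAt) (fun x _ => hf x)
    rw [sub_sub_cancel, fa, eq_div_iff hs0.ne'] at e
    have h1 := hΛ ξ a
    have hΛ0 : 0 ≤ Λ := by
      have := hΛ 1 0
      rw [sub_zero, abs_one, mul_one] at this
      exact (abs_nonneg _).trans this
    have h2 : |ξ - a| ≤ s := abs_le.2 ⟨by linarith [hξ.1], by linarith [hξ.2]⟩
    have h3 : Λ * s ≤ δ / 2 := by
      rw [hs, ← mul_div_assoc, div_le_iff₀ hδ]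
      linarith
    have h4 : Λ * |ξ - a| ≤ Λ * s := by gcongr
    have h5 := (abs_le.1 h1).2
    have h6 : f' ξ ≤ -(δ / 2) := by linarith
    have h7 := mul_le_mul_of_nonneg_right h6 hs0.le
    have h8 : δ * s = 3 * μ := by rw [hs]; field_simp
    linarith
  intro t ht
  by_contra hc
  rw [not_le] at hc
  obtain ⟨t', ht', e⟩ := intermediate_value_Icc' ht.1 (hX.mono (Set.Icc_subset_Icc_right ht.2))
    (show a - s ∈ _ from ⟨hc.le, by linarith⟩)
  have := hle t' ⟨ht'.1, ht'.2.trans ht.2⟩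
  rw [e] at this
  linarith

/-- The path may leave the half-line `[a, ∞)` only into the thin strip given by `barrier`. There the
slope is still at least `7 δ / 8` in modulus, while `1 - f` is at least `-δ / 8`. -/
theorem turning_point {f f' X : ℝ → ℝ} {Λ δ a b μ T : ℝ} (hf : ∀ x, HasDerivAt f (f' x) x)
    (hΛ : ∀ x y, |f' x - f' y| ≤ Λ * |x - y|) (hδ : 0 < δ) (hab : a < b) (fa : f a = 1)
    (hd : δ ≤ |f' a|) (hlt : ∀ x ∈ Set.Ioo a b, f x < 1) (hX : ContinuousOn X (Set.Icc 0 T))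
    (hX0 : a ≤ X 0) (hμ : 0 < μ) (small : 24 * Λ * μ ≤ δ ^ 2) (hμδ : μ ≤ δ / 8)
    (hle : ∀ t ∈ Set.Icc 0 T, f (X t) ≤ 1 + μ) :
    ∀ t ∈ Set.Icc 0 T, a ≤ X t ∨ 3 * δ / 4 ≤ (1 - f (X t)) + |f' (X t)| := by
  intro t ht
  have hΛ0 : 0 ≤ Λ := by
    have := hΛ 1 0
    rw [sub_zero, abs_one, mul_one] at this
    exact (abs_nonneg _).trans this
  have hb := barrier hf hΛ hδ hab fa hd hlt hX hX0 hμ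
    (le_trans (by have : 0 ≤ Λ * μ := by positivity
                  linarith) small) hle t ht
  rcases le_or_gt a (X t) with h | h
  · exact Or.inl h
  · right
    have h1 := hΛ a (X t)
    have h2 : |a - X t| ≤ 3 * μ / δ := by rw [abs_of_pos (by linarith)]; linarith
    have h3 := abs_sub_abs_le_abs_sub (f' a) (f' (X t))
    have h4 : Λ * |a - X t| ≤ δ / 8 := by
      calc Λ * |a - X t| ≤ Λ * (3 * μ / δ) := by gcongr
        _ = (24 * Λ * μ) / (8 * δ) := by field_simp; ring
        _ ≤ δ ^ 2 / (8 * δ) := by gcongr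
        _ = δ / 8 := by field_simp
    have h5 := hle t ht
    linarith

theorem twoU_bounds {d : ℝ → ℝ} (hd : IsProfile d) {M : ℝ} (hM : 0 < M) :
    ∃ Λ : ℝ, 0 < Λ ∧ (∀ J X, HasDerivAt (twoU d J) (deriv (twoU d J) X) X) ∧
      ∀ J I X Y : ℝ, |J| ≤ M → |I| ≤ M →
        |twoU d J X - twoU d I Y| ≤ Λ * (|J - I| + |X - Y|) ∧
        |deriv (twoU d J) X - deriv (twoU d I) Y| ≤ Λ * (|J - I| + |X - Y|) := by
  set g : ℝ → ℝ := fun X => π ^ 2 * ((d X)⁻¹ * (d X)⁻¹) with hg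
  have hb : BddSmooth g := (BddSmooth.const (π ^ 2)).mul (hd.inv_bddSmooth.mul hd.inv_bddSmooth)
  have e : ∀ J, twoU d J = fun X => J ^ 2 * g X := fun J => by
    funext X
    have := (hd.pos X).ne'
    simp only [twoU, hg]
    field_simp
  have hder : ∀ J X, HasDerivAt (twoU d J) (J ^ 2 * deriv g X) X := fun J X => by
    rw [e J]; exact (hb.hasDerivAt X).const_mul _
  obtain ⟨B₀, p₀, b₀⟩ := hb.bound
  obtain ⟨B₁, p₁, b₁⟩ := hb.deriv.bound
  obtain ⟨Λ₀, q₀, l₀⟩ := hb.lipschitz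
  obtain ⟨Λ₁, q₁, l₁⟩ := hb.deriv.lipschitz
  have key : ∀ (h : ℝ → ℝ) (B Λ : ℝ), 0 ≤ B → 0 ≤ Λ → (∀ X, |h X| ≤ B) →
      (∀ X Y, |h X - h Y| ≤ Λ * |X - Y|) → ∀ J I X Y : ℝ, |J| ≤ M → |I| ≤ M →
      |J ^ 2 * h X - I ^ 2 * h Y| ≤ (2 * M * B + M ^ 2 * Λ) * (|J - I| + |X - Y|) := by
    intro h B Λ hB hΛ hh hl J I X Y hJ hI
    have e1 : J ^ 2 * h X - I ^ 2 * h Y = (J - I) * ((J + I) * h X) + I ^ 2 * (h X - h Y) := by ring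
    have h1 : |J + I| ≤ 2 * M := (abs_add_le _ _).trans (by linarith)
    have h2 : I ^ 2 ≤ M ^ 2 := by rw [← sq_abs]; gcongr
    rw [e1]
    calc _ ≤ |J - I| * (|J + I| * |h X|) + I ^ 2 * |h X - h Y| := by
          refine (abs_add_le _ _).trans ?_
          rw [abs_mul, abs_mul, abs_mul, abs_of_nonneg (sq_nonneg I)]
      _ ≤ |J - I| * (2 * M * B) + M ^ 2 * (Λ * |X - Y|) := by
          have := hh X
          have := hl X Y
          gcongr
      _ ≤ |J - I| * (2 * M * B) + M ^ 2 * (Λ * |X - Y|)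
          + (|X - Y| * (2 * M * B) + M ^ 2 * (Λ * |J - I|)) := by
          have : 0 ≤ |X - Y| * (2 * M * B) + M ^ 2 * (Λ * |J - I|) := by positivity
          linarith
      _ = _ := by ring
  refine ⟨2 * M * B₀ + M ^ 2 * Λ₀ + (2 * M * B₁ + M ^ 2 * Λ₁) + 1, by positivity, fun J X => ?_,
    fun J I X Y hJ hI => ⟨?_, ?_⟩⟩
  · rw [(hder J X).deriv]; exact hder J X
  · rw [e J, e I]
    refine (key g B₀ Λ₀ p₀ q₀ b₀ l₀ J I X Y hJ hI).trans ?_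
    have : 0 ≤ 2 * M * B₁ + M ^ 2 * Λ₁ := by positivity
    exact mul_le_mul_of_nonneg_right (by linarith) (by positivity)
  · rw [(hder J X).deriv, (hder I Y).deriv]
    refine (key _ B₁ Λ₁ p₁ q₁ b₁ l₁ J I X Y hJ hI).trans ?_
    have : 0 ≤ 2 * M * B₀ + M ^ 2 * Λ₀ := by positivity
    exact mul_le_mul_of_nonneg_right (by linarith) (by positivity)

/-- The slow coordinate stays in a region where the level of the averaged system has no equilibria. -/
theorem confinement {d : ℝ → ℝ} (hd : IsProfile d) {δ M : ℝ} (hδ : 0 < δ) (hM : 0 < M) :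
    ∃ μ₀ : ℝ, 0 < μ₀ ∧ ∀ (I T μ : ℝ) (X : ℝ → ℝ), |I| ≤ M → 0 < μ → μ < μ₀ →
      ContinuousOn X (Set.Icc 0 T) → (∀ t ∈ Set.Icc 0 T, twoU d I (X t) ≤ 1 + μ) →
      (OverHumps d δ I ∨ OneReflection d δ I (X 0) ∨ Resonator d δ I (X 0)) →
      ∀ t ∈ Set.Icc 0 T, 3 * δ / 4 ≤ (1 - twoU d I (X t)) + |deriv (twoU d I) (X t)| := by
  obtain ⟨Λ, hΛ, hder, hl⟩ := twoU_bounds hd hM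
  refine ⟨min (δ / 8) (δ ^ 2 / (24 * Λ)), by positivity, ?_⟩
  intro I T μ X hI hμ hμ₀ hX hle hcase t ht
  have hμδ : μ ≤ δ / 8 := (hμ₀.trans_le (min_le_left _ _)).le
  have small : 24 * Λ * μ ≤ δ ^ 2 := by
    have := hμ₀.trans_le (min_le_right _ _)
    rw [lt_div_iff₀ (by positivity)] at this
    linarith
  have lip : ∀ x y, |deriv (twoU d I) x - deriv (twoU d I) y| ≤ Λ * |x - y| := fun x y => by
    simpa using (hl I I x y hI hI).2
  have right : ∀ a b, a < b → twoU d I a = 1 → δ ≤ |deriv (twoU d I) a| →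
      (∀ x ∈ Set.Ioo a b, twoU d I x < 1) → a ≤ X 0 →
      a ≤ X t ∨ 3 * δ / 4 ≤ (1 - twoU d I (X t)) + |deriv (twoU d I) (X t)| :=
    fun a b hab fa hda hlt h0 =>
      turning_point (hder I) lip hδ hab fa hda hlt hX h0 hμ small hμδ hle t ht
  -- The mirror image of the preceding statement under `X ↦ -X`.
  have left : ∀ a b, a < b → twoU d I b = 1 → δ ≤ |deriv (twoU d I) b| →
      (∀ x ∈ Set.Ioo a b, twoU d I x < 1) → X 0 ≤ b →
      X t ≤ b ∨ 3 * δ / 4 ≤ (1 - twoU d I (X t)) + |deriv (twoU d I) (X t)| := by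
    intro a b hab fb hdb hlt h0
    have := turning_point (f := fun x => twoU d I (-x)) (f' := fun x => -deriv (twoU d I) (-x))
      (X := fun t => -X t) (Λ := Λ) (δ := δ) (a := -b) (b := -a) (μ := μ) (T := T)
      (fun x => by
        exact ((hder I (-x)).comp x (hasDerivAt_neg x)).congr_deriv (by ring))
      (fun x y => by
        have h1 := lip (-y) (-x)
        rw [neg_sub_neg] at h1
        rw [neg_sub_neg]
        exact h1) hδ (by linarith)
      (by simpa using fb) (by simpa using hdb)
      (fun x hx => hlt _ ⟨by linarith [hx.2], by linarith [hx.1]⟩) hX.neg (by simpa using h0) hμ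
      small hμδ (fun t ht => by simpa using hle t ht) t ht
    simpa using this
  have weaken : δ ≤ (1 - twoU d I (X t)) + |deriv (twoU d I) (X t)| →
      3 * δ / 4 ≤ (1 - twoU d I (X t)) + |deriv (twoU d I) (X t)| := fun h => by linarith
  have slope : ∀ z, twoU d I z = 1 → δ ≤ (1 - twoU d I z) + |deriv (twoU d I) z| →
      δ ≤ |deriv (twoU d I) z| := fun z h1 h2 => by rwa [h1, sub_self, zero_add] at h2
  rcases hcase with h | ⟨a, ⟨h0, h1, h2, h3⟩ | ⟨h0, h1, h2, h3⟩⟩ | ⟨a, b, hab, h0, h1, h2, h3⟩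
  · have h1 := h (X t)
    have h2 := abs_nonneg (deriv (twoU d I) (X t))
    linarith
  · have ha := h1 a rfl
    rcases right a (a + 1) (by linarith) ha (slope a ha (h3 a Set.self_mem_Ici))
      (fun x hx => h2 x ⟨hx.1.le, ne_of_gt hx.1⟩) h0 with h | h
    · exact weaken (h3 _ h)
    · exact h
  · have ha := h1 a rfl
    rcases left (a - 1) a (by linarith) ha (slope a ha (h3 a Set.self_mem_Iic))
      (fun x hx => h2 x ⟨hx.2.le, ne_of_lt hx.2⟩) h0 with h | h
    · exact weaken (h3 _ h)
    · exact h
  · have ha := h1 a (by simp)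
    have hb := h1 b (by simp)
    have hin : ∀ x ∈ Set.Ioo a b, twoU d I x < 1 := fun x hx =>
      h2 x ⟨Set.Ioo_subset_Icc_self hx, by simp [hx.1.ne', hx.2.ne]⟩
    rcases right a b hab ha (slope a ha (h3 a (Set.left_mem_Icc.2 hab.le))) hin h0.1 with h | h
    · rcases left a b hab hb (slope b hb (h3 b (Set.right_mem_Icc.2 hab.le))) hin h0.2 with h' | h'
      · exact weaken (h3 _ ⟨h, h'⟩)
      · exact h'
    · exact h

/-! ### The flow of the averaged Hamiltonian -/

section

variable {d : ℝ → ℝ} {r : ℕ} {S K : ℝ → PS → ℝ}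

/-- Solutions of the averaged equations that start near the zero level are orbits with bounded
momentum. -/
theorem IsNormalForm.planeOrbit (h : IsNormalForm d (r - 1) S K) (hd : IsProfile d) {M c : ℝ}
    (hM : 2 ≤ M) (hc : 0 < c) :
    ∃ ε₀ : ℝ, 0 < ε₀ ∧ ∀ (ε e T J : ℝ) (ψ p ξ : ℝ → ℝ), 0 < ε → ε < ε₀ → 0 ≤ T → M⁻¹ ≤ J → J ≤ M →
      e ≤ ε → IsSigmaFlow d r ε T J ψ p ξ → |p 0| ≤ M → |K ε (J, 0, p 0, ε * ξ 0)| ≤ c * e →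
      PlaneOrbit (PlaneStrip M) (planeV K ε J) (fun z => K ε (J, 0, z.1, z.2))
        (fun z => DI K ε (J, 0, z.1, z.2)) ε e c T (fun t => (p t, ε * ξ t)) ψ := by
  have hM0 : 0 < M := by linarith
  obtain ⟨B, hB, b⟩ := h.leading hd hM0
  refine ⟨min 1 (1 / (B + c)), by positivity, ?_⟩
  intro ε e T J ψ p ξ h0 h1 hT hJ1 hJ2 he hflow hp0 hK0
  have m1 : ε < 1 := h1.trans_le (min_le_left _ _)
  have m2 : ε < 1 / (B + c) := h1.trans_le (min_le_right _ _)
  rw [lt_div_iff₀ (by positivity)] at m2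
  have hJ : 0 < J := (inv_pos.2 hM0).trans_le hJ1
  have hσ : ∀ A : ℝ, 0 < A → ∀ q X : ℝ, sigmaH d r ε A q X = K ε (A, 0, q, X) := fun A hA q X =>
    h.K_eq ε A 0 q X hA
  have dp : ∀ t ∈ Set.Icc 0 T, HasDerivWithinAt p (ε * -DX K ε (J, 0, p t, ε * ξ t))
      (Set.Icc 0 T) t := fun t ht => by
    have h2 := hflow.momentum t ht
    have h3 : deriv (fun X => sigmaH d r ε J (p t) X) (ε * ξ t) = DX K ε (J, 0, p t, ε * ξ t) := by
      have e1 : (fun X => sigmaH d r ε J (p t) X) = fun X => K ε (J, 0, p t, X) :=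
        funext fun X => hσ J hJ _ _
      rw [e1]
      exact (hasDerivAt_pos (h.polyK.differentiableAt ε (v := (J, 0, p t, ε * ξ t)) hJ)).deriv
    rw [h3] at h2
    rwa [mul_neg]
  have dξ : ∀ t ∈ Set.Icc 0 T, HasDerivWithinAt (fun t => ε * ξ t)
      (ε * DP K ε (J, 0, p t, ε * ξ t)) (Set.Icc 0 T) t := fun t ht => by
    have h2 := hflow.position t ht
    have h3 : deriv (fun q => sigmaH d r ε J q (ε * ξ t)) (p t) = DP K ε (J, 0, p t, ε * ξ t) := by
      have e1 : (fun q => sigmaH d r ε J q (ε * ξ t)) = fun q => K ε (J, 0, q, ε * ξ t) :=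
        funext fun X => hσ J hJ _ _
      rw [e1]
      exact (hasDerivAt_mom (h.polyK.differentiableAt ε (v := (J, 0, p t, ε * ξ t)) hJ)).deriv
    rw [h3] at h2
    exact h2.const_mul ε
  have dψ : ∀ t ∈ Set.Icc 0 T, HasDerivWithinAt ψ (DI K ε (J, 0, p t, ε * ξ t))
      (Set.Icc 0 T) t := fun t ht => by
    have h2 := hflow.phase t ht
    have h3 : deriv (fun A => sigmaH d r ε A (p t) (ε * ξ t)) J = DI K ε (J, 0, p t, ε * ξ t) := by
      have e1 : (fun A => sigmaH d r ε A (p t) (ε * ξ t)) =ᶠ[𝓝 J]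
          fun A => K ε (A, 0, p t, ε * ξ t) := by
        filter_upwards [lt_mem_nhds hJ] with A hA using hσ A hA _ _
      rw [e1.deriv_eq]
      exact (hasDerivAt_fst (h.polyK.differentiableAt ε (v := (J, 0, p t, ε * ξ t)) hJ)).deriv
    rwa [h3] at h2
  have const : ∀ t ∈ Set.Icc 0 T, K ε (J, 0, p t, ε * ξ t) = K ε (J, 0, p 0, ε * ξ 0) := by
    intro t ht
    have hder : ∀ s ∈ Set.Icc 0 T,
        HasDerivWithinAt (fun t => K ε (J, 0, p t, ε * ξ t)) 0 (Set.Icc 0 T) s := by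
      intro s hs
      have h2 : HasDerivWithinAt (fun t => ((J, 0, p t, ε * ξ t) : PS))
          (0, 0, ε * -DX K ε (J, 0, p s, ε * ξ s), ε * DP K ε (J, 0, p s, ε * ξ s))
          (Set.Icc 0 T) s := (hasDerivWithinAt_const s _ J).prodMk
        ((hasDerivWithinAt_const s _ (0 : ℝ)).prodMk ((dp s hs).prodMk (dξ s hs)))
      refine ((h.polyK.differentiableAt ε
        (v := (J, 0, p s, ε * ξ s)) hJ).hasFDerivAt.comp_hasDerivWithinAt s h2).congr_deriv ?_
      rw [clm_apply_eq]
      simp only [dirD]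
      ring
    have := Convex.norm_image_sub_le_of_norm_hasDerivWithin_le (C := 0) hder (fun _ _ => by simp)
      (convex_Icc 0 T) (Set.left_mem_Icc.2 hT) ht
    rw [zero_mul, norm_le_zero_iff, sub_eq_zero] at this
    exact this
  have lev : ∀ t ∈ Set.Icc 0 T, |K ε (J, 0, p t, ε * ξ t)| ≤ c * e := fun t ht => by
    rw [const t ht]; exact hK0
  -- The leading terms of the Hamiltonian are known only while `|p| ≤ M`, but there energy and `2U ≥
  -- 0` give `p ^ 2 < 2`. As `2 ≤ M`, the value `2` cannot be reached continuously, which closes the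
  -- argument.
  have bound : ∀ t ∈ Set.Icc 0 T, |p t| ≤ M → |p t| < 2 := by
    intro t ht hpt
    have h2 := (abs_le.1 (b ε J h0 m1.le hJ1 hJ2 (p t, ε * ξ t) hpt).1).1
    have h3 := (abs_le.1 (lev t ht)).2
    have h4 : 0 ≤ twoU d J (ε * ξ t) := by unfold twoU; positivity
    have h5 : c * e ≤ c * ε := by gcongr
    simp only at h2
    have h6 : p t ^ 2 < 2 ^ 2 := by linarith
    rw [← sq_abs] at h6
    exact lt_of_pow_lt_pow_left₀ 2 (by norm_num) h6
  have all : ∀ t ∈ Set.Icc 0 T, |p t| ≤ 2 := by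
    intro t ht
    by_contra hcon
    rw [not_le] at hcon
    have hcont : ContinuousOn (fun t => |p t|) (Set.Icc 0 t) := fun s hs =>
      ((dp s ⟨hs.1, hs.2.trans ht.2⟩).continuousWithinAt.mono
        (Set.Icc_subset_Icc_right ht.2)).abs
    obtain ⟨s, hs, e2⟩ := intermediate_value_Icc ht.1 hcont
      (show (2 : ℝ) ∈ _ from ⟨(bound 0 (Set.left_mem_Icc.2 hT) hp0).le, hcon.le⟩)
    have e2' : |p s| = 2 := e2
    have := bound s ⟨hs.1, hs.2.trans ht.2⟩ (by rw [e2']; exact hM)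
    linarith
  refine ⟨fun t ht => (all t ht).trans hM, fun t ht => ?_, dψ, lev⟩
  exact (dp t ht).prodMk (dξ t ht)

end

/-! ### The ray never becomes almost parallel to the axis of the waveguide -/

section

variable {d : ℝ → ℝ} {ε T : ℝ} {x y px py : ℝ → ℝ}

theorem flightTimes_mono {T' : ℝ} (hT : T' ≤ T) :
    flightTimes d ε T' x y ⊆ flightTimes d ε T x y :=
  fun _ ht => ⟨⟨ht.1.1, ht.1.2.trans hT⟩, ht.2⟩

/-- A lower bound on the vertical momentum persists if it improves itself. -/
theorem IsRay.fast_of_bootstrap (h : IsRay d ε T x y px py) (hd : IsProfile d) {D₁ c₀ : ℝ}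
    (hε : 0 < ε) (hD₁ : ∀ X, |deriv d X| ≤ D₁) (hc0 : 0 < c₀) (hc1 : c₀ ≤ 1)
    (hsmall : 4 * (ε * D₁) ≤ c₀) (hst : 0 ∈ flightTimes d ε T x y) (h0 : 2 * c₀ ≤ |py 0|)
    (step : ∀ t ∈ flightTimes d ε T x y, (∀ s ∈ flightTimes d ε t x y, c₀ ≤ |py s|) →
      2 * c₀ ≤ |py t|) :
    ∀ t ∈ flightTimes d ε T x y, c₀ ≤ |py t| := by
  by_contra hcon
  push Not at hcon
  obtain ⟨t₁, ht₁, hlt₁⟩ := hcon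
  obtain ⟨B, hB⟩ : ∃ B, B = {t ∈ flightTimes d ε T x y | |py t| < c₀} := ⟨_, rfl⟩
  have hne : B.Nonempty := ⟨t₁, by rw [hB]; exact ⟨ht₁, hlt₁⟩⟩
  have hbd : BddBelow B := ⟨0, fun t ht => by rw [hB] at ht; exact ht.1.1.1⟩
  -- The infimum of the times at which the bound fails. Before it the improved bound holds; it
  -- remains to show that the weaker bound survives for a short time after it.
  obtain ⟨τ, hτ⟩ : ∃ τ, τ = sInf B := ⟨_, rfl⟩
  have τ0 : 0 ≤ τ := hτ ▸ le_csInf hne fun t ht => by rw [hB] at ht; exact ht.1.1.1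
  have le1 : ∀ t ∈ B, τ ≤ t := fun t ht => hτ ▸ csInf_le hbd ht
  have τT : τ ≤ T := (le1 t₁ (by rw [hB]; exact ⟨ht₁, hlt₁⟩)).trans ht₁.1.2
  have before : ∀ t ∈ flightTimes d ε T x y, t < τ → c₀ ≤ |py t| := fun t ht hlt => by
    by_contra hc
    exact absurd (le1 t (by rw [hB]; exact ⟨ht, not_le.1 hc⟩)) (not_le.2 hlt)
  have before2 : ∀ t ∈ flightTimes d ε T x y, t < τ → 2 * c₀ ≤ |py t| := fun t ht hlt =>
    step t ht fun s hs => before s (flightTimes_mono ht.1.2 hs) (hs.1.2.trans_lt hlt)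
  suffices hev : ∀ᶠ s in 𝓝[≥] τ, s ∈ flightTimes d ε T x y → c₀ ≤ |py s| by
    obtain ⟨b, hb, hs⟩ := mem_nhdsGE_iff_exists_Ico_subset.1 hev
    obtain ⟨t, ht, htb⟩ := exists_lt_of_csInf_lt hne (hτ ▸ hb)
    have h1 := hs ⟨le1 t ht, htb⟩
    rw [hB] at ht
    exact absurd (h1 ht.1) (not_le.2 ht.2)
  by_cases hi : Inside d ε (x τ) (y τ)
  · have hcont := (h.flight_py τ ⟨τ0, τT⟩ hi).continuousWithinAt
    have big : 2 * c₀ ≤ |py τ| := by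
      rcases eq_or_lt_of_le τ0 with e | e
      · rw [← e]; exact h0
      · obtain ⟨a, ha0, ha, hs⟩ := h.exists_flight_left e τT
        have l1 : Filter.Tendsto (fun t => |py t|) (𝓝[<] τ) (𝓝 |py τ|) := by
          rw [← nhdsWithin_Ioo_eq_nhdsLT ha]
          exact (hcont.mono fun t ht => (hs ht).1).abs
        refine ge_of_tendsto l1 ?_
        filter_upwards [Ioo_mem_nhdsLT ha] with t ht using before2 t (hs ht) ht.2
    have ev : ∀ᶠ t in 𝓝[Set.Icc 0 T] τ, c₀ < |py t| :=
      hcont.abs.eventually_const_lt (by linarith)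
    rw [eventually_nhdsWithin_iff] at ev ⊢
    filter_upwards [ev] with t ht _ hf using (ht hf.1).le
  · have hτi : τ ∈ impactTimes d ε T x y := ⟨⟨τ0, τT⟩, hi⟩
    have lift : (∀ᶠ s in 𝓝[>] τ, s ∈ flightTimes d ε T x y → c₀ ≤ |py s|) →
        ∀ᶠ s in 𝓝[≥] τ, s ∈ flightTimes d ε T x y → c₀ ≤ |py s| := fun hev => by
      rw [eventually_nhdsWithin_iff] at hev ⊢
      filter_upwards [hev] with s hs hs1 hf
      refine hs (show τ < s from lt_of_le_of_ne hs1 ?_) hf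
      rintro rfl
      exact hi hf.2
    refine lift ?_
    rcases eq_or_lt_of_le τT with e | e
    · filter_upwards [self_mem_nhdsWithin] with s hs hf
      exact absurd (hf.1.2.trans e.ge) (not_le.2 hs)
    rcases eq_or_lt_of_le τ0 with e0 | e0
    · exact absurd (e0 ▸ hst.2) hi
    obtain ⟨v, -, -, -, h4⟩ := h.impact hd hε hD₁ hc0 hc1 hsmall hτi e0 before
    obtain ⟨w, -, -, -, -, β, β', e1, e2, e3⟩ := h4 e
    obtain ⟨s, ⟨s1, s2⟩, s3⟩ := (e1.and self_mem_nhdsWithin).exists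
    have hβ := before2 s s1 s3
    rw [s2] at hβ
    -- A reflection changes `|py|` by at most `4 ε D₁ ≤ c₀`, so out of `2 c₀` at least `c₀` is left.
    have h5 := (abs_le.1 e3).1
    filter_upwards [e2] with t ht _
    rw [ht.2]
    linarith

/-- On long time intervals the vertical momentum is bounded from below. -/
theorem IsRay.fast (hd : IsProfile d) (k : ℕ) {L c : ℝ} (hL : 0 < L) (hc : 0 < c) :
    ∃ c₀ ε₀ : ℝ, 0 < c₀ ∧ c₀ ≤ 1 ∧ 0 < ε₀ ∧ ∀ ε T : ℝ, 0 < ε → ε < ε₀ → T ≤ L / ε ^ k →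
      ∀ x y px py : ℝ → ℝ, IsRay d ε T x y px py → 0 ∈ flightTimes d ε T x y →
      c ≤ action d ε (x 0) (py 0) → ∀ t ∈ flightTimes d ε T x y, c₀ ≤ |py t| := by
  obtain ⟨D, hD0, hD⟩ := hd.bddSmooth.bound
  obtain ⟨D₁, hD10, hD₁⟩ := hd.bddSmooth.deriv.bound
  have hpi := Real.pi_pos
  -- Chosen so that an action of at least `c / 2` forces `|py| ≥ 2 c₀`.
  obtain ⟨c₀, hc₀⟩ : ∃ c₀, c₀ = min 1 (c * π / (4 * (D + 1))) := ⟨_, rfl⟩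
  have hc0 : 0 < c₀ := by rw [hc₀]; positivity
  have hc1 : c₀ ≤ 1 := hc₀ ▸ min_le_left _ _
  have hc2 : c₀ * (4 * (D + 1)) ≤ c * π := by
    rw [← le_div_iff₀ (by positivity)]
    exact hc₀ ▸ min_le_right _ _
  -- With this many terms the improved action drifts by `O(ε ^ (k + 1) (1 + T))`, that is `O(ε)` on
  -- the whole interval, independently of the order `r` of the theorem.
  obtain ⟨S, K, hnf⟩ := exists_isNormalForm hd k
  obtain ⟨M, ρ, ε₁, hM, hρ, hε₁, b₁⟩ := IsRay.hybridMotion hd hc0 hc1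
  obtain ⟨C₂, ε₂, hC₂, hε₂, b₂⟩ := HybridMotion.action_drift hnf hd hM hρ
  obtain ⟨C₃, ε₃, hC₃, hε₃, b₃⟩ := newPoint_spec hnf.polyS hM
  refine ⟨c₀, min (min ε₁ ε₂) (min ε₃ (min (min 1 (c₀ / (4 * (D₁ + 1))))
    (c / (2 * (2 * C₃ + C₂ * (1 + L)))))), hc0, hc1, by positivity, ?_⟩
  intro ε T h0 h1 hT x y px py hray hst hact
  have m1 : ε < ε₁ := h1.trans_le ((min_le_left _ _).trans (min_le_left _ _))
  have m2 : ε < ε₂ := h1.trans_le ((min_le_left _ _).trans (min_le_right _ _))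
  have m3 : ε < ε₃ := h1.trans_le ((min_le_right _ _).trans (min_le_left _ _))
  have m' := h1.trans_le ((min_le_right _ _).trans (min_le_right _ _))
  have m4 : ε < 1 := m'.trans_le ((min_le_left _ _).trans (min_le_left _ _))
  have m5 := m'.trans_le ((min_le_left _ _).trans (min_le_right _ _))
  have m6 := m'.trans_le (min_le_right _ _)
  rw [lt_div_iff₀ (by positivity)] at m5 m6
  have large : ∀ t, c / 2 ≤ action d ε (x t) (py t) → 2 * c₀ ≤ |py t| := by
    intro t ht
    rw [action, le_div_iff₀ hpi] at ht
    have h2 : d (ε * x t) ≤ D + 1 := by linarith [(le_abs_self _).trans (hD (ε * x t))]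
    have h3 : |py t| * d (ε * x t) ≤ |py t| * (D + 1) :=
      mul_le_mul_of_nonneg_left h2 (abs_nonneg _)
    refine le_of_mul_le_mul_right ?_ (show 0 < D + 1 by linarith)
    linarith
  refine hray.fast_of_bootstrap hd h0 hD₁ hc0 hc1 (by linarith) hst (large 0 (by linarith)) ?_
  intro t ht hfast
  refine large t ?_
  have hm := b₁ ε t h0 m1 x y px py (hray.mono ht.1.2) ⟨⟨le_rfl, ht.1.1⟩, hst.2⟩ hfast
  have htt : t ∈ flightTimes d ε t x y := ⟨⟨ht.1.1, le_rfl⟩, ht.2⟩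
  have d1 := abs_le.1 (b₂ ε t _ _ h0 m2 hm t htt)
  have d2 := abs_le.1 (b₃ ε h0 m3 _ (hm.slab t htt)).2.2.1
  have d3 := abs_le.1 (b₃ ε h0 m3 _ (hm.slab 0 hm.start)).2.2.1
  have e1 : (rayState d ε x y px py t).1 = action d ε (x t) (py t) := rfl
  have e0 : (rayState d ε x y px py 0).1 = action d ε (x 0) (py 0) := rfl
  rw [e1] at d2
  rw [e0] at d3
  have d4 : ε ^ k * t ≤ L := by
    have := ht.1.2.trans hT
    rw [le_div_iff₀ (by positivity)] at this
    linarith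
  have d5 : C₂ * ε ^ (k + 1) * (1 + t) ≤ C₂ * (1 + L) * ε := by
    have h5 : ε ^ k ≤ 1 := pow_le_one₀ h0.le m4.le
    calc C₂ * ε ^ (k + 1) * (1 + t) = C₂ * ε * (ε ^ k + ε ^ k * t) := by ring
      _ ≤ C₂ * ε * (1 + L) := by gcongr
      _ = _ := by ring
  linarith [d1.1, d2.2, d3.1]

end

/-! ### The phase and the improved variables along a ray -/

/-- The counting function of a finite set is locally constant on each side, and continuous from the
right. -/
theorem eventually_inter_Iic {F : Set ℝ} (hF : F.Finite) (t : ℝ) :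
    (∀ᶠ s in 𝓝[≥] t, F ∩ Set.Iic s = F ∩ Set.Iic t) ∧
      (∀ᶠ s in 𝓝[<] t, F ∩ Set.Iic s = F ∩ Set.Iio t) := by
  have h1 : (F \ {t})ᶜ ∈ 𝓝 t := (hF.sdiff.isClosed.isOpen_compl).mem_nhds (by simp)
  obtain ⟨a, b, ht, hs⟩ := mem_nhds_iff_exists_Ioo_subset.1 h1
  have far : ∀ z ∈ F, z ∈ Set.Ioo a b → z = t := fun z hz hzab => by
    by_contra hne
    exact hs hzab ⟨hz, hne⟩
  constructor
  · filter_upwards [Ico_mem_nhdsGE ht.2] with s hs'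
    ext z
    simp only [Set.mem_inter_iff, Set.mem_Iic, and_congr_right_iff]
    refine fun hz => ⟨fun hzs => ?_, fun hzt => hzt.trans hs'.1⟩
    by_contra hc
    rw [not_le] at hc
    exact hc.ne' (far z hz ⟨ht.1.trans hc, hzs.trans_lt hs'.2⟩)
  · filter_upwards [Ioo_mem_nhdsLT ht.1] with s hs'
    ext z
    simp only [Set.mem_inter_iff, Set.mem_Iic, Set.mem_Iio, and_congr_right_iff]
    refine fun hz => ⟨fun hzs => hzs.trans_lt hs'.2, fun hzt => ?_⟩
    by_contra hc
    rw [not_le] at hc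
    exact hzt.ne (far z hz ⟨hs'.1.trans hc, hzt.trans ht.2⟩)

section

variable {d : ℝ → ℝ} {ε T : ℝ} {x y px py : ℝ → ℝ}

open Classical in
/-- The phase angle in `[-π, π)`, extended by its right limits to the times of impact. -/
def phaseAngle (d : ℝ → ℝ) (ε : ℝ) (x y px py : ℝ → ℝ) (t : ℝ) : ℝ :=
  if Inside d ε (x t) (y t) then (rayState d ε x y px py t).2.1 else if y t = 0 then 0 else -π

/-- The instants of reflection off the upper wall. -/
def topImpacts (d : ℝ → ℝ) (ε T : ℝ) (x y : ℝ → ℝ) : Set ℝ :=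
  {t ∈ impactTimes d ε T x y | y t = d (ε * x t)}

/-- The phase: the phase angle plus `2π` for each reflection off the upper wall. -/
def phase (d : ℝ → ℝ) (ε T : ℝ) (x y px py : ℝ → ℝ) (t : ℝ) : ℝ :=
  phaseAngle d ε x y px py t + 2 * π * (topImpacts d ε T x y ∩ Set.Iic t).ncard

theorem IsRay.finite_topImpacts (h : IsRay d ε T x y px py) : (topImpacts d ε T x y).Finite :=
  h.finite_impacts.subset fun _ ht => ht.1

/-- Near a time of flight the phase differs from the phase angle by a constant. -/
theorem IsRay.phase_eventually (h : IsRay d ε T x y px py) {t : ℝ}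
    (ht : t ∈ flightTimes d ε T x y) :
    ∃ n : ℤ, ∀ᶠ s in 𝓝[flightTimes d ε T x y] t,
      phase d ε T x y px py s = (rayState d ε x y px py s).2.1 + 2 * π * n := by
  refine ⟨(topImpacts d ε T x y ∩ Set.Iic t).ncard, ?_⟩
  obtain ⟨h1, h2⟩ := eventually_inter_Iic h.finite_topImpacts t
  have h3 : topImpacts d ε T x y ∩ Set.Iio t = topImpacts d ε T x y ∩ Set.Iic t := by
    ext z
    simp only [Set.mem_inter_iff, Set.mem_Iic, Set.mem_Iio, and_congr_right_iff]
    refine fun hz => ⟨fun hzt => hzt.le, fun hzt => lt_of_le_of_ne hzt ?_⟩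
    rintro rfl
    exact hz.1.2 ht.2
  rw [h3] at h2
  have h4 : ∀ᶠ s in 𝓝 t, topImpacts d ε T x y ∩ Set.Iic s = topImpacts d ε T x y ∩ Set.Iic t := by
    rw [← nhdsLT_sup_nhdsGE]
    exact Filter.eventually_sup.2 ⟨h2, h1⟩
  filter_upwards [nhdsWithin_le_nhds h4, self_mem_nhdsWithin] with s hs hsf
  rw [phase, hs, phaseAngle, if_pos hsf.2, Int.cast_natCast]

/-- The phase angle lies strictly between `-π` and `π`. -/
theorem rayState_angle (hd : IsProfile d) {t : ℝ} (ht : Inside d ε (x t) (y t)) (hpy : py t ≠ 0) :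
    |(rayState d ε x y px py t).2.1| < π := by
  have hdX := hd.pos (ε * x t)
  have hpi := Real.pi_pos
  simp only [rayState, rayPoint]
  rw [abs_mul, abs_div, abs_abs, div_self (abs_ne_zero.2 hpy), one_mul,
    abs_of_pos (by have := ht.1; positivity), div_lt_iff₀ hdX]
  exact mul_lt_mul_of_pos_left ht.2 hpi

theorem IsRay.saw_phase (h : IsRay d ε T x y px py) (hd : IsProfile d) {t : ℝ}
    (ht : t ∈ flightTimes d ε T x y) (hpy : py t ≠ 0) :
    saw (phase d ε T x y px py t) = (rayState d ε x y px py t).2.1 := by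
  obtain ⟨n, hn⟩ := h.phase_eventually (px := px) (py := py) ht
  rw [hn.self_of_nhdsWithin ht]
  exact saw_add_int _ n (rayState_angle hd ht.2 hpy)

theorem IsRay.isPhase (h : IsRay d ε T x y px py) (hd : IsProfile d) {t : ℝ}
    (ht : t ∈ flightTimes d ε T x y) (hpy : py t ≠ 0) :
    IsPhase d ε (x t) (y t) (py t) (phase d ε T x y px py t) := by
  rw [IsPhase, h.saw_phase hd ht hpy]
  simp only [rayState, rayPoint]
  rcases lt_or_gt_of_ne hpy with hp | hp
  · right
    refine ⟨hp, ?_⟩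
    rw [abs_of_neg hp, div_neg, div_self hpy, neg_one_mul]
  · left
    refine ⟨hp, ?_⟩
    rw [abs_of_pos hp, div_self hpy, one_mul]

theorem IsRay.rayState_eq (h : IsRay d ε T x y px py) (hd : IsProfile d) {t : ℝ}
    (ht : t ∈ flightTimes d ε T x y) (hpy : py t ≠ 0) :
    (rayState d ε x y px py t).2.2.1
      = pHat d ε (x t) (px t) (py t) (phase d ε T x y px py t) := by
  rw [pHat, h.saw_phase hd ht hpy]
  simp only [rayState, rayPoint, action]
  have h2 : |py t| ≠ 0 := abs_ne_zero.2 hpy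
  have h3 := Real.pi_pos.ne'
  have h1 := (hd.pos (ε * x t)).ne'
  field_simp

/-- At the bottom the angle passes continuously through `0`. At the top it falls from `π` to `-π`
while the counter contributes `2π`. The values assigned to `phaseAngle` at impacts are its right
limits, in accordance with the counter. -/
theorem IsRay.continuousOn_phase (h : IsRay d ε T x y px py) (hd : IsProfile d) {D₁ c₀ : ℝ}
    (hε : 0 < ε) (hD₁ : ∀ X, |deriv d X| ≤ D₁) (hc0 : 0 < c₀) (hc1 : c₀ ≤ 1)
    (hsmall : 4 * (ε * D₁) ≤ c₀) (hst : 0 ∈ flightTimes d ε T x y)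
    (hfast : ∀ t ∈ flightTimes d ε T x y, c₀ ≤ |py t|) :
    ContinuousOn (phase d ε T x y px py) (Set.Icc 0 T) := by
  intro t ht
  obtain ⟨n1, n2⟩ := eventually_inter_Iic h.finite_topImpacts t
  by_cases hi : Inside d ε (x t) (y t)
  · have htf : t ∈ flightTimes d ε T x y := ⟨ht, hi⟩
    have hne : py t ≠ 0 := abs_pos.1 (hc0.trans_le (hfast t htf))
    have hsub : flightTimes d ε T x y ⊆ Set.Icc 0 T := fun t ht => ht.1
    have hc := (rayState_hasDeriv (ε := ε) hd ((h.flight_x t ht hi).mono hsub)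
      ((h.flight_y t ht hi).mono hsub) ((h.flight_px t ht hi).mono hsub)
      ((h.flight_py t ht hi).mono hsub) hne).continuousWithinAt
    obtain ⟨n, hn⟩ := h.phase_eventually (px := px) (py := py) htf
    have c1 : ContinuousWithinAt (phase d ε T x y px py) (flightTimes d ε T x y) t :=
      (hc.snd.fst.add_const (2 * π * n)).congr_of_eventuallyEq hn (hn.self_of_nhdsWithin htf)
    refine c1.mono_of_mem_nhdsWithin ?_
    have h1 : ∀ᶠ s in 𝓝 t, s ∉ impactTimes d ε T x y :=
      (h.finite_impacts.isClosed.isOpen_compl).mem_nhds fun hc => hc.2 hi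
    filter_upwards [nhdsWithin_le_nhds h1, self_mem_nhdsWithin] with s hs hs'
    by_contra hc
    exact hs ⟨hs', fun hin => hc ⟨hs', hin⟩⟩
  · have hti : t ∈ impactTimes d ε T x y := ⟨ht, hi⟩
    have t0 : 0 < t := lt_of_le_of_ne ht.1 (by rintro rfl; exact hi hst.2)
    obtain ⟨v, l1, v1, v2, l2⟩ := h.impact hd hε hD₁ hc0 hc1 hsmall hti t0
      fun s hs _ => hfast s hs
    have onFlight : ∀ s ∈ flightTimes d ε T x y, ∀ A : Set ℝ,
        topImpacts d ε T x y ∩ Set.Iic s = A →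
        (rayState d ε x y px py s).2.1 + 2 * π * A.ncard = phase d ε T x y px py s := by
      intro s hs A hA
      rw [phase, hA, phaseAngle, if_pos hs.2]
    have left : ContinuousWithinAt (phase d ε T x y px py) (Set.Iio t) t := by
      obtain ⟨a, -, ha, hs⟩ := h.exists_flight_left t0 ht.2
      have lim : Filter.Tendsto (phase d ε T x y px py) (𝓝[<] t)
          (𝓝 (v.2.1 + 2 * π * (topImpacts d ε T x y ∩ Set.Iio t).ncard)) := by
        refine ((((continuous_fst.comp continuous_snd).tendsto v).comp l1).add_const _).congr' ?_
        filter_upwards [n2, Ioo_mem_nhdsLT ha] with s hs1 hs2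
        exact onFlight s (hs hs2) _ hs1
      have e : phase d ε T x y px py t
          = v.2.1 + 2 * π * (topImpacts d ε T x y ∩ Set.Iio t).ncard := by
        rw [phase, phaseAngle, if_neg hi]
        rcases h.wall hti with hw | hw
        · have : topImpacts d ε T x y ∩ Set.Iic t = topImpacts d ε T x y ∩ Set.Iio t := by
            ext z
            simp only [Set.mem_inter_iff, Set.mem_Iic, Set.mem_Iio, and_congr_right_iff]
            refine fun hz => ⟨fun hzt => lt_of_le_of_ne hzt ?_, fun hzt => hzt.le⟩
            rintro rfl
            exact (hd.pos (ε * x z)).ne' (hz.2.symm.trans hw)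
          rw [if_pos hw, v1 hw, this]
        · have h0 : y t ≠ 0 := by rw [hw]; exact (hd.pos _).ne'
          have : topImpacts d ε T x y ∩ Set.Iic t
              = insert t (topImpacts d ε T x y ∩ Set.Iio t) := by
            ext z
            simp only [Set.mem_inter_iff, Set.mem_Iic, Set.mem_Iio, Set.mem_insert_iff]
            constructor
            · rintro ⟨hz, hzt⟩
              rcases eq_or_lt_of_le hzt with e | e
              · exact Or.inl e
              · exact Or.inr ⟨hz, e⟩
            · rintro (rfl | ⟨hz, hzt⟩)
              · exact ⟨⟨hti, hw⟩, le_rfl⟩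
              · exact ⟨hz, hzt.le⟩
          rw [if_neg h0, v2 hw, this, Set.ncard_insert_of_notMem (by simp)
            (h.finite_topImpacts.subset Set.inter_subset_left)]
          push_cast
          ring
      rw [ContinuousWithinAt, e]
      exact lim
    have right : ContinuousWithinAt (phase d ε T x y px py) (Set.Ioc t T) t := by
      rcases eq_or_lt_of_le ht.2 with hT | hT
      · rw [hT, Set.Ioc_self]
        simp [ContinuousWithinAt]
      obtain ⟨w, m1, -, m2, m3, -⟩ := l2 hT
      obtain ⟨b, hb, -, hs⟩ := h.exists_flight_right t0.le hT
      have lim : Filter.Tendsto (phase d ε T x y px py) (𝓝[>] t)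
          (𝓝 (w.2.1 + 2 * π * (topImpacts d ε T x y ∩ Set.Iic t).ncard)) := by
        refine ((((continuous_fst.comp continuous_snd).tendsto w).comp m1).add_const _).congr' ?_
        filter_upwards [nhdsWithin_mono t Set.Ioi_subset_Ici_self n1, Ioo_mem_nhdsGT hb]
          with s hs1 hs2
        exact onFlight s (hs hs2) _ hs1
      have e : phase d ε T x y px py t
          = w.2.1 + 2 * π * (topImpacts d ε T x y ∩ Set.Iic t).ncard := by
        rw [phase, phaseAngle, if_neg hi]
        rcases h.wall hti with hw | hw
        · rw [if_pos hw, ← m2 hw, v1 hw]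
        · have h0 : y t ≠ 0 := by rw [hw]; exact (hd.pos _).ne'
          rw [if_neg h0, m3 hw]
      have : ContinuousWithinAt (phase d ε T x y px py) (Set.Ioi t) t := by
        rw [ContinuousWithinAt, e]
        exact lim
      exact this.mono Set.Ioc_subset_Ioi_self
    refine ((left.union (continuousWithinAt_singleton)).union right).mono fun s hs => ?_
    rcases lt_trichotomy s t with h1 | h1 | h1
    · exact Or.inl (Or.inl h1)
    · exact Or.inl (Or.inr h1)
    · exact Or.inr ⟨h1, hs.2⟩

/-- The improved variables of a point of a ray. -/
theorem IsNormalForm.isImproved {r : ℕ} {S K : ℝ → PS → ℝ} (h : IsNormalForm d (r - 1) S K)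
    (hε : ε ≠ 0) {φ : ℝ} {m v : PS} (hm : 0 < m.1) (e : oldPoint S ε m = v) (hu : saw φ = v.2.1)
    (hu' : saw φ ≠ -π) :
    IsImproved d r ε v.1 φ v.2.2.1 (v.2.2.2 / ε) m.1 (φ + ε * DI S ε m) m.2.2.1
      ((shiftPoint S ε m).2.2.2 / ε) := by
  obtain ⟨I, u, p, X⟩ := m
  subst e
  simp only [oldPoint, shiftPoint] at hu ⊢
  simp only at hm
  have e1 : ε * (X / ε) = X := by field_simp
  refine ⟨?_, ?_, ?_, ?_⟩
  · rw [e1]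
    have := h.deriv_phase (ε := ε) (p := p) (X := X) hu' hm
    rw [hu] at this
    rw [genS, this]
  · rw [e1]
    have := h.deriv_act (ε := ε) (φ := φ) (p := p) (X := X) hm
    rw [hu] at this
    rw [genS, this]
  · rw [e1]
    have := h.deriv_pos (ε := ε) (φ := φ) (p := p) (X := X) hm
    rw [hu] at this
    rw [genS, this]
  · rw [e1]
    have := h.deriv_mom (ε := ε) (φ := φ) (p := p) (X := X) hm
    rw [hu] at this
    rw [genS, this]
    field_simp

end

/-! ### Conservation of the improved action on long time intervals -/

section

variable {d : ℝ → ℝ} {N : ℕ} {S K : ℝ → PS → ℝ} {M ρ : ℝ}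

/-- Pass to the normal form with `k` further terms. Its action drifts by `O(ε ^ (N + k + 1) (1 +
T))`, hence `O(ε ^ (N + 1))`, and at every instant the two improved actions differ by `O(ε ^ (N +
1))`. Thus the conservation does not deteriorate with `k`; only the constants do. -/
theorem HybridMotion.action_conserved (h : IsNormalForm d N S K) (hd : IsProfile d) (hM : 1 ≤ M)
    (hρ : 0 < ρ) (k : ℕ) {L : ℝ} (hL : 0 < L) :
    ∃ C ε₀ : ℝ, 0 < C ∧ 0 < ε₀ ∧ ∀ (ε T : ℝ) (G : Set ℝ) (γ : ℝ → PS), 0 < ε → ε < ε₀ →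
      T ≤ L / ε ^ k → HybridMotion d ε T M ρ G γ → ∀ t ∈ G,
        |(newPoint S M ε (γ t)).1 - (newPoint S M ε (γ 0)).1| ≤ C * ε ^ (N + 1) := by
  obtain ⟨s, k', hs, -, h'⟩ := h.add hd k
  obtain ⟨C₁, ε₁, hC₁, hε₁, b₁⟩ := HybridMotion.action_drift h' hd hM hρ
  obtain ⟨C₂, ε₂, hC₂, hε₂, b₂⟩ := newPoint_compare h.polyS hs N hM
  refine ⟨C₁ * (1 + L) + 2 * C₂, min ε₁ (min ε₂ 1), by positivity, by positivity, ?_⟩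
  intro ε T G γ h0 h1 hT hm t ht
  have m1 : ε < ε₁ := h1.trans_le (min_le_left _ _)
  have m2 : ε < ε₂ := h1.trans_le ((min_le_right _ _).trans (min_le_left _ _))
  have m3 : ε < 1 := h1.trans_le ((min_le_right _ _).trans (min_le_right _ _))
  have d1 := abs_le.1 (b₁ ε T G γ h0 m1 hm t ht)
  have d2 := abs_le.1 ((norm_fst_le _).trans (b₂ ε h0 m2 _ (hm.slab t ht)))
  have d3 := abs_le.1 ((norm_fst_le _).trans (b₂ ε h0 m2 _ (hm.slab 0 hm.start)))
  simp only [Prod.fst_sub] at d2 d3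
  rw [le_div_iff₀ (by positivity)] at hT
  have d4 : C₁ * ε ^ (N + k + 1) * (1 + T) ≤ C₁ * (1 + L) * ε ^ (N + 1) := by
    have h5 : ε ^ k ≤ 1 := pow_le_one₀ h0.le m3.le
    calc C₁ * ε ^ (N + k + 1) * (1 + T) = C₁ * ε ^ (N + 1) * (ε ^ k + T * ε ^ k) := by ring
      _ ≤ C₁ * ε ^ (N + 1) * (1 + L) := by gcongr
      _ = _ := by ring
  exact abs_le.2 ⟨by linarith [d1.1, d2.2, d3.1], by linarith [d1.2, d2.1, d3.2]⟩

/-- A ray together with its improved variables. -/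
structure ImprovedMotion (d : ℝ → ℝ) (N : ℕ) (S K : ℝ → PS → ℝ) (ε T M ρ c : ℝ) (G : Set ℝ)
    (γ : ℝ → PS) (φ : ℝ → ℝ) : Prop where
  hybrid : HybridMotion d ε T M ρ G γ
  slab : ∀ t ∈ G, newPoint S M ε (γ t) ∈ Slab (2 * M)
  old : ∀ t ∈ G, oldPoint S ε (newPoint S M ε (γ t)) = γ t
  action_near : ∀ t ∈ G, |(newPoint S M ε (γ t)).1 - (γ t).1| ≤ c * ε
  momentum_near : ∀ t ∈ G, |(newPoint S M ε (γ t)).2.2.1 - (γ t).2.2.1| ≤ c * ε ^ 2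
  position_near : ∀ t ∈ G, |(planePoint S M ε (γ t)).2 - (γ t).2.2.2| ≤ c * ε ^ 2
  action_const : ∀ t ∈ G,
    |(newPoint S M ε (γ t)).1 - (newPoint S M ε (γ 0)).1| ≤ c * ε ^ (N + 1)
  level : ∀ t ∈ G, |K ε ((newPoint S M ε (γ 0)).1, 0, (planePoint S M ε (γ t)).1,
    (planePoint S M ε (γ t)).2)| ≤ c * ε ^ (N + 1)
  approx : ∀ κ : ℝ,
    (∀ t ∈ G, κ ≤ ‖planeV K ε (newPoint S M ε (γ 0)).1 (planePoint S M ε (γ t))‖) →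
      ApproxOrbit (PlaneStrip (2 * M)) (planeV K ε (newPoint S M ε (γ 0)).1)
        (fun z => K ε ((newPoint S M ε (γ 0)).1, 0, z.1, z.2))
        (fun z => DI K ε ((newPoint S M ε (γ 0)).1, 0, z.1, z.2)) ε (ε ^ (N + 1)) c ρ κ T G
        (fun t => planePoint S M ε (γ t)) (fun t => φ t + ε * DI S ε (newPoint S M ε (γ t)))

theorem ApproxOrbit.weaken {D : Set (ℝ × ℝ)} {V : ℝ × ℝ → ℝ × ℝ} {K W : ℝ × ℝ → ℝ}
    {ε e c c' ρ κ T : ℝ} {G : Set ℝ} {w : ℝ → ℝ × ℝ} {Φ : ℝ → ℝ}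
    (h : ApproxOrbit D V K W ε e c ρ κ T G w Φ) (hc : c ≤ c') (hε : 0 ≤ ε) (he : 0 ≤ e) :
    ApproxOrbit D V K W ε e c' ρ κ T G w Φ where
  sub := h.sub
  start := h.start
  finite := h.finite
  sep := h.sep
  mem := h.mem
  velocity t ht := by
    obtain ⟨w', h1, h2⟩ := h.velocity t ht
    exact ⟨w', h1, h2.trans (by gcongr)⟩
  jump τ hτ := by
    obtain ⟨l, l', h1, h2, h3⟩ := h.jump τ hτ
    exact ⟨l, l', h1, h2, h3.trans (by gcongr)⟩
  phase t ht := by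
    obtain ⟨w', h1, h2⟩ := h.phase t ht
    exact ⟨w', h1, h2.trans (by gcongr)⟩
  phase_jump τ hτ := by
    obtain ⟨l, l', h1, h2, h3⟩ := h.phase_jump τ hτ
    exact ⟨l, l', h1, h2, h3.trans (by gcongr)⟩
  level t ht := (h.level t ht).trans (by gcongr)
  nondegenerate := h.nondegenerate

/-- Every ray has improved variables on long time intervals. -/
theorem IsRay.improvedMotion (h : IsNormalForm d N S K) (hd : IsProfile d) (k : ℕ) {L c : ℝ}
    (hL : 0 < L) (hc : 0 < c) :
    ∃ M ρ C ε₀ : ℝ, 1 ≤ M ∧ 0 < ρ ∧ 0 < C ∧ 0 < ε₀ ∧ ∀ ε T : ℝ, 0 < ε → ε < ε₀ → T ≤ L / ε ^ k →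
      ∀ x y px py : ℝ → ℝ, IsRay d ε T x y px py → 0 ∈ flightTimes d ε T x y →
      c ≤ action d ε (x 0) (py 0) →
      (∀ t ∈ flightTimes d ε T x y, py t ≠ 0) ∧
      ContinuousOn (phase d ε T x y px py) (Set.Icc 0 T) ∧
      ImprovedMotion d N S K ε T M ρ C (flightTimes d ε T x y) (rayState d ε x y px py)
        (phase d ε T x y px py) := by
  obtain ⟨D₁, hD0, hD₁⟩ := hd.bddSmooth.deriv.bound
  obtain ⟨c₀, ε₁, hc0, hc1, hε₁, b₁⟩ := IsRay.fast hd k hL hc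
  obtain ⟨M, ρ, ε₂, hM, hρ, hε₂, b₂⟩ := IsRay.hybridMotion hd hc0 hc1
  obtain ⟨C₃, ε₃, hC₃, hε₃, b₃⟩ := newPoint_spec h.polyS hM
  obtain ⟨C₄, ε₄, hC₄, hε₄, b₄⟩ := HybridMotion.action_conserved h hd hM hρ k hL
  obtain ⟨C₅, ε₅, hC₅, hε₅, b₅⟩ := HybridMotion.approxOrbit h hd hM hC₄
  obtain ⟨C₆, hC₆, b₆⟩ := (h.polyS.dirD (0, 0, 1, 0)).bound (show 0 < 2 * M by linarith)
  refine ⟨M, ρ, C₃ + C₄ + C₅ + C₆, min (min (min ε₁ ε₂) (min ε₃ ε₄)) (min ε₅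
    (min 1 (c₀ / (4 * (D₁ + 1))))), hM, hρ, by positivity, by positivity, ?_⟩
  intro ε T h0 h1 hT x y px py hray hst hact
  have m' := h1.trans_le (min_le_left _ _)
  have m1 : ε < ε₁ := m'.trans_le ((min_le_left _ _).trans (min_le_left _ _))
  have m2 : ε < ε₂ := m'.trans_le ((min_le_left _ _).trans (min_le_right _ _))
  have m3 : ε < ε₃ := m'.trans_le ((min_le_right _ _).trans (min_le_left _ _))
  have m4 : ε < ε₄ := m'.trans_le ((min_le_right _ _).trans (min_le_right _ _))
  have m'' := h1.trans_le (min_le_right _ _)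
  have m5 : ε < ε₅ := m''.trans_le (min_le_left _ _)
  have m6 : ε < 1 := m''.trans_le ((min_le_right _ _).trans (min_le_left _ _))
  have m7 : ε < c₀ / (4 * (D₁ + 1)) := m''.trans_le ((min_le_right _ _).trans (min_le_right _ _))
  rw [lt_div_iff₀ (by positivity)] at m7
  have hfast := b₁ ε T h0 m1 hT x y px py hray hst hact
  have hm := b₂ ε T h0 m2 x y px py hray hst hfast
  have hcont := hray.continuousOn_phase hd h0 hD₁ hc0 hc1 (by linarith) hst hfast
  have hconst := b₄ ε T _ _ h0 m4 hT hm
  have happ := fun κ => b₅ ε T ρ κ _ _ _ h0 m5 hm hconst hcont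
    (fun t ht => (hray.phase_eventually ht).imp' (fun n : ℤ => 2 * π * n) fun n hn => hn)
  have hspec := fun t ht => b₃ ε h0 m3 _ (hm.slab t ht)
  have hε2 : 0 < ε ^ 2 := by positivity
  have hεN : 0 < ε ^ (N + 1) := by positivity
  refine ⟨fun t ht => abs_pos.1 (hc0.trans_le (hfast t ht)), hcont, hm, fun t ht => (hspec t ht).1,
    fun t ht => (hspec t ht).2.1,
    fun t ht => (hspec t ht).2.2.1.trans (mul_le_mul_of_nonneg_right (by linarith) h0.le),
    fun t ht => (hspec t ht).2.2.2.1.trans (mul_le_mul_of_nonneg_right (by linarith) hε2.le),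
    fun t ht => ?_,
    fun t ht => (hconst t ht).trans (mul_le_mul_of_nonneg_right (by linarith) hεN.le),
    fun t ht => ((happ 0 fun _ _ => norm_nonneg _).level t ht).trans
      (mul_le_mul_of_nonneg_right (by linarith) hεN.le),
    fun κ hκ => (happ κ hκ).weaken (by linarith) h0.le hεN.le⟩
  have e1 : (planePoint S M ε (rayState d ε x y px py t)).2 - (rayState d ε x y px py t).2.2.2
      = ε ^ 2 * DP S ε (newPoint S M ε (rayState d ε x y px py t)) := by
    simp only [planePoint, shiftPoint]
    rw [(hspec t ht).2.2.2.2.2.1]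
    ring
  rw [e1, abs_mul, abs_of_pos hε2, mul_comm]
  refine mul_le_mul_of_nonneg_right ?_ hε2.le
  have := b₆ ε (by rw [abs_of_pos h0]; exact m6.le) _ (hspec t ht).1
  refine le_trans (show _ ≤ C₆ from this) (by linarith)

/-- On a level without equilibria the slow motion is nowhere at rest. -/
theorem ImprovedMotion.nondegenerate (h : IsNormalForm d N S K) (hd : IsProfile d) (hM : 1 ≤ M)
    {c δ : ℝ} (hc : 0 < c) (hδ : 0 < δ) :
    ∃ ε₀ : ℝ, 0 < ε₀ ∧ ∀ (ε T : ℝ) (x y px py φ : ℝ → ℝ), 0 < ε → ε < ε₀ →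
      IsRay d ε T x y px py →
      ImprovedMotion d N S K ε T M ρ c (flightTimes d ε T x y) (rayState d ε x y px py) φ →
      (OverHumps d δ (action d ε (x 0) (py 0)) ∨
        OneReflection d δ (action d ε (x 0) (py 0)) (ε * x 0) ∨
        Resonator d δ (action d ε (x 0) (py 0)) (ε * x 0)) →
      ∀ t ∈ flightTimes d ε T x y, δ / (16 * (2 * M)) ≤
        ‖planeV K ε (newPoint S M ε (rayState d ε x y px py 0)).1
          (planePoint S M ε (rayState d ε x y px py t))‖ := by
  have hM2 : 0 < 2 * M := by linarith
  obtain ⟨Λ, hΛ, hder, hlip⟩ := twoU_bounds hd hM2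
  obtain ⟨μ₀, hμ₀, hconf⟩ := confinement hd hδ hM2
  obtain ⟨ε₁, hε₁, b₁⟩ := h.nondegenerate hd (show 1 ≤ 2 * M by linarith) hδ hc
  refine ⟨min (min 1 ε₁) (min (μ₀ / (Λ * (3 * c))) (δ / (16 * Λ * c))), by positivity, ?_⟩
  intro ε T x y px py φ h0 h1 hray hm hcase t ht
  have m1 : ε < 1 := h1.trans_le ((min_le_left _ _).trans (min_le_left _ _))
  have m2 : ε < ε₁ := h1.trans_le ((min_le_left _ _).trans (min_le_right _ _))
  have m3 := h1.trans_le ((min_le_right _ _).trans (min_le_left _ _))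
  have m4 := h1.trans_le ((min_le_right _ _).trans (min_le_right _ _))
  rw [lt_div_iff₀ (by positivity)] at m3 m4
  obtain ⟨γ, hγ⟩ : ∃ γ, γ = rayState d ε x y px py := ⟨_, rfl⟩
  obtain ⟨I₀, hI₀⟩ : ∃ I₀, I₀ = action d ε (x 0) (py 0) := ⟨_, rfl⟩
  have e0 : (γ 0).1 = I₀ := by rw [hγ, hI₀]; rfl
  have eX : ∀ s, (γ s).2.2.2 = ε * x s := fun s => by rw [hγ]; rfl
  rw [← hI₀] at hcase
  rw [← hγ] at hm ⊢
  have hst := hm.hybrid.start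
  have hεN : ε ^ (N + 1) ≤ ε := by
    rw [pow_succ]
    exact mul_le_of_le_one_left h0.le (pow_le_one₀ h0.le m1.le)
  have hcN : c * ε ^ (N + 1) ≤ c * ε := mul_le_mul_of_nonneg_left hεN hc.le
  have absI : ∀ s ∈ flightTimes d ε T x y, |(γ s).1| ≤ 2 * M := fun s hs => by
    have h3 := hm.hybrid.slab s hs
    rw [abs_of_pos (Slab.pos (by linarith) h3)]
    linarith [h3.2.1]
  have hI₀M : |I₀| ≤ 2 * M := e0 ▸ absI 0 hst
  have drift : ∀ s ∈ flightTimes d ε T x y, |I₀ - (γ s).1| ≤ 3 * c * ε := fun s hs => by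
    have a1 := abs_le.1 (hm.action_near s hs)
    have a2 := abs_le.1 (hm.action_near 0 hst)
    have a3 := abs_le.1 (hm.action_const s hs)
    rw [e0] at a2
    exact abs_le.2 ⟨by linarith [a1.2, a2.1, a3.1], by linarith [a1.1, a2.2, a3.2]⟩
  -- With the current action `2U` is exactly `py ^ 2 ≤ 1`; replacing it by the initial action costs
  -- `3 c ε`, one part for the conservation of the improved action and two for its distance from the
  -- action.
  have low : ∀ s ∈ flightTimes d ε T x y, twoU d I₀ (ε * x s) ≤ 1 + Λ * (3 * c) * ε := by
    intro s hs
    have a1 := (abs_le.1 (hlip I₀ (γ s).1 (ε * x s) (ε * x s) hI₀M (absI s hs)).1).2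
    rw [sub_self, abs_zero, add_zero] at a1
    have a2 := mul_le_mul_of_nonneg_left (drift s hs) hΛ.le
    have a3 : twoU d (γ s).1 (ε * x s) = py s ^ 2 := by
      have h4 := (hd.pos (ε * x s)).ne'
      have h5 := Real.pi_pos.ne'
      rw [hγ]
      simp only [twoU, rayState, rayPoint]
      rw [← sq_abs (py s)]
      field_simp
    have a4 := hray.energy s hs.1 hs.2
    have a5 := sq_nonneg (px s)
    linarith
  have cont : ContinuousOn (fun s => ε * x s) (Set.Icc 0 T) := hray.cont_x.const_mul ε |>.congr
    fun _ _ => rfl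
  -- The confinement argument uses the intermediate value theorem and needs the bound at impacts
  -- too, where it follows by continuity from the left.
  have low' : ∀ s ∈ Set.Icc 0 T, twoU d I₀ (ε * x s) ≤ 1 + Λ * (3 * c) * ε := by
    intro s hs
    by_cases hi : Inside d ε (x s) (y s)
    · exact low s ⟨hs, hi⟩
    have s0 : 0 < s := lt_of_le_of_ne hs.1 (by rintro rfl; exact hi hst.2)
    obtain ⟨a, ha0, ha, hsub⟩ := hray.exists_flight_left s0 hs.2
    have lim : Filter.Tendsto (fun s => twoU d I₀ (ε * x s)) (𝓝[<] s)
        (𝓝 (twoU d I₀ (ε * x s))) := by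
      rw [← nhdsWithin_Ioo_eq_nhdsLT ha]
      exact (hder I₀ (ε * x s)).continuousAt.comp_continuousWithinAt
        (f := fun s => ε * x s)
        (((cont s hs).mono fun z hz => (hsub hz).1))
    refine le_of_tendsto lim ?_
    filter_upwards [Ioo_mem_nhdsLT ha] with z hz using low z (hsub hz)
  have nd := hconf I₀ T (Λ * (3 * c) * ε) (fun s => ε * x s) hI₀M (by positivity) (by linarith)
    cont low' hcase t ht.1
  have hJ := hm.slab 0 hst
  have a1 := hm.action_near 0 hst
  rw [e0, abs_sub_comm] at a1
  have a2 := hm.position_near t ht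
  rw [eX, abs_sub_comm] at a2
  have a2' : c * ε ^ 2 ≤ c * ε := by
    refine mul_le_mul_of_nonneg_left (eps_sq_le h0 m1.le) hc.le
  obtain ⟨c1, c2⟩ := hlip I₀ (newPoint S M ε (γ 0)).1 (ε * x t) (planePoint S M ε (γ t)).2 hI₀M
    (by rw [abs_of_pos (Slab.pos hM2 hJ)]; exact hJ.2.1)
  have c3 := mul_le_mul_of_nonneg_left
    (show |I₀ - (newPoint S M ε (γ 0)).1| + |ε * x t - (planePoint S M ε (γ t)).2| ≤ 2 * c * ε by
      linarith) hΛ.le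
  refine b₁ ε _ h0 m2 hJ.1 hJ.2.1 _ (hm.slab t ht).2.2.2 ((hm.level t ht).trans hcN) ?_
  have c4 := abs_sub_abs_le_abs_sub (deriv (twoU d I₀) (ε * x t))
    (deriv (twoU d (newPoint S M ε (γ 0)).1) (planePoint S M ε (γ t)).2)
  have c5 := (abs_le.1 c1).1
  linarith

end

/-! ### Comparison with the averaged system -/

section

variable {d : ℝ → ℝ} {N : ℕ} {S K : ℝ → PS → ℝ} {M ρ : ℝ}

/-- The improved momentum and position are close to the zero level of the averaged Hamiltonian. -/
theorem ImprovedMotion.near_zero_level (h : IsNormalForm d N S K) (hM : 1 ≤ M) {c κ : ℝ}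
    (hc : 0 < c) (hκ : 0 < κ) :
    ∃ C ε₀ : ℝ, 0 < C ∧ 0 < ε₀ ∧ ∀ (ε T : ℝ) (G : Set ℝ) (γ : ℝ → PS) (φ : ℝ → ℝ), 0 < ε → ε < ε₀ →
      ImprovedMotion d N S K ε T M ρ c G γ φ →
      (∀ t ∈ G, κ ≤ ‖planeV K ε (newPoint S M ε (γ 0)).1 (planePoint S M ε (γ t))‖) →
      ∀ t ∈ G, ∃ q Z : ℝ, K ε ((newPoint S M ε (γ 0)).1, 0, q, Z) = 0 ∧
        |(planePoint S M ε (γ t)).1 - q| ≤ C * ε ^ (N + 1) ∧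
        |(planePoint S M ε (γ t)).2 - Z| ≤ C * ε ^ (N + 1) := by
  have hM2 : 0 < 2 * M := by linarith
  obtain ⟨B, Λ, hB, hΛ, b⟩ := h.polyK.planeField hM2
  refine ⟨2 * c / κ, min 1 (min (κ ^ 2 / (4 * Λ * c)) (M / (c + 2 * c / κ))), by positivity,
    by positivity, ?_⟩
  intro ε T G γ φ h0 h1 hm hV t ht
  have m1 : ε < 1 := h1.trans_le (min_le_left _ _)
  have m2 := h1.trans_le ((min_le_right _ _).trans (min_le_left _ _))
  have m3 := h1.trans_le ((min_le_right _ _).trans (min_le_right _ _))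
  rw [lt_div_iff₀ (by positivity)] at m2 m3
  have hJ := hm.slab 0 hm.hybrid.start
  have hf := b ε (newPoint S M ε (γ 0)).1 (by rw [abs_of_pos h0]; exact m1.le) hJ.1 hJ.2.1
  have hεN : ε ^ (N + 1) ≤ ε := by
    rw [pow_succ]
    exact mul_le_of_le_one_left h0.le (pow_le_one₀ h0.le m1.le)
  have hεN0 : 0 < ε ^ (N + 1) := by positivity
  have hcN : c * ε ^ (N + 1) ≤ c * ε := mul_le_mul_of_nonneg_left hεN hc.le
  have hK : Continuous fun z : ℝ × ℝ => K ε ((newPoint S M ε (γ 0)).1, 0, z.1, z.2) := by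
    refine continuous_iff_continuousAt.2 fun z => ?_
    have hpos : 0 < (newPoint S M ε (γ 0)).1 := Slab.pos hM2 hJ
    exact ContinuousAt.comp (g := K ε)
      (f := fun z : ℝ × ℝ => (((newPoint S M ε (γ 0)).1, 0, z.1, z.2) : PS))
      (h.polyK.continuousAt ε hpos) (by fun_prop)
  have e : 2 * (c * ε ^ (N + 1)) / κ = 2 * c / κ * ε ^ (N + 1) := by ring
  have a1 : |(planePoint S M ε (γ t)).1| ≤ M + c * ε := by
    have h2 := hm.momentum_near t ht
    have h3 := abs_sub_abs_le_abs_sub (newPoint S M ε (γ t)).2.2.1 (γ t).2.2.1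
    have h4 := (hm.hybrid.slab t ht).2.2.2
    have h5 : c * ε ^ 2 ≤ c * ε := mul_le_mul_of_nonneg_left (eps_sq_le h0 m1.le) hc.le
    simp only [planePoint]
    linarith
  have a2 : 2 * c / κ * ε ^ (N + 1) ≤ 2 * c / κ * ε :=
    mul_le_mul_of_nonneg_left hεN (by positivity)
  obtain ⟨z', hz', hz⟩ := hf.exists_zero hK hκ (z := planePoint S M ε (γ t))
    (η := c * ε ^ (N + 1)) (by rw [e]; linarith) (by positivity) (hm.level t ht) (hV t ht)
    (by have := mul_le_mul_of_nonneg_left hcN (show 0 ≤ 4 * Λ by positivity); linarith)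
  rw [e, norm_sub_rev] at hz
  exact ⟨z'.1, z'.2, hz', (norm_fst_le _).trans hz, (norm_snd_le _).trans hz⟩

/-- Because `k ≥ 1`, both `1` and `ε T` are bounded by constant multiples of `ε ^ (1 - k)`. The
exponents are integers, since `r` may be smaller than `k`. -/
theorem long_time_bounds {C L ε T : ℝ} {k n : ℕ} (hC : 0 < C) (h0 : 0 < ε)
    (h1 : ε ≤ 1) (hk : 1 ≤ k) (hT : T ≤ L / ε ^ k) :
    C * (ε ^ n * (1 + ε * T)) ≤ C * (1 + L) * ε ^ ((n : ℤ) - k + 1) ∧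
      C * (ε ^ n / ε * (1 + ε * T)) ≤ C * (1 + L) * ε ^ ((n : ℤ) - k) := by
  have e1 : ε ^ ((n : ℤ) - k) = ε ^ n / ε ^ k := by
    rw [zpow_sub₀ h0.ne', zpow_natCast, zpow_natCast]
  have e2 : ε ^ ((n : ℤ) - k + 1) = ε ^ n / ε ^ k * ε := by
    rw [zpow_add_one₀ h0.ne', e1]
  have a1 : 1 ≤ ε / ε ^ k := by
    rw [one_le_div (by positivity)]
    exact (pow_le_pow_of_le_one h0.le h1 hk).trans (by rw [pow_one])
  have a2 : ε * T ≤ ε * (L / ε ^ k) := mul_le_mul_of_nonneg_left hT h0.le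
  have a3 : 1 + ε * T ≤ (1 + L) * (ε / ε ^ k) := by
    have : ε * (L / ε ^ k) = L * (ε / ε ^ k) := by ring
    linarith
  rw [e1, e2]
  constructor
  · calc C * (ε ^ n * (1 + ε * T)) ≤ C * (ε ^ n * ((1 + L) * (ε / ε ^ k))) := by gcongr
      _ = _ := by ring
  · calc C * (ε ^ n / ε * (1 + ε * T)) ≤ C * (ε ^ n / ε * ((1 + L) * (ε / ε ^ k))) := by gcongr
      _ = C * (1 + L) * (ε ^ n / ε ^ k) * (ε / ε) := by ring
      _ = _ := by rw [div_self h0.ne', mul_one]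

/-- The improved variables stay close to the solution of the averaged system. -/
theorem ImprovedMotion.shadow (h : IsNormalForm d N S K) (hd : IsProfile d) (hM : 1 ≤ M)
    (hρ : 0 < ρ) {c κ L : ℝ} {k : ℕ} (hc : 0 < c) (hκ : 0 < κ) (hL : 0 < L) (hk : 1 ≤ k) :
    ∃ C ε₀ : ℝ, 0 < C ∧ 0 < ε₀ ∧ ∀ (ε T : ℝ) (G : Set ℝ) (γ : ℝ → PS) (φ : ℝ → ℝ), 0 < ε → ε < ε₀ →
      T ≤ L / ε ^ k → ImprovedMotion d N S K ε T M ρ c G γ φ →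
      (∀ t ∈ G, κ ≤ ‖planeV K ε (newPoint S M ε (γ 0)).1 (planePoint S M ε (γ t))‖) →
      ∀ ψ p ξ : ℝ → ℝ, IsSigmaFlow d (N + 1) ε T (newPoint S M ε (γ 0)).1 ψ p ξ →
        ψ 0 = φ 0 + ε * DI S ε (newPoint S M ε (γ 0)) → p 0 = (planePoint S M ε (γ 0)).1 →
        ε * ξ 0 = (planePoint S M ε (γ 0)).2 →
        ∀ t ∈ G, |(planePoint S M ε (γ t)).2 - ε * ξ t| ≤ C * ε ^ (((N + 1 : ℕ) : ℤ) - k + 1) ∧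
          |(planePoint S M ε (γ t)).1 - p t| ≤ C * ε ^ (((N + 1 : ℕ) : ℤ) - k + 1) ∧
          |φ t + ε * DI S ε (newPoint S M ε (γ t)) - ψ t| ≤ C * ε ^ (((N + 1 : ℕ) : ℤ) - k) := by
  have hM2 : 0 < 2 * M := by linarith
  obtain ⟨B, Λ, hB, hΛ, b⟩ := h.polyK.planeField hM2
  obtain ⟨C₁, ε₁, hC₁, hε₁, b₁⟩ := exists_shadow_constants hρ hc.le hΛ.le hκ hB.le
  obtain ⟨ε₂, hε₂, b₂⟩ := IsNormalForm.planeOrbit (r := N + 1) h hd (show 2 ≤ 2 * M by linarith) hc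
  refine ⟨C₁ * (1 + L), min 1 (min ε₁ ε₂), by positivity, by positivity, ?_⟩
  intro ε T G γ φ h0 h1 hT hm hV ψ p ξ hflow i1 i2 i3 t ht
  have m1 : ε < 1 := h1.trans_le (min_le_left _ _)
  have m2 : ε < ε₁ := h1.trans_le ((min_le_right _ _).trans (min_le_left _ _))
  have m3 : ε < ε₂ := h1.trans_le ((min_le_right _ _).trans (min_le_right _ _))
  have hst := hm.hybrid.start
  have hJ := hm.slab 0 hst
  have hf := b ε (newPoint S M ε (γ 0)).1 (by rw [abs_of_pos h0]; exact m1.le) hJ.1 hJ.2.1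
  have hεN : ε ^ (N + 1) ≤ ε := by
    rw [pow_succ]
    exact mul_le_of_le_one_left h0.le (pow_le_one₀ h0.le m1.le)
  have hp0 : |p 0| ≤ 2 * M := by rw [i2]; exact hJ.2.2.2
  have hK0 : |K ε ((newPoint S M ε (γ 0)).1, 0, p 0, ε * ξ 0)| ≤ c * ε ^ (N + 1) := by
    rw [i2, i3]; exact hm.level 0 hst
  have horb := b₂ ε (ε ^ (N + 1)) T _ ψ p ξ h0 m3
    ((hm.hybrid.sub hst).1.trans (hm.hybrid.sub hst).2) hJ.1 hJ.2.1 hεN hflow hp0 hK0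
  obtain ⟨s1, s2⟩ := b₁ ε (ε ^ (N + 1)) T _ _ _ _ G _ _ _ ψ h0 m2 (by positivity) hεN hf
    (hm.approx κ hV) horb (Prod.ext i2.symm i3.symm) i1.symm t ht
  obtain ⟨l1, l2⟩ := long_time_bounds (n := N + 1) hC₁ h0 m1.le hk hT
  have s3 := s1.trans l1
  exact ⟨(norm_snd_le _).trans s3, (norm_fst_le _).trans s3, s2.trans l2⟩

end

end Waveguide

end

/-! ### Assembly of the theorem. -/

open Waveguide in
theorem mainTheorem5 (d : ℝ → ℝ) (hd : Waveguide.IsProfile d)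
    (r k : ℕ) (hr : 1 ≤ r) (hk : 1 ≤ k)
    (L c δ : ℝ) (hL : 0 < L) (hc : 0 < c) (hδ : 0 < δ) :
    ∃ C ε₀ : ℝ, 0 < C ∧ 0 < ε₀ ∧
      ∀ ε : ℝ, 0 < ε → ε < ε₀ →
      ∀ T : ℝ, 0 ≤ T → T ≤ L / ε ^ k →
      ∀ x y px py : ℝ → ℝ, Waveguide.IsRay d ε T x y px py →
      Waveguide.Inside d ε (x 0) (y 0) →
      c ≤ Waveguide.action d ε (x 0) (py 0) →
      ∃ φ I' φ' p' x' : ℝ → ℝ,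
        -- the phase and the improved variables along the ray
        ContinuousOn φ (Set.Icc 0 T) ∧
        (∀ t ∈ Set.Icc 0 T, Waveguide.Inside d ε (x t) (y t) →
          Waveguide.IsPhase d ε (x t) (y t) (py t) (φ t) ∧
          Waveguide.IsImproved d r ε (Waveguide.action d ε (x t) (py t)) (φ t)
            (Waveguide.pHat d ε (x t) (px t) (py t) (φ t)) (x t)
            (I' t) (φ' t) (p' t) (x' t) ∧
          |I' t - Waveguide.action d ε (x t) (py t)| ≤ C * ε ∧
          |p' t - Waveguide.pHat d ε (x t) (px t) (py t) (φ t)| ≤ C * ε ^ 2) ∧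
        -- conservation of the improved action and of the averaged Hamiltonian
        (∀ t ∈ Set.Icc 0 T, Waveguide.Inside d ε (x t) (y t) →
          |I' t - I' 0| ≤ C * ε ^ r ∧
          |Waveguide.sigmaH d r ε (I' 0) (p' t) (ε * x' t)| ≤ C * ε ^ r) ∧
        -- the three cases
        (Waveguide.OverHumps d δ (Waveguide.action d ε (x 0) (py 0)) ∨
          Waveguide.OneReflection d δ (Waveguide.action d ε (x 0) (py 0)) (ε * x 0) ∨
          Waveguide.Resonator d δ (Waveguide.action d ε (x 0) (py 0)) (ε * x 0) →
          (∀ t ∈ Set.Icc 0 T, Waveguide.Inside d ε (x t) (y t) →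
            ∃ q Z : ℝ, Waveguide.sigmaH d r ε (I' 0) q Z = 0 ∧
              |p' t - q| ≤ C * ε ^ r ∧ |ε * x' t - Z| ≤ C * ε ^ r) ∧
          ∀ ψ p ξ : ℝ → ℝ, Waveguide.IsSigmaFlow d r ε T (I' 0) ψ p ξ →
            ψ 0 = φ' 0 → p 0 = p' 0 → ξ 0 = x' 0 →
            ∀ t ∈ Set.Icc 0 T, Waveguide.Inside d ε (x t) (y t) →
              |ε * x' t - ε * ξ t| ≤ C * ε ^ ((r : ℤ) - k + 1) ∧
              |p' t - p t| ≤ C * ε ^ ((r : ℤ) - k + 1) ∧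
              |φ' t - ψ t| ≤ C * ε ^ ((r : ℤ) - k)) := by
  -- The recursion is indexed by the number of terms of `S`, which is one less than the order of the
  -- errors.
  obtain ⟨N, rfl⟩ : ∃ N, r = N + 1 := ⟨r - 1, by omega⟩
  obtain ⟨S, K, hnf⟩ := exists_isNormalForm hd N
  obtain ⟨M, ρ, C₁, ε₁, hM, hρ, hC₁, hε₁, b₁⟩ := IsRay.improvedMotion hnf hd k hL hc
  -- The lower bound for the slow velocity supplied by `ImprovedMotion.nondegenerate`. It depends on
  -- `δ` and the slab only, so the constants of the last two estimates can be fixed before the ray.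
  have hκ : 0 < δ / (16 * (2 * M)) := by positivity
  obtain ⟨ε₂, hε₂, b₂⟩ := ImprovedMotion.nondegenerate (ρ := ρ) hnf hd hM hC₁ hδ
  obtain ⟨C₃, ε₃, hC₃, hε₃, b₃⟩ := ImprovedMotion.near_zero_level (ρ := ρ) hnf hM hC₁ hκ
  obtain ⟨C₄, ε₄, hC₄, hε₄, b₄⟩ := ImprovedMotion.shadow hnf hd hM hρ hC₁ hκ hL hk
  refine ⟨C₁ + C₃ + C₄, min (min ε₁ ε₂) (min ε₃ ε₄), by positivity, by positivity, ?_⟩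
  intro ε h0 h1 T hT0 hT x y px py hray hin hact
  have m1 : ε < ε₁ := h1.trans_le ((min_le_left _ _).trans (min_le_left _ _))
  have m2 : ε < ε₂ := h1.trans_le ((min_le_left _ _).trans (min_le_right _ _))
  have m3 : ε < ε₃ := h1.trans_le ((min_le_right _ _).trans (min_le_left _ _))
  have m4 : ε < ε₄ := h1.trans_le ((min_le_right _ _).trans (min_le_right _ _))
  have hst : 0 ∈ flightTimes d ε T x y := ⟨⟨le_rfl, hT0⟩, hin⟩
  obtain ⟨hpy, hcont, hm⟩ := b₁ ε T h0 m1 hT x y px py hray hst hact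
  have hM2 : 0 < 2 * M := by linarith
  have pos : ∀ t, ε * ((planePoint S M ε (rayState d ε x y px py t)).2 / ε)
      = (planePoint S M ε (rayState d ε x y px py t)).2 := fun t => by field_simp
  have weak : ∀ {a A : ℝ}, 0 < A → a ≤ C₁ * A ∨ a ≤ C₃ * A ∨ a ≤ C₄ * A →
      a ≤ (C₁ + C₃ + C₄) * A := by
    rintro a A hA (ha | ha | ha) <;>
      exact ha.trans (mul_le_mul_of_nonneg_right (by linarith) hA.le)
  refine ⟨phase d ε T x y px py, fun t => (newPoint S M ε (rayState d ε x y px py t)).1,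
    fun t => phase d ε T x y px py t + ε * DI S ε (newPoint S M ε (rayState d ε x y px py t)),
    fun t => (planePoint S M ε (rayState d ε x y px py t)).1,
    fun t => (planePoint S M ε (rayState d ε x y px py t)).2 / ε,
    hcont, fun t ht hi => ?_, fun t ht hi => ?_, fun hcase => ?_⟩
  · have htf : t ∈ flightTimes d ε T x y := ⟨ht, hi⟩
    have hp := hpy t htf
    have hsaw := hray.saw_phase hd htf hp
    have hmom := hray.rayState_eq hd htf hp
    have himp := hnf.isImproved (r := N + 1) h0.ne' (Slab.pos hM2 (hm.slab t htf)) (hm.old t htf)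
      hsaw (by rw [hsaw]; exact (abs_lt.1 (rayState_angle hd hi hp)).1.ne')
    have ex : (rayState d ε x y px py t).2.2.2 / ε = x t :=
      mul_div_cancel_left₀ (x t) h0.ne'
    rw [hmom, ex] at himp
    refine ⟨hray.isPhase hd htf hp, himp, weak h0 (Or.inl (hm.action_near t htf)), ?_⟩
    rw [← hmom]
    exact weak (by positivity) (Or.inl (hm.momentum_near t htf))
  · have htf : t ∈ flightTimes d ε T x y := ⟨ht, hi⟩
    refine ⟨weak (by positivity) (Or.inl (hm.action_const t htf)), ?_⟩
    simp only [pos]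
    rw [sigmaH, Nat.add_sub_cancel, hnf.K_eq ε _ 0 _ _ (Slab.pos hM2 (hm.slab 0 hst))]
    exact weak (by positivity) (Or.inl (hm.level t htf))
  · have hV := b₂ ε T x y px py _ h0 m2 hray hm hcase
    refine ⟨fun t ht hi => ?_, fun ψ p ξ hflow i1 i2 i3 t ht hi => ?_⟩
    · obtain ⟨q, Z, e, hq, hZ⟩ := b₃ ε T _ _ _ h0 m3 hm hV t ⟨ht, hi⟩
      refine ⟨q, Z, ?_, weak (by positivity) (Or.inr (Or.inl hq)), ?_⟩
      · rw [sigmaH, Nat.add_sub_cancel, hnf.K_eq ε _ 0 _ _ (Slab.pos hM2 (hm.slab 0 hst))]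
        exact e
      · simp only [pos]
        exact weak (by positivity) (Or.inr (Or.inl hZ))
    · obtain ⟨s1, s2, s3⟩ := b₄ ε T _ _ _ h0 m4 hT hm hV ψ p ξ hflow i1 i2
        (by rw [i3]; exact pos 0) t ⟨ht, hi⟩
      simp only [pos]
      exact ⟨weak (by positivity) (Or.inr (Or.inr s1)), weak (by positivity) (Or.inr (Or.inr s2)),
        weak (by positivity) (Or.inr (Or.inr s3))⟩
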